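/- Let $a<b$, $T>0$, $\mu>0$, $\nu>0$. Consider on $(0,T)\times(a,b)$ the problem $$u_{tt}-u_{xx}-\nu u_{txx}=-\mu\theta_x,\qquad \theta_t-\theta_{xx}+\mu\theta u_{tx}=0,\qquad \theta\ge 0,$$ $$u(t,a)=u(t,b)=0,\quad \theta_x(t,a)=\theta_x(t,b)=0,\quad u(0,\cdot)=u_0,\ u_t(0,\cdot)=u_1,\ \theta(0,\cdot)=\theta_0 .$$ A weak solution is a pair $(u,\theta)$ with $u\in W^{1,\infty}(0,T;L^2(a,b))\cap H^1(0,T;H^1_0(a,b))$, $u_{tt}\in L^2(0,T;H^{-1}(a,b))$, $\theta\in H^1(0,T;L^2(a,b))\cap L^2(0,T;H^2(a,b))$, $\theta\ge0$, such that for a.e. $t\in(0,T)$, all $v\in H^1_0(a,b)$ and all $\psi\in H^1(a,b)$, $$\langle u_{tt},v\rangle+\int_a^b u_xv_x+\nu\int_a^b u_{tx}v_x+\mu\int_a^b\theta_xv=0,\qquad \int_a^b\theta_t\psi+\int_a^b\theta_x\psi_x+\mu\int_a^b\theta u_{tx}\psi=0,$$ and the continuous representatives of $u\in C([0,T];H^1_0)$,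 $u_t\in C([0,T];L^2)$, $\theta\in C([0,T];L^2)$ take the values $u_0,u_1,\theta_0$ at $t=0$. **Proposition.** For every $R\ge 0$ there is a constant $C=C(a,b,\mu,\nu,T,R)$ such that the following holds. Let $u_0,u_1\in H^2(a,b)\cap H^1_0(a,b)$ and $\theta_0\in H^3(a,b)$ with $\theta_0\ge0$ and with $(\theta_0)_x(a)=(\theta_0)_x(b)=0$ (that is, $(\theta_0)_x\in H^1_0(a,b)$), and suppose $\|u_0\|_{H^2},\|u_1\|_{H^2},\|\theta_0\|_{H^3}\le R$. Then the problem has a weak solution $(u,\theta)$ on $(0,T)$, it is unique, and it satisfies $$\|u\|_{W^{2,\infty}(0,T;L^2(a,b))}+\|u\|_{H^2(0,T;H^1(a,b))}+\|\theta\|_{H^2(0,T;L^2(a,b))}+\|\theta\|_{L^2(0,T;H^3(a,b))}\le C ;$$ in particular $u$ and $\theta$ belong to these spaces. -/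

import Mathlib

open MeasureTheory Set Filter
open scoped ENNReal ContDiff

noncomputable section

namespace ThermoVisco

/-! ### Spaces in the space variable -/

/-- `L²(a,b)`. -/
abbrev L2 (a b : ℝ) : Type := Lp ℝ 2 (volume.restrict (Ioo a b))

/-- `φ ∈ C_c^∞(a,b)`. -/
def IsTestFun (a b : ℝ) (φ : ℝ → ℝ) : Prop :=
  ContDiff ℝ ∞ φ ∧ HasCompactSupport φ ∧ tsupport φ ⊆ Ioo a b

/-- `g` is the weak derivative of `f` on `(a,b)`. -/
def HasWeakDeriv {a b : ℝ} (f g : L2 a b) : Prop :=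
  ∀ φ : ℝ → ℝ, IsTestFun a b φ →
    ∫ x in Ioo a b, f x * deriv φ x = -∫ x in Ioo a b, g x * φ x

theorem IsTestFun.memLp {a b : ℝ} {φ : ℝ → ℝ} (h : IsTestFun a b φ) :
    MemLp φ 2 (volume.restrict (Ioo a b)) :=
  (h.1.continuous.memLp_of_hasCompactSupport h.2.1).restrict _

theorem IsTestFun.memLp_deriv {a b : ℝ} {φ : ℝ → ℝ} (h : IsTestFun a b φ) :
    MemLp (deriv φ) 2 (volume.restrict (Ioo a b)) :=
  ((h.1.continuous_deriv (by simp)).memLp_of_hasCompactSupport h.2.1.deriv).restrict _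

theorem exists_integral_clm {a b : ℝ} {ψ : ℝ → ℝ}
    (h : MemLp ψ 2 (volume.restrict (Ioo a b))) :
    ∃ L : L2 a b →L[ℝ] ℝ, ∀ f : L2 a b, L f = ∫ x in Ioo a b, f x * ψ x := by
  refine ⟨innerSL ℝ (h.toLp ψ), fun f => ?_⟩
  rw [innerSL_apply_apply, L2.inner_def]
  refine integral_congr_ae ?_
  filter_upwards [h.coeFn_toLp] with x hx
  simp [hx]

theorem exists_weakDeriv_clm {a b : ℝ} {φ : ℝ → ℝ} (h : IsTestFun a b φ) :
    ∃ L M : L2 a b →L[ℝ] ℝ, ∀ f g : L2 a b,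
      (∫ x in Ioo a b, f x * deriv φ x = -∫ x in Ioo a b, g x * φ x) ↔ L f + M g = 0 := by
  obtain ⟨L, hL⟩ := exists_integral_clm h.memLp_deriv
  obtain ⟨M, hM⟩ := exists_integral_clm h.memLp
  exact ⟨L, M, fun f g => by rw [hL, hM, eq_neg_iff_add_eq_zero]⟩

/-- The Sobolev space `H^k(a,b)`, whose elements are recorded as the tuples
`(f, f', …, f^(k))` of `L²` weak derivatives; it carries the norm
`(∑_{j ≤ k} ‖f^(j)‖²_{L²})^{1/2}`. -/
def sobolevSubmodule (a b : ℝ) (k : ℕ) :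
    Submodule ℝ (PiLp 2 (fun _ : Fin (k + 1) => L2 a b)) where
  carrier := {F | ∀ j : Fin k, HasWeakDeriv (F j.castSucc) (F j.succ)}
  zero_mem' := by
    intro j φ hφ
    obtain ⟨L, M, h⟩ := exists_weakDeriv_clm hφ
    rw [h]; simp
  add_mem' := by
    intro F G hF hG j φ hφ
    obtain ⟨L, M, h⟩ := exists_weakDeriv_clm hφ
    have h1 := (h _ _).1 (hF j φ hφ)
    have h2 := (h _ _).1 (hG j φ hφ)
    rw [h]
    simp only [PiLp.add_apply, map_add]
    linarith
  smul_mem' := by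
    intro c F hF j φ hφ
    obtain ⟨L, M, h⟩ := exists_weakDeriv_clm hφ
    have h1 := (h _ _).1 (hF j φ hφ)
    rw [h]
    simp only [PiLp.smul_apply, map_smul, ← smul_add, h1, smul_zero]

/-- `H^k(a,b)`. -/
abbrev Sob (a b : ℝ) (k : ℕ) : Type := sobolevSubmodule a b k

instance (a b : ℝ) (k : ℕ) : NormedAddCommGroup (Sob a b k) :=
  Submodule.normedAddCommGroup _

instance (a b : ℝ) (k : ℕ) : NormedSpace ℝ (Sob a b k) :=
  Submodule.normedSpace _

theorem isClosed_sobolevSubmodule (a b : ℝ) (k : ℕ) :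
    IsClosed (sobolevSubmodule a b k : Set (PiLp 2 (fun _ : Fin (k + 1) => L2 a b))) := by
  have : (sobolevSubmodule a b k : Set (PiLp 2 (fun _ : Fin (k + 1) => L2 a b))) =
      ⋂ (j : Fin k) (φ : ℝ → ℝ) (_ : IsTestFun a b φ),
        {F | ∫ x in Ioo a b, F j.castSucc x * deriv φ x
          = -∫ x in Ioo a b, F j.succ x * φ x} := by
    ext F
    simp only [mem_iInter]
    exact Iff.rfl
  rw [this]
  refine isClosed_iInter fun j => isClosed_iInter fun φ => isClosed_iInter fun hφ => ?_
  obtain ⟨L, M, h⟩ := exists_weakDeriv_clm hφ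
  simp only [h]
  exact isClosed_eq (by fun_prop) continuous_const

instance (a b : ℝ) (k : ℕ) : CompleteSpace (Sob a b k) :=
  (isClosed_sobolevSubmodule a b k).completeSpace_coe

/-- The `j`-th weak derivative `H^k(a,b) → L²(a,b)`; for `j = 0` this is the embedding. -/
def Sob.D {a b : ℝ} {k : ℕ} (j : Fin (k + 1)) : Sob a b k →L[ℝ] L2 a b :=
  (PiLp.proj 2 (fun _ : Fin (k + 1) => L2 a b) j).comp (sobolevSubmodule a b k).subtypeL

/-- `H^1_0(a,b)`: the closure of `C_c^∞(a,b)` in `H^1(a,b)`. -/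
def sobolevZero (a b : ℝ) : Submodule ℝ (Sob a b 1) :=
  (Submodule.span ℝ {F : Sob a b 1 | ∃ φ : ℝ → ℝ, IsTestFun a b φ ∧
    (Sob.D 0 F : ℝ → ℝ) =ᵐ[volume.restrict (Ioo a b)] φ}).topologicalClosure

/-- `H^1_0(a,b)` with the `H^1` norm. -/
abbrev H10 (a b : ℝ) : Type := sobolevZero a b

instance (a b : ℝ) : NormedAddCommGroup (H10 a b) := Submodule.normedAddCommGroup _

instance (a b : ℝ) : NormedSpace ℝ (H10 a b) := Submodule.normedSpace _

instance (a b : ℝ) : CompleteSpace (H10 a b) :=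
  (Submodule.isClosed_topologicalClosure _).completeSpace_coe

/-- The inclusion `H^1_0(a,b) → H^1(a,b)`. -/
def H10.toSob {a b : ℝ} : H10 a b →L[ℝ] Sob a b 1 := (sobolevZero a b).subtypeL

/-- The inclusion `H^1_0(a,b) → L²(a,b)`. -/
def H10.toL2 {a b : ℝ} : H10 a b →L[ℝ] L2 a b := (Sob.D 0).comp H10.toSob

/-- The weak derivative `v ↦ v_x`, `H^1_0(a,b) → L²(a,b)`. -/
def H10.dx {a b : ℝ} : H10 a b →L[ℝ] L2 a b := (Sob.D 1).comp H10.toSob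

/-- The `L²` function `f` belongs to `H^1_0(a,b)`. -/
def MemH10 {a b : ℝ} (f : L2 a b) : Prop := ∃ v : H10 a b, H10.toL2 v = f

/-- `H^{-1}(a,b)`, the dual of `H^1_0(a,b)`. -/
abbrev Hneg (a b : ℝ) : Type := H10 a b →L[ℝ] ℝ

/-- The embedding `L²(a,b) → H^{-1}(a,b)`, `f ↦ (v ↦ ∫ f v)`. -/
def L2.toHneg {a b : ℝ} (f : L2 a b) : Hneg a b := (innerSL ℝ f).comp H10.toL2

/-! ### Spaces of functions of time -/

section Time

variable {X : Type*} [NormedAddCommGroup X] [NormedSpace ℝ X]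
variable {Y : Type*} [NormedAddCommGroup Y] [NormedSpace ℝ Y]

/-- Lebesgue measure on the time interval `(0,T)`. -/
abbrev timeMeasure (T : ℝ) : Measure ℝ := volume.restrict (Ioo 0 T)

/-- `g` is the weak time derivative on `(0,T)` of the Banach-space-valued function `w`. -/
def HasWeakTimeDeriv (T : ℝ) (w g : ℝ → X) : Prop :=
  ∀ φ : ℝ → ℝ, IsTestFun 0 T φ →
    ∫ t in Ioo 0 T, deriv φ t • w t = -∫ t in Ioo 0 T, φ t • g t

/-- Let `ι : Y → X` be the embedding of a Banach space `Y` into `X`. The functions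
`d 0, …, d k` are in `L^p(0,T;Y)`, `d 0` is the function `w` (seen as `Y`-valued), and
`d (j+1)` is the weak time derivative of `d j` for `j < k`. Thus `w ∈ W^{k,p}(0,T;Y)`
with weak derivatives `d 0, …, d k`. -/
def IsDerivTower (ι : Y →L[ℝ] X) (k : ℕ) (p : ℝ≥0∞) (T : ℝ) (w : ℝ → X)
    (d : ℕ → ℝ → Y) : Prop :=
  (∀ᵐ t ∂timeMeasure T, ι (d 0 t) = w t) ∧
  (∀ j ≤ k, MemLp (d j) p (timeMeasure T)) ∧
  (∀ j < k, HasWeakTimeDeriv T (d j) (d (j + 1)))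

/-- The norm `∑_{j ≤ k} ‖∂_t^j w‖_{L^p(0,T;Y)}` of `W^{k,p}(0,T;Y)`, where `ι : Y → X` is the
embedding of `Y`; it is `⊤` exactly when `w ∉ W^{k,p}(0,T;Y)`. (Weak derivatives being unique
almost everywhere, the infimum is over one value or none.) -/
def timeSobolevNorm (ι : Y →L[ℝ] X) (k : ℕ) (p : ℝ≥0∞) (T : ℝ) (w : ℝ → X) : ℝ≥0∞ :=
  ⨅ (d : ℕ → ℝ → Y) (_ : IsDerivTower ι k p T w d),
    ∑ j ∈ Finset.range (k + 1), eLpNorm (d j) p (timeMeasure T)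

/-- `w₀` is the value at time `0` of the continuous representative `[0,T] → X` of `w`. -/
def HasInitialValue (T : ℝ) (w : ℝ → X) (w₀ : X) : Prop :=
  ∃ c : ℝ → X, ContinuousOn c (Icc 0 T) ∧ (∀ᵐ t ∂timeMeasure T, c t = w t) ∧ c 0 = w₀

end Time

/-! ### Weak solutions -/

/-- `(u,θ)` is a weak solution on `(0,T)` of
`u_tt - u_xx - ν u_txx = -μ θ_x`, `θ_t - θ_xx + μ θ u_tx = 0`, `θ ≥ 0`, with
`u = 0` and `θ_x = 0` at `x = a, b`, and with initial data `u(0) = u₀`, `u_t(0) = u₁`,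
`θ(0) = θ₀`:

* `u ∈ W^{1,∞}(0,T;L²) ∩ H¹(0,T;H¹₀)` and `u_tt ∈ L²(0,T;H⁻¹)`;
* `θ ∈ H¹(0,T;L²) ∩ L²(0,T;H²)` and `θ ≥ 0`;
* for almost every `t`, the two variational equations hold for all `v ∈ H¹₀`, `ψ ∈ H¹`;
* the initial conditions hold for the continuous representatives of `u`, `u_t`, `θ`.

Here `U 0, U 1` stand for `u, u_t` with values in `H¹₀`, `A` for `u_tt`, `Θ 0, Θ 1` for
`θ, θ_t` with values in `L²`, and `H 0` for `θ` with values in `H²`. -/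
def IsWeakSolution (a b μ ν T : ℝ) (u₀ u₁ θ₀ : L2 a b) (u θ : ℝ → L2 a b) : Prop :=
  ∃ (V : ℕ → ℝ → L2 a b) (U : ℕ → ℝ → H10 a b) (A : ℝ → Hneg a b)
    (Θ : ℕ → ℝ → L2 a b) (H : ℕ → ℝ → Sob a b 2),
    IsDerivTower (ContinuousLinearMap.id ℝ (L2 a b)) 1 ⊤ T u V ∧
    IsDerivTower H10.toL2 1 2 T u U ∧
    MemLp A 2 (timeMeasure T) ∧
    HasWeakTimeDeriv T (fun t => L2.toHneg (H10.toL2 (U 1 t))) A ∧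
    IsDerivTower (ContinuousLinearMap.id ℝ (L2 a b)) 1 2 T θ Θ ∧
    IsDerivTower (Sob.D 0) 0 2 T θ H ∧
    (∀ᵐ t ∂timeMeasure T, ∀ᵐ x ∂volume.restrict (Ioo a b), 0 ≤ θ t x) ∧
    (∀ᵐ t ∂timeMeasure T, ∀ v : H10 a b,
      A t v + (∫ x in Ioo a b, H10.dx (U 0 t) x * H10.dx v x)
        + ν * (∫ x in Ioo a b, H10.dx (U 1 t) x * H10.dx v x)
        + μ * (∫ x in Ioo a b, Sob.D 1 (H 0 t) x * H10.toL2 v x) = 0) ∧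
    (∀ᵐ t ∂timeMeasure T, ∀ ψ : Sob a b 1,
      (∫ x in Ioo a b, Θ 1 t x * Sob.D 0 ψ x)
        + (∫ x in Ioo a b, Sob.D 1 (H 0 t) x * Sob.D 1 ψ x)
        + μ * (∫ x in Ioo a b, Sob.D 0 (H 0 t) x * H10.dx (U 1 t) x * Sob.D 0 ψ x) = 0) ∧
    (∃ w₀ : H10 a b, H10.toL2 w₀ = u₀ ∧ HasInitialValue T (U 0) w₀) ∧
    HasInitialValue T (fun t => H10.toL2 (U 1 t)) u₁ ∧
    HasInitialValue T θ θ₀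

end ThermoVisco

end

/-! The system is differentiated once in time. Put `z = θ_t`, `w = u_t`, `v = u_tt` and `f = u_xx -
μ θ_x`. Then `z_t - z_xx = G` with Neumann conditions and `v_t - ν v_xx = K` with Dirichlet
conditions, where `G = -μ (θ w_x)_t` and `K = f_t = ν⁻¹ (v - f) - μ z_x`. The hypotheses on the data
say that the initial values dictated by the equations satisfy `z(0) ∈ H¹` and `v(0) ∈ L²`. For given
square integrable `G` and `K` both equations are diagonal, in cosines and in sines, and are solved
mode by mode (`EigenSystem`, `exists_linSol`). The functions `θ`, `w`, `u` are recovered by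
integration in time, and `ν w_xx = v - f`, `θ_xx = z - F`, with `F` the primitive of `G`, turn
regularity in time into regularity in space. Time derivatives are handled through primitives of
Bochner integrable functions (`HasPrim`).

Existence. The map from sources to the sources computed from their solution is causal and, on balls,
Lipschitz with an integrable kernel. A fixed point can therefore be continued in steps of uniform
length as long as it is bounded a priori (`exists_causal_fixedPoint`, `exists_nonlin`).

A priori bounds. They come in a chain, each link linear in the quantity to be bounded. Testing the
heat equation with a negative multiple of the squared negative part of `θ` shows that `θ ≥ 0`
(`LinSol.Nonlin.nonneg`). In the energy identity the coupling terms cancel, and the thermal energy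
is nonnegative by positivity, so the viscous dissipation `∫ ‖w_x‖²` is bounded
(`bound_integral_dx_w`). Testing the heat equation with `θ_t` and using `H¹ ⊆ L^∞` in one dimension
gives a Grönwall inequality with the integrable kernel `‖w_x‖²`, hence `θ` in `L^∞(H¹)` and `θ_t` in
`L²(L²)` (`bound_θ_aux`). As `K` is the space derivative of `w_x - μ z`, the energy inequality then
bounds `v` in `L^∞(L²)` and `v_x` in `L²(L²)` (`LinSol.Nonlin.parabolic`). Now the bound of `∫ ‖G‖²`
is affine in `∫ ‖z‖²` and parabolic regularity bounds `z` in `L^∞(H¹)` (`bound_z`). The norms in the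
statement are read off from these bounds and the equations.

Uniqueness. An arbitrary weak solution is compared with the regular one already built. The strain
difference and the temperature difference satisfy together a Grönwall inequality with zero data,
whose kernel involves the strain rate of the weak solution only through its integrable square norm
(`IntegratedSol.eq_of_nonlin`). -/

noncomputable section

namespace ThermoVisco

/-! ### Primitives of Bochner integrable functions -/

section Primitive

variable {E F G : Type*} [NormedAddCommGroup E] [NormedSpace ℝ E]
  [NormedAddCommGroup F] [NormedSpace ℝ F]
  [NormedAddCommGroup G] [NormedSpace ℝ G]

/-- `y` is on `[0,T]` a primitive of the integrable function `g`. -/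
structure HasPrim (T : ℝ) (y g : ℝ → E) : Prop where
  integrable : IntegrableOn g (Ioc 0 T)
  eq : ∀ t ∈ Icc 0 T, y t = y 0 + ∫ s in (0 : ℝ)..t, g s

theorem intervalIntegral_eq_indicator {φ : ℝ → E} {s t : ℝ} (hs : s ∈ Icc 0 t) :
    ∫ r in (0 : ℝ)..s, φ r = ∫ r in Ioc 0 t, (Iic s).indicator φ r := by
  rw [intervalIntegral.integral_of_le hs.1, setIntegral_indicator measurableSet_Iic]
  congr 2
  ext r
  simp only [mem_Ioc, mem_inter_iff, mem_Iic]
  exact ⟨fun h => ⟨⟨h.1, h.2.trans hs.2⟩, h.2⟩, fun h => ⟨h.1.1, h.2⟩⟩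

theorem intervalIntegral_eq_indicator_Iio {φ : ℝ → E} {s t : ℝ} (hs : s ∈ Icc 0 t) :
    ∫ r in (0 : ℝ)..s, φ r = ∫ r in Ioc 0 t, (Iio s).indicator φ r := by
  rw [intervalIntegral.integral_of_le hs.1, setIntegral_indicator measurableSet_Iio,
    integral_Ioc_eq_integral_Ioo]
  congr 2
  ext r
  simp only [mem_Ioc, mem_Ioo, mem_inter_iff, mem_Iio]
  exact ⟨fun h => ⟨⟨h.1, h.2.le.trans hs.2⟩, h.2⟩, fun h => ⟨h.1.1, h.2⟩⟩

/-- Fubini on the square `(0,t]²`: the two terms are the integrals of `B (g s) (h r)` over the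
triangles `r ≤ s` and `s < r`. Taking one triangle closed and the other open makes them a partition,
so integration by parts needs integrability only. -/
theorem integral_bilin_prim [CompleteSpace E] [CompleteSpace F] [CompleteSpace G]
    (B : E →L[ℝ] F →L[ℝ] G) {t : ℝ} {g : ℝ → E} {h : ℝ → F}
    (hg : IntegrableOn g (Ioc 0 t)) (hh : IntegrableOn h (Ioc 0 t)) :
    (∫ s in Ioc 0 t, B (g s) (∫ r in (0 : ℝ)..s, h r))
      + (∫ s in Ioc 0 t, B (∫ r in (0 : ℝ)..s, g r) (h s))
      = B (∫ s in Ioc 0 t, g s) (∫ s in Ioc 0 t, h s) := by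
  set μ := volume.restrict (Ioc (0 : ℝ) t) with hμ
  have hP : Integrable (fun q : ℝ × ℝ => B (g q.1) (h q.2)) (μ.prod μ) := by
    refine Integrable.mono' ((hg.norm.mul_prod hh.norm).const_mul ‖B‖)
      (B.aestronglyMeasurable_comp₂ hg.1.comp_fst hh.1.comp_snd) (Eventually.of_forall fun q => ?_)
    simpa [mul_assoc] using B.le_opNorm₂ (g q.1) (h q.2)
  have hm1 : MeasurableSet {q : ℝ × ℝ | q.2 ≤ q.1} := measurableSet_le measurable_snd measurable_fst
  have hm2 : MeasurableSet {q : ℝ × ℝ | q.1 < q.2} := measurableSet_lt measurable_fst measurable_snd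
  have e1 : (∫ s in Ioc 0 t, B (g s) (∫ r in (0 : ℝ)..s, h r))
      = ∫ q, {q : ℝ × ℝ | q.2 ≤ q.1}.indicator (fun q : ℝ × ℝ => B (g q.1) (h q.2)) q ∂μ.prod μ := by
    rw [integral_prod _ (hP.indicator hm1)]
    refine setIntegral_congr_fun measurableSet_Ioc fun s hs => ?_
    rw [intervalIntegral_eq_indicator (Ioc_subset_Icc_self hs),
      ← ContinuousLinearMap.integral_comp_comm _ (hh.indicator measurableSet_Iic)]
    refine integral_congr_ae (Eventually.of_forall fun r => ?_)
    simp only [indicator, mem_Iic, mem_ofPred_eq]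
    split_ifs <;> simp
  have e2 : (∫ s in Ioc 0 t, B (∫ r in (0 : ℝ)..s, g r) (h s))
      = ∫ q, {q : ℝ × ℝ | q.1 < q.2}.indicator (fun q : ℝ × ℝ => B (g q.1) (h q.2)) q ∂μ.prod μ := by
    rw [integral_prod_symm _ (hP.indicator hm2)]
    refine setIntegral_congr_fun measurableSet_Ioc fun s hs => ?_
    rw [intervalIntegral_eq_indicator_Iio (Ioc_subset_Icc_self hs),
      ← B.flip_apply, ← ContinuousLinearMap.integral_comp_comm _ (hg.indicator measurableSet_Iio)]
    refine integral_congr_ae (Eventually.of_forall fun r => ?_)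
    simp only [indicator, mem_Iio, mem_ofPred_eq]
    split_ifs <;> simp
  rw [e1, e2, ← integral_add (hP.indicator hm1) (hP.indicator hm2)]
  have e3 : (fun q : ℝ × ℝ =>
      {q : ℝ × ℝ | q.2 ≤ q.1}.indicator (fun q : ℝ × ℝ => B (g q.1) (h q.2)) q
      + {q : ℝ × ℝ | q.1 < q.2}.indicator (fun q : ℝ × ℝ => B (g q.1) (h q.2)) q)
      = fun q => B (g q.1) (h q.2) := by
    funext q
    simp only [indicator, mem_ofPred_eq]
    rcases le_or_gt q.2 q.1 with h | h
    · simp [h, not_lt.2 h]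
    · simp [h, not_le.2 h]
  rw [e3, integral_prod _ hP]
  have : ∀ s, (∫ r, B (g s) (h r) ∂μ) = B (g s) (∫ r, h r ∂μ) := fun s =>
    ContinuousLinearMap.integral_comp_comm _ hh
  simp only [this]
  simp_rw [← B.flip_apply]
  rw [ContinuousLinearMap.integral_comp_comm _ hg]

namespace HasPrim

variable {T : ℝ} {y g : ℝ → E} {x h : ℝ → F}

theorem intervalIntegrable (hy : HasPrim T y g) {s t : ℝ} (hs : s ∈ Icc 0 T) (ht : t ∈ Icc 0 T) :
    IntervalIntegrable g volume s t := by
  rw [intervalIntegrable_iff]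
  refine hy.integrable.mono_set ?_
  rw [uIoc]
  exact Ioc_subset_Ioc (le_min hs.1 ht.1) (max_le hs.2 ht.2)

theorem mono (hy : HasPrim T y g) {τ : ℝ} (hτ : τ ≤ T) : HasPrim τ y g :=
  ⟨hy.1.mono_set (Ioc_subset_Ioc_right hτ), fun t ht => hy.2 t ⟨ht.1, ht.2.trans hτ⟩⟩

theorem continuousOn (hy : HasPrim T y g) : ContinuousOn y (Icc 0 T) := by
  rcases le_or_gt 0 T with hT | hT
  · have : ContinuousOn (fun t => y 0 + ∫ s in (0 : ℝ)..t, g s) (Icc 0 T) := by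
      refine continuousOn_const.add ?_
      have := intervalIntegral.continuousOn_primitive_interval (μ := volume) (f := g) (a := 0) (b := T)
        (by rw [uIcc_of_le hT, integrableOn_Icc_iff_integrableOn_Ioc]; exact hy.1)
      rwa [uIcc_of_le hT] at this
    exact this.congr hy.2
  · simp [Icc_eq_empty (not_le.2 hT)]

theorem congr_ae (hy : HasPrim T y g) {g' : ℝ → E}
    (h : ∀ᵐ t ∂volume.restrict (Ioc 0 T), g t = g' t) : HasPrim T y g' := by
  refine ⟨hy.1.congr h, fun t ht => ?_⟩
  rw [hy.2 t ht, intervalIntegral.integral_of_le ht.1, intervalIntegral.integral_of_le ht.1]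
  congr 1
  exact integral_congr_ae (ae_restrict_of_ae_restrict_of_subset (Ioc_subset_Ioc_right ht.2) h)

theorem congr_left (hy : HasPrim T y g) {y' : ℝ → E} (h : ∀ t ∈ Icc 0 T, y' t = y t) :
    HasPrim T y' g := by
  refine ⟨hy.1, fun t ht => ?_⟩
  rw [h t ht, h 0 ⟨le_rfl, ht.1.trans ht.2⟩, hy.2 t ht]

theorem clm [CompleteSpace E] [CompleteSpace F] (hy : HasPrim T y g) (L : E →L[ℝ] F) :
    HasPrim T (fun t => L (y t)) (fun t => L (g t)) := by
  refine ⟨L.integrable_comp hy.1, fun t ht => ?_⟩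
  rw [hy.2 t ht, map_add, L.intervalIntegral_comp_comm
    (hy.intervalIntegrable ⟨le_rfl, ht.1.trans ht.2⟩ ht)]

theorem add (hy : HasPrim T y g) {y' g' : ℝ → E} (hy' : HasPrim T y' g') :
    HasPrim T (fun t => y t + y' t) (fun t => g t + g' t) := by
  refine ⟨hy.1.add hy'.1, fun t ht => ?_⟩
  rw [intervalIntegral.integral_add (hy.intervalIntegrable ⟨le_rfl, ht.1.trans ht.2⟩ ht)
    (hy'.intervalIntegrable ⟨le_rfl, ht.1.trans ht.2⟩ ht), hy.2 t ht, hy'.2 t ht]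
  abel

theorem const_smul (hy : HasPrim T y g) (c : ℝ) :
    HasPrim T (fun t => c • y t) (fun t => c • g t) := by
  refine ⟨hy.1.smul c, fun t ht => ?_⟩
  rw [intervalIntegral.integral_smul, hy.2 t ht, smul_add]

theorem neg (hy : HasPrim T y g) : HasPrim T (fun t => - y t) (fun t => - g t) := by
  simpa using hy.const_smul (-1)

theorem sub (hy : HasPrim T y g) {y' g' : ℝ → E} (hy' : HasPrim T y' g') :
    HasPrim T (fun t => y t - y' t) (fun t => g t - g' t) := by
  simpa [sub_eq_add_neg] using hy.add hy'.neg

theorem const (c : E) : HasPrim T (fun _ => c) (fun _ => (0 : E)) :=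
  ⟨integrableOn_zero, by simp⟩

theorem of_integral (c : E) (hg : IntegrableOn g (Ioc 0 T)) :
    HasPrim T (fun t => c + ∫ s in (0 : ℝ)..t, g s) g :=
  ⟨hg, by simp⟩

/-- The product rule for absolutely continuous curves. Once the initial values are subtracted from
both factors, what remains is `integral_bilin_prim`. -/
theorem bilin [CompleteSpace E] [CompleteSpace F] [CompleteSpace G] (B : E →L[ℝ] F →L[ℝ] G)
    (hy : HasPrim T y g) (hx : HasPrim T x h) :
    HasPrim T (fun t => B (y t) (x t)) (fun t => B (g t) (x t) + B (y t) (h t)) := by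
  have i1 : IntegrableOn (fun t => B (g t) (x t)) (Ioc 0 T) := by
    obtain ⟨C, hC⟩ := isCompact_Icc.exists_bound_of_continuousOn hx.continuousOn
    refine B.integrable_of_bilin_of_bdd_right C hy.1
      ((hx.continuousOn.mono Ioc_subset_Icc_self).aestronglyMeasurable measurableSet_Ioc) ?_
    filter_upwards [ae_restrict_mem measurableSet_Ioc] with t ht using hC t (Ioc_subset_Icc_self ht)
  have i2 : IntegrableOn (fun t => B (y t) (h t)) (Ioc 0 T) := by
    obtain ⟨C, hC⟩ := isCompact_Icc.exists_bound_of_continuousOn hy.continuousOn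
    refine B.integrable_of_bilin_of_bdd_left C
      ((hy.continuousOn.mono Ioc_subset_Icc_self).aestronglyMeasurable measurableSet_Ioc) ?_ hx.1
    filter_upwards [ae_restrict_mem measurableSet_Ioc] with t ht using hC t (Ioc_subset_Icc_self ht)
  refine ⟨i1.add i2, fun t ht => ?_⟩
  have hsub : Ioc 0 t ⊆ Ioc 0 T := Ioc_subset_Ioc_right ht.2
  have hg := hy.1.mono_set hsub
  have hh := hx.1.mono_set hsub
  have key := integral_bilin_prim B hg hh
  rw [intervalIntegral.integral_of_le ht.1, integral_add (i1.mono_set hsub) (i2.mono_set hsub)]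
  have a1 : ∫ s in Ioc 0 t, B (g s) (x s)
      = B (∫ s in Ioc 0 t, g s) (x 0) + ∫ s in Ioc 0 t, B (g s) (∫ r in (0 : ℝ)..s, h r) := by
    have : ∀ s ∈ Ioc 0 t, B (g s) (x s) - B (g s) (x 0) = B (g s) (∫ r in (0 : ℝ)..s, h r) := by
      intro s hs
      rw [hx.2 s ⟨hs.1.le, hs.2.trans ht.2⟩, map_add, add_sub_cancel_left]
    rw [← setIntegral_congr_fun measurableSet_Ioc this]
    have i3 : IntegrableOn (fun s => B (g s) (x 0)) (Ioc 0 t) :=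
      (B.flip (x 0)).integrable_comp hg
    rw [integral_sub (i1.mono_set hsub) i3]
    have := (B.flip (x 0)).integral_comp_comm hg
    simp only [ContinuousLinearMap.flip_apply] at this
    rw [this]; abel
  have a2 : ∫ s in Ioc 0 t, B (y s) (h s)
      = B (y 0) (∫ s in Ioc 0 t, h s) + ∫ s in Ioc 0 t, B (∫ r in (0 : ℝ)..s, g r) (h s) := by
    have : ∀ s ∈ Ioc 0 t, B (y s) (h s) - B (y 0) (h s) = B (∫ r in (0 : ℝ)..s, g r) (h s) := by
      intro s hs
      rw [hy.2 s ⟨hs.1.le, hs.2.trans ht.2⟩, map_add, _root_.add_apply,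
        add_sub_cancel_left]
    rw [← setIntegral_congr_fun measurableSet_Ioc this]
    have i3 : IntegrableOn (fun s => B (y 0) (h s)) (Ioc 0 t) := (B (y 0)).integrable_comp hh
    rw [integral_sub (i2.mono_set hsub) i3, (B (y 0)).integral_comp_comm hh]
    abel
  have e : B (y t) (x t) = B (y 0) (x 0) + B (∫ s in Ioc 0 t, g s) (x 0)
      + B (y 0) (∫ s in Ioc 0 t, h s) + B (∫ s in Ioc 0 t, g s) (∫ s in Ioc 0 t, h s) := by
    rw [hy.2 t ht, hx.2 t ht, intervalIntegral.integral_of_le ht.1,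
      intervalIntegral.integral_of_le ht.1]
    simp only [map_add, _root_.add_apply]
    abel
  rw [e, a1, a2, ← key]
  abel

theorem of_hasDerivAt [CompleteSpace E] (hg : ContinuousOn g (Icc 0 T))
    (h : ∀ t ∈ Icc 0 T, HasDerivAt y (g t) t) : HasPrim T y g := by
  refine ⟨(hg.integrableOn_Icc).mono_set Ioc_subset_Icc_self, fun t ht => ?_⟩
  rw [intervalIntegral.integral_eq_sub_of_hasDerivAt]
  · abel
  · intro s hs
    rw [uIcc_of_le ht.1] at hs
    exact h s ⟨hs.1, hs.2.trans ht.2⟩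
  · refine ContinuousOn.intervalIntegrable ?_
    rw [uIcc_of_le ht.1]
    exact hg.mono (Icc_subset_Icc_right ht.2)

theorem mul {y g x h : ℝ → ℝ} (hy : HasPrim T y g) (hx : HasPrim T x h) :
    HasPrim T (fun t => y t * x t) (fun t => g t * x t + y t * h t) :=
  bilin (ContinuousLinearMap.mul ℝ ℝ) hy hx

theorem pow_succ {y g : ℝ → ℝ} (hy : HasPrim T y g) (n : ℕ) :
    HasPrim T (fun t => y t ^ (n + 1)) (fun t => (n + 1) * (g t * y t ^ n)) := by
  induction n with
  | zero => simpa using hy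
  | succ n ih =>
    have := ih.mul hy
    refine (this.congr_left fun t _ => by ring).congr_ae (Eventually.of_forall fun t => ?_)
    push_cast; ring

/-- The product rule for `φ • y` between `0` and `T`; the boundary terms vanish with `φ`. -/
theorem weakTimeDeriv [CompleteSpace E] (hy : HasPrim T y g) (hT : 0 ≤ T) : HasWeakTimeDeriv T y g := by
  intro φ hφ
  have hd : HasPrim T φ (deriv φ) := by
    refine of_hasDerivAt (hφ.1.continuous_deriv (by simp)).continuousOn fun t _ => ?_
    exact (hφ.1.differentiable (by simp)).differentiableAt.hasDerivAt
  have key := (bilin (ContinuousLinearMap.lsmul ℝ ℝ) hd hy).2 T ⟨hT, le_rfl⟩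
  have h0 : ∀ t, t ∉ Ioo 0 T → φ t = 0 := fun t ht =>
    image_eq_zero_of_notMem_tsupport fun h => ht (hφ.2.2 h)
  simp only [ContinuousLinearMap.lsmul_apply] at key
  rw [h0 T (by simp), h0 0 (by simp), zero_smul, zero_smul, zero_add,
    intervalIntegral.integral_of_le hT, integral_Ioc_eq_integral_Ioo] at key
  have hc := (hd.continuousOn)
  have i1 : IntegrableOn (fun t => deriv φ t • y t) (Ioo 0 T) :=
    (((hφ.1.continuous_deriv (by simp)).continuousOn.smul hy.continuousOn).integrableOn_Icc).mono_set
      Ioo_subset_Icc_self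
  have i2 : IntegrableOn (fun t => φ t • g t) (Ioo 0 T) := by
    have hb := isCompact_Icc.exists_bound_of_continuousOn hc
    obtain ⟨C, hC⟩ := hb
    refine Integrable.bdd_smul (hy.1.mono_set Ioo_subset_Ioc_self) C
      hφ.1.continuous.aestronglyMeasurable ?_
    filter_upwards [ae_restrict_mem measurableSet_Ioo] with t ht using hC t (Ioo_subset_Icc_self ht)
  rw [integral_add i1 i2] at key
  exact eq_neg_of_add_eq_zero_left key.symm

end HasPrim

end Primitive

end ThermoVisco

namespace ThermoVisco

/-! ### Square integrable functions of time and Grönwall's inequality -/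

section TimeIntegrals

variable {E : Type*} [NormedAddCommGroup E]

theorem timeMeasure_eq (T : ℝ) : timeMeasure T = volume.restrict (Ioc 0 T) :=
  Measure.restrict_congr_set Ioo_ae_eq_Ioc

theorem MemLp.integrableOn_norm_sq {T : ℝ} {g : ℝ → E} (hg : MemLp g 2 (timeMeasure T)) :
    IntegrableOn (fun t => ‖g t‖ ^ 2) (Ioc 0 T) := by
  rw [IntegrableOn, ← timeMeasure_eq]
  exact hg.integrable_norm_pow (by norm_num)

theorem MemLp.integrableOn {T : ℝ} {g : ℝ → E} (hg : MemLp g 2 (timeMeasure T)) :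
    IntegrableOn g (Ioc 0 T) := by
  rw [IntegrableOn, ← timeMeasure_eq]
  exact hg.integrable (by norm_num)

theorem ae_Ioc {T : ℝ} {p : ℝ → Prop} (hp : ∀ᵐ t ∂timeMeasure T, p t) :
    ∀ᵐ t ∂volume.restrict (Ioc 0 T), p t := timeMeasure_eq T ▸ hp

theorem ae_time_of_Ioc {T : ℝ} {p : ℝ → Prop} (hp : ∀ᵐ t ∂volume.restrict (Ioc 0 T), p t) :
    ∀ᵐ t ∂timeMeasure T, p t := (timeMeasure_eq T).symm ▸ hp

theorem timeMeasure_mono {τ T : ℝ} (h : τ ≤ T) : timeMeasure τ ≤ timeMeasure T :=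
  Measure.restrict_mono (Ioo_subset_Ioo_right h) le_rfl

theorem ae_timeMeasure_mono {τ T : ℝ} (h : τ ≤ T) {p : ℝ → Prop} (hp : ∀ᵐ t ∂timeMeasure T, p t) :
    ∀ᵐ t ∂timeMeasure τ, p t :=
  ae_restrict_of_ae_restrict_of_subset (Ioo_subset_Ioo_right h) hp

theorem _root_.ContinuousOn.memLp_timeMeasure {T : ℝ} {g : ℝ → E} (p : ℝ≥0∞)
    (hg : ContinuousOn g (Icc 0 T)) : MemLp g p (timeMeasure T) := by
  obtain ⟨C, hC⟩ := isCompact_Icc.exists_bound_of_continuousOn hg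
  refine MemLp.of_bound ((hg.mono Ioo_subset_Icc_self).aestronglyMeasurable measurableSet_Ioo) C ?_
  filter_upwards [ae_restrict_mem measurableSet_Ioo] with t ht using hC t (Ioo_subset_Icc_self ht)

theorem lp_norm_sq_eq {T : ℝ} (hT : 0 ≤ T) (F : Lp E 2 (timeMeasure T)) :
    ‖F‖ ^ 2 = ∫ t in (0 : ℝ)..T, ‖F t‖ ^ 2 := by
  have h := (Lp.memLp F).eLpNorm_eq_integral_rpow_norm (by norm_num) (by norm_num)
  rw [Lp.norm_def, h, ENNReal.toReal_ofReal (by positivity), intervalIntegral.integral_of_le hT,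
    integral_Ioc_eq_integral_Ioo]
  simp only [ENNReal.toReal_ofNat, Real.rpow_two]
  rw [← Real.rpow_natCast, ← Real.rpow_mul (by positivity)]
  norm_num

variable [NormedSpace ℝ E]

/-- Cauchy–Schwarz, obtained by integrating `(‖g‖ - m)² ≥ 0` with `m` the mean value of `‖g‖`. -/
theorem sq_norm_integral_le {t : ℝ} (ht : 0 ≤ t) {g : ℝ → E} (hg : MemLp g 2 (timeMeasure t)) :
    ‖∫ s in (0 : ℝ)..t, g s‖ ^ 2 ≤ t * ∫ s in (0 : ℝ)..t, ‖g s‖ ^ 2 := by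
  rcases ht.eq_or_lt with rfl | ht'
  · simp
  have h1 : ‖∫ s in (0 : ℝ)..t, g s‖ ≤ ∫ s in (0 : ℝ)..t, ‖g s‖ :=
    intervalIntegral.norm_integral_le_integral_norm ht
  set m := (∫ s in (0 : ℝ)..t, ‖g s‖) / t with hm
  have i1 : IntervalIntegrable (fun s => ‖g s‖) volume 0 t :=
    (intervalIntegrable_iff_integrableOn_Ioc_of_le ht).2 (MemLp.integrableOn hg).norm
  have i2 : IntervalIntegrable (fun s => ‖g s‖ ^ 2) volume 0 t :=
    (intervalIntegrable_iff_integrableOn_Ioc_of_le ht).2 (MemLp.integrableOn_norm_sq hg)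
  have h2 : ∫ s in (0 : ℝ)..t, (2 * m * ‖g s‖ - m ^ 2) ≤ ∫ s in (0 : ℝ)..t, ‖g s‖ ^ 2 := by
    refine intervalIntegral.integral_mono_on ht ((i1.const_mul _).sub (by simp)) i2 fun s _ => ?_
    nlinarith [sq_nonneg (‖g s‖ - m)]
  rw [intervalIntegral.integral_sub (i1.const_mul _) (by simp), intervalIntegral.integral_const_mul]
    at h2
  simp only [intervalIntegral.integral_const, sub_zero, smul_eq_mul] at h2
  have hmt : (∫ s in (0 : ℝ)..t, ‖g s‖) = m * t := by rw [hm]; field_simp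
  rw [hmt] at h1 h2
  have h3 : ‖∫ s in (0 : ℝ)..t, g s‖ ^ 2 ≤ (m * t) ^ 2 := by gcongr
  nlinarith

/-- Grönwall's inequality with an integrable kernel. -/
theorem gronwall_integral {T A : ℝ} {φ k : ℝ → ℝ} (hφ : ContinuousOn φ (Icc 0 T))
    (hk : IntegrableOn k (Ioc 0 T)) (hk0 : ∀ t, 0 ≤ k t)
    (h : ∀ t ∈ Icc 0 T, φ t ≤ A + ∫ s in (0 : ℝ)..t, k s * φ s) :
    ∀ t ∈ Icc 0 T, φ t ≤ A * Real.exp (∫ s in (0 : ℝ)..t, k s) := by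
  obtain ⟨M, hM⟩ := isCompact_Icc.exists_bound_of_continuousOn hφ
  have hK := HasPrim.of_integral (0 : ℝ) hk
  simp only [zero_add] at hK
  set K : ℝ → ℝ := fun t => ∫ s in (0 : ℝ)..t, k s with hKdef
  have hK0 : K 0 = 0 := by simp [hKdef]
  -- The terms of the exponential series of `K` are successive primitives weighted by `k`; the case
  -- `n = 0` is the constant `1`.
  have hpow : ∀ n : ℕ, HasPrim T (fun t => K t ^ n / n.factorial)
      (fun t => if n = 0 then 0 else k t * (K t ^ (n - 1) / (n - 1).factorial)) := by
    intro n
    cases n with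
    | zero => simpa using HasPrim.const (T := T) (1 : ℝ)
    | succ n =>
      have := (hK.pow_succ n).const_smul (1 / (n + 1).factorial : ℝ)
      refine (this.congr_left fun t _ => ?_).congr_ae (Eventually.of_forall fun t => ?_)
      · simp only [smul_eq_mul]; ring
      · have : (n.factorial : ℝ) ≠ 0 := by positivity
        have : (n + 1 : ℝ) ≠ 0 := by positivity
        simp only [smul_eq_mul, Nat.factorial_succ, Nat.add_sub_cancel, Nat.succ_ne_zero, if_false]
        push_cast
        field_simp
  -- The hypothesis substituted `n` times into itself. The last term is the remainder, which tends
  -- to `0`; no sign of `A` or `φ` is needed.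
  have key : ∀ n : ℕ, ∀ t ∈ Icc 0 T,
      φ t ≤ A * ∑ j ∈ Finset.range n, K t ^ j / j.factorial + M * (K t ^ n / n.factorial) := by
    intro n
    induction n with
    | zero =>
      intro t ht
      simpa using (le_abs_self _).trans (hM t ht)
    | succ n ih =>
      intro t ht
      have hT0 : (0 : ℝ) ∈ Icc 0 T := ⟨le_rfl, ht.1.trans ht.2⟩
      refine (h t ht).trans ?_
      have ii : ∀ j : ℕ, IntervalIntegrable (fun s => k s * (K s ^ j / j.factorial)) volume 0 t := by
        intro j
        have := (hpow (j + 1)).intervalIntegrable hT0 ht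
        simpa using this
      have ie : ∀ j : ℕ, ∫ s in (0 : ℝ)..t, k s * (K s ^ j / j.factorial)
          = K t ^ (j + 1) / (j + 1).factorial := by
        intro j
        have := (hpow (j + 1)).2 t ht
        simp only [hK0, Nat.succ_ne_zero, if_false, Nat.add_sub_cancel] at this
        rw [this]; simp
      have i1 : IntervalIntegrable (fun s => k s * φ s) volume 0 t := by
        rw [intervalIntegrable_iff_integrableOn_Ioc_of_le ht.1]
        have hsub : Ioc 0 t ⊆ Ioc 0 T := Ioc_subset_Ioc_right ht.2
        refine Integrable.mul_bdd (c := M) (hk.mono_set hsub)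
          (((hφ.mono Ioc_subset_Icc_self).mono hsub).aestronglyMeasurable measurableSet_Ioc) ?_
        filter_upwards [ae_restrict_mem measurableSet_Ioc] with s hs
          using hM s (Ioc_subset_Icc_self (hsub hs))
      have i2 : IntervalIntegrable (fun s => A * ∑ j ∈ Finset.range n, k s * (K s ^ j / j.factorial)
          + M * (k s * (K s ^ n / n.factorial))) volume 0 t := by
        refine IntervalIntegrable.add ?_ ((ii n).const_mul _)
        refine IntervalIntegrable.const_mul ?_ A
        have := IntervalIntegrable.sum (Finset.range n) (fun j _ => ii j)
        simpa [Finset.sum_fn] using this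
      have hle : ∫ s in (0 : ℝ)..t, k s * φ s ≤ ∫ s in (0 : ℝ)..t,
          (A * ∑ j ∈ Finset.range n, k s * (K s ^ j / j.factorial)
          + M * (k s * (K s ^ n / n.factorial))) := by
        refine intervalIntegral.integral_mono_on ht.1 i1 i2 fun s hs => ?_
        have := mul_le_mul_of_nonneg_left (ih s ⟨hs.1, hs.2.trans ht.2⟩) (hk0 s)
        refine this.trans (le_of_eq ?_)
        rw [← Finset.mul_sum]; ring
      rw [intervalIntegral.integral_add _ ((ii n).const_mul _),
        intervalIntegral.integral_const_mul, intervalIntegral.integral_const_mul,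
        intervalIntegral.integral_finsetSum (fun j _ => ii j), ie n] at hle
      · simp only [ie] at hle
        rw [Finset.sum_range_succ']
        simp only [pow_zero, Nat.factorial_zero, Nat.cast_one, div_one]
        linarith
      · refine IntervalIntegrable.const_mul ?_ A
        have := IntervalIntegrable.sum (Finset.range n) (fun j _ => ii j)
        simpa [Finset.sum_fn] using this
  intro t ht
  have hexp : Tendsto (fun n : ℕ => ∑ j ∈ Finset.range n, K t ^ j / j.factorial) atTop
      (nhds (Real.exp (K t))) := by
    have := NormedSpace.expSeries_div_hasSum_exp (𝔸 := ℝ) (K t)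
    rw [← Real.exp_eq_exp_ℝ] at this
    exact this.tendsto_sum_nat
  have hz : Tendsto (fun n : ℕ => K t ^ n / n.factorial) atTop (nhds 0) :=
    FloorSemiring.tendsto_pow_div_factorial_atTop (K t)
  have hlim := (hexp.const_mul A).add (hz.const_mul M)
  rw [mul_zero, add_zero] at hlim
  exact ge_of_tendsto' hlim fun n => key n t ht

end TimeIntegrals

theorem HasPrim.norm_sq {H : Type*} [NormedAddCommGroup H] [InnerProductSpace ℝ H] [CompleteSpace H]
    {T : ℝ} {y g : ℝ → H} (hy : HasPrim T y g) :
    HasPrim T (fun t => ‖y t‖ ^ 2) (fun t => 2 * inner ℝ (g t) (y t)) := by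
  have := HasPrim.bilin (innerSL ℝ) hy hy
  refine (this.congr_left fun t _ => ?_).congr_ae (Eventually.of_forall fun t => ?_)
  · exact (real_inner_self_eq_norm_sq _).symm
  · change inner ℝ (g t) (y t) + inner ℝ (y t) (g t) = _
    rw [real_inner_comm (g t) (y t)]; ring

end ThermoVisco

namespace ThermoVisco

/-! ### Fixed points of causal maps -/

/-- Uniform continuity on `[0,T]` of the primitive of `m`. -/
theorem exists_small_integral {T : ℝ} {m : ℝ → ℝ} (hm : IntegrableOn m (Ioc 0 T)) {ε : ℝ}
    (hε : 0 < ε) : ∃ δ > 0, ∀ s ∈ Icc 0 T, ∀ t ∈ Icc 0 T, s ≤ t → t - s ≤ δ →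
      ∫ r in s..t, m r ≤ ε := by
  have h := HasPrim.of_integral (0 : ℝ) hm
  have hu := isCompact_Icc.uniformContinuousOn_of_continuous h.continuousOn
  rw [Metric.uniformContinuousOn_iff] at hu
  obtain ⟨δ, hδ, H⟩ := hu ε hε
  refine ⟨δ / 2, by positivity, fun s hs t ht hst hd => ?_⟩
  have h0 : (0 : ℝ) ∈ Icc 0 T := ⟨le_rfl, hs.1.trans hs.2⟩
  have := H t ht s hs (by rw [Real.dist_eq, abs_of_nonneg (by linarith)]; linarith)
  rw [Real.dist_eq, zero_add, zero_add, intervalIntegral.integral_interval_sub_left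
    (h.intervalIntegrable h0 ht) (h.intervalIntegrable h0 hs)] at this
  exact (le_abs_self _).trans this.le

variable {E : Type*} [NormedAddCommGroup E] [CompleteSpace E]

/-- One continuation step, from a solution `F` on `(0,τ)` to a solution on `(0,τ')`. The unknown is
sought as `F` plus something living on `(τ,τ']`, by contraction in a ball. The room between `B` and
`ρ²` is what the step may add to the square norm. -/
theorem causal_step {T : ℝ} (N : Lp E 2 (timeMeasure T) → Lp E 2 (timeMeasure T))
    {B ρ τ τ' : ℝ} (hρ0 : 0 ≤ ρ) (hρ : B + 1 ≤ ρ ^ 2) (h0 : 0 ≤ τ) (hττ' : τ ≤ τ')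
    (hτ' : τ' ≤ T) {k : ℝ → ℝ} (hk : IntegrableOn k (Ioc 0 T)) (hk0 : ∀ t, 0 ≤ k t)
    (H1 : ∀ F G, ‖F‖ ≤ ρ → ‖G‖ ≤ ρ → ∀ᵐ t ∂timeMeasure T,
      ‖N F t - N G t‖ ^ 2 ≤ k t * ∫ s in (0 : ℝ)..t, ‖F s - G s‖ ^ 2)
    (hsm : ∫ t in τ..τ', (2 * ρ ^ 2 * k t + 2 * ‖N 0 t‖ ^ 2) ≤ 1)
    (hsk : ∫ t in τ..τ', k t ≤ 1 / 4)
    (F : Lp E 2 (timeMeasure T)) (hF : ‖F‖ ^ 2 ≤ B)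
    (hFz : ∀ᵐ t ∂timeMeasure T, τ < t → F t = 0)
    (hFN : ∀ᵐ t ∂timeMeasure τ, N F t = F t) :
    ∃ G : Lp E 2 (timeMeasure T), (∀ᵐ t ∂timeMeasure T, τ' < t → G t = 0) ∧
      (∀ᵐ t ∂timeMeasure τ', N G t = G t) := by
  have hT : 0 ≤ T := h0.trans (hττ'.trans hτ')
  have sub1 : Ioc τ τ' ⊆ Ioc 0 T := Ioc_subset_Ioc h0 hτ'
  have hkI : IntervalIntegrable k volume τ τ' :=
    (intervalIntegrable_iff_integrableOn_Ioc_of_le hττ').2 (hk.mono_set sub1)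
  have hsqI : ∀ G : Lp E 2 (timeMeasure T), IntegrableOn (fun t => ‖G t‖ ^ 2) (Ioc 0 T) :=
    fun G => MemLp.integrableOn_norm_sq (Lp.memLp G)
  have hNI : IntervalIntegrable (fun t => ‖N 0 t‖ ^ 2) volume τ τ' :=
    (intervalIntegrable_iff_integrableOn_Ioc_of_le hττ').2 ((hsqI _).mono_set sub1)
  have hI : ∀ G : Lp E 2 (timeMeasure T), MemLp ((Ioc τ τ').indicator (N G)) 2 (timeMeasure T) :=
    fun G => (Lp.memLp (N G)).indicator measurableSet_Ioc
  -- The past is frozen to `F` and the equation is imposed only on the step.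
  set M : Lp E 2 (timeMeasure T) → Lp E 2 (timeMeasure T) := fun G => F + (hI G).toLp with hM
  have hMe : ∀ G, ∀ᵐ t ∂timeMeasure T, M G t = F t + (Ioc τ τ').indicator (N G) t := by
    intro G
    filter_upwards [Lp.coeFn_add F (hI G).toLp, (hI G).coeFn_toLp] with t h1 h2
    rw [hM, h1, Pi.add_apply, h2]
  -- the square norm of a function living on the step
  have hind : ∀ (Φ : Lp E 2 (timeMeasure T)) (m : ℝ → ℝ), IntervalIntegrable m volume τ τ' →
      (∀ᵐ t ∂timeMeasure T, ‖Φ t‖ ^ 2 ≤ (Ioc τ τ').indicator m t) →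
      ‖Φ‖ ^ 2 ≤ ∫ t in τ..τ', m t := by
    intro Φ m hm h
    rw [lp_norm_sq_eq hT, intervalIntegral.integral_of_le hT, intervalIntegral.integral_of_le hττ']
    have e : ∫ t in Ioc τ τ', m t = ∫ t in Ioc 0 T, (Ioc τ τ').indicator m t := by
      rw [setIntegral_indicator measurableSet_Ioc, inter_eq_self_of_subset_right sub1]
    rw [e]
    refine integral_mono_ae (hsqI Φ) ?_ (ae_Ioc h)
    rw [integrable_indicator_iff measurableSet_Ioc, IntegrableOn,
      Measure.restrict_restrict measurableSet_Ioc, inter_eq_self_of_subset_left sub1]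
    exact (intervalIntegrable_iff_integrableOn_Ioc_of_le hττ').1 hm
  have hle : ∀ G G' : Lp E 2 (timeMeasure T), ∀ t ∈ Ioo 0 T,
      ∫ s in (0 : ℝ)..t, ‖G s - G' s‖ ^ 2 ≤ ‖G - G'‖ ^ 2 := by
    intro G G' t ht
    rw [lp_norm_sq_eq hT, intervalIntegral.integral_of_le ht.1.le, intervalIntegral.integral_of_le hT]
    have e : ∫ s in Ioc 0 t, ‖G s - G' s‖ ^ 2 = ∫ s in Ioc 0 t, ‖(G - G') s‖ ^ 2 := by
      refine integral_congr_ae ?_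
      have := ae_Ioc (Lp.coeFn_sub G G')
      filter_upwards [ae_restrict_of_ae_restrict_of_subset (Ioc_subset_Ioc_right ht.2.le) this]
        with s hs
      rw [hs, Pi.sub_apply]
    rw [e]
    exact setIntegral_mono_set (hsqI _) (Eventually.of_forall fun s => by positivity)
      (Ioc_subset_Ioc_right ht.2.le).eventuallyLE
  have hρ' : (0 : ℝ) ≤ ρ := hρ0
  have hmaps : MapsTo M (Metric.closedBall 0 ρ) (Metric.closedBall 0 ρ) := by
    intro G hG
    rw [mem_closedBall_zero_iff] at hG ⊢
    have hz := H1 G 0 hG (by simpa using hρ')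
    have hN : ∫ t in τ..τ', ‖N G t‖ ^ 2 ≤ 1 := by
      refine le_trans ?_ hsm
      rw [intervalIntegral.integral_of_le hττ', intervalIntegral.integral_of_le hττ']
      refine integral_mono_ae ((hsqI _).mono_set sub1)
        (((hk.mono_set sub1).const_mul _).add (((hsqI _).mono_set sub1).const_mul _)) ?_
      have hz' := ae_restrict_of_ae_restrict_of_subset sub1 (ae_Ioc hz)
      have hmem : ∀ᵐ t ∂volume.restrict (Ioc τ τ'), t ∈ Ioo 0 T := by
        have : ∀ᵐ t ∂volume.restrict (Ioc 0 T), t ∈ Ioo 0 T := by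
          rw [← timeMeasure_eq]; exact ae_restrict_mem measurableSet_Ioo
        exact ae_restrict_of_ae_restrict_of_subset sub1 this
      filter_upwards [hz', hmem] with t ht htm
      have h1 := hle G 0 t htm
      rw [sub_zero] at h1
      have h2 : ‖N G t‖ ≤ ‖N G t - N 0 t‖ + ‖N 0 t‖ := by
        simpa using norm_add_le (N G t - N 0 t) (N 0 t)
      have h3 : ‖G‖ ^ 2 ≤ ρ ^ 2 := by gcongr
      have h4 : ‖N G t - N 0 t‖ ^ 2 ≤ k t * ρ ^ 2 :=
        ht.trans (mul_le_mul_of_nonneg_left (h1.trans h3) (hk0 t))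
      nlinarith [norm_nonneg (N G t), norm_nonneg (N 0 t), sq_nonneg (‖N G t - N 0 t‖ - ‖N 0 t‖),
        pow_le_pow_left₀ (norm_nonneg _) h2 2]
    -- `F` vanishes after `τ`, so the two parts of `M G` have disjoint supports and their square
    -- norms add.
    have hsum : ‖M G‖ ^ 2 ≤ ‖F‖ ^ 2 + ∫ t in τ..τ', ‖N G t‖ ^ 2 := by
      have hdec : ∀ᵐ t ∂timeMeasure T, ‖M G t‖ ^ 2
          = ‖F t‖ ^ 2 + (Ioc τ τ').indicator (fun t => ‖N G t‖ ^ 2) t := by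
        filter_upwards [hMe G, hFz] with t h1 h2
        rw [h1]
        by_cases ht : t ∈ Ioc τ τ'
        · simp [ht, h2 ht.1]
        · simp [ht]
      rw [lp_norm_sq_eq hT, lp_norm_sq_eq hT, intervalIntegral.integral_of_le hT,
        intervalIntegral.integral_of_le hT, intervalIntegral.integral_of_le hττ']
      have e : ∫ t in Ioc τ τ', ‖N G t‖ ^ 2
          = ∫ t in Ioc 0 T, (Ioc τ τ').indicator (fun t => ‖N G t‖ ^ 2) t := by
        rw [setIntegral_indicator measurableSet_Ioc, inter_eq_self_of_subset_right sub1]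
      rw [e, ← integral_add (hsqI _) ((hsqI _).indicator measurableSet_Ioc)]
      refine le_of_eq (integral_congr_ae (ae_Ioc hdec))
    have : ‖M G‖ ^ 2 ≤ ρ ^ 2 := by linarith
    exact (pow_le_pow_iff_left₀ (norm_nonneg _) hρ' two_ne_zero).1 this
  have hlip : ContractingWith (1 / 2) (hmaps.restrict M _ _) := by
    refine ⟨by norm_num, LipschitzWith.of_dist_le_mul fun G G' => ?_⟩
    obtain ⟨G, hG⟩ := G
    obtain ⟨G', hG'⟩ := G'
    rw [mem_closedBall_zero_iff] at hG hG'
    change dist (M G) (M G') ≤ _ * dist G G'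
    rw [dist_eq_norm, dist_eq_norm]
    have h1 : ‖M G - M G'‖ ^ 2 ≤ ∫ t in τ..τ', k t * ‖G - G'‖ ^ 2 := by
      refine hind _ _ (hkI.mul_const _) ?_
      filter_upwards [hMe G, hMe G', Lp.coeFn_sub (M G) (M G'), H1 G G' hG hG',
        ae_restrict_mem measurableSet_Ioo] with t a1 a2 a3 a4 a5
      rw [a3, Pi.sub_apply, a1, a2]
      by_cases ht : t ∈ Ioc τ τ'
      · simp only [ht, indicator_of_mem, add_sub_add_left_eq_sub]
        exact a4.trans (mul_le_mul_of_nonneg_left (hle G G' t a5) (hk0 t))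
      · simp [ht]
    rw [intervalIntegral.integral_mul_const] at h1
    have h2 : ‖M G - M G'‖ ^ 2 ≤ (1 / 2 * ‖G - G'‖) ^ 2 := by
      nlinarith [sq_nonneg ‖G - G'‖]
    have := (pow_le_pow_iff_left₀ (norm_nonneg _) (by positivity) two_ne_zero).1 h2
    simpa using this
  obtain ⟨G, hGb, hGfix, -⟩ := ContractingWith.exists_fixedPoint'
    (Metric.isClosed_closedBall.isComplete) hmaps hlip (x := 0) (by simpa using hρ')
    (edist_ne_top _ _)
  rw [mem_closedBall_zero_iff] at hGb
  have hGe : ∀ᵐ t ∂timeMeasure T, G t = F t + (Ioc τ τ').indicator (N G) t := by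
    have := hMe G
    rwa [hGfix] at this
  have hFb : ‖F‖ ≤ ρ := by
    have : ‖F‖ ^ 2 ≤ ρ ^ 2 := by linarith
    exact (pow_le_pow_iff_left₀ (norm_nonneg _) hρ' two_ne_zero).1 this
  refine ⟨G, ?_, ?_⟩
  · filter_upwards [hGe, hFz] with t h1 h2 ht
    rw [h1, h2 (hττ'.trans_lt ht)]
    simp [ht]
  · have hGF : ∀ᵐ t ∂timeMeasure T, t ≤ τ → G t = F t := by
      filter_upwards [hGe] with t h1 ht
      simp [h1, ht]
    filter_upwards [ae_timeMeasure_mono hτ' hGe, ae_timeMeasure_mono hτ' hFz,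
      ae_timeMeasure_mono hτ' (H1 G F hGb hFb),
      ae_timeMeasure_mono hτ' ((ae_restrict_iff' measurableSet_Ioo).2
        ((ae_restrict_iff' measurableSet_Ioo).1 hFN |>.mono fun t h _ => h) :
        ∀ᵐ t ∂timeMeasure T, t ∈ Ioo 0 τ → N F t = F t),
      (ae_restrict_mem measurableSet_Ioo : ∀ᵐ t ∂timeMeasure τ', t ∈ Ioo 0 τ'),
      (ae_restrict_of_ae (compl_mem_ae_iff.2 (measure_singleton τ)) :
        ∀ᵐ t ∂timeMeasure τ', t ∈ ({τ} : Set ℝ)ᶜ)] with t h1 h2 h3 h4 h5 h6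
    -- Before `τ` the fixed point coincides with `F`, and causality, contained in `H1`, gives `N G =
    -- N F` there; after `τ` the fixed point equation is the claim. The instant `τ` is discarded as
    -- a null set.
    rcases lt_or_gt_of_ne (show t ≠ τ from h6) with hlt | hgt
    · have hz : ∫ s in (0 : ℝ)..t, ‖G s - F s‖ ^ 2 = 0 := by
        rw [intervalIntegral.integral_of_le h5.1.le]
        refine integral_eq_zero_of_ae ?_
        filter_upwards [ae_restrict_of_ae_restrict_of_subset
          (Ioc_subset_Ioc_right (h5.2.le.trans hτ')) (ae_Ioc hGF), ae_restrict_mem measurableSet_Ioc]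
          with s hs hs'
        simp [hs (hs'.2.trans hlt.le)]
      rw [hz, mul_zero] at h3
      have h7 : N G t = N F t := by
        have : ‖N G t - N F t‖ = 0 := by nlinarith [norm_nonneg (N G t - N F t)]
        exact sub_eq_zero.1 (norm_eq_zero.1 this)
      rw [h7, h4 ⟨h5.1, hlt⟩, h1]
      simp [not_lt.2 hlt.le]
    · rw [h1, h2 hgt]
      simp [hgt, h5.2.le]

/-- A causal, locally Lipschitz map of `L²(0,T;E)` has a fixed point as soon as the solutions of
the fixed point equation on the intervals `(0,τ)` are a priori bounded. -/
theorem exists_causal_fixedPoint {T : ℝ} (hT : 0 ≤ T)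
    (N : Lp E 2 (timeMeasure T) → Lp E 2 (timeMeasure T))
    (H1 : ∀ ρ : ℝ, ∃ k : ℝ → ℝ, IntegrableOn k (Ioc 0 T) ∧ (∀ t, 0 ≤ k t) ∧
      ∀ F G, ‖F‖ ≤ ρ → ‖G‖ ≤ ρ → ∀ᵐ t ∂timeMeasure T,
      ‖N F t - N G t‖ ^ 2 ≤ k t * ∫ s in (0 : ℝ)..t, ‖F s - G s‖ ^ 2)
    (H2 : ∃ B : ℝ, ∀ τ ∈ Icc 0 T, ∀ F, (∀ᵐ t ∂timeMeasure τ, N F t = F t) →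
      ∫ s in (0 : ℝ)..τ, ‖F s‖ ^ 2 ≤ B) :
    ∃ F, N F = F := by
  obtain ⟨B, hBd⟩ := H2
  have hB : 0 ≤ B := by simpa using hBd 0 ⟨le_rfl, hT⟩ 0 (by simp [timeMeasure])
  -- The radius `B + 1` is admissible for `causal_step` because `B ≥ 0` gives `B + 1 ≤ (B + 1)²`.
  obtain ⟨k, hk, hk0, hL⟩ := H1 (B + 1)
  have hm : IntegrableOn (fun t => 2 * (B + 1) ^ 2 * k t + 2 * ‖N 0 t‖ ^ 2) (Ioc 0 T) :=
    Integrable.add (f := fun t => 2 * (B + 1) ^ 2 * k t) (g := fun t => 2 * ‖N 0 t‖ ^ 2)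
      (Integrable.const_mul hk _)
      (Integrable.const_mul (MemLp.integrableOn_norm_sq (Lp.memLp (N 0))) _)
  obtain ⟨δ₁, hδ₁, h₁⟩ := exists_small_integral hm one_pos
  obtain ⟨δ₂, hδ₂, h₂⟩ := exists_small_integral hk (show (0 : ℝ) < 1 / 4 by norm_num)
  -- The step length depends on `B` and `T` only, not on the time already reached, so finitely many
  -- steps exhaust `(0,T)`.
  set δ := min δ₁ δ₂
  have hδ : 0 < δ := lt_min hδ₁ hδ₂
  have key : ∀ n : ℕ, ∃ F : Lp E 2 (timeMeasure T),
      (∀ᵐ t ∂timeMeasure T, min (n * δ) T < t → F t = 0) ∧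
      (∀ᵐ t ∂timeMeasure (min (n * δ) T), N F t = F t) := by
    intro n
    induction n with
    | zero =>
      refine ⟨0, ?_, ?_⟩
      · filter_upwards [Lp.coeFn_zero E 2 (timeMeasure T)] with t ht _ using by simpa using ht
      · simp [timeMeasure, hT]
    | succ n ih =>
      obtain ⟨F, hF1, hF2⟩ := ih
      set τ := min (n * δ) T
      set τ' := min ((n + 1 : ℕ) * δ) T
      have h0 : 0 ≤ τ := le_min (by positivity) hT
      have hττ' : τ ≤ τ' := min_le_min_right _ (by push_cast; nlinarith)
      have hd : τ' - τ ≤ δ := by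
        rcases min_choice ((n : ℝ) * δ) T with h | h
        · have : τ' ≤ (n + 1 : ℕ) * δ := min_le_left _ _
          have h' : τ = n * δ := h
          push_cast at this; linarith
        · have : τ' ≤ T := min_le_right _ _
          have h' : τ = T := h
          linarith
      have hτm : τ ∈ Icc 0 T := ⟨h0, min_le_right _ _⟩
      have hτm' : τ' ∈ Icc 0 T := ⟨h0.trans hττ', min_le_right _ _⟩
      have hFB : ‖F‖ ^ 2 ≤ B := by
        refine le_trans (le_of_eq ?_) (hBd τ hτm F hF2)
        have hI := (MemLp.integrableOn_norm_sq (Lp.memLp F))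
        rw [lp_norm_sq_eq hT, ← intervalIntegral.integral_add_adjacent_intervals (b := τ)
          ((intervalIntegrable_iff_integrableOn_Ioc_of_le h0).2
            (hI.mono_set (Ioc_subset_Ioc_right hτm.2)))
          ((intervalIntegrable_iff_integrableOn_Ioc_of_le hτm.2).2
            (hI.mono_set (Ioc_subset_Ioc_left h0)))]
        rw [add_eq_left, intervalIntegral.integral_of_le hτm.2]
        refine integral_eq_zero_of_ae ?_
        filter_upwards [ae_restrict_of_ae_restrict_of_subset (Ioc_subset_Ioc_left h0) (ae_Ioc hF1),
          ae_restrict_mem measurableSet_Ioc] with t ht ht'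
        simp [ht ht'.1]
      exact causal_step N (by linarith) (by nlinarith) h0 hττ' hτm'.2 hk hk0 hL
        (h₁ τ hτm τ' hτm' hττ' (hd.trans (min_le_left _ _)))
        (h₂ τ hτm τ' hτm' hττ' (hd.trans (min_le_right _ _))) F hFB hF1 hF2
  obtain ⟨n, hn⟩ := exists_nat_ge (T / δ)
  obtain ⟨F, -, hF⟩ := key n
  refine ⟨F, Lp.ext ?_⟩
  rwa [min_eq_right ((div_le_iff₀ hδ).1 hn)] at hF

end ThermoVisco

namespace ThermoVisco

/-! ### Functions of time given by their coefficients in a Hilbert basis -/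

section Coefficients

variable {X : Type*} [NormedAddCommGroup X] [InnerProductSpace ℝ X]

theorem hasSum_sq_inner (b : HilbertBasis ℕ ℝ X) (x : X) :
    HasSum (fun n => (inner ℝ (b n) x) ^ 2) (‖x‖ ^ 2) := by
  have := b.hasSum_inner_mul_inner x x
  rw [real_inner_self_eq_norm_sq] at this
  refine this.congr_fun fun n => ?_
  rw [real_inner_comm (b n) x, sq]

theorem exists_of_summable_sq (b : HilbertBasis ℕ ℝ X) {q : ℕ → ℝ}
    (hq : Summable fun n => q n ^ 2) : ∃ x : X, ∀ n, inner ℝ (b n) x = q n := by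
  have hm : Memℓp q 2 := by
    refine memℓp_gen ?_
    simpa using hq
  refine ⟨b.repr.symm ⟨q, hm⟩, fun n => ?_⟩
  rw [← b.repr_apply_apply]
  simp

/-- By Parseval `‖Y t - Y t₀‖²` is the series of `(q n t - q n t₀)²`, which is dominated by `4 B n`
and hence continuous in `t`. -/
theorem exists_continuous_of_coeff (b : HilbertBasis ℕ ℝ X) {q : ℕ → ℝ → ℝ} {B : ℕ → ℝ}
    (hq : ∀ n, Continuous (q n)) (hB : Summable B) (h : ∀ n t, q n t ^ 2 ≤ B n) :
    ∃ Y : ℝ → X, Continuous Y ∧ ∀ n t, inner ℝ (b n) (Y t) = q n t := by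
  have hs : ∀ t, Summable fun n => q n t ^ 2 := fun t =>
    Summable.of_nonneg_of_le (fun n => by positivity) (fun n => h n t) hB
  choose Y hY using fun t => exists_of_summable_sq b (hs t)
  refine ⟨Y, ?_, fun n t => hY t n⟩
  rw [continuous_iff_continuousAt]
  intro t₀
  have hc : Continuous fun t => ∑' n, (q n t - q n t₀) ^ 2 := by
    refine continuous_tsum (fun n => by fun_prop) (hB.mul_left 4) fun n t => ?_
    rw [Real.norm_of_nonneg (by positivity)]
    nlinarith [h n t, h n t₀, sq_nonneg (q n t + q n t₀)]
  have he : ∀ t, ∑' n, (q n t - q n t₀) ^ 2 = ‖Y t - Y t₀‖ ^ 2 := by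
    intro t
    rw [← (hasSum_sq_inner b _).tsum_eq]
    simp [inner_sub_right, hY]
  simp only [he] at hc
  have h1 : Tendsto (fun t => ‖Y t - Y t₀‖ ^ 2) (nhds t₀) (nhds 0) := by
    have := hc.tendsto t₀
    simpa using this
  have h2 : Tendsto (fun t => ‖Y t - Y t₀‖) (nhds t₀) (nhds 0) := by
    have := h1.sqrt
    simpa [Real.sqrt_sq] using this
  exact tendsto_iff_norm_sub_tendsto_zero.2 h2

/-- Dominated convergence, the full sum `A` being itself the majorant of its partial sums. -/
theorem integral_le_of_hasSum {μ : Measure ℝ} {a : ℕ → ℝ → ℝ} {A : ℝ → ℝ} {S : ℝ}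
    (ha0 : ∀ n s, 0 ≤ a n s) (ha : ∀ n, AEStronglyMeasurable (a n) μ)
    (hA : Integrable A μ) (h : ∀ᵐ s ∂μ, HasSum (fun n => a n s) (A s))
    (hS : ∀ N : ℕ, ∫ s, ∑ n ∈ Finset.range N, a n s ∂μ ≤ S) : ∫ s, A s ∂μ ≤ S := by
  have hlim : Tendsto (fun N : ℕ => ∫ s, ∑ n ∈ Finset.range N, a n s ∂μ) atTop
      (nhds (∫ s, A s ∂μ)) := by
    refine tendsto_integral_of_dominated_convergence A (fun N => ?_) hA (fun N => ?_) ?_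
    · exact Finset.aestronglyMeasurable_fun_sum _ fun n _ => ha n
    · filter_upwards [h] with s hs
      rw [Real.norm_of_nonneg (Finset.sum_nonneg fun n _ => ha0 n s)]
      exact sum_le_hasSum _ (fun n _ => ha0 n s) hs
    · filter_upwards [h] with s hs using hs.tendsto_sum_nat
  exact le_of_tendsto' hlim hS

/-- A Riesz–Fischer theorem with a parameter: a uniform bound of the partial sums in `L²(0,T)`
produces a Bochner square integrable function with the prescribed coefficients. -/
theorem exists_memLp_of_coeff (b : HilbertBasis ℕ ℝ X) {T S : ℝ} {q : ℕ → ℝ → ℝ}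
    (hq : ∀ n, MemLp (q n) 2 (timeMeasure T))
    (hS : ∀ N : ℕ, ∫ s, ∑ n ∈ Finset.range N, q n s ^ 2 ∂timeMeasure T ≤ S) :
    ∃ Y : ℝ → X, MemLp Y 2 (timeMeasure T) ∧
      (∀ᵐ t ∂timeMeasure T, ∀ n, inner ℝ (b n) (Y t) = q n t) ∧
      ∫ s, ‖Y s‖ ^ 2 ∂timeMeasure T ≤ S := by
  have hsq : ∀ n, Integrable (fun s => q n s ^ 2) (timeMeasure T) := fun n => (hq n).integrable_sq
  -- Working in `[0,∞]` first, where sum and integral can be exchanged freely; finiteness then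
  -- yields summability for almost every `s`.
  have hfin : ∫⁻ s, ∑' n, ENNReal.ofReal (q n s ^ 2) ∂timeMeasure T ≤ ENNReal.ofReal S := by
    rw [lintegral_tsum fun n => (hsq n).1.aemeasurable.ennreal_ofReal]
    refine ENNReal.tsum_le_of_sum_range_le fun N => ?_
    rw [← lintegral_finsetSum' _ fun n _ => (hsq n).1.aemeasurable.ennreal_ofReal]
    have : ∀ s, ∑ n ∈ Finset.range N, ENNReal.ofReal (q n s ^ 2)
        = ENNReal.ofReal (∑ n ∈ Finset.range N, q n s ^ 2) := fun s =>
      (ENNReal.ofReal_sum_of_nonneg fun n _ => by positivity).symm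
    simp only [this]
    rw [← ofReal_integral_eq_lintegral_ofReal (integrable_finsetSum _ fun n _ => hsq n)
      (Eventually.of_forall fun s => Finset.sum_nonneg fun n _ => by positivity)]
    exact ENNReal.ofReal_le_ofReal (hS N)
  have hae : ∀ᵐ s ∂timeMeasure T, Summable fun n => q n s ^ 2 := by
    have hm : AEMeasurable (fun s => ∑' n, ENNReal.ofReal (q n s ^ 2)) (timeMeasure T) :=
      AEMeasurable.tsum fun n => (hsq n).1.aemeasurable.ennreal_ofReal
    filter_upwards [ae_lt_top' hm (hfin.trans_lt ENNReal.ofReal_lt_top).ne] with s hs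
    have := ENNReal.summable_toReal hs.ne
    refine this.congr fun n => ?_
    rw [ENNReal.toReal_ofReal (by positivity)]
  classical
  -- `Y` is chosen pointwise, without regard to measurability, which comes back from the measurable
  -- partial sums converging to it.
  set Y : ℝ → X := fun s => if h : Summable (fun n => q n s ^ 2) then
    (exists_of_summable_sq b h).choose else 0 with hYdef
  have hY : ∀ᵐ t ∂timeMeasure T, ∀ n, inner ℝ (b n) (Y t) = q n t := by
    filter_upwards [hae] with t ht n
    simp only [hYdef, dif_pos ht]
    exact (exists_of_summable_sq b ht).choose_spec n
  have hYsum : ∀ᵐ t ∂timeMeasure T, HasSum (fun n => q n t ^ 2) (‖Y t‖ ^ 2) := by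
    filter_upwards [hY] with t ht
    simpa [ht] using hasSum_sq_inner b (Y t)
  have hYm : AEStronglyMeasurable Y (timeMeasure T) := by
    refine aestronglyMeasurable_of_tendsto_ae atTop
      (f := fun N s => ∑ n ∈ Finset.range N, q n s • b n) (fun N => ?_) ?_
    · exact Finset.aestronglyMeasurable_fun_sum _ fun n _ => (hq n).1.smul_const _
    · filter_upwards [hY] with t ht
      have := (b.hasSum_repr (Y t)).tendsto_sum_nat
      simpa [b.repr_apply_apply, ht] using this
  have hYI : Integrable (fun s => ‖Y s‖ ^ 2) (timeMeasure T) := by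
    refine ⟨(hYm.norm.pow 2), ?_⟩
    rw [hasFiniteIntegral_iff_ofReal (Eventually.of_forall fun s => by positivity)]
    refine lt_of_le_of_lt (le_of_eq ?_) (hfin.trans_lt ENNReal.ofReal_lt_top)
    refine lintegral_congr_ae ?_
    filter_upwards [hYsum] with s hs
    rw [← hs.tsum_eq, ENNReal.ofReal_tsum_of_nonneg (fun n => by positivity) hs.summable]
  refine ⟨Y, (memLp_two_iff_integrable_sq_norm hYm).2 hYI, hY, ?_⟩
  exact integral_le_of_hasSum (fun n s => by positivity) (fun n => (hsq n).1) hYI hYsum hS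

end Coefficients

/-! ### The scalar equation `y' + c y = r` -/

section Scalar

/-- Duhamel's formula `exp(-c t) (y₀ + ∫₀ᵗ exp(c s) r(s) ds)`. -/
theorem exists_scalar_solution {T : ℝ} (c y₀ : ℝ) {r : ℝ → ℝ} (hr : IntegrableOn r (Ioc 0 T)) :
    ∃ y : ℝ → ℝ, y 0 = y₀ ∧ HasPrim T y (fun t => r t - c * y t) := by
  have he : ∀ c : ℝ, HasPrim T (fun t => Real.exp (c * t)) (fun t => c * Real.exp (c * t)) := by
    intro c
    refine HasPrim.of_hasDerivAt (by fun_prop) fun t _ => ?_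
    have := ((hasDerivAt_id t).const_mul c).exp
    simpa [mul_comm] using this
  have hr' : IntegrableOn (fun s => Real.exp (c * s) * r s) (Ioc 0 T) := by
    obtain ⟨C, hC⟩ := isCompact_Icc.exists_bound_of_continuousOn
      (f := fun s => Real.exp (c * s)) (s := Icc 0 T) (by fun_prop)
    refine Integrable.bdd_mul (c := C) hr (Continuous.aestronglyMeasurable (by fun_prop)) ?_
    filter_upwards [ae_restrict_mem measurableSet_Ioc] with s hs using hC s (Ioc_subset_Icc_self hs)
  have h := (he (-c)).mul (HasPrim.of_integral y₀ hr')
  refine ⟨_, by simp, h.congr_ae (Eventually.of_forall fun t => ?_)⟩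
  have : Real.exp (-c * t) * Real.exp (c * t) = 1 := by rw [← Real.exp_add]; simp
  rw [← mul_assoc (Real.exp (-c * t)), this]
  ring

variable {T c : ℝ} {y r : ℝ → ℝ}

theorem HasPrim.memLp_of_continuousOn {E : Type*} [NormedAddCommGroup E] [NormedSpace ℝ E]
    {y g : ℝ → E} (hy : HasPrim T y g) : MemLp y 2 (timeMeasure T) :=
  hy.continuousOn.memLp_timeMeasure 2

theorem scalar_energy (hy : HasPrim T y (fun t => r t - c * y t)) :
    HasPrim T (fun t => y t ^ 2) (fun t => 2 * (r t * y t - c * y t ^ 2)) := by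
  refine (hy.mul hy).congr_left (fun t _ => sq _) |>.congr_ae (Eventually.of_forall fun t => ?_)
  ring

/-- The energy identity multiplied by `c`, with `2 c r y - 2 c² y² = r² - (r - c y)² - (c y)²`. It
is maximal regularity for one mode: `y'` and `c y` are controlled separately by `r`, uniformly in
`c`. -/
theorem scalar_energy_deriv (hy : HasPrim T y (fun t => r t - c * y t)) {t : ℝ} (ht : t ∈ Icc 0 T)
    (hr : MemLp r 2 (timeMeasure T)) :
    c * y t ^ 2 + (∫ s in (0 : ℝ)..t, (r s - c * y s) ^ 2) + (∫ s in (0 : ℝ)..t, (c * y s) ^ 2)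
      = c * y 0 ^ 2 + ∫ s in (0 : ℝ)..t, r s ^ 2 := by
  have h := (scalar_energy hy).const_smul c
  have h2 := h.2 t ht
  have h0 : (0 : ℝ) ∈ Icc 0 T := ⟨le_rfl, ht.1.trans ht.2⟩
  have hy2 := hy.memLp_of_continuousOn
  have hI : ∀ {φ : ℝ → ℝ}, MemLp φ 2 (timeMeasure T) →
      IntervalIntegrable (fun s => φ s ^ 2) volume 0 t := by
    intro φ hφ
    rw [intervalIntegrable_iff_integrableOn_Ioc_of_le ht.1]
    have := hφ.integrable_sq
    rw [timeMeasure_eq] at this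
    exact this.mono_measure (Measure.restrict_mono (Ioc_subset_Ioc_right ht.2) le_rfl)
  have hm1 : MemLp (fun s => r s - c * y s) 2 (timeMeasure T) := hr.sub (hy2.const_mul c)
  have i1 := hI hm1
  have i2 := hI (hy2.const_mul c)
  have i3 := hI hr
  have e : ∫ s in (0 : ℝ)..t, c • (2 * (r s * y s - c * y s ^ 2))
      = (∫ s in (0 : ℝ)..t, r s ^ 2) - (∫ s in (0 : ℝ)..t, (r s - c * y s) ^ 2)
        - (∫ s in (0 : ℝ)..t, (c * y s) ^ 2) := by
    rw [← intervalIntegral.integral_sub i3 i1, ← intervalIntegral.integral_sub (i3.sub i1) i2]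
    refine intervalIntegral.integral_congr fun s _ => ?_
    simp only [smul_eq_mul]; ring
  rw [e] at h2
  simp only [smul_eq_mul] at h2
  linarith

/-- The damping is dropped and `2 r y ≤ r² + y²` is fed to Grönwall. This complements
`scalar_energy_deriv`, which says nothing about `y t` itself when `c = 0`. -/
theorem scalar_bound (hy : HasPrim T y (fun t => r t - c * y t)) (hc : 0 ≤ c)
    (hr : MemLp r 2 (timeMeasure T)) {t : ℝ} (ht : t ∈ Icc 0 T) :
    y t ^ 2 ≤ (y 0 ^ 2 + ∫ s in (0 : ℝ)..t, r s ^ 2) * Real.exp t := by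
  have hrt : IntegrableOn (fun s => r s ^ 2) (Ioc 0 T) := by
    rw [IntegrableOn, ← timeMeasure_eq]; exact hr.integrable_sq
  have h := gronwall_integral (T := t) (φ := fun t => y t ^ 2) (k := fun _ => 1)
    (A := y 0 ^ 2 + ∫ s in (0 : ℝ)..t, r s ^ 2)
    ((hy.continuousOn.mono (Icc_subset_Icc_right ht.2)).pow 2)
    (integrableOn_const (by simp)) (fun _ => zero_le_one) (fun s hs => ?_) t ⟨ht.1, le_rfl⟩
  · simpa using h
  have hsT : s ∈ Icc 0 T := ⟨hs.1, hs.2.trans ht.2⟩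
  have h0 : (0 : ℝ) ∈ Icc 0 T := ⟨le_rfl, ht.1.trans ht.2⟩
  have he := scalar_energy hy
  have iy : IntervalIntegrable (fun s => y s ^ 2) volume 0 s := by
    refine ContinuousOn.intervalIntegrable ?_
    rw [uIcc_of_le hs.1]
    exact (hy.continuousOn.mono (Icc_subset_Icc_right hsT.2)).pow 2
  have ir : IntervalIntegrable (fun s => r s ^ 2) volume 0 s :=
    (intervalIntegrable_iff_integrableOn_Ioc_of_le hs.1).2
      (hrt.mono_set (Ioc_subset_Ioc_right hsT.2))
  have h1 : ∫ q in (0 : ℝ)..s, 2 * (r q * y q - c * y q ^ 2)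
      ≤ ∫ q in (0 : ℝ)..s, (r q ^ 2 + y q ^ 2) := by
    refine intervalIntegral.integral_mono_on hs.1 (he.intervalIntegrable h0 hsT) (ir.add iy)
      fun q _ => ?_
    nlinarith [sq_nonneg (r q - y q), mul_nonneg hc (sq_nonneg (y q))]
  rw [intervalIntegral.integral_add ir iy] at h1
  have h2 : ∫ q in (0 : ℝ)..s, r q ^ 2 ≤ ∫ q in (0 : ℝ)..t, r q ^ 2 := by
    refine intervalIntegral.integral_mono_interval le_rfl hs.1 hs.2
      (Eventually.of_forall fun q => by positivity) ?_
    exact (intervalIntegrable_iff_integrableOn_Ioc_of_le ht.1).2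
      (hrt.mono_set (Ioc_subset_Ioc_right ht.2))
  have := he.2 s hsT
  simp only [one_mul]
  linarith

end Scalar

end ThermoVisco

namespace ThermoVisco

/-! ### Diagonal parabolic equations -/

/-- A Hilbert triple `V → H` whose energy form `⟪D ·, D ·⟫` is diagonal in the family `e`, which
is an orthonormal basis of `H`; `eig n` are the eigenvalues. -/
structure EigenSystem (V H W : Type*) [NormedAddCommGroup V] [InnerProductSpace ℝ V]
    [NormedAddCommGroup H] [InnerProductSpace ℝ H]
    [NormedAddCommGroup W] [InnerProductSpace ℝ W] where
  ι : V →L[ℝ] H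
  D : V →L[ℝ] W
  e : ℕ → V
  eig : ℕ → ℝ
  norm_sq : ∀ ψ, ‖ψ‖ ^ 2 = ‖ι ψ‖ ^ 2 + ‖D ψ‖ ^ 2
  injective : Function.Injective ι
  orthonormal : Orthonormal ℝ fun n => ι (e n)
  complete : ∀ f : H, (∀ n, inner ℝ (ι (e n)) f = 0) → f = 0
  inner_D : ∀ n ψ, inner ℝ (D (e n)) (D ψ) = eig n * inner ℝ (ι (e n)) (ι ψ)

namespace EigenSystem

set_option linter.unusedSectionVars false

variable {V H W : Type*} [NormedAddCommGroup V] [InnerProductSpace ℝ V] [CompleteSpace V]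
  [NormedAddCommGroup H] [InnerProductSpace ℝ H] [CompleteSpace H]
  [NormedAddCommGroup W] [InnerProductSpace ℝ W] (S : EigenSystem V H W)

theorem inner_eq (x y : V) :
    inner ℝ x y = inner ℝ (S.ι x) (S.ι y) + inner ℝ (S.D x) (S.D y) := by
  have h1 := S.norm_sq (x + y)
  rw [map_add, map_add, norm_add_sq_real, norm_add_sq_real, norm_add_sq_real, S.norm_sq x,
    S.norm_sq y] at h1
  linarith

theorem norm_D_le (x : V) : ‖S.D x‖ ≤ ‖x‖ := by
  have := S.norm_sq x
  exact (pow_le_pow_iff_left₀ (norm_nonneg _) (norm_nonneg _) two_ne_zero).1 (by nlinarith [norm_nonneg (S.ι x)])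

theorem norm_sq_D_e (n : ℕ) : ‖S.D (S.e n)‖ ^ 2 = S.eig n := by
  rw [← real_inner_self_eq_norm_sq, S.inner_D, real_inner_self_eq_norm_sq, S.orthonormal.1 n]
  norm_num

theorem eig_nonneg (n : ℕ) : 0 ≤ S.eig n := by rw [← S.norm_sq_D_e]; positivity

theorem inner_e (n : ℕ) (ψ : V) :
    inner ℝ (S.e n) ψ = (1 + S.eig n) * inner ℝ (S.ι (S.e n)) (S.ι ψ) := by
  rw [S.inner_eq, S.inner_D]; ring

/-- The basis of `H`. -/
def basisH : HilbertBasis ℕ ℝ H :=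
  HilbertBasis.mkOfOrthogonalEqBot S.orthonormal (by
    rw [Submodule.eq_bot_iff]
    intro f hf
    refine S.complete f fun n => ?_
    exact (Submodule.mem_orthogonal _ _).1 hf _ (Submodule.subset_span ⟨n, rfl⟩))

theorem basisH_apply (n : ℕ) : S.basisH n = S.ι (S.e n) := by
  simp [basisH]

theorem sqrt_pos (n : ℕ) : 0 < √(1 + S.eig n) := Real.sqrt_pos.2 (by linarith [S.eig_nonneg n])

theorem sq_sqrt (n : ℕ) : √(1 + S.eig n) ^ 2 = 1 + S.eig n :=
  Real.sq_sqrt (by linarith [S.eig_nonneg n])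

/-- By `inner_e` the eigenvectors stay orthogonal in `V`, with square norm `1 + eig n`. -/
theorem orthonormal_V : Orthonormal ℝ fun n => (√(1 + S.eig n))⁻¹ • S.e n := by
  rw [orthonormal_iff_ite]
  intro i j
  have h := orthonormal_iff_ite.1 S.orthonormal i j
  have hp := S.sqrt_pos i
  rw [inner_smul_left, inner_smul_right, S.inner_e, h]
  split_ifs with hij
  · subst hij
    simp only [conj_trivial, mul_one]
    have h2 := S.sq_sqrt i
    field_simp
    exact h2.symm
  · simp

/-- The basis of `V`. -/
def basisV : HilbertBasis ℕ ℝ V :=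
  HilbertBasis.mkOfOrthogonalEqBot S.orthonormal_V (by
    rw [Submodule.eq_bot_iff]
    intro ψ hψ
    refine S.injective ?_
    rw [map_zero]
    refine S.complete _ fun n => ?_
    have := (Submodule.mem_orthogonal _ _).1 hψ _ (Submodule.subset_span ⟨n, rfl⟩)
    rw [inner_smul_left, S.inner_e] at this
    have h1 := S.sqrt_pos n
    have h2 := S.eig_nonneg n
    have h3 : (1 + S.eig n) ≠ 0 := by linarith
    simpa [h1.ne', h3] using this)

theorem inner_basisV (n : ℕ) (ψ : V) :
    inner ℝ (S.basisV n) ψ = √(1 + S.eig n) * inner ℝ (S.ι (S.e n)) (S.ι ψ) := by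
  have : S.basisV n = (√(1 + S.eig n))⁻¹ • S.e n := by simp [basisV]
  rw [this, inner_smul_left, S.inner_e]
  simp only [conj_trivial]
  have h1 := S.sqrt_pos n
  nth_rewrite 2 [← S.sq_sqrt]
  field_simp

/-- A functional on `V` vanishing on the eigenvectors is zero. -/
theorem eq_zero_of_e (L : V →L[ℝ] ℝ) (h : ∀ n, L (S.e n) = 0) (ψ : V) : L ψ = 0 := by
  have hs := (S.basisV.hasSum_repr ψ).mapL L
  have : ∀ n, L (S.basisV.repr ψ n • S.basisV n) = 0 := by
    intro n
    have : S.basisV n = (√(1 + S.eig n))⁻¹ • S.e n := by simp [basisV]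
    rw [this, map_smul, map_smul, h n]; simp
  simp only [this] at hs
  exact hs.unique hasSum_zero

theorem hasSum_sq_V (ψ : V) :
    HasSum (fun n => (1 + S.eig n) * (inner ℝ (S.ι (S.e n)) (S.ι ψ)) ^ 2) (‖ψ‖ ^ 2) := by
  refine (hasSum_sq_inner S.basisV ψ).congr_fun fun n => ?_
  rw [S.inner_basisV, mul_pow, S.sq_sqrt]

theorem hasSum_sq_H (f : H) : HasSum (fun n => (inner ℝ (S.ι (S.e n)) f) ^ 2) (‖f‖ ^ 2) := by
  refine (hasSum_sq_inner S.basisH f).congr_fun fun n => ?_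
  rw [S.basisH_apply]

theorem hasSum_sq_D (ψ : V) :
    HasSum (fun n => S.eig n * (inner ℝ (S.ι (S.e n)) (S.ι ψ)) ^ 2) (‖S.D ψ‖ ^ 2) := by
  have := (S.hasSum_sq_V ψ).sub (S.hasSum_sq_H (S.ι ψ))
  rw [S.norm_sq, add_sub_cancel_left] at this
  refine this.congr_fun fun n => ?_
  ring

/-- The coefficients of `y` solve `y_n' + κ λ_n y_n = r_n`. -/
def ModeEq (κ T : ℝ) (y : ℝ → H) (r : ℕ → ℝ → ℝ) : Prop :=
  ∀ n, HasPrim T (fun t => inner ℝ (S.ι (S.e n)) (y t))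
    (fun t => r n t - κ * S.eig n * inner ℝ (S.ι (S.e n)) (y t))

variable {S}

theorem ModeEq.sub {κ T : ℝ} {y y' : ℝ → H} {r r' : ℕ → ℝ → ℝ} (h : S.ModeEq κ T y r)
    (h' : S.ModeEq κ T y' r') :
    S.ModeEq κ T (fun t => y t - y' t) (fun n t => r n t - r' n t) := by
  intro n
  refine (((h n).sub (h' n)).congr_left fun t _ => ?_).congr_ae (Eventually.of_forall fun t => ?_)
  · exact inner_sub_right _ _ _
  · simp only [inner_sub_right]; ring

theorem ModeEq.add {κ T : ℝ} {y y' : ℝ → H} {r r' : ℕ → ℝ → ℝ} (h : S.ModeEq κ T y r)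
    (h' : S.ModeEq κ T y' r') :
    S.ModeEq κ T (fun t => y t + y' t) (fun n t => r n t + r' n t) := by
  intro n
  refine (((h n).add (h' n)).congr_left fun t _ => ?_).congr_ae (Eventually.of_forall fun t => ?_)
  · exact inner_add_right _ _ _
  · simp only [inner_add_right]; ring

variable (S)

theorem memLp_coeff {T : ℝ} {f : ℝ → H} (hf : MemLp f 2 (timeMeasure T)) (n : ℕ) :
    MemLp (fun t => inner ℝ (S.ι (S.e n)) (f t)) 2 (timeMeasure T) :=
  (innerSL ℝ (S.ι (S.e n))).comp_memLp' hf

theorem sum_integral_sq_le {t : ℝ} (ht : 0 ≤ t) {f : ℝ → H} (hf : MemLp f 2 (timeMeasure t))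
    (s : Finset ℕ) :
    ∑ n ∈ s, ∫ q in (0 : ℝ)..t, (inner ℝ (S.ι (S.e n)) (f q)) ^ 2
      ≤ ∫ q in (0 : ℝ)..t, ‖f q‖ ^ 2 := by
  have hI : ∀ n, IntervalIntegrable (fun q => (inner ℝ (S.ι (S.e n)) (f q)) ^ 2) volume 0 t := by
    intro n
    rw [intervalIntegrable_iff_integrableOn_Ioc_of_le ht, IntegrableOn, ← timeMeasure_eq]
    exact (S.memLp_coeff hf n).integrable_sq
  rw [← intervalIntegral.integral_finsetSum fun n _ => hI n]
  refine intervalIntegral.integral_mono_on ht ?_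
    ((intervalIntegrable_iff_integrableOn_Ioc_of_le ht).2 (MemLp.integrableOn_norm_sq hf))
    fun q _ => sum_le_hasSum _ (fun n _ => by positivity) (S.hasSum_sq_H (f q))
  have := IntervalIntegrable.sum s (fun j _ => hI j)
  simpa [Finset.sum_fn] using this

/-- `max 0 (min t T)`. -/
def clip (T t : ℝ) : ℝ := max 0 (min t T)

theorem clip_mem {T : ℝ} (hT : 0 ≤ T) (t : ℝ) : clip T t ∈ Icc 0 T :=
  ⟨le_max_left _ _, max_le hT (min_le_right _ _)⟩

theorem clip_eq {T t : ℝ} (ht : t ∈ Icc 0 T) : clip T t = t := by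
  rw [clip, min_eq_left ht.2, max_eq_right ht.1]

theorem continuous_clip (T : ℝ) : Continuous (clip T) := by unfold clip; fun_prop

/-- The scalar solutions are extended by constants outside `[0,T]`. They become continuous on the
whole line, and the third clause carries bounds on `[0,T]` over to all times. -/
theorem exists_modes {κ T : ℝ} (hT : 0 ≤ T) (y₀ : H) {f : ℝ → H}
    (hf : MemLp f 2 (timeMeasure T)) :
    ∃ q : ℕ → ℝ → ℝ, (∀ n, Continuous (q n)) ∧ (∀ n, q n 0 = inner ℝ (S.ι (S.e n)) y₀) ∧
      (∀ n t, ∃ s ∈ Icc 0 T, q n t = q n s) ∧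
      ∀ n, HasPrim T (q n) (fun t => inner ℝ (S.ι (S.e n)) (f t) - κ * S.eig n * q n t) := by
  have h := fun n => exists_scalar_solution (T := T) (κ * S.eig n) (inner ℝ (S.ι (S.e n)) y₀)
    (MemLp.integrableOn (S.memLp_coeff hf n))
  choose p hp0 hp using h
  refine ⟨fun n t => p n (clip T t), fun n => ?_, fun n => ?_, fun n t => ?_, fun n => ?_⟩
  · rw [← continuousOn_univ]
    exact (hp n).continuousOn.comp (continuous_clip T).continuousOn fun t _ => clip_mem hT t
  · simp only [clip_eq ⟨le_rfl, hT⟩, hp0]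
  · refine ⟨clip T t, clip_mem hT t, ?_⟩
    simp only [clip_eq (clip_mem hT t)]
  · refine ((hp n).congr_left fun t ht => by simp only [clip_eq ht]).congr_ae ?_
    filter_upwards [ae_restrict_mem measurableSet_Ioc] with t ht
    rw [clip_eq (Ioc_subset_Icc_self ht)]

theorem summable_integral_sq {T : ℝ} (hT : 0 ≤ T) {f : ℝ → H} (hf : MemLp f 2 (timeMeasure T)) :
    Summable fun n => ∫ q in (0 : ℝ)..T, (inner ℝ (S.ι (S.e n)) (f q)) ^ 2 :=
  summable_of_sum_le (fun n => intervalIntegral.integral_nonneg hT fun q _ => by positivity)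
    (S.sum_integral_sq_le hT hf)

theorem integral_sq_mono {T : ℝ} {r : ℝ → ℝ} (hr : MemLp r 2 (timeMeasure T)) {t : ℝ}
    (ht : t ∈ Icc 0 T) : ∫ q in (0 : ℝ)..t, r q ^ 2 ≤ ∫ q in (0 : ℝ)..T, r q ^ 2 := by
  refine intervalIntegral.integral_mono_interval le_rfl ht.1 ht.2
    (Eventually.of_forall fun q => by positivity) ?_
  rw [intervalIntegrable_iff_integrableOn_Ioc_of_le (ht.1.trans ht.2), IntegrableOn,
    ← timeMeasure_eq]
  exact hr.integrable_sq

/-- A continuous coefficient estimate for the scalar equations. -/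
theorem mode_bound {κ T : ℝ} (hκ : 0 < κ) {n : ℕ} {y r : ℝ → ℝ}
    (hy : HasPrim T y (fun t => r t - κ * S.eig n * y t)) (hr : MemLp r 2 (timeMeasure T))
    {t : ℝ} (ht : t ∈ Icc 0 T) :
    (1 + S.eig n) * y t ^ 2 ≤ (Real.exp T + 1 + κ⁻¹) *
      ((1 + S.eig n) * y 0 ^ 2 + ∫ q in (0 : ℝ)..t, r q ^ 2) := by
  have hΛ := S.eig_nonneg n
  have hc : 0 ≤ κ * S.eig n := by positivity
  have h1 := scalar_bound hy hc hr ht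
  have h2 := scalar_energy_deriv hy ht hr
  have i1 : 0 ≤ ∫ s in (0 : ℝ)..t, (r s - κ * S.eig n * y s) ^ 2 :=
    intervalIntegral.integral_nonneg ht.1 fun s _ => by positivity
  have i2 : 0 ≤ ∫ s in (0 : ℝ)..t, (κ * S.eig n * y s) ^ 2 :=
    intervalIntegral.integral_nonneg ht.1 fun s _ => by positivity
  have i3 : 0 ≤ ∫ s in (0 : ℝ)..t, r s ^ 2 :=
    intervalIntegral.integral_nonneg ht.1 fun s _ => by positivity
  set I := ∫ s in (0 : ℝ)..t, r s ^ 2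
  -- The part weighted by the eigenvalue comes from the energy identity with `c = κ λ_n`, divided by
  -- `κ`; the unweighted part is `h1`.
  have h3 : S.eig n * y t ^ 2 ≤ S.eig n * y 0 ^ 2 + κ⁻¹ * I := by
    have : κ * (S.eig n * y t ^ 2) ≤ κ * (S.eig n * y 0 ^ 2 + κ⁻¹ * I) := by
      rw [mul_add, ← mul_assoc κ κ⁻¹, mul_inv_cancel₀ hκ.ne']; linarith
    exact le_of_mul_le_mul_left this hκ
  have h4 : Real.exp t ≤ Real.exp T := Real.exp_le_exp.2 ht.2
  have h5 : (y 0 ^ 2 + I) * Real.exp t ≤ (y 0 ^ 2 + I) * Real.exp T :=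
    mul_le_mul_of_nonneg_left h4 (by positivity)
  have hκ' : 0 < κ⁻¹ := inv_pos.2 hκ
  have e1 := Real.exp_pos T
  nlinarith [mul_nonneg hΛ (sq_nonneg (y 0)), mul_nonneg e1.le (mul_nonneg hΛ (sq_nonneg (y 0))),
    mul_nonneg hκ'.le (mul_nonneg hΛ (sq_nonneg (y 0))), mul_nonneg hκ'.le (sq_nonneg (y 0))]

/-- For data in `V` and a source in `H`, `mode_bound` majorises the `V`-weighted squares of the
coefficients by a summable sequence independent of time, so the solution is continuous with values
in `V`. -/
theorem exists_regular {κ T : ℝ} (hκ : 0 < κ) (hT : 0 ≤ T) (x₀ : V) {f : ℝ → H}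
    (hf : MemLp f 2 (timeMeasure T)) :
    ∃ Y : ℝ → V, Continuous Y ∧ Y 0 = x₀ ∧
      S.ModeEq κ T (fun t => S.ι (Y t)) (fun n t => inner ℝ (S.ι (S.e n)) (f t)) := by
  obtain ⟨q, hq1, hq2, hq3, hq4⟩ := S.exists_modes (κ := κ) hT (S.ι x₀) hf
  have hsum : Summable fun n => (Real.exp T + 1 + κ⁻¹) * ((1 + S.eig n) *
      (inner ℝ (S.ι (S.e n)) (S.ι x₀)) ^ 2 + ∫ s in (0 : ℝ)..T, (inner ℝ (S.ι (S.e n)) (f s)) ^ 2) :=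
    ((S.hasSum_sq_V x₀).summable.add (S.summable_integral_sq hT hf)).mul_left _
  obtain ⟨Y, hYc, hY⟩ := exists_continuous_of_coeff S.basisV (q := fun n t => √(1 + S.eig n) * q n t)
    (fun n => continuous_const.mul (hq1 n)) hsum (fun n t => by
      obtain ⟨s, hs, hts⟩ := hq3 n t
      rw [mul_pow, S.sq_sqrt, hts]
      refine (S.mode_bound hκ (hq4 n) (S.memLp_coeff hf n) hs).trans ?_
      rw [hq2]
      have := integral_sq_mono (S.memLp_coeff hf n) hs
      have hκ' : 0 < κ⁻¹ := inv_pos.2 hκ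
      gcongr)
  have hYq : ∀ n t, inner ℝ (S.ι (S.e n)) (S.ι (Y t)) = q n t := by
    intro n t
    have := hY n t
    rw [S.inner_basisV] at this
    exact mul_left_cancel₀ (S.sqrt_pos n).ne' this
  refine ⟨Y, hYc, ?_, fun n => ?_⟩
  · refine S.injective (sub_eq_zero.1 (S.complete _ fun n => ?_))
    rw [inner_sub_right, hYq, hq2, sub_self]
  · simpa only [hYq] using hq4 n

/-- Estimate of regular solutions. -/
theorem norm_sq_regular_le {κ T : ℝ} (hκ : 0 < κ) {Y : ℝ → V} {f : ℝ → H}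
    (hf : MemLp f 2 (timeMeasure T))
    (h : S.ModeEq κ T (fun t => S.ι (Y t)) (fun n t => inner ℝ (S.ι (S.e n)) (f t)))
    {t : ℝ} (ht : t ∈ Icc 0 T) :
    ‖Y t‖ ^ 2 ≤ (Real.exp T + 1 + κ⁻¹) * (‖Y 0‖ ^ 2 + ∫ s in (0 : ℝ)..t, ‖f s‖ ^ 2) := by
  have hκ' : 0 < κ⁻¹ := inv_pos.2 hκ
  refine hasSum_le_of_sum_le (S.hasSum_sq_V (Y t)) fun s => ?_
  refine (Finset.sum_le_sum fun n _ => S.mode_bound hκ (h n) (S.memLp_coeff hf n) ht).trans ?_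
  rw [← Finset.mul_sum, Finset.sum_add_distrib]
  have h1 := sum_le_hasSum s (fun n _ => mul_nonneg (by linarith [S.eig_nonneg n]) (sq_nonneg _))
    (S.hasSum_sq_V (Y 0))
  have h2 := S.sum_integral_sq_le ht.1 (hf.mono_measure (timeMeasure_mono ht.2)) s
  have := Real.exp_pos T
  gcongr

/-- Regular solutions have a square integrable time derivative. -/
theorem exists_deriv_regular {κ T : ℝ} (hκ : 0 < κ) (hT : 0 ≤ T) {Y : ℝ → V}
    {f : ℝ → H} (hf : MemLp f 2 (timeMeasure T))
    (h : S.ModeEq κ T (fun t => S.ι (Y t)) (fun n t => inner ℝ (S.ι (S.e n)) (f t))) :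
    ∃ g : ℝ → H, MemLp g 2 (timeMeasure T) ∧ HasPrim T (fun t => S.ι (Y t)) g ∧
      ∫ s in (0 : ℝ)..T, ‖g s‖ ^ 2 ≤ κ * ‖Y 0‖ ^ 2 + ∫ s in (0 : ℝ)..T, ‖f s‖ ^ 2 := by
  have hTm : T ∈ Icc 0 T := ⟨hT, le_rfl⟩
  have hy : ∀ n, MemLp (fun t => inner ℝ (S.ι (S.e n)) (S.ι (Y t))) 2 (timeMeasure T) := fun n =>
    (h n).memLp_of_continuousOn
  have hq : ∀ n, MemLp (fun t => inner ℝ (S.ι (S.e n)) (f t)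
      - κ * S.eig n * inner ℝ (S.ι (S.e n)) (S.ι (Y t))) 2 (timeMeasure T) := fun n =>
    (S.memLp_coeff hf n).sub ((hy n).const_mul _)
  -- The coefficients of the time derivative. Their squares are bounded by `scalar_energy_deriv`,
  -- whose initial term sums to `κ ‖D (Y 0)‖²`.
  have hS : ∀ N : ℕ, ∫ s, ∑ n ∈ Finset.range N, (inner ℝ (S.ι (S.e n)) (f s)
      - κ * S.eig n * inner ℝ (S.ι (S.e n)) (S.ι (Y s))) ^ 2 ∂timeMeasure T
      ≤ κ * ‖Y 0‖ ^ 2 + ∫ s in (0 : ℝ)..T, ‖f s‖ ^ 2 := by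
    intro N
    rw [integral_finsetSum _ fun n _ => (hq n).integrable_sq]
    have h1 : ∀ n, ∫ s, (inner ℝ (S.ι (S.e n)) (f s)
        - κ * S.eig n * inner ℝ (S.ι (S.e n)) (S.ι (Y s))) ^ 2 ∂timeMeasure T
        ≤ κ * (S.eig n * (inner ℝ (S.ι (S.e n)) (S.ι (Y 0))) ^ 2)
          + ∫ s in (0 : ℝ)..T, (inner ℝ (S.ι (S.e n)) (f s)) ^ 2 := by
      intro n
      have h2 := scalar_energy_deriv (h n) hTm (S.memLp_coeff hf n)
      have i2 : 0 ≤ ∫ s in (0 : ℝ)..T, (κ * S.eig n * inner ℝ (S.ι (S.e n)) (S.ι (Y s))) ^ 2 :=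
        intervalIntegral.integral_nonneg hT fun s _ => by positivity
      have i4 := mul_nonneg (mul_nonneg hκ.le (S.eig_nonneg n))
        (sq_nonneg (inner ℝ (S.ι (S.e n)) (S.ι (Y T))))
      rw [timeMeasure_eq, ← intervalIntegral.integral_of_le hT]
      simp only at h2
      linarith
    refine (Finset.sum_le_sum fun n _ => h1 n).trans ?_
    rw [Finset.sum_add_distrib, ← Finset.mul_sum]
    have h3 := sum_le_hasSum (Finset.range N) (fun n _ => mul_nonneg (S.eig_nonneg n) (sq_nonneg _))
      (S.hasSum_sq_D (Y 0))
    have h4 := S.sum_integral_sq_le hT hf (Finset.range N)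
    have h5 := S.norm_D_le (Y 0)
    have h6 : ‖S.D (Y 0)‖ ^ 2 ≤ ‖Y 0‖ ^ 2 := by gcongr
    have := h3.trans h6
    gcongr
  obtain ⟨g, hg, hgc, hgS⟩ := exists_memLp_of_coeff S.basisH hq hS
  refine ⟨g, hg, ⟨MemLp.integrableOn hg, fun t ht => ?_⟩, ?_⟩
  · refine sub_eq_zero.1 (S.complete _ fun n => ?_)
    have ig : IntervalIntegrable g volume 0 t :=
      (intervalIntegrable_iff_integrableOn_Ioc_of_le ht.1).2
        ((MemLp.integrableOn hg).mono_set (Ioc_subset_Ioc_right ht.2))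
    have h1 := (innerSL ℝ (S.ι (S.e n))).intervalIntegral_comp_comm ig
    simp only [innerSL_apply_apply] at h1
    have h2 : ∫ s in (0 : ℝ)..t, inner ℝ (S.ι (S.e n)) (g s) = ∫ s in (0 : ℝ)..t,
        (inner ℝ (S.ι (S.e n)) (f s) - κ * S.eig n * inner ℝ (S.ι (S.e n)) (S.ι (Y s))) := by
      rw [intervalIntegral.integral_of_le ht.1, intervalIntegral.integral_of_le ht.1]
      refine integral_congr_ae (ae_restrict_of_ae_restrict_of_subset (Ioc_subset_Ioc_right ht.2) ?_)
      filter_upwards [ae_Ioc hgc] with s hs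
      rw [← S.basisH_apply, hs n, S.basisH_apply]
    have h3 := (h n).2 t ht
    simp only at h3
    rw [inner_sub_right, inner_add_right, ← h1, h2, h3]
    ring
  · rwa [intervalIntegral.integral_of_le hT, ← timeMeasure_eq]

/-- Solutions of the homogeneous equation with data in `H`. -/
theorem exists_homogeneous {κ T : ℝ} (hκ : 0 < κ) (hT : 0 ≤ T) (y₀ : H) :
    ∃ (y : ℝ → H) (Y : ℝ → V), Continuous y ∧ y 0 = y₀ ∧ MemLp Y 2 (timeMeasure T) ∧
      (∀ᵐ t ∂timeMeasure T, S.ι (Y t) = y t) ∧ S.ModeEq κ T y (fun _ _ => 0) := by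
  have hTm : T ∈ Icc 0 T := ⟨hT, le_rfl⟩
  have hz : MemLp (fun _ : ℝ => (0 : H)) 2 (timeMeasure T) := MemLp.zero
  obtain ⟨q, hq1, hq2, hq3, hq4⟩ := S.exists_modes (κ := κ) hT y₀ hz
  simp only [inner_zero_right] at hq4
  have hz' : MemLp (fun _ : ℝ => (0 : ℝ)) 2 (timeMeasure T) := MemLp.zero
  have hb : ∀ n, ∀ t ∈ Icc 0 T, q n t ^ 2 ≤ Real.exp T * inner ℝ (S.ι (S.e n)) y₀ ^ 2 := by
    intro n t ht
    have h1 := scalar_bound (hq4 n) (mul_nonneg hκ.le (S.eig_nonneg n)) hz' ht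
    have h4 : Real.exp t ≤ Real.exp T := Real.exp_le_exp.2 ht.2
    simp only [hq2] at h1
    norm_num at h1
    nlinarith [sq_nonneg (inner ℝ (S.ι (S.e n)) y₀)]
  obtain ⟨y, hyc, hy⟩ := exists_continuous_of_coeff S.basisH hq1
    ((S.hasSum_sq_H y₀).summable.mul_left (Real.exp T)) (fun n t => by
      obtain ⟨s, hs, hts⟩ := hq3 n t
      rw [hts]; exact hb n s hs)
  have hqm : ∀ n, MemLp (q n) 2 (timeMeasure T) := fun n => (hq4 n).memLp_of_continuousOn
  -- In the constant, `T exp T` bounds the integral of `q n ²` and `κ⁻¹` that of `λ_n q n ²`, which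
  -- is the dissipated energy.
  have hS : ∀ N : ℕ, ∫ s, ∑ n ∈ Finset.range N, (√(1 + S.eig n) * q n s) ^ 2 ∂timeMeasure T
      ≤ (T * Real.exp T + κ⁻¹) * ‖y₀‖ ^ 2 := by
    intro N
    have hκ' : 0 < κ⁻¹ := inv_pos.2 hκ
    rw [integral_finsetSum _ fun n _ => ((hqm n).const_mul _).integrable_sq]
    have h1 : ∀ n, ∫ s, (√(1 + S.eig n) * q n s) ^ 2 ∂timeMeasure T
        ≤ (T * Real.exp T + κ⁻¹) * (inner ℝ (S.ι (S.e n)) y₀) ^ 2 := by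
      intro n
      have iq : IntervalIntegrable (fun s => q n s ^ 2) volume 0 T :=
        ((hq1 n).pow 2).intervalIntegrable _ _
      have a1 : ∫ s in (0 : ℝ)..T, q n s ^ 2 ≤ T * (Real.exp T * inner ℝ (S.ι (S.e n)) y₀ ^ 2) := by
        have := intervalIntegral.integral_mono_on hT iq (by simp) fun s hs => hb n s hs
        simpa [mul_left_comm] using this
      have a2 := (scalar_energy (hq4 n)).2 T hTm
      have a3 : ∫ s in (0 : ℝ)..T, 2 * (0 * q n s - κ * S.eig n * q n s ^ 2)
          = -(2 * κ) * (S.eig n * ∫ s in (0 : ℝ)..T, q n s ^ 2) := by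
        rw [← intervalIntegral.integral_const_mul, ← intervalIntegral.integral_const_mul]
        refine intervalIntegral.integral_congr fun s _ => ?_
        ring
      rw [a3, hq2] at a2
      have a4 : S.eig n * ∫ s in (0 : ℝ)..T, q n s ^ 2 ≤ κ⁻¹ * inner ℝ (S.ι (S.e n)) y₀ ^ 2 := by
        rw [inv_mul_eq_div, le_div_iff₀ hκ]
        have : 0 ≤ S.eig n * ∫ s in (0 : ℝ)..T, q n s ^ 2 := mul_nonneg (S.eig_nonneg n)
          (intervalIntegral.integral_nonneg hT fun s _ => by positivity)
        nlinarith [sq_nonneg (q n T)]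
      have a5 : ∫ s, (√(1 + S.eig n) * q n s) ^ 2 ∂timeMeasure T
          = (1 + S.eig n) * ∫ s in (0 : ℝ)..T, q n s ^ 2 := by
        rw [timeMeasure_eq, ← intervalIntegral.integral_of_le hT,
          ← intervalIntegral.integral_const_mul]
        refine intervalIntegral.integral_congr fun s _ => ?_
        simp only [mul_pow, S.sq_sqrt]
      rw [a5]
      linarith
    refine (Finset.sum_le_sum fun n _ => h1 n).trans ?_
    rw [← Finset.mul_sum]
    have h3 := sum_le_hasSum (Finset.range N) (fun n _ => sq_nonneg _) (S.hasSum_sq_H y₀)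
    have := Real.exp_pos T
    gcongr
  obtain ⟨Y, hY, hYc, -⟩ := exists_memLp_of_coeff S.basisV
    (q := fun n s => √(1 + S.eig n) * q n s) (fun n => (hqm n).const_mul _) hS
  simp only [S.basisH_apply] at hy
  refine ⟨y, Y, hyc, ?_, hY, ?_, fun n => ?_⟩
  · refine sub_eq_zero.1 (S.complete _ fun n => ?_)
    rw [inner_sub_right, hy, hq2, sub_self]
  · filter_upwards [hYc] with t ht
    refine sub_eq_zero.1 (S.complete _ fun n => ?_)
    have := ht n
    rw [S.inner_basisV] at this
    rw [inner_sub_right, mul_left_cancel₀ (S.sqrt_pos n).ne' this, hy, sub_self]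
  · simpa only [hy] using hq4 n

/-- The energy inequality for sources of the form `⟪h, D ·⟫`. -/
theorem energy_le {κ T : ℝ} (hκ : 0 < κ) {y : ℝ → H} {Y : ℝ → V} {h : ℝ → W}
    (hY : MemLp Y 2 (timeMeasure T)) (hYy : ∀ᵐ t ∂timeMeasure T, S.ι (Y t) = y t)
    (hh : MemLp h 2 (timeMeasure T))
    (hm : S.ModeEq κ T y (fun n t => inner ℝ (S.D (S.e n)) (h t))) {t : ℝ} (ht : t ∈ Icc 0 T) :
    ‖y t‖ ^ 2 + κ * ∫ s in (0 : ℝ)..t, ‖S.D (Y s)‖ ^ 2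
      ≤ ‖y 0‖ ^ 2 + κ⁻¹ * ∫ s in (0 : ℝ)..t, ‖h s‖ ^ 2 := by
  set c : ℕ → ℝ → ℝ := fun n s => inner ℝ (S.ι (S.e n)) (y s) with hc
  have ih : IntervalIntegrable (fun s => ‖h s‖ ^ 2) volume 0 t :=
    (intervalIntegrable_iff_integrableOn_Ioc_of_le ht.1).2
      ((MemLp.integrableOn_norm_sq hh).mono_set (Ioc_subset_Ioc_right ht.2))
  have h0 : (0 : ℝ) ∈ Icc 0 T := ⟨le_rfl, ht.1.trans ht.2⟩
  have ic : ∀ n, IntervalIntegrable (fun s => S.eig n * c n s ^ 2) volume 0 t := by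
    intro n
    refine ContinuousOn.intervalIntegrable ?_
    rw [uIcc_of_le ht.1]
    exact continuousOn_const.mul (((hm n).continuousOn.mono (Icc_subset_Icc_right ht.2)).pow 2)
  have iC : ∀ N : ℕ, IntervalIntegrable (fun s => ∑ n ∈ Finset.range N, S.eig n * c n s ^ 2)
      volume 0 t := by
    intro N
    have := IntervalIntegrable.sum (Finset.range N) (fun j _ => ic j)
    simpa [Finset.sum_fn] using this
  have key : ∀ N : ℕ, ∑ n ∈ Finset.range N, c n t ^ 2
      + κ * ∫ s in (0 : ℝ)..t, ∑ n ∈ Finset.range N, S.eig n * c n s ^ 2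
      ≤ ‖y 0‖ ^ 2 + κ⁻¹ * ∫ s in (0 : ℝ)..t, ‖h s‖ ^ 2 := by
    intro N
    have e1 : ∑ n ∈ Finset.range N, c n t ^ 2 = ∑ n ∈ Finset.range N, c n 0 ^ 2
        + ∫ s in (0 : ℝ)..t, ∑ n ∈ Finset.range N,
          2 * (inner ℝ (S.D (S.e n)) (h s) * c n s - κ * S.eig n * c n s ^ 2) := by
      rw [intervalIntegral.integral_finsetSum
        (fun n _ => (scalar_energy (hm n)).intervalIntegrable h0 ht), ← Finset.sum_add_distrib]
      exact Finset.sum_congr rfl fun n _ => (scalar_energy (hm n)).2 t ht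
    have e2 : ∫ s in (0 : ℝ)..t, ∑ n ∈ Finset.range N,
          2 * (inner ℝ (S.D (S.e n)) (h s) * c n s - κ * S.eig n * c n s ^ 2)
        ≤ ∫ s in (0 : ℝ)..t, (κ⁻¹ * ‖h s‖ ^ 2
          - κ * ∑ n ∈ Finset.range N, S.eig n * c n s ^ 2) := by
      refine intervalIntegral.integral_mono_on ht.1 ?_
        ((ih.const_mul _).sub ((iC N).const_mul _)) fun s _ => ?_
      · have := IntervalIntegrable.sum (Finset.range N)
          (fun n _ => (scalar_energy (hm n)).intervalIntegrable h0 ht)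
        simpa [Finset.sum_fn] using this
      -- The truncation of the solution to `N` modes. It turns the sum over modes into `2 ⟪D P, h⟫ -
      -- 2 κ ‖D P‖²`, to which Cauchy–Schwarz applies in `W` without expanding `h`.
      · set P : V := ∑ n ∈ Finset.range N, c n s • S.e n with hP
        have p1 : inner ℝ (S.D P) (h s)
            = ∑ n ∈ Finset.range N, inner ℝ (S.D (S.e n)) (h s) * c n s := by
          rw [hP, map_sum, sum_inner]
          refine Finset.sum_congr rfl fun n _ => ?_
          rw [map_smul, inner_smul_left, conj_trivial, mul_comm]
        have p2 : ‖S.D P‖ ^ 2 = ∑ n ∈ Finset.range N, S.eig n * c n s ^ 2 := by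
          rw [← real_inner_self_eq_norm_sq]
          have hPP : inner ℝ (S.D P) (S.D P) = ∑ n ∈ Finset.range N,
              inner ℝ (S.D (c n s • S.e n)) (S.D P) := by
            conv_lhs => rw [hP, map_sum, sum_inner, ← map_sum, ← hP]
          rw [hPP]
          refine Finset.sum_congr rfl fun n hn => ?_
          rw [map_smul, inner_smul_left, conj_trivial, S.inner_D, hP, map_sum, inner_sum]
          simp only [map_smul, inner_smul_right]
          rw [Finset.sum_eq_single n]
          · rw [real_inner_self_eq_norm_sq, S.orthonormal.1 n]; ring
          · intro m _ hmn
            rw [S.orthonormal.2 hmn.symm, mul_zero]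
          · intro h; exact absurd hn h
        have e3 : ∑ n ∈ Finset.range N,
            2 * (inner ℝ (S.D (S.e n)) (h s) * c n s - κ * S.eig n * c n s ^ 2)
            = 2 * inner ℝ (S.D P) (h s) - 2 * κ * ‖S.D P‖ ^ 2 := by
          rw [p1, p2, Finset.mul_sum, Finset.mul_sum, ← Finset.sum_sub_distrib]
          exact Finset.sum_congr rfl fun n _ => by ring
        rw [e3, ← p2]
        have c1 := real_inner_le_norm (S.D P) (h s)
        -- Young's inequality weighted so as to consume exactly half of the dissipation.
        have c2 : 2 * (‖S.D P‖ * ‖h s‖) ≤ κ * ‖S.D P‖ ^ 2 + κ⁻¹ * ‖h s‖ ^ 2 := by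
          have h1 : 0 ≤ κ⁻¹ * (κ * ‖S.D P‖ - ‖h s‖) ^ 2 := by positivity
          have h2 : κ⁻¹ * (κ * ‖S.D P‖ - ‖h s‖) ^ 2
              = κ * ‖S.D P‖ ^ 2 + κ⁻¹ * ‖h s‖ ^ 2 - 2 * (‖S.D P‖ * ‖h s‖) := by
            field_simp; ring
          linarith
        linarith
    rw [intervalIntegral.integral_sub (ih.const_mul _) ((iC N).const_mul _),
      intervalIntegral.integral_const_mul, intervalIntegral.integral_const_mul] at e2
    have e4 := sum_le_hasSum (Finset.range N) (fun n _ => sq_nonneg _) (S.hasSum_sq_H (y 0))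
    simp only [hc] at e1 e2 e4 ⊢
    linarith
  have hD : Integrable (fun s => ‖S.D (Y s)‖ ^ 2) (timeMeasure t) := by
    have := ((S.D.comp_memLp' hY).mono_measure (timeMeasure_mono ht.2))
    exact this.integrable_norm_pow (by norm_num)
  have hsumD : ∀ᵐ s ∂timeMeasure t, HasSum (fun n => S.eig n * c n s ^ 2) (‖S.D (Y s)‖ ^ 2) := by
    filter_upwards [ae_timeMeasure_mono ht.2 hYy] with s hs
    have := S.hasSum_sq_D (Y s)
    rwa [hs] at this
  have hlim : Tendsto (fun N : ℕ => ∫ s in (0 : ℝ)..t, ∑ n ∈ Finset.range N, S.eig n * c n s ^ 2)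
      atTop (nhds (∫ s in (0 : ℝ)..t, ‖S.D (Y s)‖ ^ 2)) := by
    simp only [intervalIntegral.integral_of_le ht.1, ← timeMeasure_eq]
    refine tendsto_integral_of_dominated_convergence _ (fun N => ?_) hD (fun N => ?_) ?_
    · have := (intervalIntegrable_iff_integrableOn_Ioc_of_le ht.1).1 (iC N)
      rw [IntegrableOn, ← timeMeasure_eq] at this
      exact this.1
    · filter_upwards [hsumD] with s hs
      have h0 : ∀ n, 0 ≤ S.eig n * c n s ^ 2 := fun n => mul_nonneg (S.eig_nonneg n) (sq_nonneg _)
      rw [Real.norm_of_nonneg (Finset.sum_nonneg fun n _ => h0 n)]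
      exact sum_le_hasSum _ (fun n _ => h0 n) hs
    · filter_upwards [hsumD] with s hs using hs.tendsto_sum_nat
  exact le_of_tendsto' ((S.hasSum_sq_H (y t)).tendsto_sum_nat.add (hlim.const_mul κ)) key

end EigenSystem

end ThermoVisco

namespace ThermoVisco

/-! ### Functions on the interval `(a,b)` -/

section Interval

variable {a b : ℝ}

/-- The element of `L²(a,b)` given by `φ` (zero if `φ` is not square integrable). -/
def ofFun (a b : ℝ) (φ : ℝ → ℝ) : L2 a b := by
  classical
  exact if h : MemLp φ 2 (volume.restrict (Ioo a b)) then h.toLp φ else 0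

theorem coeFn_ofFun {φ : ℝ → ℝ} (h : MemLp φ 2 (volume.restrict (Ioo a b))) :
    (ofFun a b φ : ℝ → ℝ) =ᵐ[volume.restrict (Ioo a b)] φ := by
  rw [ofFun, dif_pos h]; exact h.coeFn_toLp

theorem memLp_of_continuous {φ : ℝ → ℝ} (h : Continuous φ) :
    MemLp φ 2 (volume.restrict (Ioo a b)) := by
  obtain ⟨C, hC⟩ := (isCompact_Icc (a := a) (b := b)).exists_bound_of_continuousOn h.continuousOn
  refine MemLp.of_bound h.aestronglyMeasurable C ?_
  filter_upwards [ae_restrict_mem measurableSet_Ioo] with t ht using hC t (Ioo_subset_Icc_self ht)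

theorem coeFn_ofFun_continuous {φ : ℝ → ℝ} (h : Continuous φ) :
    (ofFun a b φ : ℝ → ℝ) =ᵐ[volume.restrict (Ioo a b)] φ := coeFn_ofFun (memLp_of_continuous h)

theorem eq_ofFun {f : L2 a b} {φ : ℝ → ℝ} (h : (f : ℝ → ℝ) =ᵐ[volume.restrict (Ioo a b)] φ) :
    f = ofFun a b φ :=
  Lp.ext (h.trans (coeFn_ofFun ((memLp_congr_ae h).1 (Lp.memLp f))).symm)

theorem L2_inner_eq (f g : L2 a b) : inner ℝ f g = ∫ x in Ioo a b, f x * g x := by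
  rw [L2.inner_def]
  exact integral_congr_ae (Eventually.of_forall fun x => by simp [mul_comm])

theorem inner_ofFun {f : L2 a b} {φ : ℝ → ℝ} (h : MemLp φ 2 (volume.restrict (Ioo a b))) :
    inner ℝ f (ofFun a b φ) = ∫ x in Ioo a b, f x * φ x := by
  rw [L2_inner_eq]
  refine integral_congr_ae ?_
  filter_upwards [coeFn_ofFun h] with x hx
  rw [hx]

theorem hasWeakDeriv_iff {f g : L2 a b} : HasWeakDeriv f g ↔ ∀ φ, IsTestFun a b φ →
    inner ℝ f (ofFun a b (deriv φ)) = - inner ℝ g (ofFun a b φ) := by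
  refine forall₂_congr fun φ hφ => ?_
  rw [inner_ofFun hφ.memLp_deriv, inner_ofFun hφ.memLp]

theorem eq_zero_of_test {f : L2 a b} (h : ∀ φ, IsTestFun a b φ → inner ℝ f (ofFun a b φ) = 0) :
    f = 0 := by
  have h1 : ∀ᵐ x ∂(volume.restrict (Ioo a b)), f x = 0 := by
    rw [ae_restrict_iff' measurableSet_Ioo]
    refine IsOpen.ae_eq_zero_of_integral_contDiff_smul_eq_zero isOpen_Ioo ?_ fun g hg1 hg2 hg3 => ?_
    · exact IntegrableOn.locallyIntegrableOn ((Lp.memLp f).integrable (by norm_num))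
    · have hg : IsTestFun a b g := ⟨hg1, hg2, hg3⟩
      have := h g hg
      rw [inner_ofFun hg.memLp] at this
      rw [← this, ← integral_indicator measurableSet_Ioo]
      refine integral_congr_ae (Eventually.of_forall fun x => ?_)
      by_cases hx : x ∈ Ioo a b
      · simp [hx, mul_comm]
      · simp [hx, image_eq_zero_of_notMem_tsupport fun h' => hx (hg3 h')]
  refine Lp.ext ?_
  filter_upwards [h1, Lp.coeFn_zero ℝ 2 (volume.restrict (Ioo a b))] with x h2 h3
  rw [h2, h3, Pi.zero_apply]

/-- Density of test functions in `L²`, in the form of an extension principle. It serves for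
identities, with `K = ⊥`, and for membership in closed subspaces such as `H¹₀`. -/
theorem clm_mem_of_test {E : Type*} [NormedAddCommGroup E] [NormedSpace ℝ E] {K : Submodule ℝ E}
    (hK : IsClosed (K : Set E)) (L : L2 a b →L[ℝ] E)
    (h : ∀ φ, IsTestFun a b φ → L (ofFun a b φ) ∈ K) (f : L2 a b) : L f ∈ K := by
  set P := Submodule.span ℝ {f : L2 a b | ∃ φ, IsTestFun a b φ ∧ f = ofFun a b φ}
  have hP : P.topologicalClosure = ⊤ := by
    rw [Submodule.topologicalClosure_eq_top_iff, Submodule.eq_bot_iff]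
    intro g hg
    refine eq_zero_of_test fun φ hφ => ?_
    rw [real_inner_comm]
    exact (Submodule.mem_orthogonal _ _).1 hg _ (Submodule.subset_span ⟨φ, hφ, rfl⟩)
  have hle : P.topologicalClosure ≤ K.comap (L : L2 a b →ₗ[ℝ] E) := by
    refine Submodule.topologicalClosure_minimal _ (Submodule.span_le.2 ?_) (hK.preimage L.continuous)
    rintro _ ⟨φ, hφ, rfl⟩
    exact h φ hφ
  rw [hP] at hle
  exact hle (Submodule.mem_top (x := f))

theorem HasWeakDeriv.unique {f g g' : L2 a b} (h : HasWeakDeriv f g) (h' : HasWeakDeriv f g') :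
    g = g' := by
  rw [hasWeakDeriv_iff] at h h'
  refine sub_eq_zero.1 (eq_zero_of_test fun φ hφ => ?_)
  rw [inner_sub_left]
  linarith [h φ hφ, h' φ hφ]

theorem IsTestFun.eq_zero {φ : ℝ → ℝ} (h : IsTestFun a b φ) {x : ℝ} (hx : x ∉ Ioo a b) : φ x = 0 :=
  image_eq_zero_of_notMem_tsupport fun h' => hx (h.2.2 h')

theorem IsTestFun.hasDerivAt {φ : ℝ → ℝ} (h : IsTestFun a b φ) (x : ℝ) :
    HasDerivAt φ (deriv φ x) x :=
  (h.1.differentiable (by simp)).differentiableAt.hasDerivAt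

theorem IsTestFun.continuous_deriv {φ : ℝ → ℝ} (h : IsTestFun a b φ) : Continuous (deriv φ) :=
  h.1.continuous_deriv (by simp)

theorem ofFun_add {φ ψ : ℝ → ℝ} (hφ : MemLp φ 2 (volume.restrict (Ioo a b)))
    (hψ : MemLp ψ 2 (volume.restrict (Ioo a b))) :
    ofFun a b (fun x => φ x + ψ x) = ofFun a b φ + ofFun a b ψ := by
  refine (eq_ofFun ?_).symm
  filter_upwards [Lp.coeFn_add (ofFun a b φ) (ofFun a b ψ), coeFn_ofFun hφ, coeFn_ofFun hψ]
    with x h1 h2 h3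
  rw [h1, Pi.add_apply, h2, h3]

theorem ofFun_const_mul (c : ℝ) {φ : ℝ → ℝ} (hφ : MemLp φ 2 (volume.restrict (Ioo a b))) :
    ofFun a b (fun x => c * φ x) = c • ofFun a b φ := by
  refine (eq_ofFun ?_).symm
  filter_upwards [Lp.coeFn_smul c (ofFun a b φ), coeFn_ofFun hφ] with x h1 h2
  rw [h1, Pi.smul_apply, h2, smul_eq_mul]

/-- Classical derivatives are weak derivatives. -/
theorem hasWeakDeriv_of_hasDerivAt (hab : a ≤ b) {f f' : ℝ → ℝ} (hf : ∀ x, HasDerivAt f (f' x) x)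
    (hf' : Continuous f') : HasWeakDeriv (ofFun a b f) (ofFun a b f') := by
  intro φ hφ
  have hfc : Continuous f := continuous_iff_continuousAt.2 fun x => (hf x).continuousAt
  have h := intervalIntegral.integral_mul_deriv_eq_deriv_mul (a := a) (b := b) (u := f) (v := φ)
    (u' := f') (v' := deriv φ) (fun x _ => hf x) (fun x _ => hφ.hasDerivAt x)
    (hf'.intervalIntegrable _ _) (hφ.continuous_deriv.intervalIntegrable _ _)
  rw [hφ.eq_zero (x := a) (by simp), hφ.eq_zero (x := b) (by simp)] at h
  simp only [mul_zero, sub_zero, zero_sub, intervalIntegral.integral_of_le hab,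
    integral_Ioc_eq_integral_Ioo] at h
  rw [integral_congr_ae (g := fun x => f x * deriv φ x), h]
  · congr 1
    refine integral_congr_ae ?_
    filter_upwards [coeFn_ofFun_continuous hf'] with x hx
    rw [hx]
  · filter_upwards [coeFn_ofFun_continuous hfc] with x hx
    rw [hx]

/-- To the left of the support the primitive is zero trivially; to the right it is zero because the
mean vanishes. -/
theorem isTestFun_primitive (hab : a ≤ b) {η : ℝ → ℝ} (hη : IsTestFun a b η)
    (h0 : ∫ x in Ioo a b, η x = 0) : IsTestFun a b (fun x => ∫ y in a..x, η y) ∧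
      deriv (fun x => ∫ y in a..x, η y) = η := by
  have hd : ∀ x, HasDerivAt (fun x => ∫ y in a..x, η y) (η x) x := fun x =>
    intervalIntegral.integral_hasDerivAt_right (hη.1.continuous.intervalIntegrable _ _)
      (hη.1.continuous.stronglyMeasurableAtFilter _ _) hη.1.continuous.continuousAt
  have hderiv : deriv (fun x => ∫ y in a..x, η y) = η := funext fun x => (hd x).deriv
  -- The extreme points of the support lie inside `(a,b)` by compactness; for an empty support any
  -- endpoints do.
  obtain ⟨c, d, hac, hdb, hcd⟩ : ∃ c d, a < c ∧ d < b ∧ tsupport η ⊆ Icc c d := by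
    rcases (tsupport η).eq_empty_or_nonempty with he | hne
    · exact ⟨a + 1, b - 1, by linarith, by linarith, by simp [he]⟩
    · have hc : IsCompact (tsupport η) := hη.2.1
      exact ⟨_, _, (hη.2.2 (hc.sInf_mem hne)).1, (hη.2.2 (hc.sSup_mem hne)).2,
        fun x hx => ⟨csInf_le hc.bddBelow hx, le_csSup hc.bddAbove hx⟩⟩
  have hz : ∀ x, x ∉ Icc c d → η x = 0 := fun x hx =>
    image_eq_zero_of_notMem_tsupport fun h => hx (hcd h)
  have hsupp : Function.support (fun x => ∫ y in a..x, η y) ⊆ Icc c d := by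
    intro x hx
    by_contra hcon
    refine hx ?_
    simp only [mem_Icc, not_and_or, not_le] at hcon
    rcases hcon with h | h
    · refine intervalIntegral.integral_zero_ae (Eventually.of_forall fun y hy => hz y fun h' => ?_)
      rw [uIoc] at hy
      have := hy.2.trans (max_le hac.le h.le)
      rcases le_total a x with hax | hax
      · rw [max_eq_right hax] at hy; linarith [hy.2, h'.1]
      · rw [max_eq_left hax] at hy; linarith [hy.2, h'.1]
    · have e : ∫ y in a..b, η y = 0 := by
        rw [intervalIntegral.integral_of_le hab, integral_Ioc_eq_integral_Ioo, h0]
      have e2 : ∫ y in x..b, η y = 0 := by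
        refine intervalIntegral.integral_zero_ae (Eventually.of_forall fun y hy => hz y fun h' => ?_)
        rw [uIoc] at hy
        have := (lt_min h hdb).trans hy.1
        linarith [h'.2]
      have := intervalIntegral.integral_add_adjacent_intervals
        (hη.1.continuous.intervalIntegrable (μ := volume) a x)
        (hη.1.continuous.intervalIntegrable x b)
      rw [e, e2, add_zero] at this
      exact this
  have hts : tsupport (fun x => ∫ y in a..x, η y) ⊆ Icc c d := closure_minimal hsupp isClosed_Icc
  refine ⟨⟨?_, HasCompactSupport.of_support_subset_isCompact isCompact_Icc hsupp,
    hts.trans fun x hx => ⟨hac.trans_le hx.1, hx.2.trans_lt hdb⟩⟩, hderiv⟩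
  rw [contDiff_infty_iff_deriv]
  exact ⟨fun x => (hd x).differentiableAt, by rw [hderiv]; exact hη.1⟩

theorem exists_test_integral_one (hab : a < b) :
    ∃ η, IsTestFun a b η ∧ ∫ x in Ioo a b, η x = 1 := by
  obtain ⟨f, h1, h2, h3, h4, h5⟩ := exists_contDiff_tsupport_subset (E := ℝ) (n := ⊤)
    (s := Ioo a b) (x := (a + b) / 2) (Ioo_mem_nhds (by linarith) (by linarith))
  have hf : IsTestFun a b f := ⟨h3, h2, h1⟩
  have hI : ∫ x in Ioo a b, f x = ∫ x, f x := by
    refine setIntegral_eq_integral_of_forall_compl_eq_zero fun x hx => hf.eq_zero hx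
  have hpos : 0 < ∫ x, f x := Continuous.integral_pos_of_hasCompactSupport_nonneg_nonzero
    h3.continuous h2 (fun x => (h4 ⟨x, rfl⟩).1) (x := (a + b) / 2) (by rw [h5]; norm_num)
  refine ⟨fun x => (∫ x, f x)⁻¹ * f x, ⟨contDiff_const.mul h3, h2.mul_left, ?_⟩, ?_⟩
  · exact (tsupport_mul_subset_right).trans h1
  · rw [integral_const_mul, hI, inv_mul_cancel₀ hpos.ne']

theorem IsTestFun.add_const_mul {φ ψ : ℝ → ℝ} (hφ : IsTestFun a b φ) (hψ : IsTestFun a b ψ) (c : ℝ) :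
    IsTestFun a b (fun x => φ x + c * ψ x) :=
  ⟨hφ.1.add (contDiff_const.mul hψ.1), hφ.2.1.add hψ.2.1.mul_left,
    (tsupport_add _ _).trans (union_subset hφ.2.2 ((tsupport_mul_subset_right).trans hψ.2.2))⟩

theorem integral_eq_inner_one (f : L2 a b) :
    inner ℝ f (ofFun a b fun _ => 1) = ∫ x in Ioo a b, f x := by
  rw [inner_ofFun (memLp_of_continuous continuous_const)]; simp

theorem integral_ofFun {φ : ℝ → ℝ} (h : MemLp φ 2 (volume.restrict (Ioo a b))) :
    inner ℝ (ofFun a b φ) (ofFun a b fun _ => 1) = ∫ x in Ioo a b, φ x := by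
  rw [integral_eq_inner_one]
  exact integral_congr_ae (coeFn_ofFun h)

theorem norm_sq_one (hab : a ≤ b) : ‖ofFun a b fun _ => 1‖ ^ 2 = b - a := by
  rw [← real_inner_self_eq_norm_sq, integral_ofFun (memLp_of_continuous continuous_const)]
  simp [hab]

/-- A function with vanishing weak derivative is constant. -/
theorem eq_const_of_test (hab : a < b) {h : L2 a b}
    (H : ∀ φ, IsTestFun a b φ → inner ℝ h (ofFun a b (deriv φ)) = 0) :
    ∃ c : ℝ, h = c • ofFun a b (fun _ => 1) := by
  obtain ⟨η₀, hη₀, hη₀1⟩ := exists_test_integral_one hab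
  refine ⟨inner ℝ h (ofFun a b η₀), sub_eq_zero.1 (eq_zero_of_test fun η hη => ?_)⟩
  set m := ∫ x in Ioo a b, η x with hm
  -- Subtracting `m η₀` makes the mean zero, so the result is the derivative of a test function and
  -- is annihilated by `h`.
  have ht := hη.add_const_mul hη₀ (-m)
  have hi : ∀ {φ : ℝ → ℝ}, IsTestFun a b φ → IntegrableOn φ (Ioo a b) := fun hφ =>
    (hφ.memLp).integrable (by norm_num)
  have h0 : ∫ x in Ioo a b, (η x + -m * η₀ x) = 0 := by
    rw [integral_add (hi hη) ((hi hη₀).const_mul _), integral_const_mul, hη₀1, hm]; ring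
  obtain ⟨hp, hpd⟩ := isTestFun_primitive hab.le ht h0
  have := H _ hp
  rw [hpd, ofFun_add hη.memLp (hη₀.memLp.const_mul _), ofFun_const_mul _ hη₀.memLp, inner_add_right,
    inner_smul_right] at this
  rw [inner_sub_left, inner_smul_left, real_inner_comm, real_inner_comm (ofFun a b η),
    integral_ofFun hη.memLp, ← hm, conj_trivial, real_inner_comm]
  linarith

end Interval

end ThermoVisco

namespace ThermoVisco

open scoped BoundedContinuousFunction

/-! ### Primitives in the space variable, `H¹₀` and integration by parts -/

section Interval

variable {a b : ℝ}

theorem exists_integral_norm_le (a b : ℝ) : ∃ C : ℝ, 0 ≤ C ∧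
    ∀ g : L2 a b, ∫ x in Ioo a b, ‖g x‖ ≤ C * ‖g‖ := by
  refine ⟨‖ofFun a b fun _ => 1‖, norm_nonneg _, fun g => ?_⟩
  have hm : MemLp (fun x => ‖g x‖) 2 (volume.restrict (Ioo a b)) := (Lp.memLp g).norm
  have h1 := real_inner_le_norm (ofFun a b fun x => ‖g x‖) (ofFun a b fun _ => 1)
  rw [integral_ofFun hm] at h1
  refine h1.trans (le_of_eq ?_)
  have : ‖ofFun a b fun x => ‖g x‖‖ = ‖g‖ := by
    rw [Lp.norm_def, Lp.norm_def, eLpNorm_congr_ae (coeFn_ofFun hm), eLpNorm_norm]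
  rw [this, mul_comm]

theorem integrable_L2 (g : L2 a b) : Integrable g (volume.restrict (Ioo a b)) :=
  (Lp.memLp g).integrable (by norm_num)

/-- The primitive `x ↦ ∫_a^x g`. -/
def primC (a b : ℝ) : L2 a b →L[ℝ] (ℝ →ᵇ ℝ) :=
  let C := (exists_integral_norm_le a b).choose
  have hC := (exists_integral_norm_le a b).choose_spec
  -- Integrating against the measure restricted to `(a,b)` keeps the primitive bounded on the whole
  -- line.
  have hb : ∀ (g : L2 a b) (x : ℝ), ‖∫ y in a..x, g y ∂(volume.restrict (Ioo a b))‖ ≤ C * ‖g‖ :=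
    fun g x => (intervalIntegral.norm_integral_le_integral_norm_uIoc).trans
      ((setIntegral_le_integral (integrable_L2 g).norm (Eventually.of_forall fun _ => norm_nonneg _)).trans
        (hC.2 g))
  LinearMap.mkContinuous
    { toFun := fun g => BoundedContinuousFunction.ofNormedAddCommGroup
        (fun x => ∫ y in a..x, g y ∂(volume.restrict (Ioo a b)))
        (intervalIntegral.continuous_primitive (fun _ _ => (integrable_L2 g).intervalIntegrable) a)
        (C * ‖g‖) (hb g)
      map_add' := fun f g => by
        ext x
        simp only [BoundedContinuousFunction.coe_ofNormedAddCommGroup,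
          BoundedContinuousFunction.coe_add, Pi.add_apply]
        rw [← intervalIntegral.integral_add (integrable_L2 f).intervalIntegrable
          (integrable_L2 g).intervalIntegrable]
        refine intervalIntegral.integral_congr_ae_restrict ?_
        refine ae_restrict_of_ae ?_
        filter_upwards [Lp.coeFn_add f g] with y hy
        rw [hy, Pi.add_apply]
      map_smul' := fun c g => by
        ext x
        simp only [BoundedContinuousFunction.coe_ofNormedAddCommGroup, RingHom.id_apply,
          BoundedContinuousFunction.coe_smul]
        rw [← intervalIntegral.integral_smul]
        refine intervalIntegral.integral_congr_ae_restrict ?_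
        refine ae_restrict_of_ae ?_
        filter_upwards [Lp.coeFn_smul c g] with y hy
        rw [hy, Pi.smul_apply] }
    C (fun g => BoundedContinuousFunction.norm_ofNormedAddCommGroup_le _
      (mul_nonneg hC.1 (norm_nonneg g)) (hb g))

theorem primC_apply (g : L2 a b) (x : ℝ) :
    primC a b g x = ∫ y in a..x, g y ∂(volume.restrict (Ioo a b)) := rfl

theorem primC_ofFun {φ : ℝ → ℝ} (hφ : Continuous φ) {x : ℝ} (hx : x ∈ Ioo a b) :
    primC a b (ofFun a b φ) x = ∫ y in a..x, φ y := by
  have hsub : Ioc a x ⊆ Ioo a b := fun y hy => ⟨hy.1, hy.2.trans_lt hx.2⟩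
  rw [primC_apply, intervalIntegral.integral_of_le hx.1.le, intervalIntegral.integral_of_le hx.1.le,
    Measure.restrict_restrict measurableSet_Ioc, inter_eq_self_of_subset_left hsub]
  exact integral_congr_ae (ae_restrict_of_ae_restrict_of_subset hsub (coeFn_ofFun_continuous hφ))

/-- The primitive as a map of `L²`. -/
def prim (a b : ℝ) : L2 a b →L[ℝ] L2 a b :=
  (BoundedContinuousFunction.toLp 2 (volume.restrict (Ioo a b)) ℝ).comp (primC a b)

theorem prim_ofFun {φ : ℝ → ℝ} (hφ : Continuous φ) :
    prim a b (ofFun a b φ) = ofFun a b fun x => ∫ y in a..x, φ y := by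
  refine eq_ofFun ?_
  filter_upwards [BoundedContinuousFunction.coeFn_toLp (p := 2) (volume.restrict (Ioo a b)) ℝ
    (primC a b (ofFun a b φ)), ae_restrict_mem measurableSet_Ioo] with x h1 h2
  rw [← primC_ofFun hφ h2, ← h1]; rfl

/-- Both sides are continuous in `g`, and for a test function `g` the derivative is classical. -/
theorem hasWeakDeriv_prim (hab : a ≤ b) (g : L2 a b) : HasWeakDeriv (prim a b g) g := by
  rw [hasWeakDeriv_iff]
  intro φ hφ
  have h := clm_mem_of_test (a := a) (b := b) (K := (⊥ : Submodule ℝ ℝ)) (by simp)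
    ((innerSL ℝ (ofFun a b (deriv φ))).comp (prim a b) + innerSL ℝ (ofFun a b φ)) (fun η hη => ?_) g
  · simp only [Submodule.mem_bot, _root_.add_apply, ContinuousLinearMap.comp_apply,
      innerSL_apply_apply] at h
    rw [real_inner_comm, real_inner_comm (ofFun a b φ)]
    linarith
  · have hd : ∀ x, HasDerivAt (fun x => ∫ y in a..x, η y) (η x) x := fun x =>
      intervalIntegral.integral_hasDerivAt_right (hη.1.continuous.intervalIntegrable _ _)
        (hη.1.continuous.stronglyMeasurableAtFilter _ _) hη.1.continuous.continuousAt
    have := hasWeakDeriv_iff.1 (hasWeakDeriv_of_hasDerivAt hab hd hη.1.continuous) φ hφ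
    simp only [Submodule.mem_bot, _root_.add_apply, ContinuousLinearMap.comp_apply,
      innerSL_apply_apply, prim_ofFun hη.1.continuous]
    rw [real_inner_comm, this, real_inner_comm]; ring

/-- The pair `(f, g)`, `g = f'`, as an element of `H¹`. -/
def mkSob (f g : L2 a b) (h : HasWeakDeriv f g) : Sob a b 1 :=
  ⟨WithLp.toLp 2 ![f, g], fun j => by fin_cases j; exact h⟩

@[simp] theorem D0_mkSob (f g : L2 a b) (h : HasWeakDeriv f g) : Sob.D 0 (mkSob f g h) = f := rfl

@[simp] theorem D1_mkSob (f g : L2 a b) (h : HasWeakDeriv f g) : Sob.D 1 (mkSob f g h) = g := rfl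

theorem Sob.hasWeakDeriv (ψ : Sob a b 1) : HasWeakDeriv (Sob.D 0 ψ) (Sob.D 1 ψ) := ψ.2 0

theorem Sob.ext1 {ψ χ : Sob a b 1} (h0 : Sob.D 0 ψ = Sob.D 0 χ) (h1 : Sob.D 1 ψ = Sob.D 1 χ) :
    ψ = χ := by
  refine Subtype.ext (PiLp.ext fun i => ?_)
  fin_cases i
  · exact h0
  · exact h1

theorem Sob.ext0 {ψ χ : Sob a b 1} (h0 : Sob.D 0 ψ = Sob.D 0 χ) : ψ = χ :=
  Sob.ext1 h0 ((Sob.hasWeakDeriv ψ).unique (h0 ▸ Sob.hasWeakDeriv χ))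

theorem Sob.norm_sq (ψ : Sob a b 1) : ‖ψ‖ ^ 2 = ‖Sob.D 0 ψ‖ ^ 2 + ‖Sob.D 1 ψ‖ ^ 2 := by
  have : ‖ψ‖ = ‖(ψ : PiLp 2 (fun _ : Fin (1 + 1) => L2 a b))‖ := rfl
  rw [this, PiLp.norm_sq_eq_of_L2]
  simp [Sob.D, Fin.sum_univ_two]

theorem continuous_mkSob {α : Type*} [TopologicalSpace α] {f g : α → L2 a b}
    (hf : Continuous f) (hg : Continuous g) (h : ∀ t, HasWeakDeriv (f t) (g t)) :
    Continuous fun t => mkSob (f t) (g t) (h t) := by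
  refine Continuous.subtype_mk ((PiLp.continuous_toLp 2 _).comp (continuous_pi fun i => ?_)) _
  fin_cases i
  · exact hf
  · exact hg

/-- `g ↦ (∫_a^x g, g)`. -/
def primSob (hab : a ≤ b) : L2 a b →L[ℝ] Sob a b 1 :=
  ⟨{ toFun := fun g => mkSob (prim a b g) g (hasWeakDeriv_prim hab g)
     map_add' := fun f g => Sob.ext1 (by simp) (by simp)
     map_smul' := fun c g => Sob.ext1 (by simp) (by simp) },
    continuous_mkSob (prim a b).continuous continuous_id (hasWeakDeriv_prim hab)⟩

theorem D0_primSob (hab : a ≤ b) (g : L2 a b) : Sob.D 0 (primSob hab g) = prim a b g := rfl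

theorem D1_primSob (hab : a ≤ b) (g : L2 a b) : Sob.D 1 (primSob hab g) = g := rfl

theorem test_mem_sobolevZero {F : Sob a b 1} {φ : ℝ → ℝ} (hφ : IsTestFun a b φ)
    (h : Sob.D 0 F = ofFun a b φ) : F ∈ sobolevZero a b :=
  Submodule.le_topologicalClosure _ (Submodule.subset_span
    ⟨φ, hφ, by rw [h]; exact coeFn_ofFun hφ.memLp⟩)

/-- Primitives of functions of mean zero are in `H¹₀`. -/
theorem primSob_mem (hab : a < b) {g : L2 a b} (hg : inner ℝ (ofFun a b fun _ => 1) g = 0) :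
    primSob hab.le g ∈ sobolevZero a b := by
  obtain ⟨η₀, hη₀, hη₀1⟩ := exists_test_integral_one hab
  -- The multiple of `η₀` subtracted here makes the primitive of every test function a test
  -- function; it disappears for the given `g` of mean zero.
  have h := clm_mem_of_test (a := a) (b := b) (K := sobolevZero a b)
    (Submodule.isClosed_topologicalClosure _)
    ((primSob hab.le).comp (ContinuousLinearMap.id ℝ _
      - (innerSL ℝ (ofFun a b fun _ => 1)).smulRight (ofFun a b η₀))) (fun η hη => ?_) g
  · simpa [hg] using h
  · have hI : inner ℝ (ofFun a b fun _ => 1) (ofFun a b η) = ∫ x in Ioo a b, η x := by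
      rw [real_inner_comm, integral_ofFun hη.memLp]
    have hi : ∀ {φ : ℝ → ℝ}, IsTestFun a b φ → IntegrableOn φ (Ioo a b) := fun hφ =>
      (hφ.memLp).integrable (by norm_num)
    set m := ∫ x in Ioo a b, η x with hm
    have ht := hη.add_const_mul hη₀ (-m)
    have h0 : ∫ x in Ioo a b, (η x + -m * η₀ x) = 0 := by
      rw [integral_add (hi hη) ((hi hη₀).const_mul _), integral_const_mul, hη₀1, hm]; ring
    refine test_mem_sobolevZero (isTestFun_primitive hab.le ht h0).1 ?_
    rw [ContinuousLinearMap.comp_apply, D0_primSob, ← prim_ofFun ht.1.continuous,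
      ofFun_add hη.memLp (hη₀.memLp.const_mul _), ofFun_const_mul _ hη₀.memLp]
    congr 1
    simp only [_root_.sub_apply, ContinuousLinearMap.id_apply, ContinuousLinearMap.smulRight_apply,
      innerSL_apply_apply, hI]
    rw [neg_smul, sub_eq_add_neg]

/-- Linear and continuous in `F`, hence a matter of test functions, where it is the definition of
the weak derivative of `ψ`. The boundary conditions enter the proof only in this form: no boundary
values of `ψ` are asked for. -/
theorem sobolevZero_ibp {F : Sob a b 1} (hF : F ∈ sobolevZero a b) (ψ : Sob a b 1) :
    inner ℝ (Sob.D 1 F) (Sob.D 0 ψ) = - inner ℝ (Sob.D 0 F) (Sob.D 1 ψ) := by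
  set L : Sob a b 1 →L[ℝ] ℝ :=
    (innerSL ℝ (Sob.D 0 ψ)).comp (Sob.D 1) + (innerSL ℝ (Sob.D 1 ψ)).comp (Sob.D 0) with hL
  have hle : sobolevZero a b ≤ LinearMap.ker (L : Sob a b 1 →ₗ[ℝ] ℝ) := by
    refine Submodule.topologicalClosure_minimal _ (Submodule.span_le.2 ?_)
      (isClosed_singleton.preimage L.continuous)
    rintro F ⟨φ, hφ, hF⟩
    have h0 : Sob.D 0 F = ofFun a b φ := eq_ofFun hF
    have h1 : HasWeakDeriv (Sob.D 0 F) (ofFun a b (deriv φ)) := by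
      rw [h0, hasWeakDeriv_iff]
      intro η hη
      have i := integral_mul_deriv_eq_deriv_mul_of_integrable (u := φ) (v := η) (u' := deriv φ)
        (v' := deriv η) (fun x _ => hφ.hasDerivAt x) (fun x _ => hη.hasDerivAt x)
        ((hφ.1.continuous.mul hη.continuous_deriv).integrable_of_hasCompactSupport hφ.2.1.mul_right)
        ((hφ.continuous_deriv.mul hη.1.continuous).integrable_of_hasCompactSupport
          hη.2.1.mul_left)
        ((hφ.1.continuous.mul hη.1.continuous).integrable_of_hasCompactSupport hφ.2.1.mul_right)
      have e1 : ∫ x in Ioo a b, ofFun a b φ x * deriv η x = ∫ x, φ x * deriv η x := by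
        rw [← setIntegral_eq_integral_of_forall_compl_eq_zero (s := Ioo a b)
          (f := fun x => φ x * deriv η x) fun x hx => by rw [hφ.eq_zero hx, zero_mul]]
        refine integral_congr_ae ?_
        filter_upwards [coeFn_ofFun hφ.memLp] with x hx
        rw [hx]
      have e2 : ∫ x in Ioo a b, ofFun a b (deriv φ) x * η x = ∫ x, deriv φ x * η x := by
        rw [← setIntegral_eq_integral_of_forall_compl_eq_zero (s := Ioo a b)
          (f := fun x => deriv φ x * η x) fun x hx => by rw [hη.eq_zero hx, mul_zero]]
        refine integral_congr_ae ?_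
        filter_upwards [coeFn_ofFun hφ.memLp_deriv] with x hx
        rw [hx]
      rw [inner_ofFun hη.memLp_deriv, inner_ofFun hη.memLp, e1, e2, i]
    have h2 : Sob.D 1 F = ofFun a b (deriv φ) := (Sob.hasWeakDeriv F).unique h1
    have := hasWeakDeriv_iff.1 (Sob.hasWeakDeriv ψ) φ hφ
    change inner ℝ (Sob.D 0 ψ) (Sob.D 1 F) + inner ℝ (Sob.D 1 ψ) (Sob.D 0 F) = 0
    rw [h0, h2]
    linarith
  have := hle hF
  change inner ℝ (Sob.D 0 ψ) (Sob.D 1 F) + inner ℝ (Sob.D 1 ψ) (Sob.D 0 F) = 0 at this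
  rw [real_inner_comm, real_inner_comm (Sob.D 1 ψ)]
  linarith

theorem H10.ibp (v : H10 a b) (ψ : Sob a b 1) :
    inner ℝ (H10.dx v) (Sob.D 0 ψ) = - inner ℝ (H10.toL2 v) (Sob.D 1 ψ) :=
  sobolevZero_ibp v.2 ψ

theorem H10.hasWeakDeriv (v : H10 a b) : HasWeakDeriv (H10.toL2 v) (H10.dx v) :=
  Sob.hasWeakDeriv (H10.toSob v)

theorem H10.norm_sq (v : H10 a b) : ‖v‖ ^ 2 = ‖H10.toL2 v‖ ^ 2 + ‖H10.dx v‖ ^ 2 :=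
  Sob.norm_sq (H10.toSob v)

theorem H10.toL2_injective : Function.Injective (H10.toL2 : H10 a b → L2 a b) := fun _ _ h =>
  Subtype.ext (Sob.ext0 h)

theorem Sob.D0_injective : Function.Injective (Sob.D 0 : Sob a b 1 → L2 a b) := fun _ _ h =>
  Sob.ext0 h

theorem exists_H10_of_test {φ : ℝ → ℝ} (hab : a ≤ b) (hφ : IsTestFun a b φ) :
    ∃ v : H10 a b, H10.toL2 v = ofFun a b φ ∧ H10.dx v = ofFun a b (deriv φ) :=
  ⟨⟨mkSob _ _ (hasWeakDeriv_of_hasDerivAt hab hφ.hasDerivAt hφ.continuous_deriv),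
    test_mem_sobolevZero hφ rfl⟩, rfl, rfl⟩

end Interval

end ThermoVisco

namespace ThermoVisco

open scoped BoundedContinuousFunction

/-! ### Continuous representatives, products and the chain rule in `H¹(a,b)` -/

section Interval

variable {a b : ℝ}

theorem HasWeakDeriv.smul {f g : L2 a b} (h : HasWeakDeriv f g) (c : ℝ) :
    HasWeakDeriv (c • f) (c • g) := by
  rw [hasWeakDeriv_iff] at *
  intro φ hφ
  rw [inner_smul_left, inner_smul_left, h φ hφ]; simp

theorem HasWeakDeriv.sub {f g f' g' : L2 a b} (h : HasWeakDeriv f g) (h' : HasWeakDeriv f' g') :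
    HasWeakDeriv (f - f') (g - g') := by
  rw [hasWeakDeriv_iff] at *
  intro φ hφ
  rw [inner_sub_left, inner_sub_left, h φ hφ, h' φ hφ]; ring

theorem hasWeakDeriv_one (hab : a ≤ b) : HasWeakDeriv (ofFun a b fun _ => 1) (0 : L2 a b) := by
  have h := hasWeakDeriv_of_hasDerivAt (a := a) (b := b) hab (f := fun _ => 1) (f' := fun _ => 0)
    (fun x => hasDerivAt_const x 1) continuous_const
  have h0 : ofFun a b (fun _ => 0) = 0 := by
    simpa using ofFun_const_mul (a := a) (b := b) 0 (φ := fun _ => 0)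
      (memLp_of_continuous continuous_const)
  rwa [h0] at h

theorem exists_D0_eq (hab : a < b) (ψ : Sob a b 1) :
    ∃ c : ℝ, Sob.D 0 ψ = prim a b (Sob.D 1 ψ) + c • ofFun a b (fun _ => 1) := by
  obtain ⟨c, hc⟩ := eq_const_of_test hab (h := Sob.D 0 ψ - prim a b (Sob.D 1 ψ)) fun φ hφ => by
    have := hasWeakDeriv_iff.1 ((Sob.hasWeakDeriv ψ).sub (hasWeakDeriv_prim hab.le (Sob.D 1 ψ))) φ hφ
    simpa using this
  exact ⟨c, by rw [← hc]; abel⟩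

/-- The continuous representative of an element of `H¹(a,b)`. -/
def rep (a b : ℝ) : Sob a b 1 →L[ℝ] (ℝ →ᵇ ℝ) :=
  (primC a b).comp (Sob.D 1) +
    -- The additive constant is the mean of the difference between the function and the primitive of
    -- its derivative. Written so, the representative is visibly linear and continuous in the
    -- function.
    ((b - a)⁻¹ • (innerSL ℝ (ofFun a b fun _ => 1)).comp
      (Sob.D 0 - (prim a b).comp (Sob.D 1))).smulRight (BoundedContinuousFunction.const ℝ 1)

theorem toLp_rep (hab : a < b) (ψ : Sob a b 1) :
    BoundedContinuousFunction.toLp 2 (volume.restrict (Ioo a b)) ℝ (rep a b ψ) = Sob.D 0 ψ := by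
  obtain ⟨c, hc⟩ := exists_D0_eq hab ψ
  have h1 : BoundedContinuousFunction.toLp 2 (volume.restrict (Ioo a b)) ℝ
      (BoundedContinuousFunction.const ℝ (1 : ℝ)) = ofFun a b fun _ => 1 := by
    refine eq_ofFun ?_
    filter_upwards [BoundedContinuousFunction.coeFn_toLp (p := 2) (volume.restrict (Ioo a b)) ℝ
      (BoundedContinuousFunction.const ℝ (1 : ℝ))] with x hx
    rw [hx]; rfl
  simp only [rep, _root_.add_apply, ContinuousLinearMap.comp_apply,
    ContinuousLinearMap.smulRight_apply, map_add, map_smul, h1, _root_.smul_apply,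
    innerSL_apply_apply, _root_.sub_apply]
  have h2 : Sob.D 0 ψ - prim a b (Sob.D 1 ψ) = c • ofFun a b (fun _ => 1) := by rw [hc]; abel
  rw [h2, inner_smul_right, real_inner_self_eq_norm_sq, norm_sq_one hab.le, hc]
  have : (b - a)⁻¹ • (c * (b - a)) = c := by
    rw [smul_eq_mul]; field_simp [sub_ne_zero.2 hab.ne']
  rw [this]; rfl

theorem coeFn_rep (hab : a < b) (ψ : Sob a b 1) :
    (Sob.D 0 ψ : ℝ → ℝ) =ᵐ[volume.restrict (Ioo a b)] rep a b ψ := by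
  rw [← toLp_rep hab ψ]
  exact BoundedContinuousFunction.coeFn_toLp (p := 2) (volume.restrict (Ioo a b)) ℝ _

/-- Multiplication by an `H¹` function on `L²`. -/
def mulV (a b : ℝ) : Sob a b 1 →L[ℝ] L2 a b →L[ℝ] L2 a b :=
  ((ContinuousLinearMap.mul ℝ ℝ).holderL (volume.restrict (Ioo a b)) ∞ 2 2).comp
    ((BoundedContinuousFunction.toLp ∞ (volume.restrict (Ioo a b)) ℝ).comp (rep a b))

theorem coeFn_mulV_rep (ψ : Sob a b 1) (g : L2 a b) :
    (mulV a b ψ g : ℝ → ℝ) =ᵐ[volume.restrict (Ioo a b)] fun x => rep a b ψ x * g x := by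
  set F : Lp ℝ ∞ (volume.restrict (Ioo a b)) :=
    BoundedContinuousFunction.toLp ∞ (volume.restrict (Ioo a b)) ℝ (rep a b ψ)
  have h : ((ContinuousLinearMap.mul ℝ ℝ).holder 2 F g : Lp ℝ 2 (volume.restrict (Ioo a b)))
      =ᵐ[volume.restrict (Ioo a b)] fun x => ContinuousLinearMap.mul ℝ ℝ (F x) (g x) :=
    ContinuousLinearMap.coeFn_holder _ F g
  filter_upwards [h, BoundedContinuousFunction.coeFn_toLp (p := ∞) (volume.restrict (Ioo a b)) ℝ
    (rep a b ψ)] with x h1 h2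
  rw [← h2]
  exact h1

theorem coeFn_mulV (hab : a < b) (ψ : Sob a b 1) (g : L2 a b) :
    (mulV a b ψ g : ℝ → ℝ) =ᵐ[volume.restrict (Ioo a b)] fun x => Sob.D 0 ψ x * g x := by
  filter_upwards [coeFn_mulV_rep ψ g, coeFn_rep hab ψ] with x h1 h2
  rw [h1, h2]

theorem inner_mulV (hab : a < b) (ψ : Sob a b 1) (f g : L2 a b) :
    inner ℝ (mulV a b ψ f) g = ∫ x in Ioo a b, Sob.D 0 ψ x * f x * g x := by
  rw [L2_inner_eq]
  refine integral_congr_ae ?_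
  filter_upwards [coeFn_mulV hab ψ f] with x hx
  rw [hx]

theorem mulV_comm (hab : a < b) (ψ χ : Sob a b 1) :
    mulV a b ψ (Sob.D 0 χ) = mulV a b χ (Sob.D 0 ψ) := by
  refine Lp.ext ?_
  filter_upwards [coeFn_mulV hab ψ (Sob.D 0 χ), coeFn_mulV hab χ (Sob.D 0 ψ)] with x h1 h2
  rw [h1, h2, mul_comm]

theorem inner_mulV_comm (hab : a < b) (ψ : Sob a b 1) (f g : L2 a b) :
    inner ℝ (mulV a b ψ f) g = inner ℝ f (mulV a b ψ g) := by
  rw [inner_mulV hab, real_inner_comm, inner_mulV hab]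
  refine integral_congr_ae (Eventually.of_forall fun x => ?_)
  simp only; ring

theorem ofFun_congr {φ ψ : ℝ → ℝ} (h : φ =ᵐ[volume.restrict (Ioo a b)] ψ) :
    ofFun a b φ = ofFun a b ψ := by
  by_cases hφ : MemLp φ 2 (volume.restrict (Ioo a b))
  · exact eq_ofFun ((coeFn_ofFun hφ).trans h)
  · have hψ : ¬ MemLp ψ 2 (volume.restrict (Ioo a b)) := fun h' => hφ ((memLp_congr_ae h).2 h')
    rw [ofFun, ofFun, dif_neg hφ, dif_neg hψ]

theorem norm_ofFun_sub_le {φ ψ : ℝ → ℝ} (hφ : MemLp φ 2 (volume.restrict (Ioo a b)))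
    (hψ : MemLp ψ 2 (volume.restrict (Ioo a b))) {ε : ℝ} (h : ∀ x ∈ Ioo a b, |φ x - ψ x| ≤ ε) :
    ‖ofFun a b φ - ofFun a b ψ‖ ≤ ε * ‖ofFun a b fun _ => 1‖ := by
  refine Lp.norm_le_mul_norm_of_ae_le_mul ?_
  filter_upwards [Lp.coeFn_sub (ofFun a b φ) (ofFun a b ψ), coeFn_ofFun hφ, coeFn_ofFun hψ,
    coeFn_ofFun_continuous (a := a) (b := b) (continuous_const (y := (1 : ℝ))),
    ae_restrict_mem measurableSet_Ioo] with x h1 h2 h3 h4 hx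
  rw [h1, Pi.sub_apply, h2, h3, h4]
  simpa using h x hx

theorem tendsto_ofFun {φ : ℕ → ℝ → ℝ} {ψ : ℝ → ℝ}
    (hφ : ∀ n, MemLp (φ n) 2 (volume.restrict (Ioo a b)))
    (hψ : MemLp ψ 2 (volume.restrict (Ioo a b))) (h : TendstoUniformly φ ψ atTop) :
    Tendsto (fun n => ofFun a b (φ n)) atTop (nhds (ofFun a b ψ)) := by
  rw [Metric.tendsto_atTop]
  intro ε hε
  set M := ‖ofFun a b fun _ => 1‖
  have hM : 0 ≤ M := norm_nonneg _
  obtain ⟨N, hN⟩ := eventually_atTop.1 (Metric.tendstoUniformly_iff.1 h (ε / (M + 1)) (by positivity))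
  refine ⟨N, fun n hn => ?_⟩
  rw [dist_eq_norm]
  refine (norm_ofFun_sub_le (hφ n) hψ (ε := ε / (M + 1)) fun x _ => ?_).trans_lt ?_
  · have := (hN n hn x).le
    rwa [dist_comm, Real.dist_eq] at this
  · rw [div_mul_eq_mul_div, div_lt_iff₀ (by positivity)]
    nlinarith

theorem exists_seq_test (g : L2 a b) : ∃ η : ℕ → ℝ → ℝ, (∀ n, IsTestFun a b (η n)) ∧
    Tendsto (fun n => ofFun a b (η n)) atTop (nhds g) := by
  set P : Submodule ℝ (L2 a b) :=
    { carrier := {f | ∃ φ, IsTestFun a b φ ∧ f = ofFun a b φ}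
      zero_mem' := ⟨fun _ => 0, ⟨contDiff_const, HasCompactSupport.zero, by simp [tsupport]⟩, by
        have := ofFun_const_mul (a := a) (b := b) 0 (φ := fun _ => 0)
          (memLp_of_continuous continuous_const)
        simpa using this.symm⟩
      add_mem' := by
        rintro _ _ ⟨φ, hφ, rfl⟩ ⟨ψ, hψ, rfl⟩
        refine ⟨_, hφ.add_const_mul hψ 1, ?_⟩
        simpa using (ofFun_add hφ.memLp hψ.memLp).symm
      smul_mem' := by
        rintro c _ ⟨φ, hφ, rfl⟩
        exact ⟨fun x => c * φ x, ⟨contDiff_const.mul hφ.1, hφ.2.1.mul_left,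
          tsupport_mul_subset_right.trans hφ.2.2⟩, (ofFun_const_mul c hφ.memLp).symm⟩ }
  have hg : g ∈ P.topologicalClosure := by
    have := clm_mem_of_test (a := a) (b := b) (K := P.topologicalClosure)
      P.isClosed_topologicalClosure (ContinuousLinearMap.id ℝ _)
      (fun φ hφ => Submodule.le_topologicalClosure _ ⟨φ, hφ, rfl⟩) g
    exact this
  obtain ⟨f, hf, hlim⟩ := mem_closure_iff_seq_limit.1 hg
  choose η hη he using hf
  refine ⟨η, hη, ?_⟩
  simpa only [← he] using hlim

theorem memLp_comp_rep_mul {g : ℝ → ℝ} (hg : Continuous g) (χ : Sob a b 1) (f : L2 a b) :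
    MemLp (fun x => g (rep a b χ x) * f x) 2 (volume.restrict (Ioo a b)) := by
  obtain ⟨C, hC⟩ := (isCompact_closedBall (0 : ℝ) ‖rep a b χ‖).exists_bound_of_continuousOn
    hg.continuousOn
  refine MemLp.of_le_mul (c := C) (Lp.memLp f)
    ((hg.comp (rep a b χ).continuous).aestronglyMeasurable.mul (Lp.memLp _).1)
    (Eventually.of_forall fun x => ?_)
  rw [norm_mul]
  gcongr
  exact hC _ (mem_closedBall_zero_iff.2 ((rep a b χ).norm_coe_le_norm x))

/-- The chain rule. -/
theorem hasWeakDeriv_comp (hab : a < b) {φ φ' : ℝ → ℝ} (hφ : ∀ x, HasDerivAt φ (φ' x) x)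
    (hφ' : Continuous φ') (ψ : Sob a b 1) :
    HasWeakDeriv (ofFun a b fun x => φ (rep a b ψ x))
      (ofFun a b fun x => φ' (rep a b ψ x) * Sob.D 1 ψ x) := by
  have hφc : Continuous φ := continuous_iff_continuousAt.2 fun x => (hφ x).continuousAt
  obtain ⟨c, hc⟩ := exists_D0_eq hab ψ
  obtain ⟨η, hη, hlim⟩ := exists_seq_test (Sob.D 1 ψ)
  set one : Sob a b 1 := mkSob _ _ (hasWeakDeriv_one hab.le)
  -- Approximation of the derivative by test functions with the constant kept. Convergence in `H¹`
  -- makes the representatives converge uniformly, and each approximant is classically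
  -- differentiable.
  set Ψ : ℕ → Sob a b 1 := fun n => primSob hab.le (ofFun a b (η n)) + c • one with hΨ
  have hΨlim : Tendsto Ψ atTop (nhds ψ) := by
    have : ψ = primSob hab.le (Sob.D 1 ψ) + c • one := Sob.ext0 (by
      rw [map_add, map_smul, D0_primSob, hc]; rfl)
    rw [this]
    exact (((primSob hab.le).continuous.tendsto _).comp hlim).add_const _
  have hD1 : ∀ n, Sob.D 1 (Ψ n) = ofFun a b (η n) := by
    intro n
    rw [hΨ]
    simp only [map_add, map_smul]
    rw [D1_primSob, show Sob.D 1 one = 0 from rfl, smul_zero, add_zero]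
  -- uniform convergence of the representatives
  have hrep : Tendsto (fun n => rep a b (Ψ n)) atTop (nhds (rep a b ψ)) :=
    ((rep a b).continuous.tendsto _).comp hΨlim
  have hU : TendstoUniformly (fun n x => rep a b (Ψ n) x) (rep a b ψ) atTop :=
    BoundedContinuousFunction.tendsto_iff_tendstoUniformly.1 hrep
  obtain ⟨M, hM⟩ : ∃ M, ∀ n, ‖rep a b (Ψ n)‖ ≤ M := by
    obtain ⟨M, hM⟩ := (Metric.isBounded_range_of_tendsto _ hrep).exists_norm_le
    exact ⟨M, fun n => hM _ ⟨n, rfl⟩⟩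
  have hM' : ‖rep a b ψ‖ ≤ M := le_of_tendsto' hrep.norm hM
  have hcomp : ∀ {g : ℝ → ℝ}, Continuous g →
      TendstoUniformly (fun n x => g (rep a b (Ψ n) x)) (fun x => g (rep a b ψ x)) atTop := by
    intro g hg
    have hu : UniformContinuousOn g (Metric.closedBall 0 M) :=
      (isCompact_closedBall 0 M).uniformContinuousOn_of_continuous hg.continuousOn
    exact UniformContinuousOn.comp_tendstoUniformly (s := Metric.closedBall 0 M) (F := fun n x => rep a b (Ψ n) x) (f := rep a b ψ)
      (hF := fun n x => mem_closedBall_zero_iff.2 (((rep a b (Ψ n)).norm_coe_le_norm x).trans (hM n)))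
      (hf := fun x => mem_closedBall_zero_iff.2 (((rep a b ψ).norm_coe_le_norm x).trans hM')) (hg := hu) (h := hU)
  rw [hasWeakDeriv_iff]
  intro ζ hζ
  have hmc : ∀ {g : ℝ → ℝ}, Continuous g → ∀ χ : Sob a b 1,
      MemLp (fun x => g (rep a b χ x)) 2 (volume.restrict (Ioo a b)) := fun hg χ =>
    memLp_of_continuous (hg.comp (rep a b χ).continuous)
  -- The factor `φ'` is moved to the test function, so that the limit pairs an `L²` convergent
  -- derivative with a uniformly convergent function.
  have hR : ∀ χ : Sob a b 1, inner ℝ (ofFun a b fun x => φ' (rep a b χ x) * Sob.D 1 χ x)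
      (ofFun a b ζ) = inner ℝ (Sob.D 1 χ) (ofFun a b fun x => φ' (rep a b χ x) * ζ x) := by
    intro χ
    have hm := memLp_comp_rep_mul hφ' χ (Sob.D 1 χ)
    rw [inner_ofFun hζ.memLp, inner_ofFun (φ := fun x => φ' (rep a b χ x) * ζ x)
      (memLp_of_continuous ((hφ'.comp (rep a b χ).continuous).mul hζ.1.continuous))]
    refine integral_congr_ae ?_
    filter_upwards [coeFn_ofFun hm] with x hx
    rw [hx]; ring
  rw [hR]
  have key : ∀ n, inner ℝ (ofFun a b fun x => φ (rep a b (Ψ n) x)) (ofFun a b (deriv ζ))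
      = - inner ℝ (Sob.D 1 (Ψ n)) (ofFun a b fun x => φ' (rep a b (Ψ n) x) * ζ x) := by
    intro n
    set p : ℝ → ℝ := fun x => (∫ y in a..x, η n y) + c with hp
    have hηc := (hη n).1.continuous
    have hpd : ∀ x, HasDerivAt p (η n x) x := fun x =>
      (intervalIntegral.integral_hasDerivAt_right (hηc.intervalIntegrable _ _)
        (hηc.stronglyMeasurableAtFilter _ _) hηc.continuousAt).add_const c
    have hpc : Continuous p := continuous_iff_continuousAt.2 fun x => (hpd x).continuousAt
    have hrp : (rep a b (Ψ n) : ℝ → ℝ) =ᵐ[volume.restrict (Ioo a b)] p := by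
      refine (coeFn_rep hab (Ψ n)).symm.trans ?_
      have : Sob.D 0 (Ψ n) = ofFun a b p := by
        have hc1 : Continuous fun x => ∫ y in a..x, η n y := by
          have : (fun x => ∫ y in a..x, η n y) = fun x => p x - c := by funext x; simp [hp]
          rw [this]; fun_prop
        have e2 := ofFun_const_mul (a := a) (b := b) c (φ := fun _ => 1)
          (memLp_of_continuous continuous_const)
        simp only [mul_one] at e2
        rw [hp, ofFun_add (memLp_of_continuous hc1) (memLp_of_continuous continuous_const), e2,
          ← prim_ofFun hηc]
        rfl
      rw [this]
      exact coeFn_ofFun_continuous hpc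
    rw [← hR, hD1 n]
    have h1 : ofFun a b (fun x => φ (rep a b (Ψ n) x)) = ofFun a b fun x => φ (p x) :=
      ofFun_congr (by filter_upwards [hrp] with x hx; rw [hx])
    have h2 : ofFun a b (fun x => φ' (rep a b (Ψ n) x) * ofFun a b (η n) x)
        = ofFun a b fun x => φ' (p x) * η n x :=
      ofFun_congr (by
        filter_upwards [hrp, coeFn_ofFun_continuous hηc] with x hx hx'
        rw [hx, hx'])
    rw [h1, h2]
    refine hasWeakDeriv_iff.1 (hasWeakDeriv_of_hasDerivAt hab.le
      (fun x => (hφ (p x)).comp x (hpd x)) ?_) ζ hζ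
    exact (hφ'.comp hpc).mul hηc
  have lim1 : Tendsto (fun n => ofFun a b fun x => φ (rep a b (Ψ n) x)) atTop
      (nhds (ofFun a b fun x => φ (rep a b ψ x))) :=
    tendsto_ofFun (fun n => hmc hφc _) (hmc hφc _) (hcomp hφc)
  have lim2 : Tendsto (fun n => ofFun a b fun x => φ' (rep a b (Ψ n) x) * ζ x) atTop
      (nhds (ofFun a b fun x => φ' (rep a b ψ x) * ζ x)) := by
    refine tendsto_ofFun (fun n => memLp_of_continuous
      ((hφ'.comp (rep a b _).continuous).mul hζ.1.continuous)) (memLp_of_continuous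
      ((hφ'.comp (rep a b _).continuous).mul hζ.1.continuous)) ?_
    obtain ⟨C, hC⟩ := hζ.2.1.exists_bound_of_continuous hζ.1.continuous
    have hC0 : 0 ≤ C := (norm_nonneg _).trans (hC 0)
    rw [Metric.tendstoUniformly_iff]
    intro ε hε
    filter_upwards [Metric.tendstoUniformly_iff.1 (hcomp hφ') (ε / (C + 1)) (by positivity)]
      with n hn x
    have h1 := hn x
    rw [Real.dist_eq] at h1 ⊢
    rw [← sub_mul, abs_mul]
    rw [lt_div_iff₀ (by positivity)] at h1
    refine lt_of_le_of_lt ?_ h1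
    gcongr
    have := hC x
    rw [Real.norm_eq_abs] at this
    linarith
  have limD : Tendsto (fun n => Sob.D 1 (Ψ n)) atTop (nhds (Sob.D 1 ψ)) :=
    ((Sob.D 1).continuous.tendsto _).comp hΨlim
  have l1 := lim1.inner (𝕜 := ℝ) (tendsto_const_nhds (x := ofFun a b (deriv ζ)))
  have l2 := (limD.inner (𝕜 := ℝ) lim2).neg
  simp only [key] at l1
  exact tendsto_nhds_unique l1 l2

/-- The product rule. -/
theorem hasWeakDeriv_mulV (hab : a < b) (ψ χ : Sob a b 1) :
    HasWeakDeriv (mulV a b ψ (Sob.D 0 χ)) (mulV a b ψ (Sob.D 1 χ) + mulV a b χ (Sob.D 1 ψ)) := by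
  -- The chain rule for the square; the product follows by polarization.
  have hsq : ∀ ψ : Sob a b 1, HasWeakDeriv (mulV a b ψ (Sob.D 0 ψ)) (2 • mulV a b ψ (Sob.D 1 ψ)) := by
    intro ψ
    have h := hasWeakDeriv_comp hab (φ := fun x => x ^ 2) (φ' := fun x => 2 * x)
      (fun x => by simpa using hasDerivAt_pow 2 x) (by fun_prop) ψ
    have e1 : mulV a b ψ (Sob.D 0 ψ) = ofFun a b fun x => rep a b ψ x ^ 2 := eq_ofFun (by
      filter_upwards [coeFn_mulV_rep ψ (Sob.D 0 ψ), coeFn_rep hab ψ] with x h1 h2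
      rw [h1, h2, sq])
    have e2 : 2 • mulV a b ψ (Sob.D 1 ψ) = ofFun a b fun x => 2 * rep a b ψ x * Sob.D 1 ψ x :=
      eq_ofFun (by
        rw [two_smul]
        filter_upwards [coeFn_mulV_rep ψ (Sob.D 1 ψ), Lp.coeFn_add (mulV a b ψ (Sob.D 1 ψ))
          (mulV a b ψ (Sob.D 1 ψ))] with x h1 h2
        rw [h2, Pi.add_apply, h1]; ring)
    rw [e1, e2]; exact h
  have h := (((hsq (ψ + χ)).sub (hsq ψ)).sub (hsq χ)).smul (1 / 2)
  convert h using 1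
  · simp only [map_add, _root_.add_apply, mulV_comm hab χ ψ]
    module
  · simp only [map_add, _root_.add_apply]
    module

/-- The product in `H¹`. -/
def mulSob (hab : a < b) (ψ χ : Sob a b 1) : Sob a b 1 := mkSob _ _ (hasWeakDeriv_mulV hab ψ χ)

end Interval

end ThermoVisco

namespace ThermoVisco

/-! ### The Neumann and Dirichlet eigenfunctions -/

section Trig

variable {a b : ℝ}

/-- The frequencies `nπ/(b-a)`. -/
def freq (a b : ℝ) (n : ℕ) : ℝ := n * Real.pi / (b - a)

theorem freq_mul (hab : a < b) (n : ℕ) : freq a b n * (b - a) = n * Real.pi := by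
  rw [freq, div_mul_cancel₀ _ (sub_pos.2 hab).ne']

theorem freq_nonneg (hab : a < b) (n : ℕ) : 0 ≤ freq a b n :=
  div_nonneg (by positivity) (sub_pos.2 hab).le

theorem freq_pos (hab : a < b) {n : ℕ} (hn : n ≠ 0) : 0 < freq a b n :=
  div_pos (by positivity) (sub_pos.2 hab)

theorem freq_sq_injective (hab : a < b) {m n : ℕ} (h : freq a b m ^ 2 = freq a b n ^ 2) : m = n := by
  have h1 := (pow_left_inj₀ (freq_nonneg hab m) (freq_nonneg hab n) two_ne_zero).1 h
  have h2 : (m : ℝ) * Real.pi = n * Real.pi := by rw [← freq_mul hab, ← freq_mul hab, h1]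
  exact_mod_cast mul_right_cancel₀ Real.pi_ne_zero h2

/-- `cos(nπ(x-a)/(b-a))`. -/
def cosF (a b : ℝ) (n : ℕ) (x : ℝ) : ℝ := Real.cos (freq a b n * (x - a))

/-- `sin(nπ(x-a)/(b-a))`. -/
def sinF (a b : ℝ) (n : ℕ) (x : ℝ) : ℝ := Real.sin (freq a b n * (x - a))

theorem continuous_cosF (n : ℕ) : Continuous (cosF a b n) := by unfold cosF; fun_prop

theorem continuous_sinF (n : ℕ) : Continuous (sinF a b n) := by unfold sinF; fun_prop

theorem hasDerivAt_cosF (n : ℕ) (x : ℝ) : HasDerivAt (cosF a b n) (-freq a b n * sinF a b n x) x := by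
  have h := (((hasDerivAt_id x).sub_const a).const_mul (freq a b n)).cos
  have e : -freq a b n * sinF a b n x = -Real.sin (freq a b n * (x - a)) * (freq a b n * 1) := by
    rw [sinF]; ring
  rw [e]
  exact h

theorem hasDerivAt_sinF (n : ℕ) (x : ℝ) : HasDerivAt (sinF a b n) (freq a b n * cosF a b n x) x := by
  have h := (((hasDerivAt_id x).sub_const a).const_mul (freq a b n)).sin
  have e : freq a b n * cosF a b n x = Real.cos (freq a b n * (x - a)) * (freq a b n * 1) := by
    rw [cosF]; ring
  rw [e]
  exact h

def cosL (a b : ℝ) (n : ℕ) : L2 a b := ofFun a b (cosF a b n)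

def sinL (a b : ℝ) (n : ℕ) : L2 a b := ofFun a b (sinF a b n)

theorem hasWeakDeriv_cosL (hab : a < b) (n : ℕ) :
    HasWeakDeriv (cosL a b n) (-freq a b n • sinL a b n) := by
  rw [sinL, ← ofFun_const_mul _ (memLp_of_continuous (continuous_sinF n))]
  exact hasWeakDeriv_of_hasDerivAt hab.le (hasDerivAt_cosF n) ((continuous_sinF n).const_mul _)

def cosV (hab : a < b) (n : ℕ) : Sob a b 1 := mkSob _ _ (hasWeakDeriv_cosL hab n)

theorem cosL_zero : cosL a b 0 = ofFun a b fun _ => 1 := by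
  rw [cosL]; congr 1; funext x; simp [cosF, freq]

theorem sinF_left (n : ℕ) : sinF a b n a = 0 := by simp [sinF]

theorem sinF_right (hab : a < b) (n : ℕ) : sinF a b n b = 0 := by
  rw [sinF, freq_mul hab, Real.sin_nat_mul_pi]

theorem integral_cosF (n : ℕ) (x : ℝ) : ∫ y in a..x, freq a b n * cosF a b n y = sinF a b n x := by
  rw [intervalIntegral.integral_eq_sub_of_hasDerivAt (fun y _ => hasDerivAt_sinF n y)
    (((continuous_cosF n).const_mul _).intervalIntegrable _ _), sinF_left, sub_zero]

theorem prim_cosL (n : ℕ) : prim a b (freq a b n • cosL a b n) = sinL a b n := by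
  rw [cosL, ← ofFun_const_mul _ (memLp_of_continuous (continuous_cosF n)),
    prim_ofFun ((continuous_cosF n).const_mul _), sinL]
  congr 1; funext x
  exact integral_cosF n x

theorem inner_one_cosL (hab : a < b) (n : ℕ) :
    inner ℝ (ofFun a b fun _ => 1) (freq a b n • cosL a b n) = 0 := by
  rw [real_inner_comm, cosL, ← ofFun_const_mul _ (memLp_of_continuous (continuous_cosF n)),
    integral_ofFun (memLp_of_continuous ((continuous_cosF n).const_mul _)),
    ← integral_Ioc_eq_integral_Ioo, ← intervalIntegral.integral_of_le hab.le, integral_cosF,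
    sinF_right hab]

def sinV (hab : a < b) (n : ℕ) : H10 a b :=
  ⟨primSob hab.le (freq a b n • cosL a b n), primSob_mem hab (inner_one_cosL hab n)⟩

theorem D0_cosV (hab : a < b) (n : ℕ) : Sob.D 0 (cosV hab n) = cosL a b n := rfl

theorem D1_cosV (hab : a < b) (n : ℕ) : Sob.D 1 (cosV hab n) = -freq a b n • sinL a b n := rfl

theorem toL2_sinV (hab : a < b) (n : ℕ) : H10.toL2 (sinV hab n) = sinL a b n := prim_cosL n

theorem dx_sinV (hab : a < b) (n : ℕ) : H10.dx (sinV hab n) = freq a b n • cosL a b n := rfl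

/-- Integration by parts against the sine, which lies in `H¹₀`. Hence `ψ` may be any `H¹` function,
and this is how the Neumann condition is encoded. -/
theorem inner_D1_cosV (hab : a < b) (n : ℕ) (ψ : Sob a b 1) :
    inner ℝ (Sob.D 1 (cosV hab n)) (Sob.D 1 ψ) = freq a b n ^ 2 * inner ℝ (cosL a b n) (Sob.D 0 ψ) := by
  have h := H10.ibp (sinV hab n) ψ
  rw [dx_sinV, toL2_sinV, inner_smul_left] at h
  rw [D1_cosV, inner_smul_left]
  simp only [conj_trivial] at *
  linear_combination -(freq a b n) * h

theorem inner_dx_sinV (hab : a < b) (n : ℕ) (v : H10 a b) :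
    inner ℝ (H10.dx (sinV hab n)) (H10.dx v) = freq a b n ^ 2 * inner ℝ (sinL a b n) (H10.toL2 v) := by
  have h := H10.ibp v (cosV hab n)
  rw [D0_cosV, D1_cosV, inner_smul_right, real_inner_comm, real_inner_comm (sinL a b n)] at h
  rw [dx_sinV, inner_smul_left]
  simp only [conj_trivial] at *
  linear_combination (freq a b n) * h

/-- Eigenvectors of a symmetric form for distinct eigenvalues. -/
theorem inner_cosL_of_ne (hab : a < b) {m n : ℕ} (h : m ≠ n) :
    inner ℝ (cosL a b m) (cosL a b n) = 0 := by
  have h1 := inner_D1_cosV hab m (cosV hab n)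
  have h2 := inner_D1_cosV hab n (cosV hab m)
  rw [real_inner_comm, h2, D0_cosV, D0_cosV, real_inner_comm] at h1
  have h3 : freq a b n ^ 2 - freq a b m ^ 2 ≠ 0 :=
    sub_ne_zero.2 fun h' => h (freq_sq_injective hab h').symm
  refine (mul_eq_zero.1 (?_ : (freq a b n ^ 2 - freq a b m ^ 2) * _ = 0)).resolve_left h3
  linear_combination h1

theorem inner_sinL_of_ne (hab : a < b) {m n : ℕ} (h : m ≠ n) :
    inner ℝ (sinL a b m) (sinL a b n) = 0 := by
  have h1 := inner_dx_sinV hab m (sinV hab n)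
  have h2 := inner_dx_sinV hab n (sinV hab m)
  rw [real_inner_comm, h2, toL2_sinV, toL2_sinV, real_inner_comm] at h1
  have h3 : freq a b n ^ 2 - freq a b m ^ 2 ≠ 0 :=
    sub_ne_zero.2 fun h' => h (freq_sq_injective hab h').symm
  refine (mul_eq_zero.1 (?_ : (freq a b n ^ 2 - freq a b m ^ 2) * _ = 0)).resolve_left h3
  linear_combination h1

theorem norm_sinL (hab : a < b) {n : ℕ} (hn : n ≠ 0) : ‖sinL a b n‖ = ‖cosL a b n‖ := by
  have h := inner_D1_cosV hab n (cosV hab n)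
  rw [D1_cosV, D0_cosV, real_inner_self_eq_norm_sq, real_inner_self_eq_norm_sq, norm_smul, mul_pow,
    norm_neg, Real.norm_eq_abs, sq_abs] at h
  have h2 := mul_left_cancel₀ (pow_ne_zero 2 (freq_pos hab hn).ne') h
  exact (pow_left_inj₀ (norm_nonneg _) (norm_nonneg _) two_ne_zero).1 h2

/-- If the cosine vanished almost everywhere, so would the sine, against `sin² + cos² = 1`. -/
theorem cosL_ne_zero (hab : a < b) (n : ℕ) : cosL a b n ≠ 0 := by
  intro h0
  have h1 : sinL a b n = 0 := by
    rcases eq_or_ne n 0 with rfl | hn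
    · rw [← prim_cosL, h0, smul_zero, map_zero]
    · rw [← norm_eq_zero, norm_sinL hab hn, h0, norm_zero]
  have hF : ∀ᵐ x ∂(volume.restrict (Ioo a b)), False := by
    filter_upwards [coeFn_ofFun_continuous (continuous_cosF (a := a) (b := b) n),
      coeFn_ofFun_continuous (continuous_sinF (a := a) (b := b) n),
      Lp.coeFn_zero ℝ 2 (volume.restrict (Ioo a b))] with x h2 h3 h4
    have e1 : cosF a b n x = 0 := by
      rw [← h2]; change (cosL a b n : ℝ → ℝ) x = 0; rw [h0, h4]; rfl
    have e2 : sinF a b n x = 0 := by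
      rw [← h3]; change (sinL a b n : ℝ → ℝ) x = 0; rw [h1, h4]; rfl
    have := Real.sin_sq_add_cos_sq (freq a b n * (x - a))
    unfold cosF at e1; unfold sinF at e2
    rw [e1, e2] at this
    norm_num at this
  rw [eventually_false_iff_eq_bot, ae_eq_bot, Measure.restrict_eq_zero, Real.volume_Ioo,
    ENNReal.ofReal_eq_zero] at hF
  linarith

theorem sinL_ne_zero (hab : a < b) {n : ℕ} (hn : n ≠ 0) : sinL a b n ≠ 0 := by
  rw [← norm_ne_zero_iff, norm_sinL hab hn, norm_ne_zero_iff]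
  exact cosL_ne_zero hab n

/-- The product formula `2 cos α cos β = cos (α + β) + cos (α - β)` trades one power of the first
cosine for neighbouring frequencies. Orthogonality to all cosines thus becomes orthogonality to all
polynomials in the first one. -/
theorem inner_cosF_pow {f : L2 a b} (hf : ∀ n, inner ℝ (cosL a b n) f = 0) (k : ℕ) : ∀ n,
    inner ℝ f (ofFun a b fun x => cosF a b 1 x ^ k * cosF a b n x) = 0 := by
  induction k with
  | zero => intro n; simpa [cosL] using (real_inner_comm _ _).trans (hf n)
  | succ k ih =>
    intro n
    have hc : ∀ m, MemLp (fun x => cosF a b 1 x ^ k * cosF a b m x) 2 (volume.restrict (Ioo a b)) :=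
      fun m => memLp_of_continuous (((continuous_cosF 1).pow k).mul (continuous_cosF m))
    rcases n with _ | n
    · convert ih 1 using 4 with x
      rw [show cosF a b 0 x = 1 by simp [cosF, freq], pow_succ, mul_one]
    · have e : (fun x => cosF a b 1 x ^ (k + 1) * cosF a b (n + 1) x) = fun x =>
          (1 / 2) * (cosF a b 1 x ^ k * cosF a b (n + 2) x)
            + (1 / 2) * (cosF a b 1 x ^ k * cosF a b n x) := by
        funext x
        have h1 : freq a b (n + 2) * (x - a) = freq a b (n + 1) * (x - a) + freq a b 1 * (x - a) := by
          simp only [freq]; push_cast; ring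
        have h2 : freq a b n * (x - a) = freq a b (n + 1) * (x - a) - freq a b 1 * (x - a) := by
          simp only [freq]; push_cast; ring
        simp only [cosF]
        rw [h1, h2, Real.cos_add, Real.cos_sub]; ring
      rw [e, ofFun_add ((hc _).const_mul _) ((hc _).const_mul _), ofFun_const_mul _ (hc _),
        ofFun_const_mul _ (hc _), inner_add_right, inner_smul_right, inner_smul_right, ih, ih]
      simp

/-- The cosines are complete. -/
theorem eq_zero_of_cosL (hab : a < b) {f : L2 a b} (hf : ∀ n, inner ℝ (cosL a b n) f = 0) :
    f = 0 := by
  have hpoly : ∀ p : Polynomial ℝ, inner ℝ f (ofFun a b fun x => p.eval (cosF a b 1 x)) = 0 := by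
    intro p
    induction p using Polynomial.induction_on' with
    | add p q hp hq =>
      have hm : ∀ p : Polynomial ℝ, MemLp (fun x => p.eval (cosF a b 1 x)) 2
          (volume.restrict (Ioo a b)) := fun p =>
        memLp_of_continuous (p.continuous.comp (continuous_cosF 1))
      simp only [Polynomial.eval_add]
      rw [ofFun_add (hm p) (hm q), inner_add_right, hp, hq, add_zero]
    | monomial k c =>
      simp only [Polynomial.eval_monomial]
      rw [ofFun_const_mul c (φ := fun x => cosF a b 1 x ^ k)
        (memLp_of_continuous ((continuous_cosF 1).pow k)), inner_smul_right]
      have := inner_cosF_pow hf k 0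
      simp only [show ∀ x, cosF a b 0 x = 1 from fun x => by simp [cosF, freq], mul_one] at this
      rw [this, mul_zero]
  refine eq_zero_of_test fun φ hφ => ?_
  set M := ‖f‖ * ‖ofFun a b fun _ => 1‖ with hM
  have hM0 : 0 ≤ M := by positivity
  have hle : ∀ ε > 0, |inner ℝ f (ofFun a b φ)| ≤ ε * M := by
    intro ε hε
    -- The test function is read in the variable `y = cos (π (x - a) / (b - a))`, which runs through
    -- `[-1,1]`, and Weierstrass' theorem is applied there.
    obtain ⟨p, hp⟩ := exists_polynomial_near_of_continuousOn (-1) 1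
      (fun y => φ (a + (b - a) / Real.pi * Real.arccos y))
      (hφ.1.continuous.comp (by fun_prop)).continuousOn ε hε
    have h1 : ‖ofFun a b φ - ofFun a b fun x => p.eval (cosF a b 1 x)‖
        ≤ ε * ‖ofFun a b fun _ => 1‖ := by
      refine norm_ofFun_sub_le hφ.memLp
        (memLp_of_continuous (p.continuous.comp (continuous_cosF 1))) fun x hx => ?_
      have h2 := (hp (cosF a b 1 x) ⟨Real.neg_one_le_cos _, Real.cos_le_one _⟩).le
      have hba := sub_pos.2 hab
      have h3 : Real.arccos (cosF a b 1 x) = freq a b 1 * (x - a) := by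
        refine Real.arccos_cos (mul_nonneg (freq_nonneg hab _) (by linarith [hx.1])) ?_
        have := freq_mul hab 1
        have h5 : freq a b 1 * (x - a) ≤ freq a b 1 * (b - a) :=
          mul_le_mul_of_nonneg_left (by linarith [hx.2]) (freq_nonneg hab _)
        rw [this] at h5; simpa using h5
      have h4 : a + (b - a) / Real.pi * Real.arccos (cosF a b 1 x) = x := by
        rw [h3, freq]
        have := Real.pi_ne_zero
        field_simp
        ring
      rw [h4] at h2
      rwa [abs_sub_comm]
    have h2 : inner ℝ f (ofFun a b φ)
        = inner ℝ f (ofFun a b φ - ofFun a b fun x => p.eval (cosF a b 1 x)) := by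
      rw [inner_sub_right, hpoly, sub_zero]
    rw [h2]
    calc _ ≤ ‖f‖ * _ := abs_real_inner_le_norm _ _
      _ ≤ ‖f‖ * (ε * ‖ofFun a b fun _ => 1‖) := by gcongr
      _ = ε * M := by rw [hM]; ring
  refine abs_eq_zero.1 (le_antisymm (le_of_forall_pos_le_add fun ε hε => ?_) (abs_nonneg _))
  refine (hle (ε / (M + 1)) (by positivity)).trans ?_
  rw [zero_add, div_mul_eq_mul_div, div_le_iff₀ (by positivity)]
  nlinarith

/-- The sines are complete. -/
theorem eq_zero_of_sinL (hab : a < b) {f : L2 a b} (hf : ∀ n, inner ℝ (sinL a b (n + 1)) f = 0) :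
    f = 0 := by
  -- The primitive of `f` is orthogonal to all nonconstant cosines, hence is constant, and its
  -- derivative `f` is zero.
  have h1 : ∀ n, inner ℝ (cosL a b (n + 1)) (prim a b f) = 0 := by
    intro n
    have h := inner_D1_cosV hab (n + 1) (primSob hab.le f)
    rw [D1_primSob, D0_primSob, D1_cosV, inner_smul_left, hf, mul_zero] at h
    exact (mul_eq_zero.1 h.symm).resolve_left (pow_ne_zero 2 (freq_pos hab (by omega)).ne')
  set c := (b - a)⁻¹ * inner ℝ (ofFun a b fun _ => 1) (prim a b f) with hc
  have hba := sub_pos.2 hab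
  have h2 : prim a b f - c • ofFun a b (fun _ => 1) = 0 := by
    refine eq_zero_of_cosL hab fun n => ?_
    rw [inner_sub_right, inner_smul_right, ← cosL_zero]
    rcases n with _ | n
    · rw [real_inner_self_eq_norm_sq, cosL_zero, norm_sq_one hab.le, hc]
      field_simp; ring
    · rw [h1, inner_cosL_of_ne hab (by omega)]; simp
  have h3 := (hasWeakDeriv_one (a := a) (b := b) hab.le).smul c
  rw [← sub_eq_zero.1 h2, smul_zero] at h3
  exact (hasWeakDeriv_prim hab.le f).unique h3

theorem orthonormal_normalize {E : Type*} [NormedAddCommGroup E] [InnerProductSpace ℝ E] {v : ℕ → E}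
    (h0 : ∀ n, v n ≠ 0) (h : ∀ m n, m ≠ n → inner ℝ (v m) (v n) = 0) :
    Orthonormal ℝ fun n => ‖v n‖⁻¹ • v n := by
  refine ⟨fun n => ?_, fun m n hmn => ?_⟩
  · rw [norm_smul, norm_inv, norm_norm, inv_mul_cancel₀ (norm_ne_zero_iff.2 (h0 n))]
  · change inner ℝ (‖v m‖⁻¹ • v m) (‖v n‖⁻¹ • v n) = 0
    rw [inner_smul_left, inner_smul_right, h m n hmn]; simp

/-- The Neumann Laplacian. -/
def neumann (hab : a < b) : EigenSystem (Sob a b 1) (L2 a b) (L2 a b) where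
  ι := Sob.D 0
  D := Sob.D 1
  e n := ‖cosL a b n‖⁻¹ • cosV hab n
  eig n := freq a b n ^ 2
  norm_sq := Sob.norm_sq
  injective := Sob.D0_injective
  orthonormal := by
    simp only [map_smul, D0_cosV]
    exact orthonormal_normalize (cosL_ne_zero hab) fun m n h => inner_cosL_of_ne hab h
  complete f hf := eq_zero_of_cosL hab fun n => by
    have h := hf n
    rw [map_smul, D0_cosV, inner_smul_left] at h
    exact (mul_eq_zero.1 h).resolve_left (by simpa using cosL_ne_zero hab n)
  inner_D n ψ := by
    rw [map_smul, map_smul, inner_smul_left, inner_smul_left, inner_D1_cosV, D0_cosV]; ring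

/-- The Dirichlet Laplacian. -/
def dirichlet (hab : a < b) : EigenSystem (H10 a b) (L2 a b) (L2 a b) where
  ι := H10.toL2
  D := H10.dx
  -- The index is shifted because the sine of frequency zero vanishes.
  e n := ‖sinL a b (n + 1)‖⁻¹ • sinV hab (n + 1)
  eig n := freq a b (n + 1) ^ 2
  norm_sq := H10.norm_sq
  injective := H10.toL2_injective
  orthonormal := by
    simp only [map_smul, toL2_sinV]
    exact orthonormal_normalize (fun n => sinL_ne_zero hab (by omega))
      fun m n h => inner_sinL_of_ne hab (by omega)
  complete f hf := eq_zero_of_sinL hab fun n => by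
    have h := hf n
    rw [map_smul, toL2_sinV, inner_smul_left] at h
    exact (mul_eq_zero.1 h).resolve_left (by simpa using sinL_ne_zero hab n.succ_ne_zero)
  inner_D n ψ := by
    rw [map_smul, map_smul, inner_smul_left, inner_smul_left, inner_dx_sinV, toL2_sinV]; ring

end Trig

end ThermoVisco

namespace ThermoVisco

/-! ### The linearised problem -/

theorem HasPrim.eq_of_ae_zero {E : Type*} [NormedAddCommGroup E] [NormedSpace ℝ E]
    {T : ℝ} {y g : ℝ → E} (h : HasPrim T y g)
    (h0 : ∀ᵐ t ∂volume.restrict (Ioc 0 T), g t = 0) {t : ℝ} (ht : t ∈ Icc 0 T) : y t = y 0 := by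
  have := (h.congr_ae h0).eq t ht
  simpa using this

variable {a b μ ν : ℝ}

/-- Compatible initial data: `z₀` and `v₀` are the initial values of `θ_t` and `u_tt`, and `f₀` is
that of `u_xx - μ θ_x`. -/
structure Data (a b μ ν : ℝ) where
  θ₀ : Sob a b 1
  z₀ : Sob a b 1
  u₀ : H10 a b
  u₁ : H10 a b
  v₀ : L2 a b
  f₀ : L2 a b
  heat : ∀ ψ : Sob a b 1, inner ℝ (Sob.D 1 θ₀) (Sob.D 1 ψ) + inner ℝ (Sob.D 0 z₀) (Sob.D 0 ψ)
    = inner ℝ (-μ • mulV a b θ₀ (H10.dx u₁)) (Sob.D 0 ψ)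
  wave : ∀ φ : H10 a b, inner ℝ v₀ (H10.toL2 φ) + ν * inner ℝ (H10.dx u₁) (H10.dx φ)
    = inner ℝ f₀ (H10.toL2 φ)
  stress : ∀ φ : H10 a b, inner ℝ f₀ (H10.toL2 φ) + inner ℝ (H10.dx u₀) (H10.dx φ)
    + μ * inner ℝ (Sob.D 1 θ₀) (H10.toL2 φ) = 0
  nonneg : ∀ᵐ x ∂volume.restrict (Ioo a b), 0 ≤ Sob.D 0 θ₀ x

/-- All the data are bounded by `M`. -/
structure Data.Bound (D : Data a b μ ν) (M : ℝ) : Prop where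
  θ₀ : ‖D.θ₀‖ ≤ M
  z₀ : ‖D.z₀‖ ≤ M
  u₀ : ‖D.u₀‖ ≤ M
  u₁ : ‖D.u₁‖ ≤ M
  v₀ : ‖D.v₀‖ ≤ M
  f₀ : ‖D.f₀‖ ≤ M

/-- Solutions `z = θ_t`, `v = u_tt` of the equations `z_t - z_xx = G`, `v_t - ν v_xx = K`. -/
structure LinSol (hab : a < b) (D : Data a b μ ν) (T : ℝ) where
  G : ℝ → L2 a b
  K : ℝ → L2 a b
  memG : MemLp G 2 (timeMeasure T)
  memK : MemLp K 2 (timeMeasure T)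
  z : ℝ → Sob a b 1
  v : ℝ → L2 a b
  vV : ℝ → H10 a b
  continuous_z : Continuous z
  z_zero : z 0 = D.z₀
  z_modes : (neumann hab).ModeEq 1 T (fun t => (neumann hab).ι (z t))
    (fun n t => inner ℝ ((neumann hab).ι ((neumann hab).e n)) (G t))
  continuous_v : Continuous v
  v_zero : v 0 = D.v₀
  memV : MemLp vV 2 (timeMeasure T)
  toL2_vV : ∀ᵐ t ∂timeMeasure T, H10.toL2 (vV t) = v t
  v_modes : (dirichlet hab).ModeEq ν T v
    (fun n t => inner ℝ ((dirichlet hab).ι ((dirichlet hab).e n)) (K t))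

namespace LinSol

variable {hab : a < b} {D : Data a b μ ν} {T : ℝ}

/-- The temperature. -/
def θ (S : LinSol hab D T) (t : ℝ) : Sob a b 1 := D.θ₀ + ∫ s in (0 : ℝ)..t, S.z s

/-- The velocity. -/
def w (S : LinSol hab D T) (t : ℝ) : H10 a b := D.u₁ + ∫ s in (0 : ℝ)..t, S.vV s

/-- The displacement. -/
def u (S : LinSol hab D T) (t : ℝ) : H10 a b := D.u₀ + ∫ s in (0 : ℝ)..t, S.w s

/-- The primitive of the source of the wave equation. -/
def f (S : LinSol hab D T) (t : ℝ) : L2 a b := D.f₀ + ∫ s in (0 : ℝ)..t, S.K s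

/-- The primitive of the source of the heat equation. -/
def F (S : LinSol hab D T) (t : ℝ) : L2 a b :=
  -μ • mulV a b D.θ₀ (H10.dx D.u₁) + ∫ s in (0 : ℝ)..t, S.G s

variable (S : LinSol hab D T)

theorem θ_zero : S.θ 0 = D.θ₀ := by simp [θ]

theorem w_zero : S.w 0 = D.u₁ := by simp [w]

theorem u_zero : S.u 0 = D.u₀ := by simp [u]

theorem f_zero : S.f 0 = D.f₀ := by simp [f]

theorem F_zero : S.F 0 = -μ • mulV a b D.θ₀ (H10.dx D.u₁) := by simp [F]

theorem hasPrim_θ : HasPrim T S.θ S.z :=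
  HasPrim.of_integral _ ((S.continuous_z.integrableOn_Icc).mono_set Ioc_subset_Icc_self)

theorem hasPrim_w : HasPrim T S.w S.vV := HasPrim.of_integral _ (MemLp.integrableOn S.memV)

theorem hasPrim_u : HasPrim T S.u S.w :=
  HasPrim.of_integral _ ((S.hasPrim_w.continuousOn.integrableOn_Icc).mono_set Ioc_subset_Icc_self)

theorem hasPrim_f : HasPrim T S.f S.K := HasPrim.of_integral _ (MemLp.integrableOn S.memK)

theorem hasPrim_F : HasPrim T S.F S.G := HasPrim.of_integral _ (MemLp.integrableOn S.memG)

theorem hasPrim_toL2_w : HasPrim T (fun t => H10.toL2 (S.w t)) S.v :=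
  (S.hasPrim_w.clm H10.toL2).congr_ae (ae_Ioc S.toL2_vV)

theorem hasDerivAt_θ (t : ℝ) : HasDerivAt S.θ (S.z t) t :=
  haveI : SecondCountableTopologyEither ℝ (Sob a b 1) := secondCountableTopologyEither_of_left ℝ _
  (intervalIntegral.integral_hasDerivAt_right (S.continuous_z.intervalIntegrable _ _)
    (S.continuous_z.stronglyMeasurableAtFilter _ _) S.continuous_z.continuousAt).const_add _

theorem continuous_θ : Continuous S.θ :=
  continuous_iff_continuousAt.2 fun t => (S.hasDerivAt_θ t).continuousAt

theorem continuousOn_dx_w : ContinuousOn (fun t => H10.dx (S.w t)) (Icc 0 T) :=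
  H10.dx.continuous.comp_continuousOn S.hasPrim_w.continuousOn

theorem memLp_dx : MemLp (fun t => H10.dx (S.vV t)) 2 (timeMeasure T) :=
  H10.dx.comp_memLp' S.memV

/-- `z - θ_xx = F`. -/
theorem heat {t : ℝ} (ht : t ∈ Icc 0 T) (ψ : Sob a b 1) :
    inner ℝ (Sob.D 1 (S.θ t)) (Sob.D 1 ψ) + inner ℝ (Sob.D 0 (S.z t)) (Sob.D 0 ψ)
      = inner ℝ (S.F t) (Sob.D 0 ψ) := by
  set N := neumann hab with hN
  set L : Sob a b 1 →L[ℝ] ℝ := (innerSL ℝ (Sob.D 1 (S.θ t))).comp (Sob.D 1)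
    + (innerSL ℝ (Sob.D 0 (S.z t) - S.F t)).comp (Sob.D 0) with hL
  -- On an eigenvector the expression is constant in time, since the mode equation makes its
  -- derivative zero; it starts at zero because the data are compatible.
  have key : L ψ = 0 := by
    refine N.eq_zero_of_e L (fun n => ?_) ψ
    have h1 := S.hasPrim_θ.clm ((innerSL ℝ (Sob.D 1 (N.e n))).comp (Sob.D 1))
    have h2 := S.z_modes n
    have h3 := S.hasPrim_F.clm (innerSL ℝ (Sob.D 0 (N.e n)))
    have h4 := ((h1.add h2).sub h3).eq_of_ae_zero (Eventually.of_forall fun s => ?_) ht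
    · have h5 := D.heat (N.e n)
      simp only [ContinuousLinearMap.comp_apply, innerSL_apply_apply, S.θ_zero, S.z_zero,
        S.F_zero] at h4
      change inner ℝ (Sob.D 1 (S.θ t)) (Sob.D 1 (N.e n))
        + inner ℝ (Sob.D 0 (S.z t) - S.F t) (Sob.D 0 (N.e n)) = 0
      change inner ℝ (Sob.D 1 (N.e n)) (Sob.D 1 (S.θ t))
        + inner ℝ (Sob.D 0 (N.e n)) (Sob.D 0 (S.z t)) - inner ℝ (Sob.D 0 (N.e n)) (S.F t)
        = inner ℝ (Sob.D 1 (N.e n)) (Sob.D 1 D.θ₀)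
        + inner ℝ (Sob.D 0 (N.e n)) (Sob.D 0 D.z₀) - _ at h4
      rw [real_inner_comm (Sob.D 1 (S.θ t)), real_inner_comm (Sob.D 0 (S.z t)),
        real_inner_comm (S.F t), real_inner_comm (Sob.D 1 D.θ₀), real_inner_comm (Sob.D 0 D.z₀),
        h5, real_inner_comm (-μ • _)] at h4
      rw [inner_sub_left]
      linarith
    · have h6 := N.inner_D n (S.z s)
      change inner ℝ (Sob.D 1 (N.e n)) (Sob.D 1 (S.z s)) + (inner ℝ (N.ι (N.e n)) (S.G s)
        - 1 * N.eig n * inner ℝ (N.ι (N.e n)) (N.ι (S.z s))) - inner ℝ (N.ι (N.e n)) (S.G s) = 0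
      have h7 : inner ℝ (Sob.D 1 (N.e n)) (Sob.D 1 (S.z s))
        = N.eig n * inner ℝ (N.ι (N.e n)) (N.ι (S.z s)) := h6
      rw [h7]; ring
  change inner ℝ (Sob.D 1 (S.θ t)) (Sob.D 1 ψ)
        + inner ℝ (Sob.D 0 (S.z t) - S.F t) (Sob.D 0 ψ) = 0 at key
  rw [inner_sub_left] at key
  linarith

/-- `v - ν w_xx = f`. -/
theorem wave {t : ℝ} (ht : t ∈ Icc 0 T) (φ : H10 a b) :
    inner ℝ (S.v t) (H10.toL2 φ) + ν * inner ℝ (H10.dx (S.w t)) (H10.dx φ)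
      = inner ℝ (S.f t) (H10.toL2 φ) := by
  set N := dirichlet hab with hN
  set L : H10 a b →L[ℝ] ℝ := (innerSL ℝ (ν • H10.dx (S.w t))).comp H10.dx
    + (innerSL ℝ (S.v t - S.f t)).comp H10.toL2 with hL
  have key : L φ = 0 := by
    refine N.eq_zero_of_e L (fun n => ?_) φ
    have h1 := S.hasPrim_w.clm (ν • (innerSL ℝ (H10.dx (N.e n))).comp H10.dx)
    have h2 := S.v_modes n
    have h3 := S.hasPrim_f.clm (innerSL ℝ (H10.toL2 (N.e n)))
    have h4 := ((h1.add h2).sub h3).eq_of_ae_zero ?_ ht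
    · have h5 := D.wave (N.e n)
      simp only [S.w_zero, S.v_zero, S.f_zero] at h4
      change inner ℝ (ν • H10.dx (S.w t)) (H10.dx (N.e n))
        + inner ℝ (S.v t - S.f t) (H10.toL2 (N.e n)) = 0
      change ν * inner ℝ (H10.dx (N.e n)) (H10.dx (S.w t))
        + inner ℝ (H10.toL2 (N.e n)) (S.v t) - inner ℝ (H10.toL2 (N.e n)) (S.f t)
        = ν * inner ℝ (H10.dx (N.e n)) (H10.dx D.u₁)
        + inner ℝ (H10.toL2 (N.e n)) D.v₀ - inner ℝ (H10.toL2 (N.e n)) D.f₀ at h4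
      rw [real_inner_comm (H10.dx (S.w t)), real_inner_comm (S.v t),
        real_inner_comm (S.f t), real_inner_comm (H10.dx D.u₁), real_inner_comm D.v₀,
        real_inner_comm D.f₀] at h4
      rw [inner_sub_left, real_inner_smul_left]
      linarith
    · filter_upwards [ae_Ioc S.toL2_vV] with s hs
      have h6 := N.inner_D n (S.vV s)
      change ν * inner ℝ (H10.dx (N.e n)) (H10.dx (S.vV s)) + (inner ℝ (N.ι (N.e n)) (S.K s)
        - ν * N.eig n * inner ℝ (N.ι (N.e n)) (S.v s)) - inner ℝ (N.ι (N.e n)) (S.K s) = 0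
      have h7 : inner ℝ (H10.dx (N.e n)) (H10.dx (S.vV s))
        = N.eig n * inner ℝ (N.ι (N.e n)) (S.v s) := by rw [← hs]; exact h6
      rw [h7]; ring
  change inner ℝ (ν • H10.dx (S.w t)) (H10.dx φ)
        + inner ℝ (S.v t - S.f t) (H10.toL2 φ) = 0 at key
  rw [inner_sub_left, real_inner_smul_left] at key
  linarith

/-- Space regularity out of time regularity: `ν w_xx = v - f` read against test functions. -/
theorem hasWeakDeriv_dx_w (hν : 0 < ν) {t : ℝ} (ht : t ∈ Icc 0 T) :
    HasWeakDeriv (H10.dx (S.w t)) (ν⁻¹ • (S.v t - S.f t)) := by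
  rw [hasWeakDeriv_iff]
  intro φ hφ
  obtain ⟨χ, h1, h2⟩ := exists_H10_of_test hab.le hφ
  have h := S.wave ht χ
  rw [h1, h2] at h
  rw [real_inner_smul_left, inner_sub_left]
  field_simp
  linarith

theorem hasWeakDeriv_dx_θ {t : ℝ} (ht : t ∈ Icc 0 T) :
    HasWeakDeriv (Sob.D 1 (S.θ t)) (Sob.D 0 (S.z t) - S.F t) := by
  rw [hasWeakDeriv_iff]
  intro φ hφ
  obtain ⟨χ, h1, h2⟩ := exists_H10_of_test hab.le hφ
  have h := S.heat ht (H10.toSob χ)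
  change inner ℝ (Sob.D 1 (S.θ t)) (H10.dx χ) + inner ℝ (Sob.D 0 (S.z t)) (H10.toL2 χ)
      = inner ℝ (S.F t) (H10.toL2 χ) at h
  rw [h1, h2] at h
  rw [inner_sub_left]
  linarith

end LinSol

/-- The value `v₀` is only in `L²`, so `v` is split into the homogeneous solution started at `v₀`
and the more regular solution with source `K` and zero data. The function `z` starts in `H¹` and
needs no splitting. -/
theorem exists_linSol (hab : a < b) (hν : 0 < ν) {T : ℝ} (hT : 0 ≤ T) (D : Data a b μ ν)
    {G K : ℝ → L2 a b} (hG : MemLp G 2 (timeMeasure T)) (hK : MemLp K 2 (timeMeasure T)) :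
    ∃ S : LinSol hab D T, S.G = G ∧ S.K = K := by
  obtain ⟨z, hz1, hz2, hz3⟩ := (neumann hab).exists_regular one_pos hT D.z₀ hG
  obtain ⟨y, Y, hy1, hy2, hy3, hy4, hy5⟩ := (dirichlet hab).exists_homogeneous hν hT D.v₀
  obtain ⟨X, hX1, hX2, hX3⟩ := (dirichlet hab).exists_regular hν hT 0 hK
  refine ⟨{ G := G, K := K, memG := hG, memK := hK, z := z
            v := fun t => y t + (dirichlet hab).ι (X t), vV := fun t => Y t + X t
            continuous_z := hz1, z_zero := hz2, z_modes := hz3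
            continuous_v := hy1.add ((dirichlet hab).ι.continuous.comp hX1)
            v_zero := by rw [hy2, hX2, map_zero, add_zero]
            memV := hy3.add (hX1.continuousOn.memLp_timeMeasure 2)
            toL2_vV := by
              filter_upwards [hy4] with t ht
              rw [map_add]
              exact congrArg₂ _ ht rfl
            v_modes := by simpa using hy5.add hX3 }, rfl, rfl⟩

end ThermoVisco

namespace ThermoVisco

/-! ### The nonlinear equations and positivity of the temperature -/

theorem hasDerivAt_min_sq (s : ℝ) : HasDerivAt (fun s : ℝ => (min s 0) ^ 2) (2 * min s 0) s := by
  rcases lt_trichotomy s 0 with h | rfl | h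
  · have h1 : HasDerivAt (fun s : ℝ => s ^ 2) (2 * s) s := by simpa using hasDerivAt_pow 2 s
    rw [min_eq_left h.le]
    refine h1.congr_of_eventuallyEq ?_
    filter_upwards [Iio_mem_nhds h] with y hy
    rw [min_eq_left (le_of_lt hy)]
  · have h1 : HasDerivAt (fun s : ℝ => s ^ 2) 0 0 := by simpa using hasDerivAt_pow 2 (0 : ℝ)
    rw [hasDerivAt_iff_isLittleO] at *
    simp only [min_self, mul_zero, smul_zero, sub_zero, ne_eq, OfNat.ofNat_ne_zero,
      not_false_eq_true, zero_pow] at *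
    refine (Asymptotics.isBigO_of_le _ fun y => ?_).trans_isLittleO h1
    rw [norm_pow, norm_pow]
    gcongr
    rcases le_total y 0 with hy | hy
    · rw [min_eq_left hy]
    · rw [min_eq_right hy]; simp
  · rw [min_eq_right h.le, mul_zero]
    refine (hasDerivAt_const s (0 : ℝ)).congr_of_eventuallyEq ?_
    filter_upwards [Ioi_mem_nhds h] with y hy
    rw [min_eq_right (le_of_lt hy)]; simp

theorem mul_min_sq (s : ℝ) : s * (min s 0) ^ 2 = (min s 0) ^ 3 := by
  rcases le_total s 0 with h | h
  · rw [min_eq_left h]; ring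
  · rw [min_eq_right h]; simp

theorem mul_min (s : ℝ) : s * min s 0 = (min s 0) ^ 2 := by
  rcases le_total s 0 with h | h
  · rw [min_eq_left h]; ring
  · rw [min_eq_right h]; simp

/-- The cube of the negative part is preferred to its square because its derivative, which becomes
the test function, must itself be `C¹` for `hasWeakDeriv_comp`. -/
theorem hasDerivAt_min_cube (s : ℝ) :
    HasDerivAt (fun s : ℝ => (min s 0) ^ 3) (3 * (min s 0) ^ 2) s := by
  have h := (hasDerivAt_id s).mul (hasDerivAt_min_sq s)
  have e : (fun s : ℝ => (min s 0) ^ 3) = id * fun s : ℝ => (min s 0) ^ 2 := by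
    funext y; exact (mul_min_sq y).symm
  have e' : 3 * (min s 0) ^ 2 = 1 * (min s 0) ^ 2 + s * (2 * min s 0) := by
    linear_combination -2 * mul_min s
  rw [e, e']
  exact h

variable {a b μ ν : ℝ}

theorem exists_rep_bound (a b : ℝ) : ∃ c : ℝ, 0 ≤ c ∧ ∀ (ψ : Sob a b 1) (x : ℝ),
    |rep a b ψ x| ≤ c * ‖ψ‖ :=
  ⟨‖rep a b‖, ContinuousLinearMap.opNorm_nonneg _, fun ψ x =>
    ((rep a b ψ).norm_coe_le_norm x).trans ((rep a b).le_opNorm ψ)⟩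

/-- The constant function `1`. -/
def oneV (hab : a < b) : Sob a b 1 := mkSob _ _ (hasWeakDeriv_one hab.le)

theorem mulV_one (hab : a < b) (ψ : Sob a b 1) :
    mulV a b ψ (ofFun a b fun _ => 1) = Sob.D 0 ψ := by
  refine Lp.ext ?_
  filter_upwards [coeFn_mulV hab ψ (ofFun a b fun _ => 1),
    coeFn_ofFun_continuous (a := a) (b := b) (continuous_const (y := (1 : ℝ)))] with x h1 h2
  rw [h1, h2, mul_one]

namespace LinSol

variable {hab : a < b} {D : Data a b μ ν} {T : ℝ}

/-- `G = -μ (θ u_tx)_t` and `K = (u_xx - μ θ_x)_t`. -/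
structure Nonlin (S : LinSol hab D T) : Prop where
  G_eq : ∀ᵐ t ∂timeMeasure T, S.G t = -μ • (mulV a b (S.z t) (H10.dx (S.w t))
    + mulV a b (S.θ t) (H10.dx (S.vV t)))
  K_eq : ∀ᵐ t ∂timeMeasure T, S.K t = ν⁻¹ • (S.v t - S.f t) - μ • Sob.D 1 (S.z t)

variable {S : LinSol hab D T}

/-- Both sides have the same time derivative, by the bilinear product rule, and the same initial
value. -/
theorem Nonlin.F_eq (h : S.Nonlin) {t : ℝ} (ht : t ∈ Icc 0 T) :
    S.F t = -μ • mulV a b (S.θ t) (H10.dx (S.w t)) := by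
  have h1 := (HasPrim.bilin (mulV a b) S.hasPrim_θ (S.hasPrim_w.clm H10.dx)).const_smul (-μ)
  have h2 := (S.hasPrim_F.sub h1).eq_of_ae_zero
    (by filter_upwards [ae_Ioc h.G_eq] with s hs; rw [hs, sub_self]) ht
  simp only [S.F_zero, S.θ_zero, S.w_zero, sub_self] at h2
  exact sub_eq_zero.1 h2

/-- `f = u_xx - μ θ_x`. -/
theorem Nonlin.stress (h : S.Nonlin) (hν : 0 < ν) {t : ℝ} (ht : t ∈ Icc 0 T) (φ : H10 a b) :
    inner ℝ (S.f t) (H10.toL2 φ) + inner ℝ (H10.dx (S.u t)) (H10.dx φ)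
      + μ * inner ℝ (Sob.D 1 (S.θ t)) (H10.toL2 φ) = 0 := by
  have h1 := S.hasPrim_f.clm (innerSL ℝ (H10.toL2 φ))
  have h2 := S.hasPrim_u.clm ((innerSL ℝ (H10.dx φ)).comp H10.dx)
  have h3 := S.hasPrim_θ.clm (μ • (innerSL ℝ (H10.toL2 φ)).comp (Sob.D 1))
  have h4 := ((h1.add h2).add h3).eq_of_ae_zero ?_ ht
  · have h5 := D.stress φ
    simp only [S.f_zero, S.u_zero, S.θ_zero] at h4
    change inner ℝ (H10.toL2 φ) (S.f t) + inner ℝ (H10.dx φ) (H10.dx (S.u t))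
      + μ * inner ℝ (H10.toL2 φ) (Sob.D 1 (S.θ t)) = inner ℝ (H10.toL2 φ) D.f₀
      + inner ℝ (H10.dx φ) (H10.dx D.u₀) + μ * inner ℝ (H10.toL2 φ) (Sob.D 1 D.θ₀) at h4
    rw [real_inner_comm (S.f t), real_inner_comm (H10.dx (S.u t)),
      real_inner_comm (Sob.D 1 (S.θ t)), real_inner_comm D.f₀, real_inner_comm (H10.dx D.u₀),
      real_inner_comm (Sob.D 1 D.θ₀)] at h4
    linarith
  · filter_upwards [ae_Ioc h.K_eq, ae_restrict_mem measurableSet_Ioc] with s hs hsm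
    have h6 := S.wave (Ioc_subset_Icc_self hsm) φ
    change inner ℝ (H10.toL2 φ) (S.K s) + inner ℝ (H10.dx φ) (H10.dx (S.w s))
      + μ * inner ℝ (H10.toL2 φ) (Sob.D 1 (S.z s)) = 0
    rw [hs, inner_sub_right, real_inner_smul_right, real_inner_smul_right, inner_sub_right,
      real_inner_comm (S.v s), real_inner_comm (S.f s), real_inner_comm (H10.dx (S.w s))]
    field_simp
    linarith

theorem Nonlin.wave (h : S.Nonlin) (hν : 0 < ν) {t : ℝ} (ht : t ∈ Icc 0 T) (φ : H10 a b) :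
    inner ℝ (S.v t) (H10.toL2 φ) + inner ℝ (H10.dx (S.u t)) (H10.dx φ)
      + ν * inner ℝ (H10.dx (S.w t)) (H10.dx φ)
      + μ * inner ℝ (Sob.D 1 (S.θ t)) (H10.toL2 φ) = 0 := by
  linarith [h.stress hν ht φ, S.wave ht φ]

theorem Nonlin.heat (h : S.Nonlin) {t : ℝ} (ht : t ∈ Icc 0 T) (ψ : Sob a b 1) :
    inner ℝ (Sob.D 1 (S.θ t)) (Sob.D 1 ψ) + inner ℝ (Sob.D 0 (S.z t)) (Sob.D 0 ψ)
      = -μ * inner ℝ (mulV a b (S.θ t) (H10.dx (S.w t))) (Sob.D 0 ψ) := by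
  rw [S.heat ht, h.F_eq ht, real_inner_smul_left]

theorem continuousOn_f : ContinuousOn S.f (Icc 0 T) := S.hasPrim_f.continuousOn

/-- The strain rate `w_x` has its weak derivative bounded in `L²` over `[0,T]`, so it is bounded in
`L^∞`. The bound `P` depends on the solution, which is harmless: it serves only to prove positivity.
-/
theorem exists_dx_w (S : LinSol hab D T) (hν : 0 < ν) : ∃ P : ℝ, 0 ≤ P ∧ ∀ t ∈ Icc 0 T,
    ∃ p : Sob a b 1, Sob.D 0 p = H10.dx (S.w t) ∧ ∀ x, |rep a b p x| ≤ P := by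
  obtain ⟨c, hc0, hc⟩ := exists_rep_bound a b
  obtain ⟨C1, hC1⟩ := isCompact_Icc.exists_bound_of_continuousOn S.continuousOn_dx_w
  obtain ⟨C2, hC2⟩ := isCompact_Icc.exists_bound_of_continuousOn
    ((S.continuous_v.continuousOn.sub S.continuousOn_f).const_smul ν⁻¹)
  refine ⟨c * √(C1 ^ 2 + C2 ^ 2), by positivity, fun t ht =>
    ⟨mkSob _ _ (S.hasWeakDeriv_dx_w hν ht), rfl, fun x => (hc _ x).trans ?_⟩⟩
  gcongr
  refine Real.le_sqrt_of_sq_le ?_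
  rw [Sob.norm_sq, D0_mkSob, D1_mkSob]
  have h1 := hC1 t ht
  have h2 : ‖ν⁻¹ • (S.v t - S.f t)‖ ≤ C2 := hC2 t ht
  gcongr

/-- The functional measuring the negative part of the temperature. -/
theorem hasDerivAt_negPart (S : LinSol hab D T) (t : ℝ) :
    HasDerivAt (fun t => ∫ x in Ioo a b, -(min (rep a b (S.θ t) x) 0) ^ 3)
      (∫ x in Ioo a b, -(3 * (min (rep a b (S.θ t) x) 0) ^ 2) * rep a b (S.z t) x) t := by
  have hcθ : Continuous fun s => rep a b (S.θ s) := (rep a b).continuous.comp S.continuous_θ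
  have hcz : Continuous fun s => rep a b (S.z s) := (rep a b).continuous.comp S.continuous_z
  obtain ⟨A, hA⟩ := (isCompact_closedBall t 1).exists_bound_of_continuousOn hcθ.continuousOn
  obtain ⟨B, hB⟩ := (isCompact_closedBall t 1).exists_bound_of_continuousOn hcz.continuousOn
  have hm : ∀ s, Continuous fun x => -(min (rep a b (S.θ s) x) 0) ^ 3 := fun s =>
    (((rep a b (S.θ s)).continuous.min continuous_const).pow 3).neg
  have hm' : ∀ s, Continuous fun x => -(3 * (min (rep a b (S.θ s) x) 0) ^ 2) * rep a b (S.z s) x :=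
    fun s => (((((rep a b (S.θ s)).continuous.min continuous_const).pow 2).const_mul 3).neg).mul
      (rep a b (S.z s)).continuous
  refine (hasDerivAt_integral_of_dominated_loc_of_deriv_le (μ := volume.restrict (Ioo a b))
    (F := fun s x => -(min (rep a b (S.θ s) x) 0) ^ 3)
    (F' := fun s x => -(3 * (min (rep a b (S.θ s) x) 0) ^ 2) * rep a b (S.z s) x)
    (bound := fun _ => 3 * A ^ 2 * B)
    (Metric.closedBall_mem_nhds t one_pos) (Eventually.of_forall fun s =>
      (hm s).aestronglyMeasurable) ((memLp_of_continuous (hm t)).integrable (by norm_num))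
    (hm' t).aestronglyMeasurable (Eventually.of_forall fun x s hs => ?_) (integrable_const _)
    (Eventually.of_forall fun x s _ => ?_)).2
  · have h1 := ((rep a b (S.θ s)).norm_coe_le_norm x).trans (hA s hs)
    have h2 := ((rep a b (S.z s)).norm_coe_le_norm x).trans (hB s hs)
    rw [Real.norm_eq_abs] at h1 h2 ⊢
    have h3 : |min (rep a b (S.θ s) x) 0| ≤ A := by
      refine le_trans ?_ h1
      rcases le_total (rep a b (S.θ s) x) 0 with h | h
      · rw [min_eq_left h]
      · rw [min_eq_right h, abs_zero]; exact abs_nonneg _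
    rw [abs_mul, abs_neg, abs_mul, abs_pow, abs_of_pos (by norm_num : (0 : ℝ) < 3)]
    have := abs_nonneg (min (rep a b (S.θ s) x) 0)
    gcongr
  · have hd : HasDerivAt (fun s => rep a b (S.θ s) x) (rep a b (S.z s) x) s := by
      have h1 := ((BoundedContinuousFunction.evalCLM ℝ x).comp (rep a b)).hasFDerivAt
        |>.comp_hasDerivAt s (S.hasDerivAt_θ s)
      exact h1
    have h2 := ((hasDerivAt_min_cube (rep a b (S.θ s) x)).comp s hd).neg
    rw [neg_mul]
    exact h2

/-- The heat equation tested with `-3 min(θ,0)²`. Diffusion contributes with a favourable sign, and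
the reaction term is at most `3 μ P` times the functional because `θ min(θ,0)² = min(θ,0)³`. -/
theorem Nonlin.deriv_negPart_le (h : S.Nonlin) (hμ : 0 < μ) {P t : ℝ} (ht : t ∈ Icc 0 T)
    {p : Sob a b 1} (hp : Sob.D 0 p = H10.dx (S.w t)) (hP : ∀ x, |rep a b p x| ≤ P) :
    ∫ x in Ioo a b, -(3 * (min (rep a b (S.θ t) x) 0) ^ 2) * rep a b (S.z t) x
      ≤ 3 * μ * P * ∫ x in Ioo a b, -(min (rep a b (S.θ t) x) 0) ^ 3 := by
  have hφ : ∀ s : ℝ, HasDerivAt (fun s : ℝ => -(3 * (min s 0) ^ 2)) (-(3 * (2 * min s 0))) s :=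
    fun s => ((hasDerivAt_min_sq s).const_mul 3).neg
  have hφ' : Continuous fun s : ℝ => -(3 * (2 * min s 0)) := by fun_prop
  have hφc : Continuous fun s : ℝ => -(3 * (min s 0) ^ 2) := by fun_prop
  have hw := hasWeakDeriv_comp hab hφ hφ' (S.θ t)
  have hψ := h.heat ht (mkSob _ _ hw)
  rw [D0_mkSob, D1_mkSob] at hψ
  have hm0 : MemLp (fun x => -(3 * (min (rep a b (S.θ t) x) 0) ^ 2)) 2 (volume.restrict (Ioo a b)) :=
    memLp_of_continuous (hφc.comp (rep a b _).continuous)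
  rw [inner_ofFun (memLp_comp_rep_mul hφ' _ _), inner_ofFun hm0, inner_ofFun hm0] at hψ
  have e1 : ∫ x in Ioo a b, Sob.D 0 (S.z t) x * -(3 * (min (rep a b (S.θ t) x) 0) ^ 2)
      = ∫ x in Ioo a b, -(3 * (min (rep a b (S.θ t) x) 0) ^ 2) * rep a b (S.z t) x := by
    refine integral_congr_ae ?_
    filter_upwards [coeFn_rep hab (S.z t)] with x hx
    rw [hx]; ring
  have e2 : 0 ≤ ∫ x in Ioo a b, Sob.D 1 (S.θ t) x *
      (-(3 * (2 * min (rep a b (S.θ t) x) 0)) * Sob.D 1 (S.θ t) x) := by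
    refine integral_nonneg fun x => ?_
    have : min (rep a b (S.θ t) x) 0 ≤ 0 := min_le_right _ _
    have h2 := mul_nonneg (neg_nonneg.2 this) (sq_nonneg (Sob.D 1 (S.θ t) x))
    simp only [Pi.zero_apply]
    nlinarith
  have e3 : -μ * ∫ x in Ioo a b, (mulV a b (S.θ t) (H10.dx (S.w t))) x *
      -(3 * (min (rep a b (S.θ t) x) 0) ^ 2)
      ≤ 3 * μ * P * ∫ x in Ioo a b, -(min (rep a b (S.θ t) x) 0) ^ 3 := by
    rw [← integral_const_mul, ← integral_const_mul]
    have hcm : Continuous fun x => (min (rep a b (S.θ t) x) 0) ^ 3 :=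
      ((rep a b (S.θ t)).continuous.min continuous_const).pow 3
    have e4 : ∫ x in Ioo a b, -μ * ((mulV a b (S.θ t) (H10.dx (S.w t))) x *
        -(3 * (min (rep a b (S.θ t) x) 0) ^ 2))
        = ∫ x in Ioo a b, 3 * μ * ((min (rep a b (S.θ t) x) 0) ^ 3 * rep a b p x) := by
      refine integral_congr_ae ?_
      filter_upwards [coeFn_mulV_rep (S.θ t) (H10.dx (S.w t)), coeFn_rep hab p] with x h1 h2
      rw [h1, ← hp, h2, ← mul_min_sq]; ring
    rw [e4]
    refine integral_mono
      ((memLp_of_continuous ((hcm.mul (rep a b p).continuous).const_mul (3 * μ))).integrable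
        (by norm_num))
      ((memLp_of_continuous (hcm.neg.const_mul (3 * μ * P))).integrable (by norm_num)) fun x => ?_
    have h3 : (min (rep a b (S.θ t) x) 0) ^ 3 ≤ 0 :=
      Odd.pow_nonpos (by decide) (min_le_right _ _)
    have h4 := (abs_le.1 (hP x)).1
    have h5 := mul_nonneg (mul_nonneg hμ.le (neg_nonneg.2 h3)) (by linarith : 0 ≤ P + rep a b p x)
    simp only
    nlinarith
  rw [e1] at hψ
  linarith

/-- The temperature stays nonnegative. -/
theorem Nonlin.nonneg (h : S.Nonlin) (hμ : 0 < μ) (hν : 0 < ν) {t : ℝ} (ht : t ∈ Icc 0 T) :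
    ∀ᵐ x ∂volume.restrict (Ioo a b), 0 ≤ Sob.D 0 (S.θ t) x := by
  obtain ⟨P, hP0, hP⟩ := S.exists_dx_w hν
  set J : ℝ → ℝ := fun t => ∫ x in Ioo a b, -(min (rep a b (S.θ t) x) 0) ^ 3 with hJ
  have hpos : ∀ y : ℝ, 0 ≤ -(min y 0) ^ 3 := fun y =>
    neg_nonneg.2 (Odd.pow_nonpos (by decide) (min_le_right _ _))
  -- The integrating factor makes the functional nonincreasing; it starts at zero and is
  -- nonnegative, hence vanishes.
  have hd : ∀ t, HasDerivAt (fun t => Real.exp (-(3 * μ * P) * t) * J t)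
      (Real.exp (-(3 * μ * P) * t) * (-(3 * μ * P)) * J t + Real.exp (-(3 * μ * P) * t) *
        ∫ x in Ioo a b, -(3 * (min (rep a b (S.θ t) x) 0) ^ 2) * rep a b (S.z t) x) t := by
    intro t
    have h1 : HasDerivAt (fun t => -(3 * μ * P) * t) (-(3 * μ * P)) t := by
      simpa using (hasDerivAt_id t).const_mul (-(3 * μ * P))
    exact h1.exp.mul (S.hasDerivAt_negPart t)
  have hanti : AntitoneOn (fun t => Real.exp (-(3 * μ * P) * t) * J t) (Icc 0 T) := by
    refine antitoneOn_of_deriv_nonpos (convex_Icc 0 T)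
      (fun t _ => (hd t).continuousAt.continuousWithinAt)
      (fun t _ => (hd t).differentiableAt.differentiableWithinAt) fun t ht => ?_
    rw [interior_Icc] at ht
    rw [(hd t).deriv]
    obtain ⟨p, hp1, hp2⟩ := hP t (Ioo_subset_Icc_self ht)
    have h1 := h.deriv_negPart_le hμ (Ioo_subset_Icc_self ht) hp1 hp2
    have h2 := mul_le_mul_of_nonneg_left h1 (Real.exp_pos (-(3 * μ * P) * t)).le
    simp only [hJ]
    linarith
  have hJ0 : J 0 = 0 := by
    rw [hJ]
    refine (integral_congr_ae ?_).trans (integral_zero _ _)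
    filter_upwards [D.nonneg, coeFn_rep hab D.θ₀] with x h1 h2
    rw [S.θ_zero, ← h2, min_eq_right h1]; simp
  have hJt : J t ≤ 0 := by
    have := hanti ⟨le_rfl, ht.1.trans ht.2⟩ ht ht.1
    simp only [hJ0, mul_zero] at this
    exact nonpos_of_mul_nonpos_right this (Real.exp_pos _)
  have hcm : Continuous fun x => -(min (rep a b (S.θ t) x) 0) ^ 3 :=
    (((rep a b (S.θ t)).continuous.min continuous_const).pow 3).neg
  have hz := (integral_eq_zero_iff_of_nonneg (fun x => hpos (rep a b (S.θ t) x))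
    ((memLp_of_continuous hcm).integrable (by norm_num))).1
    (le_antisymm hJt (integral_nonneg fun x => hpos _))
  filter_upwards [hz, coeFn_rep hab (S.θ t)] with x h1 h2
  rw [h2]
  simp only [Pi.zero_apply, neg_eq_zero] at h1
  have h3 := pow_eq_zero_iff (three_ne_zero) |>.1 h1
  exact min_eq_right_iff.1 h3

end LinSol

end ThermoVisco

namespace ThermoVisco

/-! ### A priori bounds -/

section Aux

theorem intervalIntegrable_of_Ioc {E : Type*} [NormedAddCommGroup E] {T t : ℝ} {f : ℝ → E}
    (hf : IntegrableOn f (Ioc 0 T)) (ht : t ∈ Icc 0 T) : IntervalIntegrable f volume 0 t :=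
  (intervalIntegrable_iff_integrableOn_Ioc_of_le ht.1).2 (hf.mono_set (Ioc_subset_Ioc_right ht.2))

theorem integrableOn_of_continuousOn {E : Type*} [NormedAddCommGroup E] {T : ℝ} {f : ℝ → E}
    (hf : ContinuousOn f (Icc 0 T)) : IntegrableOn f (Ioc 0 T) :=
  hf.integrableOn_Icc.mono_set Ioc_subset_Icc_self

theorem integral_le_of_ae {T t : ℝ} {f g : ℝ → ℝ} (ht : t ∈ Icc 0 T)
    (hf : IntegrableOn f (Ioc 0 T)) (hg : IntegrableOn g (Ioc 0 T))
    (h : ∀ᵐ s ∂volume.restrict (Ioc 0 T), f s ≤ g s) :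
    ∫ s in (0 : ℝ)..t, f s ≤ ∫ s in (0 : ℝ)..t, g s := by
  rw [intervalIntegral.integral_of_le ht.1, intervalIntegral.integral_of_le ht.1]
  have hs : Ioc 0 t ⊆ Ioc 0 T := Ioc_subset_Ioc_right ht.2
  exact integral_mono_ae (hf.mono_set hs) (hg.mono_set hs)
    (ae_restrict_of_ae_restrict_of_subset hs h)

theorem HasPrim.le_add_integral {T t : ℝ} {y g h : ℝ → ℝ} (hy : HasPrim T y g) (ht : t ∈ Icc 0 T)
    (hh : IntegrableOn h (Ioc 0 T)) (hgh : ∀ᵐ s ∂volume.restrict (Ioc 0 T), g s ≤ h s) :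
    y t ≤ y 0 + ∫ s in (0 : ℝ)..t, h s := by
  rw [hy.eq t ht]
  linarith [integral_le_of_ae ht hy.integrable hh hgh]

theorem integrableOn_affine {T : ℝ} {f : ℝ → ℝ} (hf : IntegrableOn f (Ioc 0 T)) (c d : ℝ) :
    IntegrableOn (fun s => c + d * f s) (Ioc 0 T) :=
  Integrable.add (f := fun _ => c) (g := fun s => d * f s)
    (integrableOn_of_continuousOn continuousOn_const) (hf.const_mul d)

theorem integral_affine {T t : ℝ} {f : ℝ → ℝ} (ht : t ∈ Icc 0 T) (hf : IntegrableOn f (Ioc 0 T))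
    (c d : ℝ) : ∫ s in (0 : ℝ)..t, (c + d * f s) = c * t + d * ∫ s in (0 : ℝ)..t, f s := by
  rw [intervalIntegral.integral_add (by simp) ((intervalIntegrable_of_Ioc hf ht).const_mul d),
    intervalIntegral.integral_const_mul, intervalIntegral.integral_const, smul_eq_mul]
  ring

theorem integrableOn_lincomb {T : ℝ} {f g : ℝ → ℝ} (hf : IntegrableOn f (Ioc 0 T))
    (hg : IntegrableOn g (Ioc 0 T)) (c d : ℝ) :
    IntegrableOn (fun s => c * f s + d * g s) (Ioc 0 T) :=
  Integrable.add (f := fun s => c * f s) (g := fun s => d * g s) (hf.const_mul c) (hg.const_mul d)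

theorem integral_lincomb {T t : ℝ} {f g : ℝ → ℝ} (ht : t ∈ Icc 0 T) (hf : IntegrableOn f (Ioc 0 T))
    (hg : IntegrableOn g (Ioc 0 T)) (c d : ℝ) : ∫ s in (0 : ℝ)..t, (c * f s + d * g s)
      = c * (∫ s in (0 : ℝ)..t, f s) + d * ∫ s in (0 : ℝ)..t, g s := by
  rw [intervalIntegral.integral_add ((intervalIntegrable_of_Ioc hf ht).const_mul c)
    ((intervalIntegrable_of_Ioc hg ht).const_mul d),
    intervalIntegral.integral_const_mul, intervalIntegral.integral_const_mul]

theorem integral_sq_nonneg {E : Type*} [NormedAddCommGroup E] {t : ℝ} (ht : 0 ≤ t) (f : ℝ → E) :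
    0 ≤ ∫ s in (0 : ℝ)..t, ‖f s‖ ^ 2 :=
  intervalIntegral.integral_nonneg ht fun _ _ => sq_nonneg _

theorem norm_sq_add_le {E : Type*} [NormedAddCommGroup E] (x y : E) :
    ‖x + y‖ ^ 2 ≤ 2 * ‖x‖ ^ 2 + 2 * ‖y‖ ^ 2 := by
  have h := norm_add_le x y
  have := norm_nonneg (x + y)
  nlinarith [sq_nonneg (‖x‖ - ‖y‖)]

theorem norm_sq_sub_le {E : Type*} [NormedAddCommGroup E] (x y : E) :
    ‖x - y‖ ^ 2 ≤ 2 * ‖x‖ ^ 2 + 2 * ‖y‖ ^ 2 := by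
  rw [sub_eq_add_neg, ← norm_neg y]; exact norm_sq_add_le _ _

theorem HasPrim.norm_sq_le {E : Type*} [NormedAddCommGroup E] [NormedSpace ℝ E] [CompleteSpace E]
    {T T₀ M t : ℝ} {y g : ℝ → E} (hy : HasPrim T y g) (hg : MemLp g 2 (timeMeasure T))
    (hT : T ≤ T₀) (h0 : ‖y 0‖ ≤ M) (ht : t ∈ Icc 0 T) :
    ‖y t‖ ^ 2 ≤ 2 * M ^ 2 + 2 * (T₀ * ∫ s in (0 : ℝ)..t, ‖g s‖ ^ 2) := by
  rw [hy.eq t ht]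
  refine (norm_sq_add_le _ _).trans ?_
  have h1 := sq_norm_integral_le ht.1 (hg.mono_measure (timeMeasure_mono ht.2))
  have h2 := integral_sq_nonneg ht.1 g
  have h3 := mul_le_mul_of_nonneg_right (ht.2.trans hT) h2
  gcongr
  exact h1.trans h3

theorem exists_mulV_bound (a b : ℝ) : ∃ c : ℝ, 0 ≤ c ∧ ∀ (ψ : Sob a b 1) (g : L2 a b),
    ‖mulV a b ψ g‖ ≤ c * ‖ψ‖ * ‖g‖ :=
  ⟨‖mulV a b‖, ContinuousLinearMap.opNorm_nonneg _, fun ψ g => (mulV a b).le_opNorm₂ ψ g⟩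

end Aux

variable {a b μ ν : ℝ}

/-- The quantity `Q` is bounded in terms of the size of the data, for nonlinear solutions on
intervals `[0,T]` with `T ≤ T₀`. -/
def UniformBound (hab : a < b) (μ ν T₀ M : ℝ)
    (Q : ∀ (D : Data a b μ ν) (T : ℝ), LinSol hab D T → ℝ → ℝ) : Prop :=
  ∃ C : ℝ, 0 ≤ C ∧ ∀ D : Data a b μ ν, D.Bound M → ∀ T, T ≤ T₀ → ∀ S : LinSol hab D T, S.Nonlin →
    ∀ t ∈ Icc 0 T, Q D T S t ≤ C

theorem Sob.norm_D0_le (ψ : Sob a b 1) : ‖Sob.D 0 ψ‖ ≤ ‖ψ‖ :=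
  (sq_le_sq₀ (norm_nonneg _) (norm_nonneg _)).1 (by rw [Sob.norm_sq ψ]; nlinarith [sq_nonneg ‖Sob.D 1 ψ‖])

theorem Sob.norm_D1_le (ψ : Sob a b 1) : ‖Sob.D 1 ψ‖ ≤ ‖ψ‖ :=
  (sq_le_sq₀ (norm_nonneg _) (norm_nonneg _)).1 (by rw [Sob.norm_sq ψ]; nlinarith [sq_nonneg ‖Sob.D 0 ψ‖])

theorem H10.norm_toL2_le (v : H10 a b) : ‖H10.toL2 v‖ ≤ ‖v‖ := Sob.norm_D0_le (H10.toSob v)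

theorem H10.norm_dx_le (v : H10 a b) : ‖H10.dx v‖ ≤ ‖v‖ := Sob.norm_D1_le (H10.toSob v)

namespace LinSol

variable {hab : a < b} {D : Data a b μ ν} {T : ℝ} {S : LinSol hab D T}

theorem integrableOn_dx_w (S : LinSol hab D T) :
    IntegrableOn (fun t => ‖H10.dx (S.w t)‖ ^ 2) (Ioc 0 T) :=
  integrableOn_of_continuousOn (S.continuousOn_dx_w.norm.pow 2)

theorem continuous_D0_z (S : LinSol hab D T) : Continuous fun t => Sob.D 0 (S.z t) :=
  (Sob.D 0).continuous.comp S.continuous_z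

theorem integrableOn_D0_z (S : LinSol hab D T) :
    IntegrableOn (fun t => ‖Sob.D 0 (S.z t)‖ ^ 2) (Ioc 0 T) :=
  integrableOn_of_continuousOn (S.continuous_D0_z.norm.pow 2).continuousOn

/-- The wave equation is tested with `u_t` and the heat equation with `1`. The two coupling terms,
`μ ∫ θ_x u_t` and `μ ∫ θ u_tx`, cancel after integration by parts, and only the viscous dissipation
remains. -/
theorem Nonlin.energy (h : S.Nonlin) (hν : 0 < ν) {t : ℝ} (ht : t ∈ Icc 0 T) :
    ‖H10.toL2 (S.w t)‖ ^ 2 + ‖H10.dx (S.u t)‖ ^ 2 + 2 * inner ℝ (Sob.D 0 (S.θ t)) (ofFun a b fun _ => 1)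
      + 2 * ν * (∫ s in (0 : ℝ)..t, ‖H10.dx (S.w s)‖ ^ 2)
      = ‖H10.toL2 D.u₁‖ ^ 2 + ‖H10.dx D.u₀‖ ^ 2
        + 2 * inner ℝ (Sob.D 0 D.θ₀) (ofFun a b fun _ => 1) := by
  have h1 := S.hasPrim_toL2_w.norm_sq
  have h2 := (S.hasPrim_u.clm H10.dx).norm_sq
  have h3 := (S.hasPrim_θ.clm ((innerSL ℝ (ofFun a b fun _ => 1)).comp (Sob.D 0))).const_smul 2
  have h4 := (((h1.add h2).add h3).congr_ae (g' := fun s => -(2 * ν) * ‖H10.dx (S.w s)‖ ^ 2)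
    (by
      filter_upwards [ae_restrict_mem measurableSet_Ioc] with s hs
      have hs' := Ioc_subset_Icc_self hs
      have e1 := h.wave hν hs' (S.w s)
      have e2 := h.heat hs' (oneV hab)
      have e3 := H10.ibp (S.w s) (S.θ s)
      rw [inner_mulV_comm hab] at e2
      change inner ℝ (Sob.D 1 (S.θ s)) (0 : L2 a b) + inner ℝ (Sob.D 0 (S.z s)) (ofFun a b fun _ => 1)
        = -μ * inner ℝ (H10.dx (S.w s)) (mulV a b (S.θ s) (ofFun a b fun _ => 1)) at e2
      rw [mulV_one hab, inner_zero_right] at e2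
      change 2 * inner ℝ (S.v s) (H10.toL2 (S.w s)) + 2 * inner ℝ (H10.dx (S.w s)) (H10.dx (S.u s))
        + 2 * inner ℝ (ofFun a b fun _ => 1) (Sob.D 0 (S.z s)) = _
      rw [real_inner_self_eq_norm_sq, real_inner_comm (H10.dx (S.w s))] at e1
      rw [real_inner_comm (Sob.D 1 (S.θ s)) (H10.toL2 (S.w s))] at e3
      rw [real_inner_comm (Sob.D 0 (S.z s))]
      linear_combination 2 * e1 + 2 * e2 - 2 * μ * e3)).eq t ht
  simp only [S.w_zero, S.u_zero, S.θ_zero, intervalIntegral.integral_const_mul] at h4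
  change ‖H10.toL2 (S.w t)‖ ^ 2 + ‖H10.dx (S.u t)‖ ^ 2
    + 2 * inner ℝ (ofFun a b fun _ => 1) (Sob.D 0 (S.θ t)) = ‖H10.toL2 D.u₁‖ ^ 2 + ‖H10.dx D.u₀‖ ^ 2
    + 2 * inner ℝ (ofFun a b fun _ => 1) (Sob.D 0 D.θ₀) + _ at h4
  rw [real_inner_comm (Sob.D 0 (S.θ t)), real_inner_comm (Sob.D 0 D.θ₀)] at h4
  linarith

end LinSol

/-- Positivity enters the estimates here: it allows the thermal energy at time `t` to be dropped
from the energy identity. -/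
theorem bound_integral_dx_w (hab : a < b) (hμ : 0 < μ) (hν : 0 < ν) (T₀ M : ℝ) :
    UniformBound hab μ ν T₀ M fun _ _ S t => ∫ s in (0 : ℝ)..t, ‖H10.dx (S.w s)‖ ^ 2 := by
  set m := ‖ofFun a b fun _ => 1‖ with hm
  have hm0 : 0 ≤ m := norm_nonneg _
  refine ⟨(2 * ν)⁻¹ * (2 * |M| ^ 2 + 2 * (|M| * m)), by positivity, fun D hD T hT S hS t ht => ?_⟩
  have h := hS.energy hν ht
  have h0 : 0 ≤ inner ℝ (Sob.D 0 (S.θ t)) (ofFun a b fun _ => 1) := by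
    rw [integral_eq_inner_one]
    exact integral_nonneg_of_ae (hS.nonneg hμ hν ht)
  have h1 := (H10.norm_toL2_le D.u₁).trans (hD.u₁.trans (le_abs_self M))
  have h2 := (H10.norm_dx_le D.u₀).trans (hD.u₀.trans (le_abs_self M))
  have h3 := real_inner_le_norm (Sob.D 0 D.θ₀) (ofFun a b fun _ => 1)
  have h4 := (Sob.norm_D0_le D.θ₀).trans (hD.θ₀.trans (le_abs_self M))
  have h5 := mul_le_mul_of_nonneg_right h4 hm0
  have h6 := pow_le_pow_left₀ (norm_nonneg _) h1 2
  have h7 := pow_le_pow_left₀ (norm_nonneg _) h2 2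
  rw [inv_mul_eq_div, le_div_iff₀ (by positivity)]
  nlinarith [sq_nonneg ‖H10.toL2 (S.w t)‖, sq_nonneg ‖H10.dx (S.u t)‖]

/-- The heat equation is tested with `θ_t`. Since `‖θ w_x‖ ≤ c ‖θ‖_{H¹} ‖w_x‖`, Grönwall applies
with a kernel that need not be bounded, only integrable, and the integral of `‖w_x‖²` is known. -/
theorem bound_θ_aux (hab : a < b) (hμ : 0 < μ) (hν : 0 < ν) (T₀ M : ℝ) :
    UniformBound hab μ ν T₀ M fun _ _ S t =>
      ‖S.θ t‖ ^ 2 + ∫ s in (0 : ℝ)..t, ‖Sob.D 0 (S.z s)‖ ^ 2 := by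
  obtain ⟨C, hC0, hC⟩ := bound_integral_dx_w hab hμ hν T₀ M
  obtain ⟨c, hc0, hc⟩ := exists_mulV_bound a b
  -- The kernel is `2 + d ‖w_x‖²`: two Young inequalities, each giving up half of `‖z‖²`. `E` bounds
  -- its integral; the absolute value spares a sign assumption on `T₀`.
  set d := 2 * μ ^ 2 * c ^ 2 with hd
  have hd0 : 0 ≤ d := by positivity
  set E := 2 * |T₀| + d * C with hE
  have hE0 : 0 ≤ E := by positivity
  refine ⟨M ^ 2 + M ^ 2 * Real.exp E * E, by positivity, fun D hD T hT S hS t ht => ?_⟩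
  set k : ℝ → ℝ := fun s => 2 + d * ‖H10.dx (S.w s)‖ ^ 2 with hk
  have hk0 : ∀ s, 0 ≤ k s := fun s => by positivity
  have hkc : ContinuousOn k (Icc 0 T) :=
    continuousOn_const.add (continuousOn_const.mul (S.continuousOn_dx_w.norm.pow 2))
  have hki := integrableOn_of_continuousOn hkc
  have hkE : ∀ t ∈ Icc 0 T, ∫ s in (0 : ℝ)..t, k s ≤ E := by
    intro t ht
    rw [integral_affine ht S.integrableOn_dx_w]
    have := hC D hD T hT S hS t ht
    have h2 : t ≤ |T₀| := ht.2.trans (hT.trans (le_abs_self _))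
    rw [hE]
    gcongr
  have hy := S.hasPrim_θ.norm_sq
  have hθc : ContinuousOn (fun t => ‖S.θ t‖ ^ 2) (Icc 0 T) := hy.continuousOn
  have hkθ : IntegrableOn (fun s => k s * ‖S.θ s‖ ^ 2) (Ioc 0 T) :=
    integrableOn_of_continuousOn (hkc.mul hθc)
  have h0 : ‖S.θ 0‖ ^ 2 ≤ M ^ 2 := by
    rw [S.θ_zero]; exact pow_le_pow_left₀ (norm_nonneg _) hD.θ₀ 2
  have key : ∀ t ∈ Icc 0 T, ‖S.θ t‖ ^ 2 + ∫ s in (0 : ℝ)..t, ‖Sob.D 0 (S.z s)‖ ^ 2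
      ≤ M ^ 2 + ∫ s in (0 : ℝ)..t, k s * ‖S.θ s‖ ^ 2 := by
    intro t ht
    have h1 := hy.le_add_integral ht (h := fun s => 1 * (k s * ‖S.θ s‖ ^ 2)
      + (-1) * ‖Sob.D 0 (S.z s)‖ ^ 2) (integrableOn_lincomb hkθ S.integrableOn_D0_z 1 (-1)) (by
        filter_upwards [ae_restrict_mem measurableSet_Ioc] with s hs
        have e1 := hS.heat (Ioc_subset_Icc_self hs) (S.z s)
        have e2 : inner ℝ (S.z s) (S.θ s) = inner ℝ (Sob.D 0 (S.z s)) (Sob.D 0 (S.θ s))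
          + inner ℝ (Sob.D 1 (S.z s)) (Sob.D 1 (S.θ s)) := (neumann hab).inner_eq _ _
        rw [e2, real_inner_comm (Sob.D 1 (S.θ s))]
        rw [real_inner_self_eq_norm_sq] at e1
        have e3 := real_inner_le_norm (Sob.D 0 (S.z s)) (Sob.D 0 (S.θ s))
        have e4 := abs_real_inner_le_norm (mulV a b (S.θ s) (H10.dx (S.w s))) (Sob.D 0 (S.z s))
        have e5 := Sob.norm_D0_le (S.θ s)
        have e6 := hc (S.θ s) (H10.dx (S.w s))
        set X := ‖Sob.D 0 (S.z s)‖
        set Y := ‖S.θ s‖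
        set p := ‖H10.dx (S.w s)‖
        have e7 := (neg_le_abs _).trans (e4.trans (mul_le_mul_of_nonneg_right e6 (norm_nonneg _)))
        have e8 := mul_le_mul_of_nonneg_left e7 hμ.le
        have e9 := e3.trans (mul_le_mul_of_nonneg_left e5 (norm_nonneg _))
        simp only [hk, hd]
        nlinarith [sq_nonneg (X - 2 * Y), sq_nonneg (X - 2 * (μ * c * p * Y))])
    rw [integral_lincomb ht hkθ S.integrableOn_D0_z] at h1
    linarith
  have hG := gronwall_integral hθc hki hk0 (A := M ^ 2) fun t ht => by
    have := key t ht
    have h2 := integral_sq_nonneg ht.1 fun s => Sob.D 0 (S.z s)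
    linarith
  have hG' : ∀ t ∈ Icc 0 T, ‖S.θ t‖ ^ 2 ≤ M ^ 2 * Real.exp E := fun t ht =>
    (hG t ht).trans (by gcongr; exact hkE t ht)
  refine (key t ht).trans ?_
  have h3 : ∫ s in (0 : ℝ)..t, k s * ‖S.θ s‖ ^ 2 ≤ ∫ s in (0 : ℝ)..t, M ^ 2 * Real.exp E * k s :=
    integral_le_of_ae ht hkθ (hki.const_mul _) (by
      filter_upwards [ae_restrict_mem measurableSet_Ioc] with s hs
      rw [mul_comm]
      exact mul_le_mul_of_nonneg_right (hG' s (Ioc_subset_Icc_self hs)) (hk0 s))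
  rw [intervalIntegral.integral_const_mul] at h3
  have h4 := mul_le_mul_of_nonneg_left (hkE t ht) (by positivity : 0 ≤ M ^ 2 * Real.exp E)
  linarith

theorem bound_θ (hab : a < b) (hμ : 0 < μ) (hν : 0 < ν) (T₀ M : ℝ) :
    UniformBound hab μ ν T₀ M fun _ _ S t => ‖S.θ t‖ ^ 2 := by
  obtain ⟨C, hC0, hC⟩ := bound_θ_aux hab hμ hν T₀ M
  refine ⟨C, hC0, fun D hD T hT S hS t ht => ?_⟩
  linarith [hC D hD T hT S hS t ht, integral_sq_nonneg ht.1 fun s => Sob.D 0 (S.z s)]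

theorem bound_integral_z (hab : a < b) (hμ : 0 < μ) (hν : 0 < ν) (T₀ M : ℝ) :
    UniformBound hab μ ν T₀ M fun _ _ S t => ∫ s in (0 : ℝ)..t, ‖Sob.D 0 (S.z s)‖ ^ 2 := by
  obtain ⟨C, hC0, hC⟩ := bound_θ_aux hab hμ hν T₀ M
  refine ⟨C, hC0, fun D hD T hT S hS t ht => ?_⟩
  linarith [hC D hD T hT S hS t ht, sq_nonneg ‖S.θ t‖]

end ThermoVisco

namespace ThermoVisco

/-! ### A priori bounds for the time derivatives -/

variable {a b μ ν : ℝ}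

namespace LinSol

variable {hab : a < b} {D : Data a b μ ν} {T : ℝ} {S : LinSol hab D T}

theorem integrableOn_dx_vV (S : LinSol hab D T) :
    IntegrableOn (fun t => ‖H10.dx (S.vV t)‖ ^ 2) (Ioc 0 T) :=
  MemLp.integrableOn_norm_sq S.memLp_dx

theorem integrableOn_G (S : LinSol hab D T) : IntegrableOn (fun t => ‖S.G t‖ ^ 2) (Ioc 0 T) :=
  MemLp.integrableOn_norm_sq S.memG

theorem integrableOn_K (S : LinSol hab D T) : IntegrableOn (fun t => ‖S.K t‖ ^ 2) (Ioc 0 T) :=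
  MemLp.integrableOn_norm_sq S.memK

/-- Against `φ ∈ H¹₀` the source `K = w_xx - μ z_x` acts as `⟪φ_x, μ z - w_x⟫`. The energy
inequality for sources in divergence form therefore asks only for the `L²` norms of `w_x` and `z`,
which are already bounded. -/
theorem Nonlin.parabolic (h : S.Nonlin) (hν : 0 < ν) {t : ℝ} (ht : t ∈ Icc 0 T) :
    ‖S.v t‖ ^ 2 + ν * ∫ s in (0 : ℝ)..t, ‖H10.dx (S.vV s)‖ ^ 2
      ≤ ‖D.v₀‖ ^ 2 + ν⁻¹ * (2 * (∫ s in (0 : ℝ)..t, ‖H10.dx (S.w s)‖ ^ 2)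
        + 2 * μ ^ 2 * ∫ s in (0 : ℝ)..t, ‖Sob.D 0 (S.z s)‖ ^ 2) := by
  set g : ℝ → L2 a b := fun t => μ • Sob.D 0 (S.z t) - H10.dx (S.w t) with hg
  have hgc : ContinuousOn g (Icc 0 T) :=
    (S.continuous_D0_z.const_smul μ).continuousOn.sub S.continuousOn_dx_w
  have hm : (dirichlet hab).ModeEq ν T S.v
      (fun n t => inner ℝ ((dirichlet hab).D ((dirichlet hab).e n)) (g t)) := by
    intro n
    refine (S.v_modes n).congr_ae ?_
    filter_upwards [ae_Ioc h.K_eq, ae_restrict_mem measurableSet_Ioc] with s hs hsm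
    have h1 := S.wave (Ioc_subset_Icc_self hsm) ((dirichlet hab).e n)
    have h2 := H10.ibp ((dirichlet hab).e n) (S.z s)
    have e : inner ℝ (H10.toL2 ((dirichlet hab).e n)) (S.K s)
        = inner ℝ (H10.dx ((dirichlet hab).e n)) (g s) := by
      rw [hs, hg]
      simp only [inner_sub_right, real_inner_smul_right]
      rw [real_inner_comm (S.v s), real_inner_comm (S.f s),
        real_inner_comm (H10.dx (S.w s)) (H10.dx ((dirichlet hab).e n)), h2]
      field_simp
      linarith
    exact congrArg₂ _ e rfl
  have h1 := (dirichlet hab).energy_le hν S.memV S.toL2_vV (hgc.memLp_timeMeasure 2) hm ht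
  rw [S.v_zero] at h1
  refine h1.trans ?_
  have h2 : ∫ s in (0 : ℝ)..t, ‖g s‖ ^ 2 ≤ ∫ s in (0 : ℝ)..t, (2 * ‖H10.dx (S.w s)‖ ^ 2
      + 2 * μ ^ 2 * ‖Sob.D 0 (S.z s)‖ ^ 2) :=
    integral_le_of_ae ht (integrableOn_of_continuousOn (hgc.norm.pow 2))
      (integrableOn_lincomb S.integrableOn_dx_w S.integrableOn_D0_z _ _)
      (Eventually.of_forall fun s => by
        have := norm_sq_sub_le (μ • Sob.D 0 (S.z s)) (H10.dx (S.w s))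
        rw [norm_smul, mul_pow, Real.norm_eq_abs, sq_abs] at this
        simp only [hg]
        linarith)
  rw [integral_lincomb ht S.integrableOn_dx_w S.integrableOn_D0_z] at h2
  gcongr

theorem norm_sq_vV (S : LinSol hab D T) : ∀ᵐ t ∂volume.restrict (Ioc 0 T),
    ‖S.vV t‖ ^ 2 = ‖S.v t‖ ^ 2 + ‖H10.dx (S.vV t)‖ ^ 2 := by
  filter_upwards [ae_Ioc S.toL2_vV] with t ht
  rw [H10.norm_sq, ht]

end LinSol

theorem bound_parabolic (hab : a < b) (hμ : 0 < μ) (hν : 0 < ν) (T₀ M : ℝ) :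
    UniformBound hab μ ν T₀ M fun _ _ S t =>
    ‖S.v t‖ ^ 2 + ν * ∫ s in (0 : ℝ)..t, ‖H10.dx (S.vV s)‖ ^ 2 := by
  obtain ⟨C, hC0, hC⟩ := bound_integral_dx_w hab hμ hν T₀ M
  obtain ⟨C', hC0', hC'⟩ := bound_integral_z hab hμ hν T₀ M
  refine ⟨M ^ 2 + ν⁻¹ * (2 * C + 2 * μ ^ 2 * C'), by positivity, fun D hD T hT S hS t ht => ?_⟩
  refine (hS.parabolic hν ht).trans ?_
  have h1 := hC D hD T hT S hS t ht
  have h2 := hC' D hD T hT S hS t ht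
  have h3 := pow_le_pow_left₀ (norm_nonneg _) hD.v₀ 2
  gcongr

theorem bound_v (hab : a < b) (hμ : 0 < μ) (hν : 0 < ν) (T₀ M : ℝ) :
    UniformBound hab μ ν T₀ M fun _ _ S t => ‖S.v t‖ ^ 2 := by
  obtain ⟨C, hC0, hC⟩ := bound_parabolic hab hμ hν T₀ M
  refine ⟨C, hC0, fun D hD T hT S hS t ht => ?_⟩
  have h := mul_nonneg hν.le (integral_sq_nonneg ht.1 fun s => H10.dx (S.vV s))
  linarith [hC D hD T hT S hS t ht]

theorem bound_integral_dx_vV (hab : a < b) (hμ : 0 < μ) (hν : 0 < ν) (T₀ M : ℝ) :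
    UniformBound hab μ ν T₀ M fun _ _ S t => ∫ s in (0 : ℝ)..t, ‖H10.dx (S.vV s)‖ ^ 2 := by
  obtain ⟨C, hC0, hC⟩ := bound_parabolic hab hμ hν T₀ M
  refine ⟨ν⁻¹ * C, by positivity, fun D hD T hT S hS t ht => ?_⟩
  rw [inv_mul_eq_div, le_div_iff₀ hν, mul_comm]
  linarith [hC D hD T hT S hS t ht, sq_nonneg ‖S.v t‖]

theorem bound_integral_vV (hab : a < b) (hμ : 0 < μ) (hν : 0 < ν) (T₀ M : ℝ) :
    UniformBound hab μ ν T₀ M fun _ _ S t => ∫ s in (0 : ℝ)..t, ‖S.vV s‖ ^ 2 := by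
  obtain ⟨C, hC0, hC⟩ := bound_v hab hμ hν T₀ M
  obtain ⟨C', hC0', hC'⟩ := bound_integral_dx_vV hab hμ hν T₀ M
  refine ⟨C * |T₀| + 1 * C', by positivity, fun D hD T hT S hS t ht => ?_⟩
  have h1 := integral_le_of_ae ht (MemLp.integrableOn_norm_sq S.memV)
    (g := fun s => C + 1 * ‖H10.dx (S.vV s)‖ ^ 2)
    (integrableOn_affine S.integrableOn_dx_vV C 1) (by
      filter_upwards [S.norm_sq_vV, ae_restrict_mem measurableSet_Ioc] with s hs hsm
      rw [hs, one_mul]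
      linarith [hC D hD T hT S hS s (Ioc_subset_Icc_self hsm)])
  rw [integral_affine ht S.integrableOn_dx_vV] at h1
  refine h1.trans ?_
  have h2 := hC' D hD T hT S hS t ht
  have h3 : t ≤ |T₀| := ht.2.trans (hT.trans (le_abs_self _))
  gcongr

theorem bound_w (hab : a < b) (hμ : 0 < μ) (hν : 0 < ν) (T₀ M : ℝ) :
    UniformBound hab μ ν T₀ M fun _ _ S t => ‖S.w t‖ ^ 2 := by
  obtain ⟨C, hC0, hC⟩ := bound_integral_vV hab hμ hν T₀ M
  refine ⟨2 * M ^ 2 + 2 * (|T₀| * C), by positivity, fun D hD T hT S hS t ht => ?_⟩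
  refine (S.hasPrim_w.norm_sq_le S.memV (hT.trans (le_abs_self _)) (S.w_zero.symm ▸ hD.u₁) ht).trans ?_
  have h2 := hC D hD T hT S hS t ht
  gcongr

theorem bound_u (hab : a < b) (hμ : 0 < μ) (hν : 0 < ν) (T₀ M : ℝ) :
    UniformBound hab μ ν T₀ M fun _ _ S t => ‖S.u t‖ ^ 2 := by
  obtain ⟨C, hC0, hC⟩ := bound_w hab hμ hν T₀ M
  refine ⟨2 * M ^ 2 + 2 * (|T₀| * (|T₀| * C)), by positivity, fun D hD T hT S hS t ht => ?_⟩
  have hwc : ContinuousOn S.w (Icc 0 T) := S.hasPrim_w.continuousOn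
  refine (S.hasPrim_u.norm_sq_le (hwc.memLp_timeMeasure 2) (hT.trans (le_abs_self _))
    (S.u_zero.symm ▸ hD.u₀) ht).trans ?_
  have h2 : ∫ s in (0 : ℝ)..t, ‖S.w s‖ ^ 2 ≤ ∫ _ in (0 : ℝ)..t, C :=
    integral_le_of_ae ht (integrableOn_of_continuousOn (hwc.norm.pow 2))
      (integrableOn_of_continuousOn continuousOn_const) (by
        filter_upwards [ae_restrict_mem measurableSet_Ioc] with s hs
        exact hC D hD T hT S hS s (Ioc_subset_Icc_self hs))
  rw [intervalIntegral.integral_const, sub_zero, smul_eq_mul] at h2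
  have h3 : t ≤ |T₀| := ht.2.trans (hT.trans (le_abs_self _))
  have h4 := mul_le_mul_of_nonneg_right h3 hC0
  gcongr
  exact h2.trans h4

/-- The bound is affine in `∫ ‖z‖²` because the other factors are under control: `w` and `θ`
uniformly in `H¹`, and `v_x` in `L²`. This linearity lets Grönwall close in `bound_z`. -/
theorem bound_G_aux (hab : a < b) (hμ : 0 < μ) (hν : 0 < ν) (T₀ M : ℝ) : ∃ C C' : ℝ, 0 ≤ C ∧ 0 ≤ C' ∧
    ∀ D : Data a b μ ν, D.Bound M → ∀ T, T ≤ T₀ → ∀ S : LinSol hab D T, S.Nonlin →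
    ∀ t ∈ Icc 0 T, ∫ s in (0 : ℝ)..t, ‖S.G s‖ ^ 2 ≤ C + C' * ∫ s in (0 : ℝ)..t, ‖S.z s‖ ^ 2 := by
  obtain ⟨Cw, hCw0, hCw⟩ := bound_w hab hμ hν T₀ M
  obtain ⟨Cθ, hCθ0, hCθ⟩ := bound_θ hab hμ hν T₀ M
  obtain ⟨Cv, hCv0, hCv⟩ := bound_integral_dx_vV hab hμ hν T₀ M
  obtain ⟨c, hc0, hc⟩ := exists_mulV_bound a b
  refine ⟨2 * μ ^ 2 * c ^ 2 * Cθ * Cv, 2 * μ ^ 2 * c ^ 2 * Cw, by positivity, by positivity,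
    fun D hD T hT S hS t ht => ?_⟩
  have hzi : IntegrableOn (fun s => ‖S.z s‖ ^ 2) (Ioc 0 T) :=
    integrableOn_of_continuousOn (S.continuous_z.norm.pow 2).continuousOn
  have h1 := integral_le_of_ae ht S.integrableOn_G (integrableOn_lincomb hzi S.integrableOn_dx_vV
    (2 * μ ^ 2 * c ^ 2 * Cw) (2 * μ ^ 2 * c ^ 2 * Cθ)) (by
      filter_upwards [ae_Ioc hS.G_eq, ae_restrict_mem measurableSet_Ioc] with s hs hsm
      have hs' := Ioc_subset_Icc_self hsm
      rw [hs, norm_smul, mul_pow, norm_neg, Real.norm_eq_abs, sq_abs]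
      refine (mul_le_mul_of_nonneg_left (norm_sq_add_le _ _) (sq_nonneg μ)).trans ?_
      have e1 := pow_le_pow_left₀ (norm_nonneg _) (hc (S.z s) (H10.dx (S.w s))) 2
      have e2 := pow_le_pow_left₀ (norm_nonneg _) (hc (S.θ s) (H10.dx (S.vV s))) 2
      have e3 := (pow_le_pow_left₀ (norm_nonneg _) (H10.norm_dx_le (S.w s)) 2).trans
        (hCw D hD T hT S hS s hs')
      have e4 := hCθ D hD T hT S hS s hs'
      calc _ ≤ μ ^ 2 * (2 * (c * ‖S.z s‖ * ‖H10.dx (S.w s)‖) ^ 2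
            + 2 * (c * ‖S.θ s‖ * ‖H10.dx (S.vV s)‖) ^ 2) := by gcongr
        _ = 2 * μ ^ 2 * c ^ 2 * ‖H10.dx (S.w s)‖ ^ 2 * ‖S.z s‖ ^ 2
            + 2 * μ ^ 2 * c ^ 2 * ‖S.θ s‖ ^ 2 * ‖H10.dx (S.vV s)‖ ^ 2 := by ring
        _ ≤ _ := by gcongr)
  rw [integral_lincomb ht hzi S.integrableOn_dx_vV] at h1
  have h2 := mul_le_mul_of_nonneg_left (hCv D hD T hT S hS t ht)
    (by positivity : 0 ≤ 2 * μ ^ 2 * c ^ 2 * Cθ)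
  linarith

/-- The parabolic estimate `norm_sq_regular_le` with `κ = 1`, fed with `bound_G_aux` and closed by
Grönwall. -/
theorem bound_z (hab : a < b) (hμ : 0 < μ) (hν : 0 < ν) (T₀ M : ℝ) :
    UniformBound hab μ ν T₀ M fun _ _ S t => ‖S.z t‖ ^ 2 := by
  obtain ⟨C, C', hC0, hC0', hC⟩ := bound_G_aux hab hμ hν T₀ M
  set e := Real.exp |T₀| + 1 + 1⁻¹ with he
  have he0 : 0 ≤ e := by positivity
  refine ⟨e * (M ^ 2 + C) * Real.exp (e * C' * |T₀|), by positivity,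
    fun D hD T hT S hS t ht => ?_⟩
  have hg := gronwall_integral (T := T) (φ := fun t => ‖S.z t‖ ^ 2) (k := fun _ => e * C')
    (A := e * (M ^ 2 + C)) (S.continuous_z.norm.pow 2).continuousOn
    (integrableOn_of_continuousOn continuousOn_const) (fun _ => by positivity) (fun t ht => by
      have h1 := (neumann hab).norm_sq_regular_le one_pos S.memG S.z_modes ht
      have h2 := hC D hD T hT S hS t ht
      have h3 : ‖S.z 0‖ ^ 2 ≤ M ^ 2 := by
        rw [S.z_zero]; exact pow_le_pow_left₀ (norm_nonneg _) hD.z₀ 2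
      have h4 : Real.exp T + 1 + 1⁻¹ ≤ e := by
        rw [he]; gcongr; exact hT.trans (le_abs_self _)
      have h5 := integral_sq_nonneg ht.1 S.G
      rw [intervalIntegral.integral_const_mul]
      refine h1.trans ?_
      calc _ ≤ e * (M ^ 2 + (C + C' * ∫ s in (0 : ℝ)..t, ‖S.z s‖ ^ 2)) := by gcongr
        _ = _ := by ring) t ht
  refine hg.trans ?_
  rw [intervalIntegral.integral_const, sub_zero, smul_eq_mul, mul_comm t]
  have h3 : t ≤ |T₀| := ht.2.trans (hT.trans (le_abs_self _))
  gcongr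

theorem bound_integral_G (hab : a < b) (hμ : 0 < μ) (hν : 0 < ν) (T₀ M : ℝ) :
    UniformBound hab μ ν T₀ M fun _ _ S t => ∫ s in (0 : ℝ)..t, ‖S.G s‖ ^ 2 := by
  obtain ⟨C, C', hC0, hC0', hC⟩ := bound_G_aux hab hμ hν T₀ M
  obtain ⟨Cz, hCz0, hCz⟩ := bound_z hab hμ hν T₀ M
  refine ⟨C + C' * (|T₀| * Cz), by positivity, fun D hD T hT S hS t ht => ?_⟩
  refine (hC D hD T hT S hS t ht).trans ?_
  have h2 : ∫ s in (0 : ℝ)..t, ‖S.z s‖ ^ 2 ≤ ∫ _ in (0 : ℝ)..t, Cz :=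
    integral_le_of_ae ht (integrableOn_of_continuousOn (S.continuous_z.norm.pow 2).continuousOn)
      (integrableOn_of_continuousOn continuousOn_const) (by
        filter_upwards [ae_restrict_mem measurableSet_Ioc] with s hs
        exact hCz D hD T hT S hS s (Ioc_subset_Icc_self hs))
  rw [intervalIntegral.integral_const, sub_zero, smul_eq_mul] at h2
  have h3 : t ≤ |T₀| := ht.2.trans (hT.trans (le_abs_self _))
  have h4 := mul_le_mul_of_nonneg_right h3 hCz0
  gcongr
  exact h2.trans h4

/-- In `K = ν⁻¹ (v - f) - μ z_x` only `f` is not yet bounded, and `f` is a primitive of `K`; so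
`bound_f` closes by Grönwall. -/
theorem bound_K_aux (hab : a < b) (hμ : 0 < μ) (hν : 0 < ν) (T₀ M : ℝ) : ∃ C C' : ℝ, 0 ≤ C ∧ 0 ≤ C' ∧
    ∀ D : Data a b μ ν, D.Bound M → ∀ T, T ≤ T₀ → ∀ S : LinSol hab D T, S.Nonlin →
    ∀ t ∈ Icc 0 T, ∫ s in (0 : ℝ)..t, ‖S.K s‖ ^ 2 ≤ C * t + C' * ∫ s in (0 : ℝ)..t, ‖S.f s‖ ^ 2 := by
  obtain ⟨Cv, hCv0, hCv⟩ := bound_v hab hμ hν T₀ M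
  obtain ⟨Cz, hCz0, hCz⟩ := bound_z hab hμ hν T₀ M
  refine ⟨4 * ν⁻¹ ^ 2 * Cv + 2 * μ ^ 2 * Cz, 4 * ν⁻¹ ^ 2, by positivity, by positivity,
    fun D hD T hT S hS t ht => ?_⟩
  have hfi : IntegrableOn (fun s => ‖S.f s‖ ^ 2) (Ioc 0 T) :=
    integrableOn_of_continuousOn (S.continuousOn_f.norm.pow 2)
  rw [← integral_affine ht hfi]
  refine integral_le_of_ae ht S.integrableOn_K (integrableOn_affine hfi _ _) ?_
  filter_upwards [ae_Ioc hS.K_eq, ae_restrict_mem measurableSet_Ioc] with s hs hsm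
  have hs' := Ioc_subset_Icc_self hsm
  have e1 := norm_sq_sub_le (ν⁻¹ • (S.v s - S.f s)) (μ • Sob.D 1 (S.z s))
  rw [norm_smul, norm_smul, mul_pow, mul_pow, Real.norm_eq_abs, Real.norm_eq_abs, sq_abs, sq_abs,
    ← hs] at e1
  have e2 := norm_sq_sub_le (S.v s) (S.f s)
  have e3 := hCv D hD T hT S hS s hs'
  have e4 := (pow_le_pow_left₀ (norm_nonneg _) (Sob.norm_D1_le (S.z s)) 2).trans
    (hCz D hD T hT S hS s hs')
  calc _ ≤ _ := e1
    _ ≤ 2 * (ν⁻¹ ^ 2 * (2 * Cv + 2 * ‖S.f s‖ ^ 2)) + 2 * (μ ^ 2 * Cz) := by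
      gcongr
      exact e2.trans (by gcongr)
    _ = _ := by ring

theorem bound_f (hab : a < b) (hμ : 0 < μ) (hν : 0 < ν) (T₀ M : ℝ) :
    UniformBound hab μ ν T₀ M fun _ _ S t => ‖S.f t‖ ^ 2 := by
  obtain ⟨C, C', hC0, hC0', hC⟩ := bound_K_aux hab hμ hν T₀ M
  refine ⟨(2 * M ^ 2 + 2 * (|T₀| * (C * |T₀|))) * Real.exp (2 * |T₀| * C' * |T₀|), by positivity,
    fun D hD T hT S hS t ht => ?_⟩
  have hg := gronwall_integral (T := T) (φ := fun t => ‖S.f t‖ ^ 2) (k := fun _ => 2 * |T₀| * C')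
    (A := 2 * M ^ 2 + 2 * (|T₀| * (C * |T₀|))) (S.continuousOn_f.norm.pow 2)
    (integrableOn_of_continuousOn continuousOn_const) (fun _ => by positivity) (fun t ht => by
      have h1 := S.hasPrim_f.norm_sq_le S.memK (hT.trans (le_abs_self _))
        (S.f_zero.symm ▸ hD.f₀) ht
      have h2 := hC D hD T hT S hS t ht
      have h3 : t ≤ |T₀| := ht.2.trans (hT.trans (le_abs_self _))
      rw [intervalIntegral.integral_const_mul]
      refine h1.trans ?_
      calc _ ≤ 2 * M ^ 2 + 2 * (|T₀| * (C * |T₀| + C' * ∫ s in (0 : ℝ)..t, ‖S.f s‖ ^ 2)) := by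
            gcongr
            exact h2.trans (by gcongr)
        _ = _ := by ring) t ht
  refine hg.trans ?_
  rw [intervalIntegral.integral_const, sub_zero, smul_eq_mul, mul_comm t]
  have h3 : t ≤ |T₀| := ht.2.trans (hT.trans (le_abs_self _))
  gcongr

theorem bound_integral_K (hab : a < b) (hμ : 0 < μ) (hν : 0 < ν) (T₀ M : ℝ) :
    UniformBound hab μ ν T₀ M fun _ _ S t => ∫ s in (0 : ℝ)..t, ‖S.K s‖ ^ 2 := by
  obtain ⟨C, C', hC0, hC0', hC⟩ := bound_K_aux hab hμ hν T₀ M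
  obtain ⟨Cf, hCf0, hCf⟩ := bound_f hab hμ hν T₀ M
  refine ⟨C * |T₀| + C' * (|T₀| * Cf), by positivity, fun D hD T hT S hS t ht => ?_⟩
  refine (hC D hD T hT S hS t ht).trans ?_
  have h2 : ∫ s in (0 : ℝ)..t, ‖S.f s‖ ^ 2 ≤ ∫ _ in (0 : ℝ)..t, Cf :=
    integral_le_of_ae ht (integrableOn_of_continuousOn (S.continuousOn_f.norm.pow 2))
      (integrableOn_of_continuousOn continuousOn_const) (by
        filter_upwards [ae_restrict_mem measurableSet_Ioc] with s hs
        exact hCf D hD T hT S hS s (Ioc_subset_Icc_self hs))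
  rw [intervalIntegral.integral_const, sub_zero, smul_eq_mul] at h2
  have h3 : t ≤ |T₀| := ht.2.trans (hT.trans (le_abs_self _))
  have h4 := mul_le_mul_of_nonneg_right h3 hCf0
  gcongr
  exact h2.trans h4

end ThermoVisco

namespace ThermoVisco

/-! ### Existence for the nonlinear problem -/

variable {a b μ ν : ℝ}

namespace LinSol

variable {hab : a < b} {D : Data a b μ ν} {T : ℝ}

/-- Restriction to a shorter time interval. -/
def restrict (S : LinSol hab D T) {τ : ℝ} (hτ : τ ≤ T) : LinSol hab D τ where
  G := S.G
  K := S.K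
  memG := S.memG.mono_measure (timeMeasure_mono hτ)
  memK := S.memK.mono_measure (timeMeasure_mono hτ)
  z := S.z
  v := S.v
  vV := S.vV
  continuous_z := S.continuous_z
  z_zero := S.z_zero
  z_modes n := (S.z_modes n).mono hτ
  continuous_v := S.continuous_v
  v_zero := S.v_zero
  memV := S.memV.mono_measure (timeMeasure_mono hτ)
  toL2_vV := ae_timeMeasure_mono hτ S.toL2_vV
  v_modes n := (S.v_modes n).mono hτ

/-- The source `-μ (θ u_tx)_t` of the heat equation. -/
def nextG (S : LinSol hab D T) (t : ℝ) : L2 a b :=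
  -μ • (mulV a b (S.z t) (H10.dx (S.w t)) + mulV a b (S.θ t) (H10.dx (S.vV t)))

/-- The source `(u_xx - μ θ_x)_t` of the wave equation. -/
def nextK (S : LinSol hab D T) (t : ℝ) : L2 a b :=
  ν⁻¹ • (S.v t - S.f t) - μ • Sob.D 1 (S.z t)

theorem memLp_nextG (S : LinSol hab D T) : MemLp S.nextG 2 (timeMeasure T) := by
  have h1 : MemLp (fun t => mulV a b (S.z t) (H10.dx (S.w t))) 2 (timeMeasure T) :=
    ((mulV a b).memLp_of_bilin (p := ∞) (q := 2) 2
      (S.continuous_z.continuousOn.memLp_timeMeasure ∞) (S.continuousOn_dx_w.memLp_timeMeasure 2))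
  have h2 : MemLp (fun t => mulV a b (S.θ t) (H10.dx (S.vV t))) 2 (timeMeasure T) :=
    ((mulV a b).memLp_of_bilin (p := ∞) (q := 2) 2
      (S.continuous_θ.continuousOn.memLp_timeMeasure ∞) S.memLp_dx)
  exact (h1.add h2).const_smul (-μ)

theorem memLp_nextK (S : LinSol hab D T) : MemLp S.nextK 2 (timeMeasure T) := by
  have h1 : ContinuousOn (fun t => ν⁻¹ • (S.v t - S.f t)) (Icc 0 T) :=
    (S.continuous_v.continuousOn.sub S.continuousOn_f).const_smul ν⁻¹
  have h2 : Continuous fun t => Sob.D 1 (S.z t) := (Sob.D 1).continuous.comp S.continuous_z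
  have h3 : ContinuousOn (fun t => μ • Sob.D 1 (S.z t)) (Icc 0 T) :=
    h2.continuousOn.const_smul μ
  exact (h1.memLp_timeMeasure 2).sub (h3.memLp_timeMeasure 2)

theorem norm_sq_z_sub_le (S S' : LinSol hab D T) {t : ℝ} (ht : t ∈ Icc 0 T) :
    ‖S.z t - S'.z t‖ ^ 2 ≤ (Real.exp T + 1 + 1⁻¹) * ∫ s in (0 : ℝ)..t, ‖S.G s - S'.G s‖ ^ 2 := by
  have h := S.z_modes.sub S'.z_modes
  simp only [← map_sub, ← inner_sub_right] at h
  have h1 := (neumann hab).norm_sq_regular_le one_pos (Y := fun t => S.z t - S'.z t)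
    (f := fun t => S.G t - S'.G t) (S.memG.sub S'.memG) h ht
  simpa [S.z_zero, S'.z_zero] using h1

/-- The difference starts at zero, so it coincides with the regular solution `X` for the source `K -
K'`: what is left has zero data and zero source, and the energy inequality kills it. Hence
differences of `v` are controlled in `H¹₀`, although `v` itself is not. -/
theorem exists_v_sub (hν : 0 < ν) (S S' : LinSol hab D T) (hT : 0 ≤ T) : ∃ X : ℝ → H10 a b,
    (∀ t ∈ Icc 0 T, S.v t - S'.v t = H10.toL2 (X t)) ∧
    (∀ᵐ t ∂volume.restrict (Ioc 0 T), S.vV t - S'.vV t = X t) ∧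
    ∀ t ∈ Icc 0 T, ‖X t‖ ^ 2
      ≤ (Real.exp T + 1 + ν⁻¹) * ∫ s in (0 : ℝ)..t, ‖S.K s - S'.K s‖ ^ 2 := by
  have hK : MemLp (fun t => S.K t - S'.K t) 2 (timeMeasure T) := S.memK.sub S'.memK
  obtain ⟨X, hX1, hX2, hX3⟩ := (dirichlet hab).exists_regular hν hT 0 hK
  have h := (S.v_modes.sub S'.v_modes).sub hX3
  have hm : (dirichlet hab).ModeEq ν T (fun t => S.v t - S'.v t - (dirichlet hab).ι (X t))
      (fun n t => inner ℝ ((dirichlet hab).D ((dirichlet hab).e n)) ((fun _ => 0 : ℝ → L2 a b) t)) := by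
    intro n
    refine (h n).congr_ae (Eventually.of_forall fun t => ?_)
    simp only [inner_sub_right, inner_zero_right]
    ring
  have hae : ∀ᵐ t ∂timeMeasure T, (dirichlet hab).ι (S.vV t - S'.vV t - X t)
      = S.v t - S'.v t - (dirichlet hab).ι (X t) := by
    filter_upwards [S.toL2_vV, S'.toL2_vV] with t h1 h2
    rw [map_sub, map_sub]
    exact congrArg₂ _ (congrArg₂ _ h1 h2) rfl
  have hv : ∀ t ∈ Icc 0 T, S.v t - S'.v t = H10.toL2 (X t) := by
    intro t ht
    have h1 := (dirichlet hab).energy_le hν (Y := fun t => S.vV t - S'.vV t - X t) (h := fun _ => 0)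
      ((S.memV.sub S'.memV).sub (hX1.continuousOn.memLp_timeMeasure 2)) hae MemLp.zero hm ht
    have h2 := mul_nonneg hν.le (integral_sq_nonneg ht.1 fun s =>
      (dirichlet hab).D (S.vV s - S'.vV s - X s))
    simp only [S.v_zero, S'.v_zero, hX2, map_zero, sub_self, norm_zero, ne_eq, OfNat.ofNat_ne_zero,
      not_false_eq_true, zero_pow, intervalIntegral.integral_zero, mul_zero, add_zero] at h1
    have h3 : ‖S.v t - S'.v t - (dirichlet hab).ι (X t)‖ ^ 2 ≤ 0 := le_trans (le_add_of_nonneg_right h2) h1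
    have h4 := pow_eq_zero_iff two_ne_zero |>.1 (le_antisymm h3 (sq_nonneg _))
    exact sub_eq_zero.1 (norm_eq_zero.1 h4)
  refine ⟨X, hv, ?_, fun t ht => ?_⟩
  · filter_upwards [ae_Ioc S.toL2_vV, ae_Ioc S'.toL2_vV, ae_restrict_mem measurableSet_Ioc]
      with t h1 h2 ht
    refine H10.toL2_injective ?_
    rw [map_sub, h1, h2, hv t (Ioc_subset_Icc_self ht)]
  · have h1 := (dirichlet hab).norm_sq_regular_le hν hK hX3 ht
    simpa [hX2] using h1

end LinSol

theorem integral_sq_mono {E : Type*} [NormedAddCommGroup E] {T s t : ℝ} {g : ℝ → E}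
    (hg : IntegrableOn (fun s => ‖g s‖ ^ 2) (Ioc 0 T)) (hs : 0 ≤ s) (hst : s ≤ t) (ht : t ≤ T) :
    ∫ r in (0 : ℝ)..s, ‖g r‖ ^ 2 ≤ ∫ r in (0 : ℝ)..t, ‖g r‖ ^ 2 :=
  intervalIntegral.integral_mono_interval le_rfl hs hst (Eventually.of_forall fun _ => sq_nonneg _)
    (intervalIntegrable_of_Ioc hg ⟨hs.trans hst, ht⟩)

theorem HasPrim.norm_sq_sub_le {E : Type*} [NormedAddCommGroup E] [NormedSpace ℝ E] [CompleteSpace E]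
    {T c : ℝ} {y g y' g' : ℝ → E} {δ : ℝ → ℝ} (hy : HasPrim T y g) (hy' : HasPrim T y' g')
    (hg : MemLp g 2 (timeMeasure T)) (hg' : MemLp g' 2 (timeMeasure T))
    (h0 : y 0 = y' 0) (hc : 0 ≤ c) (hδ : MonotoneOn δ (Icc 0 T)) (hδ0 : ∀ t ∈ Icc 0 T, 0 ≤ δ t)
    (h : ∀ᵐ t ∂volume.restrict (Ioc 0 T), ‖g t - g' t‖ ^ 2 ≤ c * δ t) {t : ℝ} (ht : t ∈ Icc 0 T) :
    ‖y t - y' t‖ ^ 2 ≤ T ^ 2 * c * δ t := by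
  rw [(hy.sub hy').eq t ht, h0, sub_self, zero_add]
  have hm : MemLp (fun s => g s - g' s) 2 (timeMeasure T) := hg.sub hg'
  have h1 := sq_norm_integral_le ht.1 (hm.mono_measure (timeMeasure_mono ht.2))
  have h2 : ∫ s in (0 : ℝ)..t, ‖g s - g' s‖ ^ 2 ≤ ∫ _ in (0 : ℝ)..t, c * δ t :=
    integral_le_of_ae (T := t) ⟨ht.1, le_rfl⟩
      ((MemLp.integrableOn_norm_sq hm).mono_set (Ioc_subset_Ioc_right ht.2))
      (integrableOn_of_continuousOn continuousOn_const) (by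
        filter_upwards [ae_restrict_of_ae_restrict_of_subset (Ioc_subset_Ioc_right ht.2) h,
          ae_restrict_mem measurableSet_Ioc] with s hs hsm
        exact hs.trans (mul_le_mul_of_nonneg_left
          (hδ ⟨hsm.1.le, hsm.2.trans ht.2⟩ ht hsm.2) hc))
  rw [intervalIntegral.integral_const, sub_zero, smul_eq_mul] at h2
  have h3 := mul_nonneg hc (hδ0 t ht)
  have h4 := mul_le_mul_of_nonneg_left h2 ht.1
  have h5 : t ^ 2 ≤ T ^ 2 := pow_le_pow_left₀ ht.1 ht.2 2
  have h6 := mul_le_mul_of_nonneg_right h5 h3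
  calc _ ≤ _ := h1
    _ ≤ _ := h4
    _ = t ^ 2 * (c * δ t) := by ring
    _ ≤ _ := h6
    _ = _ := by ring

/-- All differences of two linear solutions are controlled by those of the sources. -/
theorem exists_lipschitz (hab : a < b) (hν : 0 < ν) (D : Data a b μ ν) {T : ℝ} (hT : 0 ≤ T) :
    ∃ c : ℝ, 0 ≤ c ∧ ∀ (S S' : LinSol hab D T) (E : ℝ → L2 a b × L2 a b),
      MemLp E 2 (timeMeasure T) → (∀ t, ‖S.G t - S'.G t‖ ≤ ‖E t‖) → (∀ t, ‖S.K t - S'.K t‖ ≤ ‖E t‖) →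
      ∀ᵐ t ∂volume.restrict (Ioc 0 T),
        ‖S.z t - S'.z t‖ ^ 2 ≤ c * (∫ s in (0 : ℝ)..t, ‖E s‖ ^ 2) ∧
        ‖S.θ t - S'.θ t‖ ^ 2 ≤ c * (∫ s in (0 : ℝ)..t, ‖E s‖ ^ 2) ∧
        ‖S.w t - S'.w t‖ ^ 2 ≤ c * (∫ s in (0 : ℝ)..t, ‖E s‖ ^ 2) ∧
        ‖S.vV t - S'.vV t‖ ^ 2 ≤ c * (∫ s in (0 : ℝ)..t, ‖E s‖ ^ 2) ∧
        ‖S.v t - S'.v t‖ ^ 2 ≤ c * (∫ s in (0 : ℝ)..t, ‖E s‖ ^ 2) ∧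
        ‖S.f t - S'.f t‖ ^ 2 ≤ c * (∫ s in (0 : ℝ)..t, ‖E s‖ ^ 2) := by
  set c₁ := Real.exp T + 1 + 1⁻¹ with hc₁
  set c₂ := Real.exp T + 1 + ν⁻¹ with hc₂
  have h1 : 0 ≤ c₁ := by positivity
  have h2 : 0 ≤ c₂ := by positivity
  -- A sum of the separate constants: `c₁` for `z`, `T² c₁` for `θ`, `T² c₂` for `w`, `c₂` for `vV`
  -- and `v`, and `T` for `f`.
  refine ⟨c₁ + T ^ 2 * c₁ + T ^ 2 * c₂ + c₂ + T, by positivity, fun S S' E hE hG hK => ?_⟩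
  have hEi := MemLp.integrableOn_norm_sq hE
  set δ : ℝ → ℝ := fun t => ∫ s in (0 : ℝ)..t, ‖E s‖ ^ 2 with hδ
  have hδm : MonotoneOn δ (Icc 0 T) := fun s hs t ht hst => integral_sq_mono hEi hs.1 hst ht.2
  have hδ0 : ∀ t ∈ Icc 0 T, 0 ≤ δ t := fun t ht => integral_sq_nonneg ht.1 E
  have hGE : ∀ t ∈ Icc 0 T, ∫ s in (0 : ℝ)..t, ‖S.G s - S'.G s‖ ^ 2 ≤ δ t := fun t ht =>
    integral_le_of_ae ht (MemLp.integrableOn_norm_sq (S.memG.sub S'.memG)) hEi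
      (Eventually.of_forall fun s => pow_le_pow_left₀ (norm_nonneg _) (hG s) 2)
  have hKE : ∀ t ∈ Icc 0 T, ∫ s in (0 : ℝ)..t, ‖S.K s - S'.K s‖ ^ 2 ≤ δ t := fun t ht =>
    integral_le_of_ae ht (MemLp.integrableOn_norm_sq (S.memK.sub S'.memK)) hEi
      (Eventually.of_forall fun s => pow_le_pow_left₀ (norm_nonneg _) (hK s) 2)
  have hz : ∀ t ∈ Icc 0 T, ‖S.z t - S'.z t‖ ^ 2 ≤ c₁ * δ t := fun t ht =>
    (S.norm_sq_z_sub_le S' ht).trans (mul_le_mul_of_nonneg_left (hGE t ht) h1)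
  obtain ⟨X, hX1, hX2, hX3⟩ := S.exists_v_sub hν S' hT
  have hX : ∀ t ∈ Icc 0 T, ‖X t‖ ^ 2 ≤ c₂ * δ t := fun t ht =>
    (hX3 t ht).trans (mul_le_mul_of_nonneg_left (hKE t ht) h2)
  have hvV : ∀ᵐ t ∂volume.restrict (Ioc 0 T), ‖S.vV t - S'.vV t‖ ^ 2 ≤ c₂ * δ t := by
    filter_upwards [hX2, ae_restrict_mem measurableSet_Ioc] with t ht htm
    rw [ht]; exact hX t (Ioc_subset_Icc_self htm)
  have hθ : ∀ t ∈ Icc 0 T, ‖S.θ t - S'.θ t‖ ^ 2 ≤ T ^ 2 * c₁ * δ t := fun t ht =>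
    S.hasPrim_θ.norm_sq_sub_le S'.hasPrim_θ (S.continuous_z.continuousOn.memLp_timeMeasure 2)
      (S'.continuous_z.continuousOn.memLp_timeMeasure 2) (by rw [S.θ_zero, S'.θ_zero]) h1 hδm hδ0 (by
        filter_upwards [ae_restrict_mem measurableSet_Ioc] with s hs
        exact hz s (Ioc_subset_Icc_self hs)) ht
  have hw : ∀ t ∈ Icc 0 T, ‖S.w t - S'.w t‖ ^ 2 ≤ T ^ 2 * c₂ * δ t := fun t ht =>
    S.hasPrim_w.norm_sq_sub_le S'.hasPrim_w S.memV S'.memV (by rw [S.w_zero, S'.w_zero]) h2 hδm hδ0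
      hvV ht
  have hf : ∀ t ∈ Icc 0 T, ‖S.f t - S'.f t‖ ^ 2 ≤ T * δ t := by
    intro t ht
    rw [(S.hasPrim_f.sub S'.hasPrim_f).eq t ht, S.f_zero, S'.f_zero, sub_self, zero_add]
    refine (sq_norm_integral_le ht.1 ((S.memK.sub S'.memK).mono_measure
      (timeMeasure_mono ht.2))).trans ?_
    have h3 := integral_sq_nonneg ht.1 fun s => S.K s - S'.K s
    have h4 := hKE t ht
    have h5 := ht.2
    exact mul_le_mul h5 h4 h3 hT
  filter_upwards [hvV, ae_restrict_mem measurableSet_Ioc] with t h3 htm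
  have ht := Ioc_subset_Icc_self htm
  have e0 := hδ0 t ht
  have e1 := mul_nonneg h1 e0
  have e2 := mul_nonneg h2 e0
  have e3 := mul_nonneg hT e0
  have e4 := mul_nonneg (mul_nonneg (sq_nonneg T) h1) e0
  have e5 := mul_nonneg (mul_nonneg (sq_nonneg T) h2) e0
  have e6 := hz t ht
  have e7 := hθ t ht
  have e8 := hw t ht
  have e9 : ‖S.v t - S'.v t‖ ^ 2 ≤ c₂ * δ t := by
    rw [hX1 t ht]
    exact (pow_le_pow_left₀ (norm_nonneg _) (H10.norm_toL2_le _) 2).trans (hX t ht)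
  have e10 := hf t ht
  have e : (c₁ + T ^ 2 * c₁ + T ^ 2 * c₂ + c₂ + T) * δ t
      = c₁ * δ t + T ^ 2 * c₁ * δ t + T ^ 2 * c₂ * δ t + c₂ * δ t + T * δ t := by ring
  simp only [hδ] at *
  refine ⟨?_, ?_, ?_, ?_, ?_, ?_⟩ <;> linarith

end ThermoVisco

namespace ThermoVisco

/-! ### Lipschitz dependence of the sources and global existence -/

variable {a b μ ν : ℝ}

namespace LinSol

variable {hab : a < b} {D : Data a b μ ν} {T : ℝ}

theorem norm_sq_nextG_sub_le (S S' : LinSol hab D T) {c d t : ℝ} (hc0 : 0 ≤ c)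
    (hc : ∀ (ψ : Sob a b 1) (g : L2 a b), ‖mulV a b ψ g‖ ≤ c * ‖ψ‖ * ‖g‖)
    (hz : ‖S.z t - S'.z t‖ ^ 2 ≤ d) (hθ : ‖S.θ t - S'.θ t‖ ^ 2 ≤ d)
    (hw : ‖S.w t - S'.w t‖ ^ 2 ≤ d) (hv : ‖S.vV t - S'.vV t‖ ^ 2 ≤ d) :
    ‖S.nextG t - S'.nextG t‖ ^ 2
      ≤ 4 * μ ^ 2 * c ^ 2 * d * (‖S.w t‖ ^ 2 + ‖S'.z t‖ ^ 2 + ‖S.vV t‖ ^ 2 + ‖S'.θ t‖ ^ 2) := by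
  have hd : 0 ≤ d := (sq_nonneg _).trans hz
  -- Each product is telescoped so that every term contains one difference factor.
  have e : S.nextG t - S'.nextG t = -μ • ((mulV a b (S.z t - S'.z t) (H10.dx (S.w t))
      + mulV a b (S'.z t) (H10.dx (S.w t - S'.w t)))
      + (mulV a b (S.θ t - S'.θ t) (H10.dx (S.vV t))
      + mulV a b (S'.θ t) (H10.dx (S.vV t - S'.vV t)))) := by
    simp only [nextG, map_sub, _root_.sub_apply]
    module
  have hb : ∀ (ψ : Sob a b 1) (φ : H10 a b) {x y : ℝ}, ‖ψ‖ ^ 2 ≤ x → ‖φ‖ ^ 2 ≤ y →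
      ‖mulV a b ψ (H10.dx φ)‖ ^ 2 ≤ c ^ 2 * (x * y) := by
    intro ψ φ x y hx hy
    have h1 := (hc ψ (H10.dx φ)).trans (mul_le_mul_of_nonneg_left (H10.norm_dx_le φ) (by positivity))
    calc _ ≤ (c * ‖ψ‖ * ‖φ‖) ^ 2 := pow_le_pow_left₀ (norm_nonneg _) h1 2
      _ = c ^ 2 * (‖ψ‖ ^ 2 * ‖φ‖ ^ 2) := by ring
      _ ≤ _ := by
        have : 0 ≤ x := (sq_nonneg _).trans hx
        gcongr
  rw [e, norm_smul, mul_pow, norm_neg, Real.norm_eq_abs, sq_abs]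
  have h1 := hb _ _ hz (le_refl (‖S.w t‖ ^ 2))
  have h2 := hb _ _ (le_refl (‖S'.z t‖ ^ 2)) hw
  have h3 := hb _ _ hθ (le_refl (‖S.vV t‖ ^ 2))
  have h4 := hb _ _ (le_refl (‖S'.θ t‖ ^ 2)) hv
  refine (mul_le_mul_of_nonneg_left ((norm_sq_add_le _ _).trans
    (add_le_add (mul_le_mul_of_nonneg_left (norm_sq_add_le _ _) zero_le_two)
      (mul_le_mul_of_nonneg_left (norm_sq_add_le _ _) zero_le_two))) (sq_nonneg μ)).trans ?_
  have h5 := mul_le_mul_of_nonneg_left (add_le_add (add_le_add h1 h2) (add_le_add h3 h4))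
    (by positivity : 0 ≤ 4 * μ ^ 2)
  refine le_trans (le_of_eq ?_) (h5.trans (le_of_eq ?_)) <;> ring

theorem norm_sq_nextK_sub_le (S S' : LinSol hab D T) {d t : ℝ}
    (hz : ‖S.z t - S'.z t‖ ^ 2 ≤ d) (hv : ‖S.v t - S'.v t‖ ^ 2 ≤ d)
    (hf : ‖S.f t - S'.f t‖ ^ 2 ≤ d) :
    ‖S.nextK t - S'.nextK t‖ ^ 2 ≤ (8 * ν⁻¹ ^ 2 + 2 * μ ^ 2) * d := by
  have e : S.nextK t - S'.nextK t = ν⁻¹ • ((S.v t - S'.v t) - (S.f t - S'.f t))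
      - μ • Sob.D 1 (S.z t - S'.z t) := by
    simp only [nextK, map_sub]
    module
  rw [e]
  refine (norm_sq_sub_le _ _).trans ?_
  rw [norm_smul, norm_smul, mul_pow, mul_pow, Real.norm_eq_abs, Real.norm_eq_abs, sq_abs, sq_abs]
  have h1 := norm_sq_sub_le (S.v t - S'.v t) (S.f t - S'.f t)
  have h2 := (pow_le_pow_left₀ (norm_nonneg _) (Sob.norm_D1_le (S.z t - S'.z t)) 2).trans hz
  calc _ ≤ 2 * (ν⁻¹ ^ 2 * (2 * d + 2 * d)) + 2 * (μ ^ 2 * d) := by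
        gcongr
        exact h1.trans (by gcongr)
    _ = _ := by ring

end LinSol

theorem Data.exists_bound (D : Data a b μ ν) : ∃ M, D.Bound M := by
  have h1 := norm_nonneg D.θ₀
  have h2 := norm_nonneg D.z₀
  have h3 := norm_nonneg D.u₀
  have h4 := norm_nonneg D.u₁
  have h5 := norm_nonneg D.v₀
  have h6 := norm_nonneg D.f₀
  refine ⟨‖D.θ₀‖ + ‖D.z₀‖ + ‖D.u₀‖ + ‖D.u₁‖ + ‖D.v₀‖ + ‖D.f₀‖, ?_, ?_, ?_, ?_, ?_, ?_⟩ <;> linarith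

theorem norm_sq_le_of_sub {E : Type*} [NormedAddCommGroup E] {x y : E} {d : ℝ}
    (h : ‖x - y‖ ^ 2 ≤ d) : ‖x‖ ^ 2 ≤ 2 * ‖y‖ ^ 2 + 2 * d := by
  have := norm_sq_add_le (x - y) y
  rw [sub_add_cancel] at this
  linarith

set_option maxHeartbeats 1000000 in
/-- Global existence. -/
theorem exists_nonlin (hab : a < b) (hμ : 0 < μ) (hν : 0 < ν) {T : ℝ} (hT : 0 ≤ T)
    (D : Data a b μ ν) : ∃ S : LinSol hab D T, S.Nonlin := by
  have hG : ∀ F : Lp (L2 a b × L2 a b) 2 (timeMeasure T), MemLp (fun t => (F t).1) 2 (timeMeasure T) :=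
    fun F => (Lp.memLp F).fst
  have hK : ∀ F : Lp (L2 a b × L2 a b) 2 (timeMeasure T), MemLp (fun t => (F t).2) 2 (timeMeasure T) :=
    fun F => (Lp.memLp F).snd
  choose S hSG hSK using fun F => exists_linSol hab hν hT D (hG F) (hK F)
  have hm : ∀ F, MemLp (fun t => ((S F).nextG t, (S F).nextK t)) 2 (timeMeasure T) := fun F =>
    (memLp_prod_iff.2 ⟨(S F).memLp_nextG, (S F).memLp_nextK⟩)
  obtain ⟨c, hc0, hc⟩ := exists_lipschitz hab hν D hT
  obtain ⟨m, hm0, hmm⟩ := exists_mulV_bound a b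
  -- The unknown is the pair of sources `(G, K)`, as a square integrable function with values in `L²
  -- × L²`.
  obtain ⟨F, hF⟩ : ∃ F, (hm F).toLp _ = F := by
    refine exists_causal_fixedPoint hT (fun F => (hm F).toLp _) (fun ρ => ?_) ?_
    · set S₀ := S 0 with hS₀
      -- Comparison with the solution for zero sources: for sources in the ball of radius `ρ` each
      -- of the four square norms is at most twice that of `S₀` plus `2 c ρ²`.
      set κ : ℝ → ℝ := fun t => 2 * (‖S₀.w t‖ ^ 2 + ‖S₀.z t‖ ^ 2 + ‖S₀.vV t‖ ^ 2 + ‖S₀.θ t‖ ^ 2)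
        + 8 * (c * ρ ^ 2) with hκ
      have hκi : IntegrableOn κ (Ioc 0 T) := by
        have i1 : IntegrableOn (fun t => ‖S₀.w t‖ ^ 2) (Ioc 0 T) :=
          integrableOn_of_continuousOn (S₀.hasPrim_w.continuousOn.norm.pow 2)
        have i2 : IntegrableOn (fun t => ‖S₀.z t‖ ^ 2) (Ioc 0 T) :=
          integrableOn_of_continuousOn (S₀.continuous_z.norm.pow 2).continuousOn
        have i3 : IntegrableOn (fun t => ‖S₀.vV t‖ ^ 2) (Ioc 0 T) :=
          MemLp.integrableOn_norm_sq S₀.memV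
        have i4 : IntegrableOn (fun t => ‖S₀.θ t‖ ^ 2) (Ioc 0 T) :=
          integrableOn_of_continuousOn (S₀.continuous_θ.norm.pow 2).continuousOn
        exact ((((i1.add i2).add i3).add i4).const_mul 2).add
          (integrableOn_of_continuousOn continuousOn_const)
      refine ⟨fun t => 4 * μ ^ 2 * m ^ 2 * c * κ t + (8 * ν⁻¹ ^ 2 + 2 * μ ^ 2) * c, ?_, ?_, ?_⟩
      · exact Integrable.add (f := fun t => 4 * μ ^ 2 * m ^ 2 * c * κ t)
          (g := fun _ => (8 * ν⁻¹ ^ 2 + 2 * μ ^ 2) * c) (hκi.const_mul _)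
          (integrableOn_of_continuousOn continuousOn_const)
      · intro t
        positivity
      intro F F' hFρ hFρ'
      have hdiff : ∀ A B : Lp (L2 a b × L2 a b) 2 (timeMeasure T), ∀ᵐ t ∂volume.restrict (Ioc 0 T), _ :=
        fun A B => hc (S A) (S B) (fun t => A t - B t) ((Lp.memLp A).sub (Lp.memLp B))
          (fun t => by rw [hSG, hSG]; exact norm_fst_le (A t - B t))
          (fun t => by rw [hSK, hSK]; exact norm_snd_le (A t - B t))
      have hsmall : ∀ A : Lp (L2 a b × L2 a b) 2 (timeMeasure T), ‖A‖ ≤ ρ → ∀ t ∈ Icc 0 T,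
          c * ∫ s in (0 : ℝ)..t, ‖A s - (0 : Lp (L2 a b × L2 a b) 2 (timeMeasure T)) s‖ ^ 2
            ≤ c * ρ ^ 2 := by
        intro A hA t ht
        have h1 : ∫ s in (0 : ℝ)..t, ‖A s - (0 : Lp (L2 a b × L2 a b) 2 (timeMeasure T)) s‖ ^ 2
            ≤ ∫ s in (0 : ℝ)..t, ‖A s‖ ^ 2 :=
          integral_le_of_ae ht (MemLp.integrableOn_norm_sq ((Lp.memLp A).sub (Lp.memLp 0)))
            (MemLp.integrableOn_norm_sq (Lp.memLp A)) (by
              filter_upwards [ae_Ioc (Lp.coeFn_zero (L2 a b × L2 a b) 2 (timeMeasure T))] with s hs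
              rw [hs]; simp)
        have h2 := integral_sq_mono (MemLp.integrableOn_norm_sq (Lp.memLp A)) ht.1 ht.2 le_rfl
        rw [← lp_norm_sq_eq hT] at h2
        have h3 := pow_le_pow_left₀ (norm_nonneg _) hA 2
        gcongr
        linarith
      refine ae_time_of_Ioc ?_
      filter_upwards [hdiff F F', hdiff F 0, hdiff F' 0, ae_Ioc (hm F).coeFn_toLp,
        ae_Ioc (hm F').coeFn_toLp, ae_restrict_mem measurableSet_Ioc]
        with t h1 h2 h3 e1 e2 htm
      have ht := Ioc_subset_Icc_self htm
      obtain ⟨d1, d2, d3, d4, d5, d6⟩ := h1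
      rw [e1, e2]
      set δ := ∫ s in (0 : ℝ)..t, ‖F s - F' s‖ ^ 2 with hδ
      have hδ0 : 0 ≤ δ := integral_sq_nonneg ht.1 _
      have g1 := (S F).norm_sq_nextG_sub_le (S F') hm0 hmm d1 d2 d3 d4
      have g2 := (S F).norm_sq_nextK_sub_le (S F') d1 d5 d6
      have b1 := norm_sq_le_of_sub (h2.2.2.1.trans (hsmall F hFρ t ht))
      have b2 := norm_sq_le_of_sub (h2.2.2.2.1.trans (hsmall F hFρ t ht))
      have b3 := norm_sq_le_of_sub (h3.1.trans (hsmall F' hFρ' t ht))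
      have b4 := norm_sq_le_of_sub (h3.2.1.trans (hsmall F' hFρ' t ht))
      have b5 : ‖(S F).w t‖ ^ 2 + ‖(S F').z t‖ ^ 2 + ‖(S F).vV t‖ ^ 2 + ‖(S F').θ t‖ ^ 2 ≤ κ t := by
        simp only [hκ]; linarith
      have hp : ‖((S F).nextG t, (S F).nextK t) - ((S F').nextG t, (S F').nextK t)‖ ^ 2
          ≤ ‖(S F).nextG t - (S F').nextG t‖ ^ 2 + ‖(S F).nextK t - (S F').nextK t‖ ^ 2 := by
        rw [Prod.mk_sub_mk, Prod.norm_mk]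
        rcases max_choice ‖(S F).nextG t - (S F').nextG t‖ ‖(S F).nextK t - (S F').nextK t‖ with h | h
        · rw [h]; exact le_add_of_nonneg_right (sq_nonneg _)
        · rw [h]; exact le_add_of_nonneg_left (sq_nonneg _)
      have b6 := mul_le_mul_of_nonneg_left b5 (by positivity : 0 ≤ 4 * μ ^ 2 * m ^ 2 * (c * δ))
      calc _ ≤ _ := hp
        _ ≤ 4 * μ ^ 2 * m ^ 2 * (c * δ) * κ t + (8 * ν⁻¹ ^ 2 + 2 * μ ^ 2) * (c * δ) :=
          add_le_add (g1.trans b6) g2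
        _ = _ := by ring
    · obtain ⟨M, hM⟩ := D.exists_bound
      obtain ⟨C, hC0, hC⟩ := bound_integral_G hab hμ hν T M
      obtain ⟨C', hC0', hC'⟩ := bound_integral_K hab hμ hν T M
      refine ⟨1 * C + 1 * C', fun τ hτ F hF => ?_⟩
      -- Restricted to `(0,τ)` a local fixed point solves the nonlinear problem, so the uniform
      -- bounds, taken with `T₀ = T`, apply independently of `τ`.
      have hN : ((S F).restrict hτ.2).Nonlin := by
        have h1 := ae_timeMeasure_mono hτ.2 (hm F).coeFn_toLp
        constructor
        · filter_upwards [hF, h1] with t h2 h3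
          have h4 : F t = ((S F).nextG t, (S F).nextK t) := h2.symm.trans h3
          change (S F).G t = (S F).nextG t
          rw [hSG]
          exact congrArg Prod.fst h4
        · filter_upwards [hF, h1] with t h2 h3
          have h4 : F t = ((S F).nextG t, (S F).nextK t) := h2.symm.trans h3
          change (S F).K t = (S F).nextK t
          rw [hSK]
          exact congrArg Prod.snd h4
      have hτm : τ ∈ Icc 0 τ := ⟨hτ.1, le_rfl⟩
      have h1 := hC D hM τ hτ.2 _ hN τ hτm
      have h2 := hC' D hM τ hτ.2 _ hN τ hτm
      change ∫ s in (0 : ℝ)..τ, ‖(S F).G s‖ ^ 2 ≤ C at h1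
      change ∫ s in (0 : ℝ)..τ, ‖(S F).K s‖ ^ 2 ≤ C' at h2
      have iG : IntegrableOn (fun s => ‖(S F).G s‖ ^ 2) (Ioc 0 τ) :=
        (S F).integrableOn_G.mono_set (Ioc_subset_Ioc_right hτ.2)
      have iK : IntegrableOn (fun s => ‖(S F).K s‖ ^ 2) (Ioc 0 τ) :=
        (S F).integrableOn_K.mono_set (Ioc_subset_Ioc_right hτ.2)
      have h3 := integral_le_of_ae hτm (f := fun s => ‖F s‖ ^ 2)
        ((MemLp.integrableOn_norm_sq (Lp.memLp F)).mono_set (Ioc_subset_Ioc_right hτ.2))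
        (integrableOn_lincomb iG iK 1 1)
        (Eventually.of_forall fun s => by
          rw [hSG, hSK, one_mul, one_mul]
          change ‖F s‖ ^ 2 ≤ ‖(F s).1‖ ^ 2 + ‖(F s).2‖ ^ 2
          rw [Prod.norm_def]
          rcases max_choice ‖(F s).1‖ ‖(F s).2‖ with h | h
          · rw [h]; exact le_add_of_nonneg_right (sq_nonneg _)
          · rw [h]; exact le_add_of_nonneg_left (sq_nonneg _))
      rw [integral_lincomb hτm iG iK] at h3
      linarith
  refine ⟨S F, ?_, ?_⟩
  · filter_upwards [(hm F).coeFn_toLp] with t h3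
    rw [hF] at h3
    change (S F).G t = (S F).nextG t
    rw [hSG]
    exact congrArg Prod.fst h3
  · filter_upwards [(hm F).coeFn_toLp] with t h3
    rw [hF] at h3
    change (S F).K t = (S F).nextK t
    rw [hSK]
    exact congrArg Prod.snd h3

end ThermoVisco

namespace ThermoVisco

/-! ### Uniqueness of weak solutions -/

/-- A continuous function is a primitive of its weak time derivative. -/
theorem hasPrim_of_weakTimeDeriv {X : Type*} [NormedAddCommGroup X] [NormedSpace ℝ X]
    [CompleteSpace X] {T : ℝ} (hT : 0 < T) {w g c : ℝ → X} (hw : HasWeakTimeDeriv T w g)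
    (hg : MemLp g 2 (timeMeasure T)) (hc : ContinuousOn c (Icc 0 T))
    (hcw : ∀ᵐ t ∂timeMeasure T, c t = w t) : HasPrim T c g := by
  have hgi := MemLp.integrableOn hg
  have hP := HasPrim.of_integral (0 : X) hgi
  set P : ℝ → X := fun t => 0 + ∫ s in (0 : ℝ)..t, g s with hPdef
  have hP0 : P 0 = 0 := by simp [hPdef]
  have hd : ContinuousOn (fun t => c t - P t) (Icc 0 T) := hc.sub hP.continuousOn
  refine ⟨hgi, fun t ht => ?_⟩
  have key : c t - P t = c 0 - P 0 := by
    -- Functionals reduce the claim to real functions of time, where `eq_const_of_test` applies on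
    -- `(0,T)`; continuity upgrades equality almost everywhere.
    refine (SeparatingDual.eq_iff_forall_dual_eq (R := ℝ)).2 fun ℓ => ?_
    have hf : ContinuousOn (fun t => ℓ (c t - P t)) (Icc 0 T) := ℓ.continuous.comp_continuousOn hd
    have hfm : MemLp (fun t => ℓ (c t - P t)) 2 (timeMeasure T) := hf.memLp_timeMeasure 2
    obtain ⟨k, hk⟩ := eq_const_of_test hT (h := ofFun 0 T fun t => ℓ (c t - P t)) fun φ hφ => by
      rw [inner_ofFun hφ.memLp_deriv]
      have e1 : ∫ t in Ioo 0 T, (ofFun 0 T fun t => ℓ (c t - P t)) t * deriv φ t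
          = ∫ t in Ioo 0 T, ℓ (deriv φ t • (c t - P t)) := by
        refine integral_congr_ae ?_
        filter_upwards [coeFn_ofFun hfm] with t ht
        rw [ht, map_smul, smul_eq_mul, mul_comm]
      have hi : ∀ {y : ℝ → X}, ContinuousOn y (Icc 0 T) →
          Integrable (fun t => deriv φ t • y t) (timeMeasure T) := fun hy =>
        ((hφ.continuous_deriv.continuousOn.smul hy).memLp_timeMeasure 2).integrable (by norm_num)
      have e2 : ∫ t in Ioo 0 T, deriv φ t • (c t - P t) = 0 := by
        simp only [smul_sub]
        rw [integral_sub (hi hc) (hi hP.continuousOn), hP.weakTimeDeriv hT.le φ hφ]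
        have e3 : ∫ t in Ioo 0 T, deriv φ t • c t = ∫ t in Ioo 0 T, deriv φ t • w t := by
          refine integral_congr_ae ?_
          filter_upwards [hcw] with t ht
          rw [ht]
        rw [e3, hw φ hφ, sub_self]
      rw [e1, ContinuousLinearMap.integral_comp_comm ℓ (hi hd), e2, map_zero]
    have hae : (fun t => ℓ (c t - P t)) =ᵐ[volume.restrict (Icc 0 T)] fun _ => k := by
      rw [← restrict_Ioo_eq_restrict_Icc]
      filter_upwards [coeFn_ofFun hfm, Lp.coeFn_smul k (ofFun 0 T fun _ => 1),
        coeFn_ofFun_continuous (a := 0) (b := T) (continuous_const (y := (1 : ℝ)))] with t h1 h2 h3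
      rw [← h1, hk, h2, Pi.smul_apply, h3, smul_eq_mul, mul_one]
    have hE := Measure.eqOn_Icc_of_ae_eq volume hT.ne hae hf continuousOn_const
    exact (hE ht).trans (hE ⟨le_rfl, hT.le⟩).symm
  rw [hP0, sub_zero] at key
  rw [← key, hPdef]
  simp

variable {a b μ ν : ℝ}

/-- A weak solution, in integrated form, for the continuous representatives. -/
structure IntegratedSol (a b μ ν T : ℝ) (u₀ u₁ θ₀ : L2 a b) (u θ : ℝ → L2 a b) where
  U : ℝ → H10 a b
  p : ℝ → H10 a b
  W : ℝ → L2 a b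
  θc : ℝ → L2 a b
  θt : ℝ → L2 a b
  θV : ℝ → Sob a b 1
  hasPrim_U : HasPrim T U p
  U_zero : H10.toL2 (U 0) = u₀
  memp : MemLp p 2 (timeMeasure T)
  W_zero : W 0 = u₁
  toL2_p : ∀ᵐ t ∂timeMeasure T, H10.toL2 (p t) = W t
  wave : ∀ v : H10 a b, HasPrim T (fun t => inner ℝ (W t) (H10.toL2 v)) fun t =>
    -(inner ℝ (H10.dx (U t)) (H10.dx v) + ν * inner ℝ (H10.dx (p t)) (H10.dx v)
      + μ * inner ℝ (Sob.D 1 (θV t)) (H10.toL2 v))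
  hasPrim_θ : HasPrim T θc θt
  θ_zero : θc 0 = θ₀
  D0_θV : ∀ᵐ t ∂timeMeasure T, Sob.D 0 (θV t) = θc t
  heat : ∀ᵐ t ∂timeMeasure T, ∀ ψ : Sob a b 1, inner ℝ (θt t) (Sob.D 0 ψ)
    + inner ℝ (Sob.D 1 (θV t)) (Sob.D 1 ψ)
    + μ * inner ℝ (mulV a b (θV t) (H10.dx (p t))) (Sob.D 0 ψ) = 0
  u_eq : ∀ᵐ t ∂timeMeasure T, u t = H10.toL2 (U t)
  θ_eq : ∀ᵐ t ∂timeMeasure T, θ t = θc t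

/-- The embedding `L² → H⁻¹` as a continuous linear map. -/
def toHnegL (a b : ℝ) : L2 a b →L[ℝ] Hneg a b :=
  (ContinuousLinearMap.precomp ℝ H10.toL2).comp (innerSL ℝ)

theorem toHnegL_apply (f : L2 a b) : toHnegL a b f = L2.toHneg f := rfl

/-- The lower order part of an element of `H²`. -/
def Sob.low (ψ : Sob a b 2) : Sob a b 1 := mkSob (Sob.D 0 ψ) (Sob.D 1 ψ) (ψ.2 0)

/-- The derivative of `u_t` exists only in `H⁻¹`. Its continuous representative is thus first shown
to be a primitive there, and then paired with a fixed `v ∈ H¹₀`. -/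
theorem IsWeakSolution.integrated (hab : a < b) {T : ℝ} (hT : 0 < T) {u₀ u₁ θ₀ : L2 a b}
    {u θ : ℝ → L2 a b} (h : IsWeakSolution a b μ ν T u₀ u₁ θ₀ u θ) :
    Nonempty (IntegratedSol a b μ ν T u₀ u₁ θ₀ u θ) := by
  obtain ⟨V, U, A, Θ, H, hV, hU, hA, hAd, hΘ, hH, -, hwave, hheat, ⟨w₀, hw₀, c, hc1, hc2, hc3⟩,
    ⟨W, hW1, hW2, hW3⟩, ⟨θc, hθ1, hθ2, hθ3⟩⟩ := h
  have hc := hasPrim_of_weakTimeDeriv hT (hU.2.2 0 one_pos) (hU.2.1 1 le_rfl) hc1 hc2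
  have hθ := hasPrim_of_weakTimeDeriv hT (hΘ.2.2 0 one_pos) (hΘ.2.1 1 le_rfl) hθ1 (by
    filter_upwards [hθ2, hΘ.1] with t h1 h2
    rw [h1, ← h2]; rfl)
  have hW := hasPrim_of_weakTimeDeriv hT (c := fun t => toHnegL a b (W t)) hAd hA
    ((toHnegL a b).continuous.comp_continuousOn hW1) (by
      filter_upwards [hW2] with t ht
      rw [ht, toHnegL_apply])
  refine ⟨{ U := c, p := U 1, W := W, θc := θc, θt := Θ 1, θV := fun t => Sob.low (H 0 t)
            hasPrim_U := hc, U_zero := by rw [hc3, hw₀], memp := hU.2.1 1 le_rfl, W_zero := hW3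
            toL2_p := by filter_upwards [hW2] with t ht; exact ht.symm
            wave := fun v => ?_
            hasPrim_θ := hθ, θ_zero := hθ3
            D0_θV := ?_, heat := ?_, u_eq := ?_, θ_eq := ?_ }⟩
  · refine (hW.clm (ContinuousLinearMap.apply ℝ ℝ v)).congr_ae ?_
    filter_upwards [ae_Ioc hwave, ae_Ioc hc2] with t ht htc
    have h1 := ht v
    rw [← L2_inner_eq, ← L2_inner_eq, ← L2_inner_eq] at h1
    rw [htc]
    change A t v = -(_ + _ + μ * inner ℝ (Sob.D 1 (H 0 t)) (H10.toL2 v))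
    linarith
  · filter_upwards [hH.1, hθ2] with t h1 h2
    rw [h2, ← h1]; rfl
  · filter_upwards [hheat] with t ht ψ
    have h1 := ht ψ
    rw [← L2_inner_eq, ← L2_inner_eq] at h1
    rw [inner_mulV hab]
    exact h1
  · filter_upwards [hU.1, hc2] with t h1 h2
    rw [h2, h1]
  · filter_upwards [hθ2] with t h1
    exact h1.symm

namespace IntegratedSol

variable {hab : a < b} {D : Data a b μ ν} {T : ℝ} {u θ : ℝ → L2 a b}

/-- The differences satisfy a heat equation for the velocity with zero data and a source in
divergence form. Moving the derivative of the temperature difference onto the test function leaves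
only its `L²` norm in the bound. -/
theorem wave_sub_le (hν : 0 < ν) (I : IntegratedSol a b μ ν T (H10.toL2 D.u₀) (H10.toL2 D.u₁)
    (Sob.D 0 D.θ₀) u θ) {S : LinSol hab D T} (hS : S.Nonlin) {t : ℝ} (ht : t ∈ Icc 0 T) :
    ∫ s in (0 : ℝ)..t, ‖H10.dx (I.p s - S.w s)‖ ^ 2
      ≤ (2 * ν⁻¹ ^ 2) * (∫ s in (0 : ℝ)..t, ‖H10.dx (I.U s - S.u s)‖ ^ 2)
        + (2 * ν⁻¹ ^ 2 * μ ^ 2) * ∫ s in (0 : ℝ)..t, ‖I.θc s - Sob.D 0 (S.θ s)‖ ^ 2 := by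
  set N := dirichlet hab with hN
  have hUc : ContinuousOn (fun s => H10.dx (I.U s - S.u s)) (Icc 0 T) :=
    H10.dx.continuous.comp_continuousOn (I.hasPrim_U.sub S.hasPrim_u).continuousOn
  have hθc : ContinuousOn (fun s => I.θc s - Sob.D 0 (S.θ s)) (Icc 0 T) :=
    I.hasPrim_θ.continuousOn.sub ((Sob.D 0).continuous.comp S.continuous_θ).continuousOn
  set h : ℝ → L2 a b := fun s => μ • (I.θc s - Sob.D 0 (S.θ s)) - H10.dx (I.U s - S.u s) with hh
  have hhc : ContinuousOn h (Icc 0 T) := (hθc.const_smul μ).sub hUc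
  have hwm : MemLp S.w 2 (timeMeasure T) := S.hasPrim_w.continuousOn.memLp_timeMeasure 2
  have hm : N.ModeEq ν T (fun t => I.W t - H10.toL2 (S.w t))
      (fun n t => inner ℝ (N.D (N.e n)) (h t)) := by
    intro n
    have h1 := I.wave (N.e n)
    have h2 := S.hasPrim_toL2_w.clm (innerSL ℝ (H10.toL2 (N.e n)))
    refine ((h1.sub h2).congr_left fun s _ => ?_).congr_ae ?_
    · change inner ℝ (H10.toL2 (N.e n)) (I.W s - H10.toL2 (S.w s))
        = inner ℝ (I.W s) (H10.toL2 (N.e n)) - inner ℝ (H10.toL2 (N.e n)) (H10.toL2 (S.w s))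
      rw [inner_sub_right, real_inner_comm]
    · filter_upwards [ae_Ioc I.D0_θV, ae_Ioc I.toL2_p, ae_restrict_mem measurableSet_Ioc]
        with s h3 h4 hsm
      have e1 := hS.wave hν (Ioc_subset_Icc_self hsm) (N.e n)
      have e2 := N.inner_D n (I.p s - S.w s)
      have e3 := H10.ibp (N.e n) (I.θV s - S.θ s)
      change inner ℝ (H10.dx (N.e n)) (H10.dx (I.p s - S.w s))
        = N.eig n * inner ℝ (N.ι (N.e n)) (H10.toL2 (I.p s - S.w s)) at e2
      rw [map_sub, map_sub, h4] at e2
      rw [map_sub, map_sub, h3] at e3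
      change -(inner ℝ (H10.dx (I.U s)) (H10.dx (N.e n))
        + ν * inner ℝ (H10.dx (I.p s)) (H10.dx (N.e n))
        + μ * inner ℝ (Sob.D 1 (I.θV s)) (H10.toL2 (N.e n))) - inner ℝ (H10.toL2 (N.e n)) (S.v s)
        = inner ℝ (H10.dx (N.e n)) (h s)
          - ν * N.eig n * inner ℝ (N.ι (N.e n)) (I.W s - H10.toL2 (S.w s))
      rw [mul_assoc, ← e2]
      simp only [hh, map_sub, inner_sub_right, real_inner_smul_right] at e3 ⊢
      rw [real_inner_comm (H10.dx (N.e n)) (H10.dx (I.U s)),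
        real_inner_comm (H10.dx (N.e n)) (H10.dx (I.p s)),
        real_inner_comm (H10.toL2 (N.e n)) (Sob.D 1 (I.θV s))]
      rw [real_inner_comm (H10.toL2 (N.e n)) (S.v s), real_inner_comm (H10.dx (N.e n)) (H10.dx (S.u s)),
        real_inner_comm (H10.dx (N.e n)) (H10.dx (S.w s)),
        real_inner_comm (H10.toL2 (N.e n)) (Sob.D 1 (S.θ s))] at e1
      linear_combination -e1 - μ * e3
  have h1 := N.energy_le hν (Y := fun t => I.p t - S.w t) (I.memp.sub hwm) (by
    filter_upwards [I.toL2_p] with s hs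
    rw [map_sub]
    exact congrArg₂ _ hs rfl) (hhc.memLp_timeMeasure 2) hm ht
  simp only [I.W_zero, S.w_zero, sub_self, norm_zero, ne_eq, OfNat.ofNat_ne_zero,
    not_false_eq_true, zero_pow, zero_add] at h1
  have iU : IntegrableOn (fun s => ‖H10.dx (I.U s - S.u s)‖ ^ 2) (Ioc 0 T) :=
    integrableOn_of_continuousOn (hUc.norm.pow 2)
  have iθ : IntegrableOn (fun s => ‖I.θc s - Sob.D 0 (S.θ s)‖ ^ 2) (Ioc 0 T) :=
    integrableOn_of_continuousOn (hθc.norm.pow 2)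
  have h2 : ∫ s in (0 : ℝ)..t, ‖h s‖ ^ 2 ≤ ∫ s in (0 : ℝ)..t, (2 * ‖H10.dx (I.U s - S.u s)‖ ^ 2
      + 2 * μ ^ 2 * ‖I.θc s - Sob.D 0 (S.θ s)‖ ^ 2) :=
    integral_le_of_ae ht (integrableOn_of_continuousOn (hhc.norm.pow 2))
      (integrableOn_lincomb iU iθ _ _) (Eventually.of_forall fun s => by
        have := norm_sq_sub_le (μ • (I.θc s - Sob.D 0 (S.θ s))) (H10.dx (I.U s - S.u s))
        rw [norm_smul, mul_pow, Real.norm_eq_abs, sq_abs] at this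
        simp only [hh]
        linarith)
  rw [integral_lincomb ht iU iθ] at h2
  have h3 : ν * ∫ s in (0 : ℝ)..t, ‖H10.dx (I.p s - S.w s)‖ ^ 2
      ≤ ν⁻¹ * ∫ s in (0 : ℝ)..t, ‖h s‖ ^ 2 := le_trans (le_add_of_nonneg_left (sq_nonneg _)) h1
  have h4 := mul_le_mul_of_nonneg_left h3 (inv_nonneg.2 hν.le)
  rw [inv_mul_cancel_left₀ hν.ne'] at h4
  have h5 := mul_le_mul_of_nonneg_left h2 (by positivity : 0 ≤ ν⁻¹ * ν⁻¹)
  refine h4.trans (le_trans (le_of_eq (by ring)) (h5.trans (le_of_eq (by ring))))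

end IntegratedSol

end ThermoVisco

namespace ThermoVisco

variable {a b μ ν : ℝ}

/-- All Dirichlet eigenvalues are positive. -/
theorem H10.eq_zero_of_dx (hab : a < b) {v : H10 a b} (h : H10.dx v = 0) : v = 0 := by
  refine H10.toL2_injective ?_
  rw [map_zero]
  refine (dirichlet hab).complete _ fun n => ?_
  have h1 := (dirichlet hab).inner_D n v
  change inner ℝ (H10.dx ((dirichlet hab).e n)) (H10.dx v) = freq a b (n + 1) ^ 2 *
    inner ℝ ((dirichlet hab).ι ((dirichlet hab).e n)) (H10.toL2 v) at h1
  rw [h, inner_zero_right] at h1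
  exact (mul_eq_zero.1 h1.symm).resolve_left (pow_ne_zero 2 (freq_pos hab n.succ_ne_zero).ne')

namespace IntegratedSol

variable {hab : a < b} {D : Data a b μ ν} {T : ℝ} {u θ : ℝ → L2 a b}

set_option maxHeartbeats 1000000 in
-- The difference of the heat equations is tested with the temperature difference. The strain rate
-- `I.p` of the weak solution is only square integrable in time with values in `H¹₀`, so its square
-- norm must appear as a Grönwall kernel.
theorem heat_sub_le (hμ : 0 < μ) (I : IntegratedSol a b μ ν T (H10.toL2 D.u₀) (H10.toL2 D.u₁)
    (Sob.D 0 D.θ₀) u θ) {S : LinSol hab D T} (hS : S.Nonlin) : ∃ B d : ℝ, 0 ≤ B ∧ 0 ≤ d ∧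
    ∀ t ∈ Icc 0 T, ‖I.θc t - Sob.D 0 (S.θ t)‖ ^ 2
      ≤ (∫ s in (0 : ℝ)..t, (B + d * ‖H10.dx (I.p s)‖ ^ 2) * ‖I.θc s - Sob.D 0 (S.θ s)‖ ^ 2)
        + ∫ s in (0 : ℝ)..t, ‖H10.dx (I.p s - S.w s)‖ ^ 2 := by
  obtain ⟨c, hc0, hc⟩ := exists_mulV_bound a b
  obtain ⟨E, hE⟩ := isCompact_Icc.exists_bound_of_continuousOn (S.continuous_θ.continuousOn (s := Icc 0 T))
  refine ⟨1 + (μ * c * E) ^ 2, (μ * c) ^ 2, by positivity, by positivity, fun t ht => ?_⟩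
  have hy := (I.hasPrim_θ.sub (S.hasPrim_θ.clm (Sob.D 0))).norm_sq
  have hwm : MemLp S.w 2 (timeMeasure T) := S.hasPrim_w.continuousOn.memLp_timeMeasure 2
  have iq : IntegrableOn (fun s => ‖H10.dx (I.p s - S.w s)‖ ^ 2) (Ioc 0 T) :=
    MemLp.integrableOn_norm_sq (H10.dx.comp_memLp' (I.memp.sub hwm))
  have ip : IntegrableOn (fun s => ‖H10.dx (I.p s)‖ ^ 2) (Ioc 0 T) :=
    MemLp.integrableOn_norm_sq (H10.dx.comp_memLp' I.memp)
  have ik : IntegrableOn (fun s => (1 + (μ * c * E) ^ 2 + (μ * c) ^ 2 * ‖H10.dx (I.p s)‖ ^ 2)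
      * ‖I.θc s - Sob.D 0 (S.θ s)‖ ^ 2) (Ioc 0 T) := by
    obtain ⟨C, hC⟩ := isCompact_Icc.exists_bound_of_continuousOn hy.continuousOn
    refine Integrable.mul_bdd (c := C) (integrableOn_affine ip _ _)
      ((hy.continuousOn.mono Ioc_subset_Icc_self).aestronglyMeasurable measurableSet_Ioc) ?_
    filter_upwards [ae_restrict_mem measurableSet_Ioc] with s hs
    exact hC s (Ioc_subset_Icc_self hs)
  have h1 := hy.le_add_integral ht (integrableOn_lincomb ik iq 1 1) (by
    filter_upwards [ae_Ioc I.heat, ae_Ioc I.D0_θV, ae_restrict_mem measurableSet_Ioc]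
      with s h1 h2 hsm
    have hs := Ioc_subset_Icc_self hsm
    set ψ := I.θV s - S.θ s with hψ
    have eψ : Sob.D 0 ψ = I.θc s - Sob.D 0 (S.θ s) := by rw [hψ, map_sub, h2]
    have e1 := h1 ψ
    have e2 := hS.heat hs ψ
    -- The splitting pairs the strain rate difference with the regular temperature, whose `H¹` norm
    -- is bounded by `E`. The other term contains the full `H¹` norm of `ψ`, whose gradient part is
    -- absorbed by diffusion.
    have e3 : mulV a b (I.θV s) (H10.dx (I.p s)) = mulV a b (S.θ s) (H10.dx (S.w s))
        + mulV a b ψ (H10.dx (I.p s)) + mulV a b (S.θ s) (H10.dx (I.p s - S.w s)) := by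
      simp only [hψ, map_sub, _root_.sub_apply]; abel
    have e4 : Sob.D 1 (I.θV s) = Sob.D 1 (S.θ s) + Sob.D 1 ψ := by rw [hψ, map_sub]; abel
    rw [e3, e4, inner_add_left, inner_add_left, inner_add_left, real_inner_self_eq_norm_sq] at e1
    rw [← eψ, inner_sub_left]
    have hn := Sob.norm_sq ψ
    have f1 := (neg_le_abs _).trans ((abs_real_inner_le_norm (mulV a b ψ (H10.dx (I.p s)))
      (Sob.D 0 ψ)).trans (mul_le_mul_of_nonneg_right (hc ψ (H10.dx (I.p s))) (norm_nonneg _)))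
    have f2 := (neg_le_abs _).trans ((abs_real_inner_le_norm
      (mulV a b (S.θ s) (H10.dx (I.p s - S.w s))) (Sob.D 0 ψ)).trans (mul_le_mul_of_nonneg_right
        (hc (S.θ s) (H10.dx (I.p s - S.w s))) (norm_nonneg _)))
    have f3 : c * ‖S.θ s‖ * ‖H10.dx (I.p s - S.w s)‖ * ‖Sob.D 0 ψ‖
        ≤ c * E * ‖H10.dx (I.p s - S.w s)‖ * ‖Sob.D 0 ψ‖ := by
      have := hE s hs
      gcongr
    have f1' := mul_le_mul_of_nonneg_left f1 hμ.le
    have f2' := mul_le_mul_of_nonneg_left (f2.trans f3) hμ.le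
    set P := ‖H10.dx (I.p s)‖
    set Q := ‖H10.dx (I.p s - S.w s)‖
    set Y := ‖Sob.D 0 ψ‖
    set Z := ‖ψ‖
    have g1 := sq_nonneg (Z - μ * c * P * Y)
    have g2 := sq_nonneg (Q - μ * c * E * Y)
    linarith [sq_nonneg ‖Sob.D 1 ψ‖])
  rw [integral_lincomb ht ik iq] at h1
  have h0 : I.θc 0 - Sob.D 0 (S.θ 0) = 0 := by rw [I.θ_zero, S.θ_zero, sub_self]
  rw [h0, norm_zero] at h1
  linarith

set_option maxHeartbeats 1000000 in
-- Grönwall with zero initial value for the sum of the square norms of the strain and temperature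
-- differences.
theorem eq_of_nonlin (hμ : 0 < μ) (hν : 0 < ν) (I : IntegratedSol a b μ ν T (H10.toL2 D.u₀)
    (H10.toL2 D.u₁) (Sob.D 0 D.θ₀) u θ) {S : LinSol hab D T} (hS : S.Nonlin) {t : ℝ}
    (ht : t ∈ Icc 0 T) : I.U t = S.u t ∧ I.θc t = Sob.D 0 (S.θ t) := by
  have hT : 0 ≤ T := ht.1.trans ht.2
  obtain ⟨B, d, hB, hd, hI⟩ := I.heat_sub_le hμ hS
  have hU := (I.hasPrim_U.sub S.hasPrim_u).clm H10.dx
  have hU0 : I.U 0 = S.u 0 := H10.toL2_injective (by rw [I.U_zero, S.u_zero])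
  have hθc : ContinuousOn (fun s => I.θc s - Sob.D 0 (S.θ s)) (Icc 0 T) :=
    I.hasPrim_θ.continuousOn.sub ((Sob.D 0).continuous.comp S.continuous_θ).continuousOn
  have hwm : MemLp S.w 2 (timeMeasure T) := S.hasPrim_w.continuousOn.memLp_timeMeasure 2
  have hqm : MemLp (fun s => H10.dx (I.p s - S.w s)) 2 (timeMeasure T) :=
    H10.dx.comp_memLp' (I.memp.sub hwm)
  have ip : IntegrableOn (fun s => ‖H10.dx (I.p s)‖ ^ 2) (Ioc 0 T) :=
    MemLp.integrableOn_norm_sq (H10.dx.comp_memLp' I.memp)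
  set X : ℝ → ℝ := fun s => ‖H10.dx (I.U s - S.u s)‖ ^ 2 with hX
  set Y : ℝ → ℝ := fun s => ‖I.θc s - Sob.D 0 (S.θ s)‖ ^ 2 with hY
  have hXc : ContinuousOn X (Icc 0 T) := hU.continuousOn.norm.pow 2
  have hYc : ContinuousOn Y (Icc 0 T) := hθc.norm.pow 2
  have hX0 : ∀ s, 0 ≤ X s := fun s => sq_nonneg _
  have hY0 : ∀ s, 0 ≤ Y s := fun s => sq_nonneg _
  set α := 2 * ν⁻¹ ^ 2 with hα
  set β := 2 * ν⁻¹ ^ 2 * μ ^ 2 with hβ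
  have hα0 : 0 ≤ α := by positivity
  have hβ0 : 0 ≤ β := by positivity
  -- The strain rate difference is integrated with weight `T` in the bound of `X` and `1` in that of
  -- `Y`; `wave_sub_le` replaces it by `α X + β Y`, whence `(1 + T) (α + β)`.
  set k : ℝ → ℝ := fun s => (B + (1 + T) * (α + β)) + d * ‖H10.dx (I.p s)‖ ^ 2 with hk
  have hk0 : ∀ s, 0 ≤ k s := fun s => by positivity
  have hki : IntegrableOn k (Ioc 0 T) := integrableOn_affine ip _ _
  have hkey : ∀ t ∈ Icc 0 T, X t + Y t ≤ 0 + ∫ s in (0 : ℝ)..t, k s * (X s + Y s) := by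
    intro t ht
    have h1 := hI t ht
    have h2 := I.wave_sub_le hν hS ht
    have h3 : X t ≤ T * ∫ s in (0 : ℝ)..t, ‖H10.dx (I.p s - S.w s)‖ ^ 2 := by
      have e := hU.eq t ht
      rw [hU0, sub_self, map_zero, zero_add] at e
      simp only [hX]
      rw [e]
      exact (sq_norm_integral_le ht.1 (hqm.mono_measure (timeMeasure_mono ht.2))).trans
        (mul_le_mul_of_nonneg_right ht.2 (integral_sq_nonneg ht.1 _))
    have iX := integrableOn_of_continuousOn hXc
    have iY := integrableOn_of_continuousOn hYc
    have ibd : ∀ {Z : ℝ → ℝ} {e : ℝ}, ContinuousOn Z (Icc 0 T) →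
        IntegrableOn (fun s => (e + d * ‖H10.dx (I.p s)‖ ^ 2) * Z s) (Ioc 0 T) := by
      intro Z e hZ
      obtain ⟨C, hC⟩ := isCompact_Icc.exists_bound_of_continuousOn hZ
      refine Integrable.mul_bdd (c := C) (integrableOn_affine ip _ _)
        ((hZ.mono Ioc_subset_Icc_self).aestronglyMeasurable measurableSet_Ioc) ?_
      filter_upwards [ae_restrict_mem measurableSet_Ioc] with s hs
      exact hC s (Ioc_subset_Icc_self hs)
    have i1 : IntegrableOn (fun s => (B + d * ‖H10.dx (I.p s)‖ ^ 2) * Y s) (Ioc 0 T) := ibd hYc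
    have i2 : IntegrableOn (fun s => α * X s + β * Y s) (Ioc 0 T) := integrableOn_lincomb iX iY _ _
    have h4 : (∫ s in (0 : ℝ)..t, (1 * ((B + d * ‖H10.dx (I.p s)‖ ^ 2) * Y s)
        + (1 + T) * (α * X s + β * Y s))) ≤ ∫ s in (0 : ℝ)..t, k s * (X s + Y s) := by
      refine integral_le_of_ae ht (integrableOn_lincomb i1 i2 _ _) (ibd (hXc.add hYc))
        (Eventually.of_forall fun s => ?_)
      simp only [hk]
      have e1 := mul_nonneg (mul_nonneg (by positivity : 0 ≤ 1 + T) hα0) (hY0 s)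
      have e2 := mul_nonneg (mul_nonneg (by positivity : 0 ≤ 1 + T) hβ0) (hX0 s)
      have e3 := mul_nonneg hB (hX0 s)
      have e4 := mul_nonneg (mul_nonneg hd (sq_nonneg ‖H10.dx (I.p s)‖)) (hX0 s)
      linarith
    rw [integral_lincomb ht i1 i2, integral_lincomb ht iX iY] at h4
    have h5 := mul_le_mul_of_nonneg_left h2 (by positivity : 0 ≤ 1 + T)
    change Y t ≤ _ at h1
    linarith
  have hG := gronwall_integral (hXc.add hYc) hki hk0 hkey t ht
  rw [zero_mul] at hG
  change X t + Y t ≤ 0 at hG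
  have e1 : X t = 0 := le_antisymm (by linarith [hY0 t]) (hX0 t)
  have e2 : Y t = 0 := le_antisymm (by linarith [hX0 t]) (hY0 t)
  exact ⟨sub_eq_zero.1 (H10.eq_zero_of_dx hab (norm_eq_zero.1 (pow_eq_zero_iff two_ne_zero |>.1 e1))),
    sub_eq_zero.1 (norm_eq_zero.1 (pow_eq_zero_iff two_ne_zero |>.1 e2))⟩

end IntegratedSol

theorem IsWeakSolution.eq_nonlin {hab : a < b} (hμ : 0 < μ) (hν : 0 < ν) {T : ℝ} (hT : 0 < T)
    {D : Data a b μ ν} {S : LinSol hab D T} (hS : S.Nonlin) {u θ : ℝ → L2 a b}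
    (h : IsWeakSolution a b μ ν T (H10.toL2 D.u₀) (H10.toL2 D.u₁) (Sob.D 0 D.θ₀) u θ) :
    ∀ᵐ t ∂timeMeasure T, u t = H10.toL2 (S.u t) ∧ θ t = Sob.D 0 (S.θ t) := by
  obtain ⟨I⟩ := h.integrated hab hT
  filter_upwards [I.u_eq, I.θ_eq, ae_restrict_mem measurableSet_Ioo] with t h1 h2 ht
  have h3 := I.eq_of_nonlin hμ hν hS (Ioo_subset_Icc_self ht)
  rw [h1, h2, h3.1, h3.2]
  exact ⟨rfl, rfl⟩

end ThermoVisco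

namespace ThermoVisco

/-! ### The nonlinear solution as a weak solution -/

variable {a b μ ν : ℝ}

/-- The element `(ψ, ψ', y)` of `H²`, where `ψ'' = y`. -/
def mkSob2 (ψ y : Sob a b 1) (h : HasWeakDeriv (Sob.D 1 ψ) (Sob.D 0 y)) : Sob a b 2 :=
  ⟨WithLp.toLp 2 ![Sob.D 0 ψ, Sob.D 1 ψ, Sob.D 0 y], fun j => by
    fin_cases j
    · exact Sob.hasWeakDeriv ψ
    · exact h⟩

/-- The element `(ψ, ψ', y, y')` of `H³`, where `ψ'' = y`. -/
def mkSob3 (ψ y : Sob a b 1) (h : HasWeakDeriv (Sob.D 1 ψ) (Sob.D 0 y)) : Sob a b 3 :=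
  ⟨WithLp.toLp 2 ![Sob.D 0 ψ, Sob.D 1 ψ, Sob.D 0 y, Sob.D 1 y], fun j => by
    fin_cases j
    · exact Sob.hasWeakDeriv ψ
    · exact h
    · exact Sob.hasWeakDeriv y⟩

theorem continuous_mkSob2 {α : Type*} [TopologicalSpace α] {ψ y : α → Sob a b 1}
    (hψ : Continuous ψ) (hy : Continuous y)
    (h : ∀ t, HasWeakDeriv (Sob.D 1 (ψ t)) (Sob.D 0 (y t))) :
    Continuous fun t => mkSob2 (ψ t) (y t) (h t) := by
  refine Continuous.subtype_mk ((PiLp.continuous_toLp 2 _).comp (continuous_pi fun i => ?_)) _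
  fin_cases i
  · exact (Sob.D 0).continuous.comp hψ
  · exact (Sob.D 1).continuous.comp hψ
  · exact (Sob.D 0).continuous.comp hy

theorem continuous_mkSob3 {α : Type*} [TopologicalSpace α] {ψ y : α → Sob a b 1}
    (hψ : Continuous ψ) (hy : Continuous y)
    (h : ∀ t, HasWeakDeriv (Sob.D 1 (ψ t)) (Sob.D 0 (y t))) :
    Continuous fun t => mkSob3 (ψ t) (y t) (h t) := by
  refine Continuous.subtype_mk ((PiLp.continuous_toLp 2 _).comp (continuous_pi fun i => ?_)) _
  fin_cases i
  · exact (Sob.D 0).continuous.comp hψ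
  · exact (Sob.D 1).continuous.comp hψ
  · exact (Sob.D 0).continuous.comp hy
  · exact (Sob.D 1).continuous.comp hy

theorem norm_sq_mkSob3 (ψ y : Sob a b 1) (h : HasWeakDeriv (Sob.D 1 ψ) (Sob.D 0 y)) :
    ‖mkSob3 ψ y h‖ ^ 2 = ‖ψ‖ ^ 2 + ‖y‖ ^ 2 := by
  have : ‖mkSob3 ψ y h‖ = ‖(mkSob3 ψ y h : PiLp 2 (fun _ : Fin (3 + 1) => L2 a b))‖ := rfl
  rw [this, PiLp.norm_sq_eq_of_L2, Sob.norm_sq, Sob.norm_sq, Fin.sum_univ_four]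
  change ‖Sob.D 0 ψ‖ ^ 2 + ‖Sob.D 1 ψ‖ ^ 2 + ‖Sob.D 0 y‖ ^ 2 + ‖Sob.D 1 y‖ ^ 2 = _
  ring

theorem exists_mulSob_bound (hab : a < b) : ∃ c : ℝ, 0 ≤ c ∧ ∀ ψ χ : Sob a b 1,
    ‖mulSob hab ψ χ‖ ≤ c * ‖ψ‖ * ‖χ‖ := by
  obtain ⟨c, hc0, hc⟩ := exists_mulV_bound a b
  -- One term for the product and two for its derivative: `1² + 2² ≤ 3²`.
  refine ⟨3 * c, by positivity, fun ψ χ => ?_⟩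
  have h1 := (hc ψ (Sob.D 0 χ)).trans
    (mul_le_mul_of_nonneg_left (Sob.norm_D0_le χ) (by positivity))
  have h2 := (hc ψ (Sob.D 1 χ)).trans
    (mul_le_mul_of_nonneg_left (Sob.norm_D1_le χ) (by positivity))
  have h3 := (hc χ (Sob.D 1 ψ)).trans
    (mul_le_mul_of_nonneg_left (Sob.norm_D1_le ψ) (by positivity))
  have h4 := norm_add_le (mulV a b ψ (Sob.D 1 χ)) (mulV a b χ (Sob.D 1 ψ))
  have h5 := Sob.norm_sq (mulSob hab ψ χ)
  have e0 : Sob.D 0 (mulSob hab ψ χ) = mulV a b ψ (Sob.D 0 χ) := rfl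
  have e1 : Sob.D 1 (mulSob hab ψ χ) = mulV a b ψ (Sob.D 1 χ) + mulV a b χ (Sob.D 1 ψ) := rfl
  have h6 : 0 ≤ c * ‖ψ‖ * ‖χ‖ := by positivity
  rw [e0, e1] at h5
  have h7 := pow_le_pow_left₀ (norm_nonneg _) h1 2
  have h8 := pow_le_pow_left₀ (norm_nonneg _)
    (h4.trans (by linarith : _ ≤ 2 * (c * ‖ψ‖ * ‖χ‖))) 2
  refine (sq_le_sq₀ (norm_nonneg _) (by positivity)).1 ?_
  nlinarith

/-- The projection onto `[0,T]`. -/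
def clamp (T t : ℝ) : ℝ := max 0 (min t T)

theorem continuous_clamp (T : ℝ) : Continuous (clamp T) := by unfold clamp; fun_prop

theorem clamp_mem {T : ℝ} (hT : 0 ≤ T) (t : ℝ) : clamp T t ∈ Icc 0 T :=
  ⟨le_max_left _ _, max_le hT (min_le_right _ _)⟩

theorem clamp_eq {T t : ℝ} (ht : t ∈ Icc 0 T) : clamp T t = t := by
  rw [clamp, min_eq_left ht.2, max_eq_right ht.1]

theorem eLpNorm_two_le {E : Type*} [NormedAddCommGroup E] {T C : ℝ} (hT : 0 ≤ T) {f : ℝ → E}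
    (hf : MemLp f 2 (timeMeasure T)) (h : ∫ t in (0 : ℝ)..T, ‖f t‖ ^ 2 ≤ C) :
    eLpNorm f 2 (timeMeasure T) ≤ ENNReal.ofReal √C := by
  rw [hf.eLpNorm_eq_integral_rpow_norm (by norm_num) (by norm_num)]
  refine ENNReal.ofReal_le_ofReal ?_
  simp only [ENNReal.toReal_ofNat, Real.rpow_two]
  rw [← integral_Ioc_eq_integral_Ioo, ← intervalIntegral.integral_of_le hT, ← one_div,
    ← Real.sqrt_eq_rpow]
  exact Real.sqrt_le_sqrt h

theorem eLpNorm_two_le_of_sup {E : Type*} [NormedAddCommGroup E] {T C : ℝ} (hT : 0 ≤ T) {f : ℝ → E}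
    (hf : ContinuousOn f (Icc 0 T)) (h : ∀ t ∈ Icc 0 T, ‖f t‖ ^ 2 ≤ C) :
    eLpNorm f 2 (timeMeasure T) ≤ ENNReal.ofReal √(T * C) := by
  refine eLpNorm_two_le hT (hf.memLp_timeMeasure 2) ?_
  have h1 := integral_le_of_ae (t := T) ⟨hT, le_rfl⟩ (integrableOn_of_continuousOn (hf.norm.pow 2))
    (g := fun _ => C) (integrableOn_of_continuousOn continuousOn_const) (by
      filter_upwards [ae_restrict_mem measurableSet_Ioc] with s hs
      exact h s (Ioc_subset_Icc_self hs))
  rwa [intervalIntegral.integral_const, sub_zero, smul_eq_mul] at h1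

theorem eLpNorm_top_le_of_sup {E : Type*} [NormedAddCommGroup E] {T C : ℝ} {f : ℝ → E}
    (h : ∀ t ∈ Icc 0 T, ‖f t‖ ^ 2 ≤ C) :
    eLpNorm f ⊤ (timeMeasure T) ≤ ENNReal.ofReal √C := by
  rw [eLpNorm_exponent_top]
  refine eLpNormEssSup_le_of_ae_bound ?_
  filter_upwards [ae_restrict_mem measurableSet_Ioo] with t ht
  exact Real.le_sqrt_of_sq_le (h t (Ioo_subset_Icc_self ht))

namespace LinSol

variable {hab : a < b} {D : Data a b μ ν} {T : ℝ}

/-- The equations hold on `[0,T]` only. Freezing time outside gives curves in Sobolev spaces defined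
and continuous on the whole line, unchanged on `[0,T]`. -/
theorem continuous_comp_clamp {E : Type*} [TopologicalSpace E] (hT : 0 ≤ T) {f : ℝ → E}
    (hf : ContinuousOn f (Icc 0 T)) : Continuous fun t => f (clamp T t) :=
  hf.comp_continuous (continuous_clamp T) (clamp_mem hT)

/-- The velocity gradient `u_tx` in `H¹`. -/
def pV (S : LinSol hab D T) (hν : 0 < ν) (hT : 0 ≤ T) (t : ℝ) : Sob a b 1 :=
  mkSob _ _ (S.hasWeakDeriv_dx_w hν (clamp_mem hT t))

theorem continuous_pV (S : LinSol hab D T) (hν : 0 < ν) (hT : 0 ≤ T) :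
    Continuous (S.pV hν hT) :=
  continuous_mkSob (continuous_comp_clamp hT S.continuousOn_dx_w)
    (continuous_comp_clamp (f := fun t => ν⁻¹ • (S.v t - S.f t)) hT
      ((S.continuous_v.continuousOn.sub S.continuousOn_f).const_smul ν⁻¹)) _

/-- The second derivative `θ_xx = θ_t + μ θ u_tx` in `H¹`. -/
def θxx (S : LinSol hab D T) (hν : 0 < ν) (hT : 0 ≤ T) (t : ℝ) : Sob a b 1 :=
  S.z (clamp T t) + μ • mulSob hab (S.θ (clamp T t)) (S.pV hν hT t)

theorem continuous_θxx (S : LinSol hab D T) (hν : 0 < ν) (hT : 0 ≤ T) :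
    Continuous (S.θxx hν hT) := by
  have h1 : Continuous fun t => S.z (clamp T t) := S.continuous_z.comp (continuous_clamp T)
  have h2 : Continuous fun t => S.θ (clamp T t) := S.continuous_θ.comp (continuous_clamp T)
  have h3 := S.continuous_pV hν hT
  have hm : ∀ {ψ : ℝ → Sob a b 1} {g : ℝ → L2 a b}, Continuous ψ → Continuous g →
      Continuous fun t => mulV a b (ψ t) (g t) := fun hψ hg =>
    ((mulV a b).continuous.comp hψ).clm_apply hg
  have h4 : Continuous fun t => mulSob hab (S.θ (clamp T t)) (S.pV hν hT t) :=
    continuous_mkSob (hm h2 ((Sob.D 0).continuous.comp h3))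
      ((hm h2 ((Sob.D 1).continuous.comp h3)).add (hm h3 ((Sob.D 1).continuous.comp h2)))
      fun t => hasWeakDeriv_mulV hab (S.θ (clamp T t)) (S.pV hν hT t)
  exact h1.add (h4.const_smul μ)

/-- The heat equation expresses `θ_xx` through `z` and the product `θ w_x`, both in `H¹`; this is
where `θ ∈ H³` comes from. -/
theorem Nonlin.hasWeakDeriv_θxx {S : LinSol hab D T} (h : S.Nonlin) (hν : 0 < ν) (hT : 0 ≤ T)
    (t : ℝ) : HasWeakDeriv (Sob.D 1 (S.θ (clamp T t))) (Sob.D 0 (S.θxx hν hT t)) := by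
  have h1 := S.hasWeakDeriv_dx_θ (clamp_mem hT t)
  rw [h.F_eq (clamp_mem hT t)] at h1
  have e : Sob.D 0 (S.θxx hν hT t) = Sob.D 0 (S.z (clamp T t))
      - -μ • mulV a b (S.θ (clamp T t)) (H10.dx (S.w (clamp T t))) := by
    rw [θxx, map_add, map_smul, neg_smul, sub_neg_eq_add]
    rfl
  rwa [e]

/-- The solution has the regularity of a weak solution. -/
theorem Nonlin.isWeakSolution {S : LinSol hab D T} (h : S.Nonlin) (hμ : 0 < μ) (hν : 0 < ν)
    (hT : 0 < T) : IsWeakSolution a b μ ν T (H10.toL2 D.u₀) (H10.toL2 D.u₁) (Sob.D 0 D.θ₀)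
      (fun t => H10.toL2 (S.u t)) (fun t => Sob.D 0 (S.θ t)) := by
  have hwc : ContinuousOn S.w (Icc 0 T) := S.hasPrim_w.continuousOn
  have huc : ContinuousOn S.u (Icc 0 T) := S.hasPrim_u.continuousOn
  have hLu : HasPrim T (fun t => H10.toL2 (S.u t)) fun t => H10.toL2 (S.w t) :=
    S.hasPrim_u.clm H10.toL2
  have hLθ : HasPrim T (fun t => Sob.D 0 (S.θ t)) fun t => Sob.D 0 (S.z t) :=
    S.hasPrim_θ.clm (Sob.D 0)
  have hIcc : ∀ᵐ t ∂timeMeasure T, t ∈ Icc 0 T := by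
    filter_upwards [ae_restrict_mem measurableSet_Ioo] with t ht using Ioo_subset_Icc_self ht
  refine ⟨fun j t => if j = 0 then H10.toL2 (S.u t) else H10.toL2 (S.w t),
    fun j t => if j = 0 then S.u t else S.w t, fun t => L2.toHneg (S.v t),
    fun j t => if j = 0 then Sob.D 0 (S.θ t) else Sob.D 0 (S.z t),
    fun _ t => mkSob2 (S.θ (clamp T t)) (S.θxx hν hT.le t) (h.hasWeakDeriv_θxx hν hT.le t),
    ⟨?_, ?_, ?_⟩, ⟨?_, ?_, ?_⟩, ?_, ?_, ⟨?_, ?_, ?_⟩, ⟨?_, ?_, ?_⟩, ?_, ?_, ?_, ⟨D.u₀, rfl, ?_⟩, ?_, ?_⟩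
  · exact Eventually.of_forall fun t => by simp
  · intro j hj
    interval_cases j
    · exact hLu.continuousOn.memLp_timeMeasure _
    · exact S.hasPrim_toL2_w.continuousOn.memLp_timeMeasure _
  · intro j hj
    interval_cases j
    exact hLu.weakTimeDeriv hT.le
  · exact Eventually.of_forall fun t => by simp
  · intro j hj
    interval_cases j
    · exact huc.memLp_timeMeasure _
    · exact hwc.memLp_timeMeasure _
  · intro j hj
    interval_cases j
    exact S.hasPrim_u.weakTimeDeriv hT.le
  · exact ((toHnegL a b).continuous.comp S.continuous_v).continuousOn.memLp_timeMeasure 2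
  · exact (S.hasPrim_toL2_w.clm (toHnegL a b)).weakTimeDeriv hT.le
  · exact Eventually.of_forall fun t => by simp
  · intro j hj
    interval_cases j
    · exact hLθ.continuousOn.memLp_timeMeasure _
    · exact S.continuous_D0_z.continuousOn.memLp_timeMeasure _
  · intro j hj
    interval_cases j
    exact hLθ.weakTimeDeriv hT.le
  · filter_upwards [hIcc] with t ht
    change Sob.D 0 (S.θ (clamp T t)) = _
    rw [clamp_eq ht]
  · intro j hj
    exact (continuous_mkSob2 (S.continuous_θ.comp (continuous_clamp T)) (S.continuous_θxx hν hT.le)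
      _).continuousOn.memLp_timeMeasure 2
  · intro j hj
    exact absurd hj (Nat.not_lt_zero j)
  · filter_upwards [hIcc] with t ht using h.nonneg hμ hν ht
  · filter_upwards [hIcc] with t ht φ
    rw [← L2_inner_eq, ← L2_inner_eq, ← L2_inner_eq]
    change inner ℝ (S.v t) (H10.toL2 φ) + inner ℝ (H10.dx (S.u t)) (H10.dx φ)
      + ν * inner ℝ (H10.dx (S.w t)) (H10.dx φ)
      + μ * inner ℝ (Sob.D 1 (S.θ (clamp T t))) (H10.toL2 φ) = 0
    rw [clamp_eq ht]
    exact h.wave hν ht φ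
  · filter_upwards [hIcc] with t ht ψ
    rw [← L2_inner_eq, ← L2_inner_eq]
    have h1 := h.heat ht ψ
    rw [inner_mulV hab] at h1
    change inner ℝ (Sob.D 0 (S.z t)) (Sob.D 0 ψ) + inner ℝ (Sob.D 1 (S.θ (clamp T t))) (Sob.D 1 ψ)
      + μ * (∫ x in Ioo a b, Sob.D 0 (S.θ (clamp T t)) x * H10.dx (S.w t) x * Sob.D 0 ψ x) = 0
    rw [clamp_eq ht]
    linarith
  · exact ⟨S.u, huc, Eventually.of_forall fun t => rfl, S.u_zero⟩
  · exact ⟨fun t => H10.toL2 (S.w t), S.hasPrim_toL2_w.continuousOn,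
      Eventually.of_forall fun t => rfl, congrArg H10.toL2 S.w_zero⟩
  · exact ⟨fun t => Sob.D 0 (S.θ t), hLθ.continuousOn, Eventually.of_forall fun t => rfl,
      congrArg (Sob.D 0) S.θ_zero⟩

end LinSol

end ThermoVisco

namespace ThermoVisco

/-! ### Regular initial data -/

variable {a b μ ν : ℝ}

theorem Sob.norm_D_le {k : ℕ} (j : Fin (k + 1)) (ψ : Sob a b k) : ‖Sob.D j ψ‖ ≤ ‖ψ‖ :=
  PiLp.norm_apply_le (ψ : PiLp 2 (fun _ : Fin (k + 1) => L2 a b)) j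

theorem norm_mkSob_le (f g : L2 a b) (h : HasWeakDeriv f g) : ‖mkSob f g h‖ ≤ ‖f‖ + ‖g‖ := by
  refine (sq_le_sq₀ (norm_nonneg _) (by positivity)).1 ?_
  rw [Sob.norm_sq, D0_mkSob, D1_mkSob]
  nlinarith [norm_nonneg f, norm_nonneg g]

theorem H10.norm_le (v : H10 a b) : ‖v‖ ≤ ‖H10.toL2 v‖ + ‖H10.dx v‖ := by
  refine (sq_le_sq₀ (norm_nonneg _) (by positivity)).1 ?_
  rw [H10.norm_sq]
  nlinarith [norm_nonneg (H10.toL2 v), norm_nonneg (H10.dx v)]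

/-- Regular initial data satisfying the boundary conditions are compatible. -/
theorem exists_data (hab : a < b) (hμ : 0 < μ) (hν : 0 < ν) (R : ℝ) : ∃ M : ℝ,
    ∀ (u₀ u₁ : Sob a b 2) (θ₀ : Sob a b 3), MemH10 (Sob.D 0 u₀) → MemH10 (Sob.D 0 u₁) →
      (∀ᵐ x ∂volume.restrict (Ioo a b), 0 ≤ Sob.D 0 θ₀ x) → MemH10 (Sob.D 1 θ₀) →
      ‖u₀‖ ≤ R → ‖u₁‖ ≤ R → ‖θ₀‖ ≤ R →
      ∃ D : Data a b μ ν, D.Bound M ∧ H10.toL2 D.u₀ = Sob.D 0 u₀ ∧ H10.toL2 D.u₁ = Sob.D 0 u₁ ∧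
        Sob.D 0 D.θ₀ = Sob.D 0 θ₀ := by
  obtain ⟨c, hc0, hc⟩ := exists_mulSob_bound hab
  refine ⟨2 * |R| + μ * (c * (2 * |R|) * (2 * |R|)) + (ν + 1 + μ) * |R|,
    fun u₀ u₁ θ₀ ⟨U₀, hU₀⟩ ⟨U₁, hU₁⟩ hpos ⟨η, hη⟩ h₀ h₁ h₂ => ?_⟩
  replace h₀ := h₀.trans (le_abs_self R)
  replace h₁ := h₁.trans (le_abs_self R)
  replace h₂ := h₂.trans (le_abs_self R)
  have b₀ := fun j => (Sob.norm_D_le j u₀).trans h₀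
  have b₁ := fun j => (Sob.norm_D_le j u₁).trans h₁
  have b₂ := fun j => (Sob.norm_D_le j θ₀).trans h₂
  have u₀1 : HasWeakDeriv (Sob.D 0 u₀) (Sob.D 1 u₀) := u₀.2 0
  have u₀2 : HasWeakDeriv (Sob.D 1 u₀) (Sob.D 2 u₀) := u₀.2 1
  have u₁1 : HasWeakDeriv (Sob.D 0 u₁) (Sob.D 1 u₁) := u₁.2 0
  have u₁2 : HasWeakDeriv (Sob.D 1 u₁) (Sob.D 2 u₁) := u₁.2 1
  have θ₀1 : HasWeakDeriv (Sob.D 0 θ₀) (Sob.D 1 θ₀) := θ₀.2 0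
  have θ₀2 : HasWeakDeriv (Sob.D 1 θ₀) (Sob.D 2 θ₀) := θ₀.2 1
  have θ₀3 : HasWeakDeriv (Sob.D 2 θ₀) (Sob.D 3 θ₀) := θ₀.2 2
  have d₀ : H10.dx U₀ = Sob.D 1 u₀ := (H10.hasWeakDeriv U₀).unique (hU₀ ▸ u₀1)
  have d₁ : H10.dx U₁ = Sob.D 1 u₁ := (H10.hasWeakDeriv U₁).unique (hU₁ ▸ u₁1)
  have d₂ : H10.dx η = Sob.D 2 θ₀ := (H10.hasWeakDeriv η).unique (hη ▸ θ₀2)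
  set A := mkSob _ _ θ₀1
  set B := mkSob _ _ u₁2
  set F := mkSob _ _ θ₀3
  have bA : ‖A‖ ≤ 2 * |R| := (norm_mkSob_le _ _ _).trans (by linarith [b₂ 0, b₂ 1])
  have bB : ‖B‖ ≤ 2 * |R| := (norm_mkSob_le _ _ _).trans (by linarith [b₁ 1, b₁ 2])
  have bF : ‖F‖ ≤ 2 * |R| := (norm_mkSob_le _ _ _).trans (by linarith [b₂ 2, b₂ 3])
  have bU₀ : ‖U₀‖ ≤ 2 * |R| := (H10.norm_le _).trans (by rw [hU₀, d₀]; linarith [b₀ 0, b₀ 1])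
  have bU₁ : ‖U₁‖ ≤ 2 * |R| := (H10.norm_le _).trans (by rw [hU₁, d₁]; linarith [b₁ 0, b₁ 1])
  have bf : ‖Sob.D 2 u₀ - μ • Sob.D 1 θ₀‖ ≤ (1 + μ) * |R| := by
    refine (norm_sub_le _ _).trans ?_
    rw [norm_smul, Real.norm_of_nonneg hμ.le]
    nlinarith [b₀ 2, b₂ 1]
  have bv : ‖ν • Sob.D 2 u₁ + (Sob.D 2 u₀ - μ • Sob.D 1 θ₀)‖ ≤ (ν + 1 + μ) * |R| := by
    refine (norm_add_le _ _).trans ?_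
    rw [norm_smul, Real.norm_of_nonneg hν.le]
    nlinarith [b₁ 2]
  have bz : ‖F - μ • mulSob hab A B‖ ≤ 2 * |R| + μ * (c * (2 * |R|) * (2 * |R|)) := by
    refine (norm_sub_le _ _).trans ?_
    rw [norm_smul, Real.norm_of_nonneg hμ.le]
    have h3 : ‖mulSob hab A B‖ ≤ c * (2 * |R|) * (2 * |R|) := (hc A B).trans (by gcongr)
    gcongr
  have p1 : 0 ≤ μ * (c * (2 * |R|) * (2 * |R|)) := by positivity
  have p2 : 0 ≤ (ν + 1 + μ) * |R| := by positivity
  have p3 : 0 ≤ 2 * |R| := by positivity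
  have p4 : 0 ≤ ν * |R| := by positivity
  -- The values of `θ_t`, `u_tt` and `u_xx - μ θ_x` dictated by the equations at time zero. The
  -- third derivative of `θ₀` puts `z₀` in `H¹`, and the condition `(θ₀)_x ∈ H¹₀`, through `η`,
  -- makes the weak heat equation valid for all `ψ ∈ H¹`.
  refine ⟨{ θ₀ := A, z₀ := F - μ • mulSob hab A B, u₀ := U₀, u₁ := U₁
            v₀ := ν • Sob.D 2 u₁ + (Sob.D 2 u₀ - μ • Sob.D 1 θ₀)
            f₀ := Sob.D 2 u₀ - μ • Sob.D 1 θ₀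
            heat := fun ψ => ?_, wave := fun φ => ?_, stress := fun φ => ?_, nonneg := hpos },
    ⟨?_, ?_, ?_, ?_, ?_, ?_⟩, hU₀, hU₁, rfl⟩
  · have h := H10.ibp η ψ
    have e : Sob.D 0 (F - μ • mulSob hab A B) = Sob.D 2 θ₀ - μ • mulV a b A (Sob.D 1 u₁) := by
      rw [map_sub, map_smul]; rfl
    rw [hη, d₂] at h
    rw [e, d₁, inner_sub_left, neg_smul, inner_neg_left, h]
    change inner ℝ (Sob.D 1 θ₀) _ + _ = _
    ring
  · have h := H10.ibp φ B
    change inner ℝ (H10.dx φ) (Sob.D 1 u₁) = -inner ℝ (H10.toL2 φ) (Sob.D 2 u₁) at h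
    rw [inner_add_left, real_inner_smul_left, d₁, ← real_inner_comm (Sob.D 1 u₁), h,
      real_inner_comm (H10.toL2 φ)]
    ring
  · have h := H10.ibp φ (mkSob _ _ u₀2)
    change inner ℝ (H10.dx φ) (Sob.D 1 u₀) = -inner ℝ (H10.toL2 φ) (Sob.D 2 u₀) at h
    rw [inner_sub_left, real_inner_smul_left, d₀, ← real_inner_comm (Sob.D 1 u₀), h,
      real_inner_comm (H10.toL2 φ)]
    change _ + μ * inner ℝ (Sob.D 1 θ₀) _ = _
    ring
  all_goals dsimp only; linarith

/-! ### Bounds of the solution -/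

theorem timeSobolevNorm_le {X Y : Type*} [NormedAddCommGroup X] [NormedSpace ℝ X]
    [NormedAddCommGroup Y] [NormedSpace ℝ Y] {ι : Y →L[ℝ] X} {k : ℕ} {p : ℝ≥0∞} {T : ℝ} {w : ℝ → X}
    {C : ℝ≥0∞} (d : ℕ → ℝ → Y) (h₀ : ∀ᵐ t ∂timeMeasure T, ι (d 0 t) = w t)
    (h₁ : ∀ j ≤ k, MemLp (d j) p (timeMeasure T))
    (h₂ : ∀ j < k, HasWeakTimeDeriv T (d j) (d (j + 1)))
    (h : ∑ j ∈ Finset.range (k + 1), eLpNorm (d j) p (timeMeasure T) ≤ C) :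
    timeSobolevNorm ι k p T w ≤ C :=
  (iInf₂_le d ⟨h₀, h₁, h₂⟩).trans h

namespace LinSol

variable {T : ℝ}

theorem bound_norm_u (hab : a < b) (hμ : 0 < μ) (hν : 0 < ν) (hT : 0 < T) (M : ℝ) : ∃ C : ℝ, 0 ≤ C ∧
    ∀ D : Data a b μ ν, D.Bound M → ∀ S : LinSol hab D T, S.Nonlin →
      timeSobolevNorm (ContinuousLinearMap.id ℝ (L2 a b)) 2 ⊤ T (fun t => H10.toL2 (S.u t))
        ≤ ENNReal.ofReal C := by
  obtain ⟨Cu, hCu0, hCu⟩ := bound_u hab hμ hν T M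
  obtain ⟨Cw, hCw0, hCw⟩ := bound_w hab hμ hν T M
  obtain ⟨Cv, hCv0, hCv⟩ := bound_v hab hμ hν T M
  refine ⟨√Cu + √Cw + √Cv, by positivity, fun D hD S hS => ?_⟩
  have hLu : HasPrim T (fun t => H10.toL2 (S.u t)) fun t => H10.toL2 (S.w t) :=
    S.hasPrim_u.clm H10.toL2
  have hle : ∀ φ : H10 a b, ‖H10.toL2 φ‖ ^ 2 ≤ ‖φ‖ ^ 2 := fun φ =>
    pow_le_pow_left₀ (norm_nonneg _) (Sob.norm_D_le 0 (H10.toSob φ)) 2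
  refine timeSobolevNorm_le (fun j t => if j = 0 then H10.toL2 (S.u t)
    else if j = 1 then H10.toL2 (S.w t) else S.v t) ?_ ?_ ?_ ?_
  · exact Eventually.of_forall fun t => by simp
  · intro j hj
    interval_cases j
    · exact hLu.continuousOn.memLp_timeMeasure _
    · exact S.hasPrim_toL2_w.continuousOn.memLp_timeMeasure _
    · exact S.continuous_v.continuousOn.memLp_timeMeasure _
  · intro j hj
    interval_cases j
    · exact hLu.weakTimeDeriv hT.le
    · exact S.hasPrim_toL2_w.weakTimeDeriv hT.le
  · rw [Finset.sum_range_succ, Finset.sum_range_succ, Finset.sum_range_one,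
      ENNReal.ofReal_add (by positivity) (by positivity),
      ENNReal.ofReal_add (by positivity) (by positivity)]
    exact add_le_add (add_le_add
      (eLpNorm_top_le_of_sup fun t ht => (hle _).trans (hCu D hD T le_rfl S hS t ht))
      (eLpNorm_top_le_of_sup fun t ht => (hle _).trans (hCw D hD T le_rfl S hS t ht)))
      (eLpNorm_top_le_of_sup fun t ht => hCv D hD T le_rfl S hS t ht)

theorem bound_norm_u_sob (hab : a < b) (hμ : 0 < μ) (hν : 0 < ν) (hT : 0 < T) (M : ℝ) :
    ∃ C : ℝ, 0 ≤ C ∧ ∀ D : Data a b μ ν, D.Bound M → ∀ S : LinSol hab D T, S.Nonlin →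
      timeSobolevNorm (Sob.D (k := 1) 0) 2 2 T (fun t => H10.toL2 (S.u t))
        ≤ ENNReal.ofReal C := by
  obtain ⟨Cu, hCu0, hCu⟩ := bound_u hab hμ hν T M
  obtain ⟨Cw, hCw0, hCw⟩ := bound_w hab hμ hν T M
  obtain ⟨Cv, hCv0, hCv⟩ := bound_integral_vV hab hμ hν T M
  refine ⟨√(T * Cu) + √(T * Cw) + √Cv, by positivity, fun D hD S hS => ?_⟩
  have hTm : T ∈ Icc 0 T := ⟨hT.le, le_rfl⟩
  have hu : HasPrim T (fun t => H10.toSob (S.u t)) fun t => H10.toSob (S.w t) :=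
    S.hasPrim_u.clm H10.toSob
  have hw : HasPrim T (fun t => H10.toSob (S.w t)) fun t => H10.toSob (S.vV t) :=
    S.hasPrim_w.clm H10.toSob
  have hv : MemLp (fun t => H10.toSob (S.vV t)) 2 (timeMeasure T) := H10.toSob.comp_memLp' S.memV
  refine timeSobolevNorm_le (fun j t => if j = 0 then H10.toSob (S.u t)
    else if j = 1 then H10.toSob (S.w t) else H10.toSob (S.vV t)) ?_ ?_ ?_ ?_
  · exact Eventually.of_forall fun t => rfl
  · intro j hj
    interval_cases j
    · exact hu.continuousOn.memLp_timeMeasure _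
    · exact hw.continuousOn.memLp_timeMeasure _
    · exact hv
  · intro j hj
    interval_cases j
    · exact hu.weakTimeDeriv hT.le
    · exact hw.weakTimeDeriv hT.le
  · rw [Finset.sum_range_succ, Finset.sum_range_succ, Finset.sum_range_one,
      ENNReal.ofReal_add (by positivity) (by positivity),
      ENNReal.ofReal_add (by positivity) (by positivity)]
    exact add_le_add (add_le_add
      (eLpNorm_two_le_of_sup hT.le hu.continuousOn fun t ht => hCu D hD T le_rfl S hS t ht)
      (eLpNorm_two_le_of_sup hT.le hw.continuousOn fun t ht => hCw D hD T le_rfl S hS t ht))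
      (eLpNorm_two_le hT.le hv (hCv D hD T le_rfl S hS T hTm))

theorem bound_norm_θ (hab : a < b) (hμ : 0 < μ) (hν : 0 < ν) (hT : 0 < T) (M : ℝ) :
    ∃ C : ℝ, 0 ≤ C ∧ ∀ D : Data a b μ ν, D.Bound M → ∀ S : LinSol hab D T, S.Nonlin →
      timeSobolevNorm (ContinuousLinearMap.id ℝ (L2 a b)) 2 2 T (fun t => Sob.D 0 (S.θ t))
        ≤ ENNReal.ofReal C := by
  obtain ⟨Cθ, hCθ0, hCθ⟩ := bound_θ hab hμ hν T M
  obtain ⟨Cz, hCz0, hCz⟩ := bound_z hab hμ hν T M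
  obtain ⟨CG, hCG0, hCG⟩ := bound_integral_G hab hμ hν T M
  refine ⟨√(T * Cθ) + √(T * Cz) + √(1 * Cz + CG), by positivity, fun D hD S hS => ?_⟩
  have hTm : T ∈ Icc 0 T := ⟨hT.le, le_rfl⟩
  have h0m : (0 : ℝ) ∈ Icc 0 T := ⟨le_rfl, hT.le⟩
  -- `g` is `θ_tt`. With `κ = 1` its square integral is at most `‖z 0‖² + ∫ ‖G‖²`, whence the
  -- constant `1 * Cz + CG`.
  obtain ⟨g, hg, hz, hgle⟩ := (neumann hab).exists_deriv_regular one_pos hT.le S.memG S.z_modes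
  have hz : HasPrim T (fun t => Sob.D 0 (S.z t)) g := hz
  have hLθ : HasPrim T (fun t => Sob.D 0 (S.θ t)) fun t => Sob.D 0 (S.z t) :=
    S.hasPrim_θ.clm (Sob.D 0)
  have hle : ∀ φ : Sob a b 1, ‖Sob.D 0 φ‖ ^ 2 ≤ ‖φ‖ ^ 2 := fun φ =>
    pow_le_pow_left₀ (norm_nonneg _) (Sob.norm_D_le 0 φ) 2
  refine timeSobolevNorm_le (fun j t => if j = 0 then Sob.D 0 (S.θ t)
    else if j = 1 then Sob.D 0 (S.z t) else g t) ?_ ?_ ?_ ?_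
  · exact Eventually.of_forall fun t => by simp
  · intro j hj
    interval_cases j
    · exact hLθ.continuousOn.memLp_timeMeasure _
    · exact hz.continuousOn.memLp_timeMeasure _
    · exact hg
  · intro j hj
    interval_cases j
    · exact hLθ.weakTimeDeriv hT.le
    · exact hz.weakTimeDeriv hT.le
  · rw [Finset.sum_range_succ, Finset.sum_range_succ, Finset.sum_range_one,
      ENNReal.ofReal_add (by positivity) (by positivity),
      ENNReal.ofReal_add (by positivity) (by positivity)]
    refine add_le_add (add_le_add
      (eLpNorm_two_le_of_sup hT.le hLθ.continuousOn fun t ht =>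
        (hle _).trans (hCθ D hD T le_rfl S hS t ht))
      (eLpNorm_two_le_of_sup hT.le hz.continuousOn fun t ht =>
        (hle _).trans (hCz D hD T le_rfl S hS t ht)))
      (eLpNorm_two_le hT.le hg (hgle.trans (add_le_add ?_ (hCG D hD T le_rfl S hS T hTm))))
    exact mul_le_mul_of_nonneg_left (hCz D hD T le_rfl S hS 0 h0m) zero_le_one

theorem bound_norm_θ_sob (hab : a < b) (hμ : 0 < μ) (hν : 0 < ν) (hT : 0 < T) (M : ℝ) :
    ∃ C : ℝ, 0 ≤ C ∧ ∀ D : Data a b μ ν, D.Bound M → ∀ S : LinSol hab D T, S.Nonlin →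
      timeSobolevNorm (Sob.D (k := 3) 0) 0 2 T (fun t => Sob.D 0 (S.θ t))
        ≤ ENNReal.ofReal C := by
  obtain ⟨Cθ, hCθ0, hCθ⟩ := bound_θ hab hμ hν T M
  obtain ⟨Cz, hCz0, hCz⟩ := bound_z hab hμ hν T M
  obtain ⟨Cw, hCw0, hCw⟩ := bound_w hab hμ hν T M
  obtain ⟨Cv, hCv0, hCv⟩ := bound_v hab hμ hν T M
  obtain ⟨Cf, hCf0, hCf⟩ := bound_f hab hμ hν T M
  obtain ⟨c, hc0, hc⟩ := exists_mulSob_bound hab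
  -- `P` bounds `u_tx` in `H¹` by way of `u_txx = ν⁻¹ (v - f)`, and `Q` bounds the square of the
  -- `H³` norm of `θ` by way of `θ_xx = z + μ θ u_tx`.
  set P := √Cw + ν⁻¹ * (√Cv + √Cf) with hP
  set Q := Cθ + (√Cz + μ * (c * √Cθ * P)) ^ 2 with hQ
  refine ⟨√(T * Q), by positivity, fun D hD S hS => ?_⟩
  have hc3 : Continuous fun t => mkSob3 (S.θ (clamp T t)) (S.θxx hν hT.le t)
      (hS.hasWeakDeriv_θxx hν hT.le t) :=
    continuous_mkSob3 (S.continuous_θ.comp (continuous_clamp T)) (S.continuous_θxx hν hT.le) _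
  refine timeSobolevNorm_le (fun _ t => mkSob3 (S.θ (clamp T t)) (S.θxx hν hT.le t)
    (hS.hasWeakDeriv_θxx hν hT.le t)) ?_ ?_ ?_ ?_
  · filter_upwards [ae_restrict_mem measurableSet_Ioo] with t ht
    change Sob.D 0 (S.θ (clamp T t)) = _
    rw [clamp_eq (Ioo_subset_Icc_self ht)]
  · intro j hj
    exact hc3.continuousOn.memLp_timeMeasure 2
  · intro j hj
    exact absurd hj (Nat.not_lt_zero j)
  · rw [zero_add, Finset.sum_range_one]
    refine eLpNorm_two_le_of_sup hT.le hc3.continuousOn fun t _ => ?_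
    have ht := clamp_mem hT.le t
    have h1 := hCθ D hD T le_rfl S hS _ ht
    have hθ := Real.le_sqrt_of_sq_le h1
    have hz := Real.le_sqrt_of_sq_le (hCz D hD T le_rfl S hS _ ht)
    have hw := Real.le_sqrt_of_sq_le (hCw D hD T le_rfl S hS _ ht)
    have hv := Real.le_sqrt_of_sq_le (hCv D hD T le_rfl S hS _ ht)
    have hf := Real.le_sqrt_of_sq_le (hCf D hD T le_rfl S hS _ ht)
    have hp : ‖S.pV hν hT.le t‖ ≤ P := by
      refine (norm_mkSob_le _ _ _).trans ?_
      rw [norm_smul, Real.norm_of_nonneg (inv_nonneg.2 hν.le)]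
      have h2 : ‖H10.dx (S.w (clamp T t))‖ ≤ √Cw :=
        (Sob.norm_D_le 1 (H10.toSob (S.w (clamp T t)))).trans hw
      have h3 := (norm_sub_le (S.v (clamp T t)) (S.f (clamp T t))).trans (add_le_add hv hf)
      exact add_le_add h2 (mul_le_mul_of_nonneg_left h3 (inv_nonneg.2 hν.le))
    have hm : ‖mulSob hab (S.θ (clamp T t)) (S.pV hν hT.le t)‖ ≤ c * √Cθ * P :=
      (hc _ _).trans (by gcongr)
    have hx : ‖S.θxx hν hT.le t‖ ≤ √Cz + μ * (c * √Cθ * P) := by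
      refine (norm_add_le _ _).trans ?_
      rw [norm_smul, Real.norm_of_nonneg hμ.le]
      gcongr
    rw [norm_sq_mkSob3]
    exact add_le_add h1 (pow_le_pow_left₀ (norm_nonneg _) hx 2)

end LinSol

end ThermoVisco

end

theorem mainTheorem6 (a b μ ν T : ℝ) (hab : a < b) (hμ : 0 < μ) (hν : 0 < ν) (hT : 0 < T)
    (R : ℝ) :
    ∃ C : ℝ, ∀ (u₀ u₁ : ThermoVisco.Sob a b 2) (θ₀ : ThermoVisco.Sob a b 3),
      ThermoVisco.MemH10 (ThermoVisco.Sob.D 0 u₀) →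
      ThermoVisco.MemH10 (ThermoVisco.Sob.D 0 u₁) →
      (∀ᵐ x ∂volume.restrict (Ioo a b), 0 ≤ ThermoVisco.Sob.D 0 θ₀ x) →
      ThermoVisco.MemH10 (ThermoVisco.Sob.D 1 θ₀) →
      ‖u₀‖ ≤ R → ‖u₁‖ ≤ R → ‖θ₀‖ ≤ R →
      ∃ u θ : ℝ → ThermoVisco.L2 a b,
        ThermoVisco.IsWeakSolution a b μ ν T (ThermoVisco.Sob.D 0 u₀) (ThermoVisco.Sob.D 0 u₁)
          (ThermoVisco.Sob.D 0 θ₀) u θ ∧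
        (∀ u' θ' : ℝ → ThermoVisco.L2 a b,
          ThermoVisco.IsWeakSolution a b μ ν T (ThermoVisco.Sob.D 0 u₀) (ThermoVisco.Sob.D 0 u₁)
            (ThermoVisco.Sob.D 0 θ₀) u' θ' →
          (∀ᵐ t ∂ThermoVisco.timeMeasure T, u' t = u t ∧ θ' t = θ t)) ∧
        ThermoVisco.timeSobolevNorm (ContinuousLinearMap.id ℝ (ThermoVisco.L2 a b)) 2 ⊤ T u
          + ThermoVisco.timeSobolevNorm (ThermoVisco.Sob.D (k := 1) 0) 2 2 T u
          + ThermoVisco.timeSobolevNorm (ContinuousLinearMap.id ℝ (ThermoVisco.L2 a b)) 2 2 T θ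
          + ThermoVisco.timeSobolevNorm (ThermoVisco.Sob.D (k := 3) 0) 0 2 T θ
          ≤ ENNReal.ofReal C := by
  obtain ⟨M, hM⟩ := ThermoVisco.exists_data (μ := μ) (ν := ν) hab hμ hν R
  obtain ⟨C₁, h₁, hC₁⟩ := ThermoVisco.LinSol.bound_norm_u hab hμ hν hT M
  obtain ⟨C₂, h₂, hC₂⟩ := ThermoVisco.LinSol.bound_norm_u_sob hab hμ hν hT M
  obtain ⟨C₃, h₃, hC₃⟩ := ThermoVisco.LinSol.bound_norm_θ hab hμ hν hT M
  obtain ⟨C₄, h₄, hC₄⟩ := ThermoVisco.LinSol.bound_norm_θ_sob hab hμ hν hT M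
  refine ⟨C₁ + C₂ + C₃ + C₄, fun u₀ u₁ θ₀ hu₀ hu₁ hpos hθ₀ n₀ n₁ n₂ => ?_⟩
  obtain ⟨D, hD, e₀, e₁, e₂⟩ := hM u₀ u₁ θ₀ hu₀ hu₁ hpos hθ₀ n₀ n₁ n₂
  obtain ⟨S, hS⟩ := ThermoVisco.exists_nonlin hab hμ hν hT.le D
  -- The given initial values are replaced by those recorded in `D`, to which existence and
  -- uniqueness refer.
  rw [← e₀, ← e₁, ← e₂]
  refine ⟨_, _, hS.isWeakSolution hμ hν hT, fun u' θ' h => h.eq_nonlin hμ hν hT hS, ?_⟩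
  rw [ENNReal.ofReal_add (by positivity) h₄, ENNReal.ofReal_add (by positivity) h₃,
    ENNReal.ofReal_add h₁ h₂]
  exact add_le_add (add_le_add (add_le_add (hC₁ D hD S hS) (hC₂ D hD S hS)) (hC₃ D hD S hS))
    (hC₄ D hD S hS)
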